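/- Let $p$ be a prime and let $1\le k\le n$ be integers. Let $m_0=1$, $m_{an}=p^{-a}$ and $m_i=0$ for $n\nmid i$ (the coefficients of the logarithm for Hazewinkel's generators with $v_n=1$ and $v_i=0$ for $i\ne n$), and let $D_s(x,y)\in\mathbb Z[x_0,x_1,\dots,y_0,y_1,\dots]$ be the unique polynomials with $\sum_{i+j=s}m_iD_j^{p^i}=\sum_{i+j+l=s}m_ix_j^{p^i}y_l^{p^{i+j}}$ for all $s\ge0$. Let $$S(n,k)=\mathbb Z/p[t_k,t_{k+1},\dots]/(t_s^{p^n}-t_s)$$ be the Hopf algebra with counit $t_s\mapsto0$ and diagonal $\Delta(t_s)=D_s(t\otimes1,1\otimes t)$, where $t_0=1$ and $t_s=0$ for $0<s<k$. It is graded by $|t_s|=2(p^s-1)$ modulo $2(p^n-1)$. Let $C^{s,t}$ be its cobar complex: $C^{s,*}=\bar S^{\otimes s}$ with $\bar S$ the augmentation ideal, $t$ is the internal degree, the product is concatenation, and $$d[\alpha_1|\cdots|\alpha_s]=\sum_i(-1)^i[\alpha_1|\cdots|\Delta(\alpha_i)-\alpha_i\otimes1-1\otimes\alpha_i|\cdots|\alpha_s].$$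 Let $H^{s,t}S(n,k)=\mathrm{Ext}^{s,t}_{S(n,k)}(\mathbb Z/p,\mathbb Z/p)$ be its cohomology. Define the May filtration by $M(t_s^{p^j})=2s-1$ for $k\le s\le n+k-1$, $M(t_s^{p^j})=\max\{2s-1,\,pM(t_{s-n}^{p^{j+n-1}})+1\}$ for $s\ge n+k$, $M(t_s^a)=\sum_ia_iM(t_s^{p^i})$ if $a=\sum_ia_ip^i$ with $0\le a_i<p$, additively on products of powers of distinct generators, and $M([\alpha_1|\cdots|\alpha_s])=\sum_iM(\alpha_i)$ for monomials $\alpha_i$. Let $F^{t,M}\subseteq S(n,k)$ and $FC^{s,t,M}\subseteq C^{s,t}$ be spanned by the monomials, respectively the $[\alpha_1|\cdots|\alpha_s]$ with monomials $\alpha_i\ne1$, of internal degree $t$ and filtration at most $M$. Then: 1. $F$ is an increasing exhaustive filtration of $S(n,k)$ (zero for $M<0$), compatible with the product, the diagonal and the internal grading. The associated bigraded algebra $\bigoplus_{t,M}F^{t,M}/F^{t,M-1}$, with the induced diagonal, is a Hopf algebra. As an algebra it is the tensor product over $s\ge k$ of the truncated polynomial algebras $T[t_s^{p^j}\mid j\in\mathbb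 Z/n]$ of height $p$, and the generators $t_s^{p^j}$ are primitive. 2. The $FC^{*,*,M}$ are subcomplexes of the cobar complex. The resulting (May) spectral sequence has $E_r^{s,t,M}=Z_r^{s,t,M}/B_r^{s,t,M}$, where $Z_r^{s,t,M}=\{z\in FC^{s,t,M}: dz\in FC^{s+1,t,M-r}\}$ and $B_r^{s,t,M}=Z_{r-1}^{s,t,M-1}+dZ_{r-1}^{s-1,t,M+r-1}$. Its differentials $d_r:E_r^{s,t,M}\to E_r^{s+1,t,M-r}$ are induced by $d$ and satisfy $d_rd_r=0$ and $E_{r+1}=H(E_r,d_r)$. For the product induced by concatenation, $d_r(xy)=d_r(x)y+(-1)^sx\,d_r(y)$ if $x\in E_r^{s,*,*}$. 3. The spectral sequence converges to $H^{*,*}S(n,k)$: the classes of cocycles in $FC^{s,t,M}$ form an increasing exhaustive filtration $F_MH^{s,t}S(n,k)$ that is zero for $M<0$, and for all $s,t,M$ and all sufficiently large $r$ (depending on $s,t,M$) sending the class of a cocycle to its class is an isomorphism $E_r^{s,t,M}\cong F_MH^{s,t}S(n,k)/F_{M-1}H^{s,t}S(n,k)$. 4. In the $E_1$-term there are, for $i\ge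 k$ and $j\in\mathbb Z/n$, elements $$h_{i,j}\in E_1^{1,\,2(p^i-1)p^j,\,M(t_i)},\qquad b_{i,j}\in E_1^{2,\,2(p^i-1)p^{j+1},\,pM(t_i)}$$ represented by $[t_i^{p^j}]$ and $\sum_{0<m<p}\frac1p\binom pm[t_i^{mp^j}|t_i^{(p-m)p^j}]$, and $$E_1\cong E[h_{i,j}\mid i\ge k,\ j\in\mathbb Z/n]\otimes P[b_{i,j}\mid i\ge k,\ j\in\mathbb Z/n],$$ as algebras if $p$ is odd. If $p=2$ the isomorphism is one of vector spaces, taking each monomial (a product of distinct $h_{i,j}$ and of any $b_{i,j}$) to the product of the same classes in $E_1$, and $h_{i,j}^2=b_{i,j}$. For all primes, in $E_1$, $$h_{i,j}h_{i_1,j_1}=-h_{i_1,j_1}h_{i,j},\qquad h_{i,j}b_{i_1,j_1}=b_{i_1,j_1}h_{i,j},\qquad b_{i,j}b_{i_1,j_1}=b_{i_1,j_1}b_{i,j}.$$ -/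

import Mathlib

open scoped TensorProduct DirectSum

set_option linter.unusedSectionVars false

noncomputable section

namespace MaySS

section Coproduct

/-- Let `m_i` be the coefficients of the logarithm determined by Hazewinkel's formula
`p m_s = ∑_{0 ≤ i < s} m_i v_{s-i}^{p^i}`, `m_0 = 1`, specialised to `v_n = 1` and `v_i = 0` for
`i ≠ n`: then `m_{an} = p^{-a}` and `m_i = 0` if `n ∤ i`.  For a family `P` this is the sum
`p^⌊s/n⌋ · ∑_{i ≤ s} m_i P(s - i, i)`, the factor in front clearing the denominators. -/
def hondaSum {A : Type*} [CommRing A] (p n : ℕ) (P : ℕ → ℕ → A) (s : ℕ) : A :=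
  ∑ a ∈ Finset.range (s / n + 1), (p : A) ^ (s / n - a) * P (s - a * n) (a * n)

/-- The sum `∑_{i + j = m} (x_i y_j^{p^i})^{p^e}`. -/
def pairSum {A : Type*} [CommRing A] (p : ℕ) (x y : ℕ → A) (m e : ℕ) : A :=
  ∑ ij ∈ Finset.HasAntidiagonal.antidiagonal m, (x ij.1 * y ij.2 ^ p ^ ij.1) ^ p ^ e

theorem hondaSum_rec {A : Type*} [CommRing A] (p n : ℕ) (hn : 0 < n) (P : ℕ → ℕ → A) (s : ℕ)
    (h : n ≤ s) : hondaSum p n P s =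
      (p : A) ^ (s / n) * P s 0 + hondaSum p n (fun m e => P m (e + n)) (s - n) := by
  have h1 : s / n = (s - n) / n + 1 := Nat.div_eq_sub_div hn h
  unfold hondaSum
  rw [h1, Finset.sum_range_succ']
  simp only [Nat.zero_mul, Nat.sub_zero, add_comm]
  congr 1
  apply Finset.sum_congr rfl
  intro a _
  rw [show (a + 1) * n = a * n + n by ring]
  congr 2 <;> omega

theorem hondaSum_lt {A : Type*} [CommRing A] (p n : ℕ) (P : ℕ → ℕ → A) (s : ℕ)
    (h : s < n) : hondaSum p n P s = P s 0 := by
  simp [hondaSum, Nat.div_eq_of_lt h]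

theorem hondaSum_dvd {A : Type*} [CommRing A] (p n c : ℕ) (hn : 0 < n) (P Q : ℕ → ℕ → A) (s : ℕ)
    (h : ∀ m ≤ s, ∀ e, (p : A) ^ (e + c) ∣ P m e - Q m e) :
    (p : A) ^ (s / n + c) ∣ hondaSum p n P s - hondaSum p n Q s := by
  unfold hondaSum
  rw [← Finset.sum_sub_distrib]
  apply Finset.dvd_sum
  intro a ha
  rw [← mul_sub]
  have h1 := h (s - a * n) (Nat.sub_le _ _) (a * n)
  have h2 : s / n + c ≤ (s / n - a) + (a * n + c) := by
    have := Nat.le_mul_of_pos_right a hn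
    omega
  refine (pow_dvd_pow _ h2).trans ?_
  rw [pow_add]
  exact mul_dvd_mul_left _ h1

theorem hondaSum_congr {A : Type*} [CommRing A] (p n : ℕ) (P Q : ℕ → ℕ → A) (s : ℕ)
    (h : ∀ m ≤ s, ∀ e, P m e = Q m e) : hondaSum p n P s = hondaSum p n Q s :=
  Finset.sum_congr rfl fun a _ => by rw [h _ (Nat.sub_le _ _)]

theorem map_hondaSum {A B : Type*} [CommRing A] [CommRing B] (g : A →+* B) (p n : ℕ)
    (P : ℕ → ℕ → A) (s : ℕ) :
    g (hondaSum p n P s) = hondaSum p n (fun m e => g (P m e)) s := by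
  simp [hondaSum]

theorem map_pairSum {A B : Type*} [CommRing A] [CommRing B] (g : A →+* B) (p : ℕ)
    (x y : ℕ → A) (m e : ℕ) :
    g (pairSum p x y m e) = pairSum p (fun i => g (x i)) (fun i => g (y i)) m e := by
  simp [pairSum]

/-- Detecting congruence modulo `p` from the sums, in a ring without `p`-torsion. -/
theorem dvd_of_hondaSum_dvd {A : Type*} [CommRing A] (p n : ℕ) (hn : 0 < n)
    (htf : ∀ a : A, (p : A) * a = 0 → a = 0) (f g : ℕ → A)
    (h : ∀ s, (p : A) ^ (s / n + 1) ∣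
      hondaSum p n (fun m e => f m ^ p ^ e) s - hondaSum p n (fun m e => g m ^ p ^ e) s)
    (s : ℕ) : (p : A) ∣ f s - g s := by
  have hc : ∀ (N : ℕ) (a : A), (p : A) ^ N * a = 0 → a = 0 := by
    intro N
    induction N with
    | zero => intro a ha; simpa using ha
    | succ N ih => intro a ha; exact ih a (htf _ (by rw [← ha]; ring))
  induction s using Nat.strong_induction_on with
  | _ s ih =>
    rcases lt_or_ge s n with hs | hs
    · have := h s
      rw [hondaSum_lt _ _ _ _ hs, hondaSum_lt _ _ _ _ hs, Nat.div_eq_of_lt hs] at this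
      simpa using this
    · have h1 := h s
      rw [hondaSum_rec _ _ hn _ _ hs, hondaSum_rec _ _ hn _ _ hs] at h1
      obtain ⟨c, hc1⟩ := h1
      have h4 := hondaSum_dvd p n 2 hn (fun m e => f m ^ p ^ (e + n)) (fun m e => g m ^ p ^ (e + n))
        (s - n) (fun m hm e => (pow_dvd_pow _ (by omega)).trans
          (dvd_sub_pow_of_dvd_sub (ih m (by omega)) (e + n)))
      rw [show (s - n) / n + 2 = s / n + 1 by rw [Nat.div_eq_sub_div hn hs]] at h4
      obtain ⟨c', hc'⟩ := h4
      refine ⟨c - c', ?_⟩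
      have : (p : A) ^ (s / n) * ((f s - g s) - p * (c - c')) = 0 := by
        simp only [pow_zero, pow_one] at hc1
        linear_combination hc1 - hc'
      exact sub_eq_zero.mp (hc _ _ this)

theorem eq_of_hondaSum_eq {A : Type*} [CommRing A] (p n : ℕ) (hn : 0 < n)
    (htf : ∀ a : A, (p : A) * a = 0 → a = 0) (f g : ℕ → A) (N : ℕ)
    (h : ∀ s < N, hondaSum p n (fun m e => f m ^ p ^ e) s =
      hondaSum p n (fun m e => g m ^ p ^ e) s)
    (s : ℕ) (hsN : s < N) : f s = g s := by
  have hc : ∀ (N : ℕ) (a : A), (p : A) ^ N * a = 0 → a = 0 := by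
    intro N
    induction N with
    | zero => intro a ha; simpa using ha
    | succ N ih => intro a ha; exact ih a (htf _ (by rw [← ha]; ring))
  induction s using Nat.strong_induction_on with
  | _ s ih =>
    have h1 := h s hsN
    rcases lt_or_ge s n with hs | hs
    · rw [hondaSum_lt _ _ _ _ hs, hondaSum_lt _ _ _ _ hs] at h1
      simpa using h1
    · rw [hondaSum_rec _ _ hn _ _ hs, hondaSum_rec _ _ hn _ _ hs,
        hondaSum_congr p n (fun m e => f m ^ p ^ (e + n)) (fun m e => g m ^ p ^ (e + n)) (s - n)
          (fun m hm e => by rw [ih m (by omega) (by omega)])] at h1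
      have : (p : A) ^ (s / n) * (f s - g s) = 0 := by
        simp only [pow_zero, pow_one] at h1
        linear_combination h1
      exact sub_eq_zero.mp (hc _ _ this)

theorem mvPoly_torsionFree {σ : Type*} (p : ℕ) [hp : Fact p.Prime] (a : MvPolynomial σ ℤ)
    (h : (p : MvPolynomial σ ℤ) * a = 0) : a = 0 := by
  rcases mul_eq_zero.mp h with h | h
  · exact absurd (by exact_mod_cast h) hp.out.ne_zero
  · exact h

theorem dvd_expand_sub_pow {σ : Type*} (p : ℕ) [hp : Fact p.Prime] (f : MvPolynomial σ ℤ) (m : ℕ) :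
    (p : MvPolynomial σ ℤ) ∣ f ^ p ^ m - MvPolynomial.expand (p ^ m) f := by
  have key : ∀ g : MvPolynomial σ ℤ, (p : MvPolynomial σ ℤ) ∣ g ^ p - MvPolynomial.expand p g := by
    intro g
    have := (MvPolynomial.C_dvd_iff_zmod p (g ^ p - MvPolynomial.expand p g)).mpr (by
      rw [map_sub, map_pow, MvPolynomial.map_expand, MvPolynomial.expand_zmod, sub_self])
    simpa using this
  induction m with
  | zero => simp
  | succ m ih =>
    have h1 := dvd_sub_pow_of_dvd_sub ih 1
    have h2 := key (MvPolynomial.expand (p ^ m) f)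
    rw [← MvPolynomial.expand_mul, ← pow_succ'] at h2
    have h3 : (p : MvPolynomial σ ℤ) ∣ (f ^ p ^ m) ^ p ^ 1 - (MvPolynomial.expand (p ^ m) f) ^ p ^ 1 :=
      (Dvd.intro _ (by rw [pow_succ'])).trans h1
    have := dvd_add h3 h2
    rw [pow_one, sub_add_sub_cancel, ← pow_mul, ← pow_succ] at this
    exact this

/-- There are integral polynomials `D_s` in variables `x_i` (`Sum.inl i`) and `y_j` (`Sum.inr j`) with
`∑_{i + j = s} m_i D_j^{p^i} = ∑_{i + j + l = s} m_i x_j^{p^i} y_l^{p^{i+j}}`. -/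
theorem exists_coprodPoly (p n : ℕ) [hp : Fact p.Prime] [NeZero n] :
    ∃ D : ℕ → MvPolynomial (ℕ ⊕ ℕ) ℤ, ∀ s,
      hondaSum p n (fun m e => D m ^ p ^ e) s =
        hondaSum p n (pairSum p (fun i => MvPolynomial.X (Sum.inl i))
          (fun j => MvPolynomial.X (Sum.inr j))) s := by
  have hn : 0 < n := Nat.pos_of_ne_zero (NeZero.ne n)
  set U := hondaSum p n (pairSum p (fun i => (MvPolynomial.X (Sum.inl i) : MvPolynomial (ℕ ⊕ ℕ) ℤ))
          (fun j => MvPolynomial.X (Sum.inr j))) with hU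
  have hN : ∀ N : ℕ, ∃ f : ℕ → MvPolynomial (ℕ ⊕ ℕ) ℤ, ∀ s < N,
      hondaSum p n (fun m e => f m ^ p ^ e) s = U s := by
    intro N
    induction N with
    | zero => exact ⟨0, by simp⟩
    | succ N ih =>
      obtain ⟨f, hf⟩ := ih
      have hdvd : ∃ c, (p : MvPolynomial (ℕ ⊕ ℕ) ℤ) ^ (N / n) * c +
          (if n ≤ N then hondaSum p n (fun m e => f m ^ p ^ (e + n)) (N - n) else 0) = U N := by
        by_cases hs : n ≤ N
        · rw [if_pos hs]
          have e1 : U N = (p : MvPolynomial (ℕ ⊕ ℕ) ℤ) ^ (N / n) * pairSum p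
              (fun i => (MvPolynomial.X (Sum.inl i) : MvPolynomial (ℕ ⊕ ℕ) ℤ))
              (fun j => MvPolynomial.X (Sum.inr j)) N 0 + MvPolynomial.expand (p ^ n) (U (N - n)) := by
            rw [hU, hondaSum_rec _ _ hn _ _ hs]
            congr 1
            rw [← AlgHom.coe_toRingHom, map_hondaSum]
            apply hondaSum_congr
            intro m _ e
            rw [map_pairSum]
            unfold pairSum
            refine Finset.sum_congr rfl fun ij _ => ?_
            simp only [AlgHom.coe_toRingHom, MvPolynomial.expand_X]
            ring
          have e2 : MvPolynomial.expand (p ^ n) (U (N - n)) =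
              hondaSum p n (fun m e => (MvPolynomial.expand (p ^ n) (f m)) ^ p ^ e) (N - n) := by
            rw [← hf (N - n) (by omega), ← AlgHom.coe_toRingHom, map_hondaSum]
            apply hondaSum_congr
            intro m _ e
            simp
          obtain ⟨c, hc⟩ := hondaSum_dvd p n 1 hn
            (fun m e => (MvPolynomial.expand (p ^ n) (f m)) ^ p ^ e)
            (fun m e => f m ^ p ^ (e + n)) (N - n) (fun m _ e => by
              have h1 := dvd_sub_pow_of_dvd_sub (dvd_expand_sub_pow p (f m) n) e
              rw [← pow_mul, ← pow_add, add_comm n e] at h1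
              exact (dvd_sub_comm).mp h1)
          rw [← Nat.div_eq_sub_div hn hs] at hc
          refine ⟨pairSum p (fun i => (MvPolynomial.X (Sum.inl i) : MvPolynomial (ℕ ⊕ ℕ) ℤ))
              (fun j => MvPolynomial.X (Sum.inr j)) N 0 + c, ?_⟩
          rw [e1, e2]
          linear_combination -hc
        · rw [if_neg hs]
          exact ⟨U N, by simp [Nat.div_eq_of_lt (not_le.mp hs)]⟩
      obtain ⟨c, hc⟩ := hdvd
      refine ⟨Function.update f N c, fun s hs => ?_⟩
      rcases Nat.lt_succ_iff_lt_or_eq.mp hs with hs | rfl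
      · rw [← hf s hs]
        apply hondaSum_congr
        intro m hm e
        rw [Function.update_of_ne (by omega)]
      · rw [← hc]
        by_cases h : n ≤ s
        · rw [hondaSum_rec _ _ hn _ _ h, if_pos h]
          simp only [Function.update_self, pow_zero, pow_one]
          congr 1
          apply hondaSum_congr
          intro m hm e
          rw [Function.update_of_ne (by omega)]
        · rw [hondaSum_lt _ _ _ _ (not_le.mp h), if_neg h]
          simp [Nat.div_eq_of_lt (not_le.mp h)]
  choose f hf using hN
  refine ⟨fun s => f (s + 1) s, fun s => ?_⟩
  rw [← hf (s + 1) s (by omega)]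
  apply hondaSum_congr
  intro m hm e
  show f (m + 1) m ^ p ^ e = _
  rw [eq_of_hondaSum_eq p n hn (mvPoly_torsionFree p) (f (m + 1)) (f (s + 1)) (m + 1)
    (fun i hi => by rw [hf _ _ hi, hf _ _ (by omega)]) m (by omega)]

/-- The integral polynomials `D_s(x, y)` determined (uniquely, as the polynomial ring is
torsion-free) by `∑_{i + j = s} m_i D_j^{p^i} = ∑_{i + j + l = s} m_i x_j^{p^i} y_l^{p^{i+j}}`.
This is the formula for the diagonal of `BP_*BP`, `D_s` being `Δ(t_s)`, `x_i = t_i ⊗ 1` and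
`y_j = 1 ⊗ t_j`, after `v_n ↦ 1` and `v_i ↦ 0` for `i ≠ n`.  So `D_s = ∑_{i + j = s} x_i y_j^{p^i}`
for `s ≤ n`, and for `s > n` there are correction terms. -/
def coprodPoly (p n : ℕ) [Fact p.Prime] [NeZero n] (s : ℕ) : MvPolynomial (ℕ ⊕ ℕ) ℤ :=
  (exists_coprodPoly p n).choose s

/-- The value of `D_s` at two families of elements of a commutative ring. -/
def coprodEval {A : Type*} [CommRing A] (p n : ℕ) [Fact p.Prime] [NeZero n] (x y : ℕ → A)
    (s : ℕ) : A :=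
  MvPolynomial.aeval (Sum.elim x y) (coprodPoly p n s)

theorem map_coprodEval {A B : Type*} [CommRing A] [CommRing B] (g : A →+* B) (p n : ℕ)
    [Fact p.Prime] [NeZero n] (x y : ℕ → A) (s : ℕ) :
    g (coprodEval p n x y s) = coprodEval p n (fun i => g (x i)) (fun i => g (y i)) s := by
  unfold coprodEval
  have : g (MvPolynomial.aeval (Sum.elim x y) (coprodPoly p n s)) =
      (g.toIntAlgHom.comp (MvPolynomial.aeval (Sum.elim x y))) (coprodPoly p n s) := rfl
  rw [this, MvPolynomial.comp_aeval]
  congr 2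
  ext i
  cases i <;> rfl

theorem hondaSum_coprodEval {A : Type*} [CommRing A] (p n : ℕ) [Fact p.Prime] [NeZero n]
    (x y : ℕ → A) (s : ℕ) :
    hondaSum p n (fun m e => coprodEval p n x y m ^ p ^ e) s = hondaSum p n (pairSum p x y) s := by
  have := congrArg ((MvPolynomial.aeval (Sum.elim x y) : MvPolynomial (ℕ ⊕ ℕ) ℤ →ₐ[ℤ] A) :
    MvPolynomial (ℕ ⊕ ℕ) ℤ →+* A) ((exists_coprodPoly p n).choose_spec s)
  rw [map_hondaSum, map_hondaSum] at this
  convert this using 2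
  · ext m e; simp [coprodEval, coprodPoly]
  · ext m e; rw [map_pairSum]; simp

theorem coprodEval_pow {A : Type*} [CommRing A] (p n : ℕ) [Fact p.Prime] [NeZero n]
    (x y : ℕ → A) (s i : ℕ) :
    (p : A) ∣ coprodEval p n x y s ^ p ^ i -
      coprodEval p n (fun m => x m ^ p ^ i) (fun m => y m ^ p ^ i) s := by
  obtain ⟨c, hc⟩ := dvd_expand_sub_pow p (coprodPoly p n s) i
  refine ⟨MvPolynomial.aeval (Sum.elim x y) c, ?_⟩
  have := congrArg (MvPolynomial.aeval (Sum.elim x y) : MvPolynomial (ℕ ⊕ ℕ) ℤ →ₐ[ℤ] A) hc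
  rw [map_sub, map_pow, map_mul, map_natCast] at this
  rw [← this]
  unfold coprodEval
  congr 1
  have h2 : MvPolynomial.aeval (Sum.elim x y) (MvPolynomial.expand (p ^ i) (coprodPoly p n s)) =
      ((MvPolynomial.aeval (Sum.elim x y) : _ →ₐ[ℤ] A).comp
        (MvPolynomial.expand (p ^ i))) (coprodPoly p n s) := rfl
  rw [h2]
  congr 1
  ext v
  cases v <;> simp

theorem sum_swap {A : Type*} [CommRing A] (n : ℕ) (hn : 0 < n) (F : ℕ → ℕ → ℕ → A) (s : ℕ) :
    ∑ a ∈ Finset.range (s / n + 1), ∑ ij ∈ Finset.HasAntidiagonal.antidiagonal (s - a * n),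
      F a ij.1 ij.2 =
    ∑ i ∈ Finset.range (s + 1), ∑ a ∈ Finset.range ((s - i) / n + 1), F a i (s - i - a * n) := by
  simp only [Finset.Nat.sum_antidiagonal_eq_sum_range_succ_mk]
  rw [Finset.sum_comm' (t' := Finset.range (s + 1))
    (s' := fun i => Finset.range ((s - i) / n + 1))]
  · refine Finset.sum_congr rfl fun i _ => Finset.sum_congr rfl fun a _ => ?_
    rw [Nat.sub_right_comm]
  · intro a i
    simp only [Finset.mem_range, Nat.lt_succ_iff, Nat.le_div_iff_mul_le hn]
    omega

theorem hondaSum_pairSum_left {A : Type*} [CommRing A] (p n : ℕ) (hn : 0 < n) (x y : ℕ → A)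
    (s : ℕ) : hondaSum p n (pairSum p x y) s =
      ∑ i ∈ Finset.range (s + 1), (p : A) ^ (s / n - (s - i) / n) *
        hondaSum p n (fun m e => x i ^ p ^ e * y m ^ p ^ (i + e)) (s - i) := by
  unfold hondaSum pairSum
  simp only [Finset.mul_sum]
  rw [sum_swap n hn (fun a i j => (p : A) ^ (s / n - a) * (x i * y j ^ p ^ i) ^ p ^ (a * n)) s]
  refine Finset.sum_congr rfl fun i _ => Finset.sum_congr rfl fun a ha => ?_
  have h1 : (s - i) / n ≤ s / n := Nat.div_le_div_right (Nat.sub_le _ _)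
  have h2 : s / n - a = (s / n - (s - i) / n) + ((s - i) / n - a) := by
    simp only [Finset.mem_range] at ha; omega
  rw [h2]
  ring

theorem hondaSum_pairSum_right {A : Type*} [CommRing A] (p n : ℕ) (hn : 0 < n) (x y : ℕ → A)
    (s : ℕ) : hondaSum p n (pairSum p x y) s =
      ∑ j ∈ Finset.range (s + 1), (p : A) ^ (s / n - (s - j) / n) * (y j ^ p ^ (s - j) *
        hondaSum p n (fun m e => x m ^ p ^ e) (s - j)) := by
  unfold hondaSum pairSum
  simp only [Finset.mul_sum]
  have h := sum_swap n hn (fun a j i => (p : A) ^ (s / n - a) * (x i * y j ^ p ^ i) ^ p ^ (a * n)) s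
  refine Eq.trans ?_ (h.trans ?_)
  · refine Finset.sum_congr rfl fun a _ => ?_
    rw [← Finset.Nat.sum_antidiagonal_swap]
    rfl
  · refine Finset.sum_congr rfl fun j _ => Finset.sum_congr rfl fun a ha => ?_
    have h1 : (s - j) / n ≤ s / n := Nat.div_le_div_right (Nat.sub_le _ _)
    simp only [Finset.mem_range, Nat.lt_succ_iff] at ha
    have h2 : s / n - a = (s / n - (s - j) / n) + ((s - j) / n - a) := by omega
    have h3 : a * n ≤ s - j := (Nat.le_div_iff_mul_le hn).mp ha
    have h4 : p ^ (s - j) = p ^ (s - j - a * n) * p ^ (a * n) := by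
      rw [← pow_add, Nat.sub_add_cancel h3]
    rw [h2, h4]
    ring

theorem hondaSum_mul {A : Type*} [CommRing A] (p n : ℕ) (c : A) (hc : c ^ p ^ n = c)
    (P : ℕ → ℕ → A) (s : ℕ) :
    hondaSum p n (fun m e => c ^ p ^ e * P m e) s = c * hondaSum p n P s := by
  have h : ∀ a : ℕ, c ^ p ^ (a * n) = c := by
    intro a
    induction a with
    | zero => simp
    | succ a ih => rw [Nat.succ_mul, pow_add, pow_mul, ih, hc]
  unfold hondaSum
  rw [Finset.mul_sum]
  refine Finset.sum_congr rfl fun a _ => ?_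
  simp only [h]
  ring

theorem hondaSum_coassoc {A : Type*} [CommRing A] (p n : ℕ) [Fact p.Prime] [NeZero n]
    (x y z : ℕ → A) (hx : ∀ i, x i ^ p ^ n = x i) (s : ℕ) :
    (p : A) ^ (s / n + 1) ∣
      hondaSum p n (pairSum p (coprodEval p n x y) z) s -
        hondaSum p n (pairSum p x (coprodEval p n y z)) s := by
  have hn : 0 < n := Nat.pos_of_ne_zero (NeZero.ne n)
  have e1 : hondaSum p n (pairSum p (coprodEval p n x y) z) s =
      ∑ i ∈ Finset.range (s + 1), (p : A) ^ (s / n - (s - i) / n) *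
        hondaSum p n (fun m e => x i ^ p ^ e *
          coprodEval p n (fun m => y m ^ p ^ i) (fun m => z m ^ p ^ i) m ^ p ^ e) (s - i) := by
    rw [hondaSum_pairSum_right p n hn]
    simp only [hondaSum_coprodEval, hondaSum_mul p n _ (hx _), hondaSum_pairSum_left p n hn x,
      Finset.mul_sum]
    simp only [hondaSum_pairSum_right p n hn, Finset.mul_sum]
    rw [Finset.sum_comm' (t' := Finset.range (s + 1))
      (s' := fun i => Finset.range (s - i + 1)) (by
        intro a i; simp only [Finset.mem_range]; omega)]
    refine Finset.sum_congr rfl fun i hi => Finset.sum_congr rfl fun j hj => ?_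
    simp only [Finset.mem_range, Nat.lt_succ_iff] at hi hj
    have e2 : (fun m e => y m ^ p ^ (i + e)) = (fun m e => (y m ^ p ^ i) ^ p ^ e) := by
      ext m e; rw [pow_add, pow_mul]
    rw [e2, ← pow_mul, ← pow_add, Nat.sub_right_comm s i j,
      show i + (s - j - i) = s - j by omega]
    have h1 : (s - j) / n ≤ s / n := Nat.div_le_div_right (Nat.sub_le _ _)
    have h2 : (s - i) / n ≤ s / n := Nat.div_le_div_right (Nat.sub_le _ _)
    have h3 : (s - j - i) / n ≤ (s - j) / n := Nat.div_le_div_right (Nat.sub_le _ _)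
    have h4 : (s - j - i) / n ≤ (s - i) / n := Nat.div_le_div_right (by omega)
    have h5 : (p : A) ^ (s / n - (s - j) / n) * (p : A) ^ ((s - j) / n - (s - j - i) / n) =
        (p : A) ^ (s / n - (s - i) / n) * (p : A) ^ ((s - i) / n - (s - j - i) / n) := by
      rw [← pow_add, ← pow_add]
      congr 1
      omega
    linear_combination (z j ^ p ^ (s - j) * x i *
      hondaSum p n (fun m e => (y m ^ p ^ i) ^ p ^ e) (s - j - i)) * h5
  rw [e1, hondaSum_pairSum_left p n hn x (coprodEval p n y z), ← Finset.sum_sub_distrib]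
  refine Finset.dvd_sum fun i hi => ?_
  rw [← mul_sub]
  have h1 : (s - i) / n ≤ s / n := Nat.div_le_div_right (Nat.sub_le _ _)
  rw [show s / n + 1 = (s / n - (s - i) / n) + ((s - i) / n + 1) by omega, pow_add]
  refine mul_dvd_mul_left _ (hondaSum_dvd p n 1 hn _ _ _ fun m _ e => ?_)
  rw [← mul_sub, pow_add p i e, pow_mul]
  exact Dvd.dvd.mul_left (dvd_sub_pow_of_dvd_sub
    (dvd_sub_comm.mp (coprodEval_pow p n y z m i)) e) _

/-- Coassociativity in characteristic `p`. -/
theorem coprodEval_coassoc {B : Type*} [CommRing B] (p n : ℕ) [hp : Fact p.Prime] [NeZero n]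
    [Algebra (ZMod p) B] (hB : ∀ b : B, b ^ p ^ n = b) (x y z : ℕ → B) (s : ℕ) :
    coprodEval p n (coprodEval p n x y) z s = coprodEval p n x (coprodEval p n y z) s := by
  rcases subsingleton_or_nontrivial B with hs | hs
  · exact Subsingleton.elim _ _
  have : CharP B p := charP_of_injective_algebraMap (algebraMap (ZMod p) B).injective p
  have hn : 0 < n := Nat.pos_of_ne_zero (NeZero.ne n)
  have hred : ∀ b : B, b ^ p = 0 → b = 0 := by
    intro b hb
    rw [← hB b, ← Nat.sub_add_cancel hn, pow_succ', pow_mul, hb,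
      zero_pow (pow_pos hp.out.pos _).ne']
  have htf : ∀ w : WittVector p B, (p : WittVector p B) * w = 0 → w = 0 := by
    intro w hw
    ext i
    rw [WittVector.zero_coeff]
    apply hred
    rw [← WittVector.mul_charP_coeff_succ, mul_comm, hw,
      WittVector.zero_coeff]
  let τ : (ℕ → B) → ℕ → WittVector p B := fun x i => WittVector.teichmuller p (x i)
  have hτ : ∀ (x : ℕ → B) (i : ℕ), WittVector.constantCoeff (τ x i) = x i := fun x i =>
    WittVector.teichmuller_coeff_zero p (x i)
  have h := dvd_of_hondaSum_dvd p n hn htf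
    (coprodEval p n (coprodEval p n (τ x) (τ y)) (τ z))
    (coprodEval p n (τ x) (coprodEval p n (τ y) (τ z)))
    (fun s => by
      rw [hondaSum_coprodEval, hondaSum_coprodEval]
      exact hondaSum_coassoc p n _ _ _ (fun i => by
        simp only [τ]; rw [← map_pow, hB]) s) s
  obtain ⟨c, hc⟩ := h
  have h2 := congrArg (WittVector.constantCoeff : WittVector p B →+* B) hc
  rw [map_sub, map_mul, map_natCast, CharP.cast_eq_zero, zero_mul, sub_eq_zero] at h2
  simp only [map_coprodEval, hτ] at h2
  exact h2

theorem coprodEval_counit_right {A : Type*} [CommRing A] (p n : ℕ) [hp : Fact p.Prime] [NeZero n]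
    (x : ℕ → A) (s : ℕ) : coprodEval p n x (Pi.single 0 1) s = x s := by
  have hn : 0 < n := Nat.pos_of_ne_zero (NeZero.ne n)
  have key : ∀ s, coprodEval p n (fun i => (MvPolynomial.X i : MvPolynomial ℕ ℤ))
      (Pi.single 0 1) s = MvPolynomial.X s := fun s => by
    refine eq_of_hondaSum_eq p n hn (mvPoly_torsionFree p) _ _ (s + 1) (fun s _ => ?_) s (by omega)
    rw [hondaSum_coprodEval]
    apply hondaSum_congr
    intro m _ e
    unfold pairSum
    rw [Finset.sum_eq_single (m, 0)]
    · simp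
    · rintro ⟨i, j⟩ hij hne
      have : j ≠ 0 := by
        rintro rfl
        simp at hij
        exact hne (by simp [hij])
      simp [this, hp.out.ne_zero]
    · simp
  have h := congrArg (MvPolynomial.aeval x : MvPolynomial ℕ ℤ →ₐ[ℤ] A) (key s)
  rw [← AlgHom.coe_toRingHom, map_coprodEval] at h
  simp only [AlgHom.coe_toRingHom, MvPolynomial.aeval_X] at h
  rw [← h]
  congr 1
  ext i
  by_cases hi : i = 0 <;> simp [hi]

theorem coprodEval_counit_left {A : Type*} [CommRing A] (p n : ℕ) [hp : Fact p.Prime] [NeZero n]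
    (y : ℕ → A) (s : ℕ) : coprodEval p n (Pi.single 0 1) y s = y s := by
  have hn : 0 < n := Nat.pos_of_ne_zero (NeZero.ne n)
  have key : ∀ s, coprodEval p n (Pi.single 0 1)
      (fun i => (MvPolynomial.X i : MvPolynomial ℕ ℤ)) s = MvPolynomial.X s := fun s => by
    refine eq_of_hondaSum_eq p n hn (mvPoly_torsionFree p) _ _ (s + 1) (fun s _ => ?_) s (by omega)
    rw [hondaSum_coprodEval]
    apply hondaSum_congr
    intro m _ e
    unfold pairSum
    rw [Finset.sum_eq_single (0, m)]
    · simp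
    · rintro ⟨i, j⟩ hij hne
      have : i ≠ 0 := by
        rintro rfl
        simp at hij
        exact hne (by simp [hij])
      simp [this, hp.out.ne_zero]
    · simp
  have h := congrArg (MvPolynomial.aeval y : MvPolynomial ℕ ℤ →ₐ[ℤ] A) (key s)
  rw [← AlgHom.coe_toRingHom, map_coprodEval] at h
  simp only [AlgHom.coe_toRingHom, MvPolynomial.aeval_X] at h
  rw [← h]
  congr 1
  ext i
  by_cases hi : i = 0 <;> simp [hi]

theorem coprodEval_lt {A : Type*} [CommRing A] (p n k : ℕ) [hp : Fact p.Prime] [NeZero n]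
    (x y : ℕ → A) (hx0 : x 0 = 1) (hy0 : y 0 = 1) (hx : ∀ i, i ≠ 0 → i < k → x i = 0)
    (hy : ∀ i, i ≠ 0 → i < k → y i = 0) (s : ℕ) (hs : s < k) :
    coprodEval p n x y s = if s = 0 then 1 else 0 := by
  have hn : 0 < n := Nat.pos_of_ne_zero (NeZero.ne n)
  let u : (ℕ → ℕ ⊕ ℕ) → ℕ → MvPolynomial (ℕ ⊕ ℕ) ℤ := fun c i =>
    if i = 0 then 1 else if i < k then 0 else MvPolynomial.X (c i)
  have key := eq_of_hondaSum_eq p n hn (mvPoly_torsionFree p)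
    (coprodEval p n (u Sum.inl) (u Sum.inr)) (fun s => if s = 0 then 1 else 0) k (fun s hs => by
      rw [hondaSum_coprodEval]
      apply hondaSum_congr
      intro m hm e
      unfold pairSum
      by_cases h0 : m = 0
      · subst h0
        simp [u]
      · rw [if_neg h0, zero_pow (pow_pos hp.out.pos _).ne']
        refine Finset.sum_eq_zero fun ij hij => ?_
        rw [Finset.HasAntidiagonal.mem_antidiagonal] at hij
        by_cases h1 : ij.1 = 0
        · have h2 : ij.2 ≠ 0 := by omega
          have h3 : ij.2 < k := by omega
          simp [u, h2, h3, hp.out.ne_zero]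
        · have h3 : ij.1 < k := by omega
          simp [u, h1, h3, hp.out.ne_zero]) s hs
  have h := congrArg (MvPolynomial.aeval (Sum.elim x y) : MvPolynomial (ℕ ⊕ ℕ) ℤ →ₐ[ℤ] A) key
  rw [← AlgHom.coe_toRingHom, map_coprodEval] at h
  have hu1 : (fun i => (MvPolynomial.aeval (Sum.elim x y) : MvPolynomial (ℕ ⊕ ℕ) ℤ →ₐ[ℤ] A).toRingHom
      (u Sum.inl i)) = x := by
    ext i
    by_cases h0 : i = 0
    · simp [u, h0, hx0]
    · by_cases h1 : i < k
      · simp [u, h0, h1, hx]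
      · simp [u, h0, h1]
  have hu2 : (fun i => (MvPolynomial.aeval (Sum.elim x y) : MvPolynomial (ℕ ⊕ ℕ) ℤ →ₐ[ℤ] A).toRingHom
      (u Sum.inr i)) = y := by
    ext i
    by_cases h0 : i = 0
    · simp [u, h0, hy0]
    · by_cases h1 : i < k
      · simp [u, h0, h1, hy]
      · simp [u, h0, h1]
  refine Eq.trans ?_ (h.trans ?_)
  · exact congrArg₂ (fun a b => coprodEval p n a b s) hu1.symm hu2.symm
  · split_ifs <;> simp

theorem coprodEval_zero {A : Type*} [CommRing A] (p n : ℕ) [hp : Fact p.Prime] [NeZero n]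
    (x y : ℕ → A) : coprodEval p n x y 0 = x 0 * y 0 := by
  have h := hondaSum_coprodEval p n x y 0
  rw [hondaSum_lt _ _ _ _ (Nat.pos_of_ne_zero (NeZero.ne n)),
    hondaSum_lt _ _ _ _ (Nat.pos_of_ne_zero (NeZero.ne n))] at h
  simpa [pairSum] using h

theorem coprodEval_top {A : Type*} [CommRing A] (p n : ℕ) [hp : Fact p.Prime] [NeZero n]
    (x y y' : ℕ → A) (s : ℕ) (h : ∀ m < s, y m = y' m) :
    coprodEval p n x y s - coprodEval p n x y' s = x 0 * (y s - y' s) := by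
  have hn : 0 < n := Nat.pos_of_ne_zero (NeZero.ne n)
  let X : ℕ → MvPolynomial (ℕ ⊕ ℕ ⊕ ℕ) ℤ := fun i => MvPolynomial.X (Sum.inl i)
  let Y : ℕ → MvPolynomial (ℕ ⊕ ℕ ⊕ ℕ) ℤ := fun i => MvPolynomial.X (Sum.inr (Sum.inl i))
  let Y' : ℕ → MvPolynomial (ℕ ⊕ ℕ ⊕ ℕ) ℤ := fun i =>
    if i < s then Y i else MvPolynomial.X (Sum.inr (Sum.inr i))
  have hYY : ∀ m < s, Y m = Y' m := fun m hm => by simp [Y', hm]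
  have hP : ∀ m < s, ∀ e, pairSum p X Y m e = pairSum p X Y' m e := fun m hm e => by
    refine Finset.sum_congr rfl fun ij hij => ?_
    rw [Finset.HasAntidiagonal.mem_antidiagonal] at hij
    rw [hYY ij.2 (by omega)]
  have hlow := eq_of_hondaSum_eq p n hn (mvPoly_torsionFree p) (coprodEval p n X Y)
    (coprodEval p n X Y') s (fun m hm => by
      rw [hondaSum_coprodEval, hondaSum_coprodEval]
      exact hondaSum_congr _ _ _ _ _ fun m' hm' e => hP m' (by omega) e)
  have hP0 : pairSum p X Y s 0 - pairSum p X Y' s 0 = X 0 * (Y s - Y' s) := by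
    unfold pairSum
    rw [← Finset.sum_sub_distrib, Finset.sum_eq_single (0, s)]
    · simp; ring
    · rintro ⟨i, j⟩ hij hne
      rw [Finset.HasAntidiagonal.mem_antidiagonal] at hij
      have : j < s := by
        rcases Nat.eq_zero_or_pos i with rfl | hi
        · exact absurd (by simpa using hij) (fun h : j = s => hne (by rw [h]))
        · simp only at hij; omega
      simp [hYY j this]
    · simp
  have key : coprodEval p n X Y s - coprodEval p n X Y' s = X 0 * (Y s - Y' s) := by
    have h1 := hondaSum_coprodEval p n X Y s
    have h2 := hondaSum_coprodEval p n X Y' s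
    rcases lt_or_ge s n with hs | hs
    · rw [hondaSum_lt _ _ _ _ hs, hondaSum_lt _ _ _ _ hs] at h1 h2
      simp only [pow_zero, pow_one] at h1 h2
      rw [h1, h2, hP0]
    · rw [hondaSum_rec _ _ hn _ _ hs, hondaSum_rec _ _ hn _ _ hs] at h1 h2
      rw [hondaSum_congr p n (fun m e => coprodEval p n X Y m ^ p ^ (e + n))
        (fun m e => coprodEval p n X Y' m ^ p ^ (e + n)) (s - n)
        (fun m hm e => by rw [hlow m (by omega)]),
        hondaSum_congr p n (fun m e => pairSum p X Y m (e + n))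
        (fun m e => pairSum p X Y' m (e + n)) (s - n)
        (fun m hm e => hP m (by omega) _)] at h1
      have hc : ∀ (N : ℕ) (a : MvPolynomial (ℕ ⊕ ℕ ⊕ ℕ) ℤ),
          (p : MvPolynomial (ℕ ⊕ ℕ ⊕ ℕ) ℤ) ^ N * a = 0 → a = 0 := by
        intro N
        induction N with
        | zero => intro a ha; simpa using ha
        | succ N ih => intro a ha; exact ih a (mvPoly_torsionFree p _ (by rw [← ha]; ring))
      refine sub_eq_zero.mp (hc (s / n) _ ?_)
      simp only [pow_zero, pow_one] at h1 h2
      rw [← hP0]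
      linear_combination h1 - h2
  have hg := congrArg (MvPolynomial.aeval (Sum.elim x (Sum.elim y y')) :
    MvPolynomial (ℕ ⊕ ℕ ⊕ ℕ) ℤ →ₐ[ℤ] A).toRingHom key
  rw [map_sub, map_coprodEval, map_coprodEval, map_mul, map_sub] at hg
  have e1 : ∀ i, (MvPolynomial.aeval (Sum.elim x (Sum.elim y y')) :
    MvPolynomial (ℕ ⊕ ℕ ⊕ ℕ) ℤ →ₐ[ℤ] A).toRingHom (X i) = x i := fun i => by simp [X]
  have e2 : ∀ i, (MvPolynomial.aeval (Sum.elim x (Sum.elim y y')) :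
    MvPolynomial (ℕ ⊕ ℕ ⊕ ℕ) ℤ →ₐ[ℤ] A).toRingHom (Y i) = y i := fun i => by simp [Y]
  have e3 : ∀ i, (MvPolynomial.aeval (Sum.elim x (Sum.elim y y')) :
    MvPolynomial (ℕ ⊕ ℕ ⊕ ℕ) ℤ →ₐ[ℤ] A).toRingHom (Y' i) = y' i := fun i => by
    by_cases hi : i < s
    · simp [Y', Y, hi, h i hi]
    · simp [Y', hi]
  simpa only [e1, e2, e3] using hg

/-- The family `c` with `D(x, c) = (1, 0, 0, …)`, for a family `x` with `x_0 = 1`; this gives the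
conjugation. -/
def invSeq {A : Type*} [CommRing A] (p n : ℕ) [Fact p.Prime] [NeZero n] (x : ℕ → A) (s : ℕ) : A :=
  (if s = 0 then 1 else 0) -
    coprodEval p n x (fun m => if _h : m < s then invSeq p n x m else 0) s

theorem coprodEval_invSeq {A : Type*} [CommRing A] (p n : ℕ) [hp : Fact p.Prime] [NeZero n]
    (x : ℕ → A) (hx : x 0 = 1) : coprodEval p n x (invSeq p n x) = Pi.single 0 1 := by
  funext s
  have h := coprodEval_top p n x (invSeq p n x)
    (fun m => if _h : m < s then invSeq p n x m else 0) s (fun m hm => by simp [hm])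
  rw [hx, one_mul] at h
  simp only [lt_irrefl, dite_false, sub_zero] at h
  rw [sub_eq_iff_eq_add] at h
  rw [h, invSeq, sub_add_cancel]
  by_cases h0 : s = 0 <;> simp [h0]

theorem invSeq_zero {A : Type*} [CommRing A] (p n : ℕ) [hp : Fact p.Prime] [NeZero n]
    (x : ℕ → A) : invSeq p n x 0 = 1 := by
  rw [invSeq, coprodEval_zero]
  simp

theorem coprodEval_invSeq_left {B : Type*} [CommRing B] (p n : ℕ) [hp : Fact p.Prime] [NeZero n]
    [Algebra (ZMod p) B] (hB : ∀ b : B, b ^ p ^ n = b) (x : ℕ → B) (hx : x 0 = 1) :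
    coprodEval p n (invSeq p n x) x = Pi.single 0 1 := by
  have h1 := coprodEval_invSeq p n x hx
  have h2 := coprodEval_invSeq p n (invSeq p n x) (invSeq_zero p n x)
  have h3 : invSeq p n (invSeq p n x) = x := by
    funext s
    have := coprodEval_coassoc p n hB x (invSeq p n x) (invSeq p n (invSeq p n x)) s
    rw [h1, h2, coprodEval_counit_left, coprodEval_counit_right] at this
    exact this
  rw [h3] at h2
  exact h2

theorem invSeq_lt {A : Type*} [CommRing A] (p n k : ℕ) [hp : Fact p.Prime] [NeZero n]
    (x : ℕ → A) (hx0 : x 0 = 1) (hx : ∀ i, i ≠ 0 → i < k → x i = 0) (s : ℕ) (h0 : s ≠ 0)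
    (hs : s < k) : invSeq p n x s = 0 := by
  induction s using Nat.strong_induction_on with
  | _ s ih =>
    rw [invSeq, coprodEval_lt p n k x _ hx0 _ hx _ s hs]
    · simp
    · simp [Nat.pos_of_ne_zero h0, invSeq_zero]
    · intro i hi0 hik
      by_cases his : i < s
      · simp [his, ih i his hi0 (by omega)]
      · simp [his]

end Coproduct

section Algebra

/-- The set of indices `s ≥ k`. -/
abbrev Idx (k : ℕ) : Type := {s : ℕ // k ≤ s}

/-- The algebra `S(n,k) = ℤ/p[t_k, t_{k+1}, …] / (t_s^{p^n} - t_s)`.  Its Hopf algebra structure is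
the instance below. -/
def MoravaAlg (p n k : ℕ) : Type :=
  MvPolynomial (Idx k) (ZMod p) ⧸
    Ideal.span (Set.range fun s : Idx k =>
      (MvPolynomial.X s ^ p ^ n - MvPolynomial.X s : MvPolynomial (Idx k) (ZMod p)))

variable (p n k : ℕ)

instance : CommRing (MoravaAlg p n k) := inferInstanceAs (CommRing (_ ⧸ _))

instance : Algebra (ZMod p) (MoravaAlg p n k) := inferInstanceAs (Algebra (ZMod p) (_ ⧸ _))

/-- The quotient map. -/
def mkHom : MvPolynomial (Idx k) (ZMod p) →ₐ[ZMod p] MoravaAlg p n k := Ideal.Quotient.mkₐ _ _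

/-- The generator `t_s` for `s ≥ k`. -/
def gen (s : Idx k) : MoravaAlg p n k := mkHom p n k (MvPolynomial.X s)

/-- The elements `t_s` for all `s ≥ 0`: `t_0 = 1` and `t_s = 0` for `0 < s < k`. -/
def tt (s : ℕ) : MoravaAlg p n k :=
  if s = 0 then 1 else if h : k ≤ s then gen p n k ⟨s, h⟩ else 0

variable {p n k}

theorem gen_pow (s : Idx k) : gen p n k s ^ p ^ n = gen p n k s := by
  unfold gen
  rw [← map_pow, ← sub_eq_zero, ← map_sub]
  exact Ideal.Quotient.eq_zero_iff_mem.mpr (Ideal.subset_span ⟨s, rfl⟩)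

/-- The algebra homomorphism out of `S(n,k)` with given values on the generators. -/
def liftHom {B : Type*} [CommRing B] [Algebra (ZMod p) B] (f : Idx k → B)
    (hf : ∀ s, f s ^ p ^ n = f s) : MoravaAlg p n k →ₐ[ZMod p] B :=
  Ideal.Quotient.liftₐ _ (MvPolynomial.aeval f) (by
    intro a ha
    have : Ideal.span (Set.range fun s : Idx k =>
      (MvPolynomial.X s ^ p ^ n - MvPolynomial.X s : MvPolynomial (Idx k) (ZMod p))) ≤
        RingHom.ker (MvPolynomial.aeval f : MvPolynomial (Idx k) (ZMod p) →ₐ[ZMod p] B) := by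
      rw [Ideal.span_le]
      rintro _ ⟨s, rfl⟩
      simp [RingHom.mem_ker, hf]
    exact this ha)

theorem liftHom_gen {B : Type*} [CommRing B] [Algebra (ZMod p) B] (f : Idx k → B)
    (hf : ∀ s, f s ^ p ^ n = f s) (s : Idx k) : liftHom f hf (gen p n k s) = f s := by
  exact MvPolynomial.aeval_X f s

theorem algHom_ext' {B : Type*} [Semiring B] [Algebra (ZMod p) B]
    {f g : MoravaAlg p n k →ₐ[ZMod p] B} (h : ∀ s, f (gen p n k s) = g (gen p n k s)) : f = g := by
  apply Ideal.Quotient.algHom_ext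
  apply MvPolynomial.algHom_ext
  exact h

theorem add_pow_q [hp : Fact p.Prime] {B : Type*} [CommRing B] [Algebra (ZMod p) B] (a b : B) :
    (a + b) ^ p ^ n = a ^ p ^ n + b ^ p ^ n := by
  rcases subsingleton_or_nontrivial B with hs | hs
  · exact Subsingleton.elim _ _
  have : CharP B p := charP_of_injective_algebraMap (algebraMap (ZMod p) B).injective p
  exact add_pow_char_pow a b p n

theorem moravaAlg_pow [hp : Fact p.Prime] (b : MoravaAlg p n k) : b ^ p ^ n = b := by
  obtain ⟨f, rfl⟩ : ∃ f, mkHom p n k f = b := Ideal.Quotient.mk_surjective b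
  induction f using MvPolynomial.induction_on with
  | C a =>
    rw [← map_pow, ← map_pow]
    congr 2
    induction n with
    | zero => simp
    | succ n ih => rw [pow_succ, pow_mul, ZMod.pow_card_pow, ZMod.pow_card]
  | add f g hf hg => rw [map_add, add_pow_q, hf, hg]
  | mul_X f s hf => rw [map_mul, mul_pow, hf]; congr 1; exact gen_pow s

theorem tensor_pow [hp : Fact p.Prime] {A B : Type*} [CommRing A] [CommRing B] [Algebra (ZMod p) A]
    [Algebra (ZMod p) B] (hA : ∀ a : A, a ^ p ^ n = a) (hB : ∀ b : B, b ^ p ^ n = b)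
    (c : A ⊗[ZMod p] B) : c ^ p ^ n = c := by
  induction c using TensorProduct.induction_on with
  | zero => exact zero_pow (pow_pos hp.out.pos _).ne'
  | tmul a b => rw [Algebra.TensorProduct.tmul_pow, hA, hB]
  | add x y hx hy => rw [add_pow_q, hx, hy]

theorem assoc_aux {R A : Type*} [CommRing R] [CommRing A] [Algebra R A] (p n : ℕ) [Fact p.Prime]
    [NeZero n] (u v : ℕ → A) (s : ℕ) :
    Algebra.TensorProduct.assoc R R R A A A
      (coprodEval p n (fun i => u i ⊗ₜ[R] (1 : A)) (fun i => (1 : A) ⊗ₜ[R] v i) s ⊗ₜ[R] (1 : A)) =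
    coprodEval p n (fun i => u i ⊗ₜ[R] ((1 : A) ⊗ₜ[R] (1 : A)))
      (fun i => (1 : A) ⊗ₜ[R] (v i ⊗ₜ[R] (1 : A))) s := by
  let g : A ⊗[R] A →ₐ[R] A ⊗[R] (A ⊗[R] A) :=
    (Algebra.TensorProduct.assoc R R R A A A).toAlgHom.comp Algebra.TensorProduct.includeLeft
  exact map_coprodEval g.toRingHom p n _ _ s

theorem include_aux {R A B : Type*} [CommRing R] [CommRing A] [CommRing B] [Algebra R A]
    [Algebra R B] (p n : ℕ) [Fact p.Prime] [NeZero n] (u v : ℕ → B) (s : ℕ) :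
    (1 : A) ⊗ₜ[R] (coprodEval p n u v s) =
    coprodEval p n (fun i => (1 : A) ⊗ₜ[R] u i) (fun i => (1 : A) ⊗ₜ[R] v i) s :=
  map_coprodEval (Algebra.TensorProduct.includeRight : B →ₐ[R] A ⊗[R] B).toRingHom p n _ _ s

variable (p n k) [hp : Fact p.Prime] [NeZero n] [NeZero k]

/-- The diagonal of `S(n,k)`: `Δ(t_s) = D_s(t ⊗ 1, 1 ⊗ t)`. -/
def comulHom : MoravaAlg p n k →ₐ[ZMod p] MoravaAlg p n k ⊗[ZMod p] MoravaAlg p n k :=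
  liftHom (fun s => coprodEval p n (fun i => tt p n k i ⊗ₜ[ZMod p] (1 : MoravaAlg p n k))
      (fun j => (1 : MoravaAlg p n k) ⊗ₜ[ZMod p] tt p n k j) s)
    (fun _ => tensor_pow moravaAlg_pow moravaAlg_pow _)

/-- The counit of `S(n,k)`: `t_s ↦ 0`. -/
def counitHom : MoravaAlg p n k →ₐ[ZMod p] ZMod p :=
  liftHom (fun _ => 0) (fun _ => zero_pow (pow_pos hp.out.pos _).ne')

theorem comulHom_tt (s : ℕ) : comulHom p n k (tt p n k s) =
    coprodEval p n (fun i => tt p n k i ⊗ₜ[ZMod p] (1 : MoravaAlg p n k))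
      (fun j => (1 : MoravaAlg p n k) ⊗ₜ[ZMod p] tt p n k j) s := by
  by_cases h : k ≤ s
  · have h0 : s ≠ 0 := by have := NeZero.ne k; omega
    rw [tt, if_neg h0, dif_pos h]
    exact liftHom_gen _ _ _
  · rw [coprodEval_lt p n k _ _ (by simp [tt, Algebra.TensorProduct.one_def])
      (by simp [tt, Algebra.TensorProduct.one_def])
      (fun i h0 hi => by simp [tt, h0, not_le.mpr hi])
      (fun i h0 hi => by simp [tt, h0, not_le.mpr hi]) s (not_le.mp h)]
    by_cases h0 : s = 0
    · simp [tt, h0]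
    · simp [tt, h0, h]

theorem counitHom_tt (s : ℕ) :
    counitHom p n k (tt p n k s) = (Pi.single 0 1 : ℕ → ZMod p) s := by
  by_cases h0 : s = 0
  · simp [tt, h0]
  · rw [Pi.single_eq_of_ne h0, tt, if_neg h0]
    by_cases h : k ≤ s
    · rw [dif_pos h]
      exact liftHom_gen _ _ _
    · rw [dif_neg h, map_zero]

theorem gen_eq_tt (s : Idx k) : gen p n k s = tt p n k s := by
  have h0 : s.1 ≠ 0 := by have := NeZero.ne k; have := s.2; omega
  rw [tt, if_neg h0, dif_pos s.2]

/-- The bialgebra `S(n,k)`. -/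
instance : Bialgebra (ZMod p) (MoravaAlg p n k) :=
  Bialgebra.ofAlgHom (comulHom p n k) (counitHom p n k)
    (by
      apply algHom_ext'
      intro s
      rw [gen_eq_tt]
      simp only [AlgHom.comp_apply]
      rw [comulHom_tt]
      rw [← AlgHom.coe_toRingHom (Algebra.TensorProduct.map (comulHom p n k) _), map_coprodEval,
        ← AlgHom.coe_toRingHom (Algebra.TensorProduct.map _ (comulHom p n k)), map_coprodEval,
        ← AlgHom.coe_toRingHom (AlgEquiv.toAlgHom _), map_coprodEval]
      simp only [AlgHom.coe_toRingHom, Algebra.TensorProduct.map_tmul, map_one, AlgHom.id_apply,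
        comulHom_tt]
      have e := coprodEval_coassoc p n
        (tensor_pow (moravaAlg_pow (p := p) (n := n) (k := k)) (tensor_pow moravaAlg_pow moravaAlg_pow))
        (fun i => tt p n k i ⊗ₜ[ZMod p] ((1 : MoravaAlg p n k) ⊗ₜ[ZMod p] (1 : MoravaAlg p n k)))
        (fun i => (1 : MoravaAlg p n k) ⊗ₜ[ZMod p] (tt p n k i ⊗ₜ[ZMod p] (1 : MoravaAlg p n k)))
        (fun i => (1 : MoravaAlg p n k) ⊗ₜ[ZMod p] ((1 : MoravaAlg p n k) ⊗ₜ[ZMod p] tt p n k i)) s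
      refine Eq.trans ?_ (e.trans ?_)
      · exact congrArg₂ (fun a b => coprodEval p n a b s) (funext fun i => assoc_aux p n _ _ i) rfl
      · exact congrArg (fun b => coprodEval p n _ b s) (funext fun i => (include_aux p n _ _ i).symm))
    (by
      apply algHom_ext'
      intro s
      rw [gen_eq_tt]
      simp only [AlgHom.comp_apply]
      rw [comulHom_tt, ← AlgHom.coe_toRingHom, map_coprodEval]
      simp only [AlgHom.coe_toRingHom, Algebra.TensorProduct.map_tmul, map_one, AlgHom.id_apply,
        counitHom_tt]
      change _ = (1 : ZMod p) ⊗ₜ[ZMod p] tt p n k s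
      refine Eq.trans ?_ (coprodEval_counit_left p n (fun j => (1 : ZMod p) ⊗ₜ[ZMod p] tt p n k j) s)
      congr 1
      funext i
      by_cases h : i = 0
      · subst h; simp [Algebra.TensorProduct.one_def]
      · simp [h])
    (by
      apply algHom_ext'
      intro s
      rw [gen_eq_tt]
      simp only [AlgHom.comp_apply]
      rw [comulHom_tt, ← AlgHom.coe_toRingHom, map_coprodEval]
      simp only [AlgHom.coe_toRingHom, Algebra.TensorProduct.map_tmul, map_one, AlgHom.id_apply,
        counitHom_tt]
      change _ = tt p n k s ⊗ₜ[ZMod p] (1 : ZMod p)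
      refine Eq.trans ?_ (coprodEval_counit_right p n (fun j => tt p n k j ⊗ₜ[ZMod p] (1 : ZMod p)) s)
      congr 1
      funext i
      by_cases h : i = 0
      · subst h; simp [Algebra.TensorProduct.one_def]
      · simp [h])

theorem tt_zero : tt p n k 0 = 1 := by simp [tt]

theorem tt_lt (s : ℕ) (h0 : s ≠ 0) (hs : s < k) : tt p n k s = 0 := by
  simp [tt, h0, not_le.mpr hs]

/-- The conjugation of `S(n,k)`. -/
def antipodeHom : MoravaAlg p n k →ₐ[ZMod p] MoravaAlg p n k :=
  liftHom (fun s => invSeq p n (tt p n k) s) (fun _ => moravaAlg_pow _)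

theorem antipodeHom_tt (s : ℕ) : antipodeHom p n k (tt p n k s) = invSeq p n (tt p n k) s := by
  by_cases h0 : s = 0
  · rw [h0, tt_zero, map_one, invSeq_zero]
  · by_cases h : k ≤ s
    · rw [← gen_eq_tt p n k ⟨s, h⟩]
      exact liftHom_gen _ _ _
    · rw [tt_lt p n k s h0 (not_le.mp h), map_zero,
        invSeq_lt p n k _ (tt_zero p n k) (fun i => tt_lt p n k i) s h0 (not_le.mp h)]

theorem unit_counit_tt (s : ℕ) : algebraMap (ZMod p) (MoravaAlg p n k)
    (counitHom p n k (tt p n k s)) = (Pi.single 0 1 : ℕ → MoravaAlg p n k) s := by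
  rw [counitHom_tt]
  by_cases h0 : s = 0
  · subst h0; simp
  · simp [h0]

/-- The Hopf algebra `S(n,k)`. -/
instance : HopfAlgebra (ZMod p) (MoravaAlg p n k) :=
  HopfAlgebra.ofAlgHom (antipodeHom p n k)
    (by
      apply algHom_ext'
      intro s
      rw [gen_eq_tt]
      refine Eq.trans ?_ (unit_counit_tt p n k s).symm
      refine Eq.trans (congrArg (Algebra.TensorProduct.lift (antipodeHom p n k)
        (AlgHom.id (ZMod p) (MoravaAlg p n k)) fun _ => Commute.all _).toRingHom
        (comulHom_tt p n k s)) ?_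
      rw [map_coprodEval, ← coprodEval_invSeq_left p n moravaAlg_pow _ (tt_zero p n k)]
      refine congrArg₂ (fun a b => coprodEval p n a b s) (funext fun i => ?_) (funext fun i => ?_)
      · refine (Algebra.TensorProduct.lift_tmul _ _ _ _ _).trans ?_
        rw [antipodeHom_tt, map_one, mul_one]
      · refine (Algebra.TensorProduct.lift_tmul _ _ _ _ _).trans ?_
        rw [map_one, one_mul]
        rfl)
    (by
      apply algHom_ext'
      intro s
      rw [gen_eq_tt]
      refine Eq.trans ?_ (unit_counit_tt p n k s).symm
      refine Eq.trans (congrArg (Algebra.TensorProduct.lift 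
        (AlgHom.id (ZMod p) (MoravaAlg p n k)) (antipodeHom p n k) fun _ _ => Commute.all _ _).toRingHom
        (comulHom_tt p n k s)) ?_
      rw [map_coprodEval, ← coprodEval_invSeq p n _ (tt_zero p n k)]
      refine congrArg₂ (fun a b => coprodEval p n a b s) (funext fun i => ?_) (funext fun i => ?_)
      · refine (Algebra.TensorProduct.lift_tmul _ _ _ _ _).trans ?_
        rw [map_one, mul_one]
        rfl
      · refine (Algebra.TensorProduct.lift_tmul _ _ _ _ _).trans ?_
        rw [antipodeHom_tt, map_one, one_mul])

end Algebra


section Subquotient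

/-- Submodules `Z i` and `B i` of an algebra, indexed by a monoid of degrees, such that the direct
sum of the quotients `Z i / (B i ∩ Z i)` inherits a graded multiplication.  Used for the associated
graded algebra of a filtered algebra and for the pages of a multiplicative spectral sequence. -/
structure SubquotientSystem (R A ι : Type*) [CommRing R] [Ring A] [Algebra R A] [AddMonoid ι] where
  Z : ι → Submodule R A
  B : ι → Submodule R A
  one_mem : (1 : A) ∈ Z 0
  mul_mem : ∀ {i j x y}, x ∈ Z i → y ∈ Z j → x * y ∈ Z (i + j)
  mul_mem_left : ∀ {i j x y}, x ∈ Z i → y ∈ Z j → y ∈ B j → x * y ∈ B (i + j)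
  mul_mem_right : ∀ {i j x y}, x ∈ Z i → y ∈ Z j → x ∈ B i → x * y ∈ B (i + j)

namespace SubquotientSystem

variable {R A ι : Type*} [CommRing R] [Ring A] [Algebra R A] [AddMonoid ι]
  (Q : SubquotientSystem R A ι)

/-- The component `Z i / (B i ∩ Z i)` of degree `i`. -/
def Piece (i : ι) : Type _ := Q.Z i ⧸ (Q.B i).submoduleOf (Q.Z i)

instance (i : ι) : AddCommGroup (Q.Piece i) := inferInstanceAs (AddCommGroup (_ ⧸ _))

instance (i : ι) : Module R (Q.Piece i) :=
  inferInstanceAs (Module R (Q.Z i ⧸ (Q.B i).submoduleOf (Q.Z i)))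

/-- The class of an element of `Z i` in the component of degree `i`. -/
def cls (i : ι) : Q.Z i →ₗ[R] Q.Piece i := Submodule.mkQ _

/-- The multiplication of components, `[x] [y] = [x y]`. -/
def mulPiece (i j : ι) : Q.Piece i →ₗ[R] Q.Piece j →ₗ[R] Q.Piece (i + j) :=
  Submodule.liftQ _ (LinearMap.flip (Submodule.liftQ _
    (LinearMap.flip (LinearMap.mk₂ R (fun (x : Q.Z i) (y : Q.Z j) =>
      Q.cls (i + j) ⟨x.1 * y.1, Q.mul_mem x.2 y.2⟩)
      (fun x x' y => by rw [← map_add]; congr 1; ext; exact add_mul _ _ _)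
      (fun c x y => by rw [← map_smul]; congr 1; ext; exact smul_mul_assoc _ _ _)
      (fun x y y' => by rw [← map_add]; congr 1; ext; exact mul_add _ _ _)
      (fun c x y => by rw [← map_smul]; congr 1; ext; exact mul_smul_comm _ _ _)))
    (by
      intro y hy
      rw [LinearMap.mem_ker]
      ext x
      exact (Submodule.Quotient.mk_eq_zero _).mpr (Q.mul_mem_left x.2 y.2 hy))))
  (by
    intro x hx
    rw [LinearMap.mem_ker]
    apply Submodule.linearMap_qext
    ext y
    exact (Submodule.Quotient.mk_eq_zero _).mpr (Q.mul_mem_right x.2 y.2 hx))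

theorem mulPiece_cls (i j : ι) (x : Q.Z i) (y : Q.Z j) :
    Q.mulPiece i j (Q.cls i x) (Q.cls j y) = Q.cls (i + j) ⟨x.1 * y.1, Q.mul_mem x.2 y.2⟩ := rfl

theorem cls_eq {i j : ι} (h : i = j) {x y : A} (hx : x ∈ Q.Z i) (hy : y ∈ Q.Z j) (hxy : x = y) :
    GradedMonoid.mk i (Q.cls i ⟨x, hx⟩) = GradedMonoid.mk j (Q.cls j ⟨y, hy⟩) := by
  subst h; subst hxy; rfl

theorem exists_cls {i : ι} (a : Q.Piece i) : ∃ x, Q.cls i x = a := Submodule.mkQ_surjective _ a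

instance : GradedMonoid.GMul Q.Piece where
  mul {i j} a b := Q.mulPiece i j a b

instance : GradedMonoid.GOne Q.Piece where
  one := Q.cls 0 ⟨1, Q.one_mem⟩

instance : GradedMonoid.GMonoid Q.Piece where
  one_mul := by
    rintro ⟨i, a⟩
    obtain ⟨x, rfl⟩ := Q.exists_cls a
    exact Q.cls_eq (zero_add i) _ x.2 (one_mul _)
  mul_one := by
    rintro ⟨i, a⟩
    obtain ⟨x, rfl⟩ := Q.exists_cls a
    exact Q.cls_eq (add_zero i) _ x.2 (mul_one _)
  mul_assoc := by
    rintro ⟨i, a⟩ ⟨j, b⟩ ⟨l, c⟩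
    obtain ⟨x, rfl⟩ := Q.exists_cls a
    obtain ⟨y, rfl⟩ := Q.exists_cls b
    obtain ⟨z, rfl⟩ := Q.exists_cls c
    exact Q.cls_eq (add_assoc i j l) _ _ (mul_assoc _ _ _)

theorem intCast_mem (m : ℤ) : (m : A) ∈ Q.Z 0 := by
  rw [← zsmul_one]
  exact zsmul_mem Q.one_mem m

theorem algebraMap_mem (c : R) : algebraMap R A c ∈ Q.Z 0 := by
  rw [Algebra.algebraMap_eq_smul_one]
  exact Submodule.smul_mem _ _ Q.one_mem

instance : DirectSum.GRing Q.Piece where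
  mul_zero a := map_zero _
  zero_mul b := by
    change Q.mulPiece _ _ 0 b = 0
    rw [map_zero, LinearMap.zero_apply]
  mul_add a b c := map_add _ _ _
  add_mul a b c := by
    change Q.mulPiece _ _ (a + b) c = Q.mulPiece _ _ a c + Q.mulPiece _ _ b c
    rw [map_add, LinearMap.add_apply]
  natCast m := Q.cls 0 ⟨(m : ℤ), Q.intCast_mem m⟩
  natCast_zero := by
    rw [← map_zero (Q.cls 0)]; congr 1; ext; simp
  natCast_succ m := by
    change _ = _ + Q.cls 0 _
    rw [← map_add]; congr 1; ext; simp
  intCast m := Q.cls 0 ⟨m, Q.intCast_mem m⟩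
  intCast_ofNat m := rfl
  intCast_negSucc_ofNat m := by
    rw [← map_neg]; congr 1; ext; simp [Int.negSucc_eq]

instance : DirectSum.GAlgebra R Q.Piece where
  toFun := (Q.cls 0).toAddMonoidHom.comp
    { toFun := fun c => ⟨algebraMap R A c, Q.algebraMap_mem c⟩
      map_zero' := by ext; simp
      map_add' := fun a b => by ext; simp }
  map_one := by
    refine congrArg (Q.cls 0) ?_
    ext; simp
  map_mul c c' := Q.cls_eq (zero_add 0).symm _ _ (map_mul _ _ _)
  commutes c := by
    rintro ⟨i, a⟩
    obtain ⟨x, rfl⟩ := Q.exists_cls a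
    exact Q.cls_eq ((zero_add i).trans (add_zero i).symm) _ _ (Algebra.commutes _ _)
  smul_def c := by
    rintro ⟨i, a⟩
    obtain ⟨x, rfl⟩ := Q.exists_cls a
    exact Q.cls_eq (zero_add i).symm (Submodule.smul_mem _ c x.2) _ (Algebra.smul_def _ _)

variable [DecidableEq ι]

/-- The direct sum of all components; it is a (graded) `R`-algebra. -/
abbrev Total : Type _ := ⨁ i, Q.Piece i

/-- The class of an element of `Z i` in the direct sum of all components. -/
def sym (i : ι) : Q.Z i →ₗ[R] Q.Total := (DirectSum.lof R ι Q.Piece i).comp (Q.cls i)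

/-- `x` lies in `Z i`, and `y` is its class in the component of degree `i`. -/
def Represents (i : ι) (x : A) (y : Q.Total) : Prop := ∃ hx : x ∈ Q.Z i, Q.sym i ⟨x, hx⟩ = y

theorem sym_mul (i j : ι) (x : Q.Z i) (y : Q.Z j) :
    Q.sym i x * Q.sym j y = Q.sym (i + j) ⟨x.1 * y.1, Q.mul_mem x.2 y.2⟩ :=
  DirectSum.of_mul_of _ _
  
end SubquotientSystem

end Subquotient


section Cobar

variable (p n k : ℕ) [hp : Fact p.Prime] [NeZero n] [NeZero k]

/-- The augmentation ideal, the kernel of the counit. -/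
abbrev augIdeal : Submodule (ZMod p) (MoravaAlg p n k) :=
  LinearMap.ker (Coalgebra.counit (R := ZMod p) (A := MoravaAlg p n k))

/-- The cobar construction as an algebra: the tensor algebra of the augmentation ideal, with
`[α₁|…|α_s]` the product of the `α_i`.  Its part of tensor degree `s` is the `s`-fold tensor power. -/
abbrev Cobar : Type := TensorAlgebra (ZMod p) (augIdeal p n k)

/-- The projection `a ↦ a - ε(a)` onto the augmentation ideal. -/
def augProj : MoravaAlg p n k →ₗ[ZMod p] augIdeal p n k :=
  LinearMap.codRestrict _
    (LinearMap.id - (Algebra.linearMap (ZMod p) (MoravaAlg p n k)).comp Coalgebra.counit)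
    (fun a => by simp [LinearMap.mem_ker])

/-- The element `[a - ε(a)]` of tensor degree one; it is `[a]` for `a` in the augmentation ideal. -/
def bar : MoravaAlg p n k →ₗ[ZMod p] Cobar p n k :=
  (TensorAlgebra.ι (ZMod p)).comp (augProj p n k)

/-- The map `a ↦ ∑ [u|v]` where `∑ u ⊗ v = Δ(a) - a ⊗ 1 - 1 ⊗ a` for `a` in the augmentation
ideal.  (Applying `id - ε` to both factors of `Δ(a)` gives `Δ(a) - a ⊗ 1 - 1 ⊗ a` for such `a`.) -/
def redComul : MoravaAlg p n k →ₗ[ZMod p] Cobar p n k :=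
  (LinearMap.mul' (ZMod p) (Cobar p n k)).comp
    ((TensorProduct.map (bar p n k) (bar p n k)).comp Coalgebra.comul)

/-- The algebra homomorphism to `2 × 2`-matrices sending `[a]` to the matrix with rows
`(-[a], d[a])` and `(0, [a])`, `d[a] = -(Δ(a) - a ⊗ 1 - 1 ⊗ a)`. -/
def dHom : Cobar p n k →ₐ[ZMod p] Matrix (Fin 2) (Fin 2) (Cobar p n k) :=
  TensorAlgebra.lift (ZMod p)
    { toFun := fun v => !![-TensorAlgebra.ι (ZMod p) v, -redComul p n k v;
                           0, TensorAlgebra.ι (ZMod p) v]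
      map_add' := fun v w => by
        ext i j; fin_cases i <;> fin_cases j <;> simp [add_comm]
      map_smul' := fun c v => by
        ext i j; fin_cases i <;> fin_cases j <;> simp }

/-- The cobar differential: the upper right entry of the matrix above.  It is the derivation with
`d(x y) = d(x) y + (-1)^s x d(y)` for `x` of tensor degree `s`, and
`d[a] = -(Δ(a) - a ⊗ 1 - 1 ⊗ a)`, that is, `d[α₁|…|α_s]` is the alternating sum
`∑ (-1)^i [α₁|…|Δ(α_i) - α_i ⊗ 1 - 1 ⊗ α_i|…|α_s]`. -/
def cobarD : Cobar p n k →ₗ[ZMod p] Cobar p n k :=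
  (Matrix.entryLinearMap (ZMod p) (Cobar p n k) 0 1).comp (dHom p n k).toLinearMap

/-- Multiplication by `(-1)^s` in tensor degree `s`. -/
def cobarSgn : Cobar p n k →ₐ[ZMod p] Cobar p n k :=
  TensorAlgebra.lift (ZMod p) (-TensorAlgebra.ι (ZMod p))

variable {p n k}

theorem dHom_eq (x : Cobar p n k) :
    dHom p n k x = !![cobarSgn p n k x, cobarD p n k x; 0, x] := by
  have h : ∀ i j, (i, j) ≠ ((0 : Fin 2), (1 : Fin 2)) → dHom p n k x i j =
      (!![cobarSgn p n k x, cobarD p n k x; 0, x] : Matrix (Fin 2) (Fin 2) (Cobar p n k)) i j := by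
    induction x using TensorAlgebra.induction with
    | algebraMap r =>
      intro i j h
      fin_cases i <;> fin_cases j <;> simp_all [Matrix.algebraMap_matrix_apply]
    | ι v =>
      intro i j h
      fin_cases i <;> fin_cases j <;> simp_all [dHom, cobarSgn]
    | mul x y hx hy =>
      intro i j h
      have hx00 := hx 0 0 (by simp)
      have hx10 := hx 1 0 (by simp)
      have hx11 := hx 1 1 (by simp)
      have hy00 := hy 0 0 (by simp)
      have hy10 := hy 1 0 (by simp)
      have hy11 := hy 1 1 (by simp)
      simp at hx00 hx10 hx11 hy00 hy10 hy11
      fin_cases i <;> fin_cases j <;>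
        simp_all [Matrix.mul_apply, Fin.sum_univ_two]
    | add x y hx hy =>
      intro i j h
      have hx := hx i j h
      have hy := hy i j h
      fin_cases i <;> fin_cases j <;> simp_all
  ext i j
  by_cases hij : (i, j) = ((0 : Fin 2), (1 : Fin 2))
  · obtain ⟨rfl, rfl⟩ := Prod.mk.inj hij
    rfl
  · exact h i j hij

theorem cobarD_mul (x y : Cobar p n k) :
    cobarD p n k (x * y) = cobarD p n k x * y + cobarSgn p n k x * cobarD p n k y := by
  have h : cobarD p n k (x * y) = dHom p n k (x * y) 0 1 := rfl
  rw [h, map_mul, dHom_eq x, dHom_eq y, Matrix.mul_apply, Fin.sum_univ_two]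
  simp [add_comm]

theorem cobarD_one : cobarD p n k 1 = 0 := by
  have h : cobarD p n k 1 = dHom p n k 1 0 1 := rfl
  rw [h, map_one]
  simp

theorem cobarD_ι (v : augIdeal p n k) :
    cobarD p n k (TensorAlgebra.ι (ZMod p) v) = -redComul p n k v := by
  have h : cobarD p n k (TensorAlgebra.ι (ZMod p) v) =
    dHom p n k (TensorAlgebra.ι (ZMod p) v) 0 1 := rfl
  rw [h, dHom, TensorAlgebra.lift_ι_apply]
  simp

theorem cobarSgn_bar (a : MoravaAlg p n k) : cobarSgn p n k (bar p n k a) = -bar p n k a := by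
  simp [bar, cobarSgn]

theorem augProj_coe (a : MoravaAlg p n k) : (augProj p n k a : MoravaAlg p n k) =
    a - algebraMap (ZMod p) _ (Coalgebra.counit (R := ZMod p) a) := rfl

theorem bar_one : bar p n k 1 = 0 := by
  have : augProj p n k 1 = 0 := by
    ext; simp [augProj_coe]
  simp [bar, this]

theorem bar_augProj (a : MoravaAlg p n k) : bar p n k (augProj p n k a) = bar p n k a := by
  have : (augProj p n k a : MoravaAlg p n k) = a - (Coalgebra.counit (R := ZMod p) a) • 1 := by
    rw [augProj_coe, Algebra.algebraMap_eq_smul_one]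
  rw [this, map_sub, map_smul, bar_one, smul_zero, sub_zero]

theorem cobarD_bar (a : MoravaAlg p n k) : cobarD p n k (bar p n k a) = -redComul p n k a := by
  have h1 : redComul p n k 1 = 0 := by
    simp [redComul, Algebra.TensorProduct.one_def, bar_one]
  have h2 : (augProj p n k a : MoravaAlg p n k) = a - (Coalgebra.counit (R := ZMod p) a) • 1 := by
    rw [augProj_coe, Algebra.algebraMap_eq_smul_one]
  unfold bar
  rw [LinearMap.comp_apply, cobarD_ι, h2, map_sub, map_smul, h1, smul_zero, sub_zero]

theorem cobarD_cobarD_bar (a : MoravaAlg p n k) :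
    cobarD p n k (cobarD p n k (bar p n k a)) = 0 := by
  let g := bar p n k
  let μ := LinearMap.mul' (ZMod p) (Cobar p n k)
  let T : MoravaAlg p n k ⊗[ZMod p] (MoravaAlg p n k ⊗[ZMod p] MoravaAlg p n k) →ₗ[ZMod p]
      Cobar p n k := μ.comp (TensorProduct.map g (μ.comp (TensorProduct.map g g)))
  have key : ∀ w : MoravaAlg p n k ⊗[ZMod p] MoravaAlg p n k,
      cobarD p n k (μ (TensorProduct.map g g w)) =
        T (Coalgebra.comul.lTensor (MoravaAlg p n k) w) -
          T (TensorProduct.assoc _ _ _ _ (Coalgebra.comul.rTensor (MoravaAlg p n k) w)) := by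
    intro w
    induction w using TensorProduct.induction_on with
    | zero => simp
    | add x y hx hy => simp only [map_add, hx, hy]; abel
    | tmul x y =>
      have h3 : ∀ v : MoravaAlg p n k ⊗[ZMod p] MoravaAlg p n k,
          T (TensorProduct.assoc (ZMod p) _ _ _ (v ⊗ₜ y)) = μ (TensorProduct.map g g v) * g y := by
        intro v
        induction v using TensorProduct.induction_on with
        | zero => simp
        | add x y hx hy => simp only [TensorProduct.add_tmul, map_add, hx, hy, add_mul]
        | tmul u v => simp [T, μ, mul_assoc]
      rw [LinearMap.lTensor_tmul, LinearMap.rTensor_tmul, h3]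
      simp only [TensorProduct.map_tmul, μ, LinearMap.mul'_apply, T, LinearMap.comp_apply]
      rw [cobarD_mul, cobarSgn_bar, cobarD_bar, cobarD_bar]
      simp only [redComul, LinearMap.comp_apply]
      noncomm_ring
  rw [cobarD_bar, map_neg, neg_eq_zero]
  refine (key _).trans ?_
  rw [Coalgebra.coassoc_apply, sub_self]

theorem cobarSgn_cobarD (x : Cobar p n k) :
    cobarD p n k (cobarSgn p n k x) = -cobarSgn p n k (cobarD p n k x) := by
  induction x using TensorAlgebra.induction with
  | algebraMap r =>
    rw [Algebra.algebraMap_eq_smul_one]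
    simp [cobarD_one]
  | ι v =>
    have h : ∀ w : MoravaAlg p n k ⊗[ZMod p] MoravaAlg p n k,
        cobarSgn p n k (LinearMap.mul' (ZMod p) _ (TensorProduct.map (bar p n k) (bar p n k) w)) =
          LinearMap.mul' (ZMod p) _ (TensorProduct.map (bar p n k) (bar p n k) w) := by
      intro w
      induction w using TensorProduct.induction_on with
      | zero => simp
      | add x y hx hy => simp only [map_add, hx, hy]
      | tmul x y => simp [cobarSgn_bar]
    rw [cobarD_ι, map_neg, redComul, LinearMap.comp_apply, LinearMap.comp_apply, h]
    simp only [cobarSgn, TensorAlgebra.lift_ι_apply, LinearMap.neg_apply, map_neg]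
    rw [cobarD_ι]
    simp [redComul]
  | mul x y hx hy =>
    simp only [map_mul, cobarD_mul, hx, hy, map_add]
    noncomm_ring
  | add x y hx hy => simp only [map_add, hx, hy]; abel

theorem cobarD_cobarD (x : Cobar p n k) : cobarD p n k (cobarD p n k x) = 0 := by
  induction x using TensorAlgebra.induction with
  | algebraMap r =>
    rw [Algebra.algebraMap_eq_smul_one]
    simp [cobarD_one]
  | ι v =>
    have h : TensorAlgebra.ι (ZMod p) v = bar p n k v := by
      have : augProj p n k v = v := by
        ext
        rw [augProj_coe, LinearMap.mem_ker.mp v.2, map_zero, sub_zero]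
      rw [bar, LinearMap.comp_apply, this]
    rw [h]
    exact cobarD_cobarD_bar _
  | mul x y hx hy =>
    simp only [cobarD_mul, map_add, hx, hy, cobarSgn_cobarD]
    noncomm_ring
  | add x y hx hy => simp only [map_add, hx, hy, add_zero]

end Cobar


section Filtration

/-- The May filtration of `t_s^{p^j}` (it does not depend on `j`): `2s - 1` for `s < n + k`, and
recursively the maximum of `2s - 1` and `p M(t_{s-n}) + 1` for `s ≥ n + k`. -/
def genWt (p n k : ℕ) [NeZero n] (s : ℕ) : ℕ :=
  if h : n + k ≤ s then max (2 * s - 1) (p * genWt p n k (s - n) + 1) else 2 * s - 1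
termination_by s
decreasing_by
  have := Nat.pos_of_ne_zero (NeZero.ne n)
  omega

/-- The group of internal degrees: integers modulo `|v_n| = 2(p^n - 1)`. -/
abbrev IDeg (p n : ℕ) : Type := ZMod (2 * (p ^ n - 1))

/-- Exponents of monomials in the generators. -/
abbrev Expo (k : ℕ) : Type := Idx k →₀ ℕ

variable (p n k : ℕ)

/-- The monomial `∏ t_s^{e_s}`. -/
def mono (e : Expo k) : MoravaAlg p n k := e.prod fun s a => gen p n k s ^ a

/-- The internal degree of a monomial, `|t_s| = 2(p^s - 1)`. -/
def expDeg (e : Expo k) : IDeg p n := e.sum fun s a => ((a * (2 * (p ^ s.1 - 1)) : ℕ) : IDeg p n)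

/-- The May filtration of a monomial: `M(t_s^a) = ∑ a_i M(t_s^{p^i})` if `a = ∑ a_i p^i` is the
`p`-adic expansion, and `M` is additive over distinct generators. -/
def expWt [NeZero n] (e : Expo k) : ℕ := e.sum fun s a => (p.digits a).sum * genWt p n k s

theorem digits_sum_add_le [hp : Fact p.Prime] (a b : ℕ) :
    (p.digits (a + b)).sum ≤ (p.digits a).sum + (p.digits b).sum := by
  have h1 := sub_one_mul_padicValNat_factorial (p := p) a
  have h2 := sub_one_mul_padicValNat_factorial (p := p) b
  have h3 := sub_one_mul_padicValNat_factorial (p := p) (a + b)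
  have h4 := Nat.digit_sum_le p a
  have h5 := Nat.digit_sum_le p b
  have h6 := Nat.digit_sum_le p (a + b)
  have h7 : padicValNat p a.factorial + padicValNat p b.factorial ≤
      padicValNat p (a + b).factorial := by
    rw [← padicValNat.mul (Nat.factorial_ne_zero _) (Nat.factorial_ne_zero _)]
    exact (padicValNat_dvd_iff_le (Nat.factorial_ne_zero _)).mp
      (pow_padicValNat_dvd.trans (Nat.factorial_mul_factorial_dvd_factorial_add a b))
  have h8 := Nat.mul_le_mul_left (p - 1) h7
  rw [mul_add, h1, h2, h3] at h8
  omega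

variable {p n k}

theorem mono_add (e f : Expo k) : mono p n k (e + f) = mono p n k e * mono p n k f :=
  Finsupp.prod_add_index' (by simp) (fun _ _ _ => pow_add _ _ _)

theorem expDeg_add (e f : Expo k) : expDeg p n k (e + f) = expDeg p n k e + expDeg p n k f :=
  Finsupp.sum_add_index' (by simp) (fun _ _ _ => by push_cast; ring)

theorem expWt_add_le [Fact p.Prime] [NeZero n] (e f : Expo k) :
    expWt p n k (e + f) ≤ expWt p n k e + expWt p n k f := by
  classical
  unfold expWt
  rw [Finsupp.sum_of_support_subset (e + f) (Finsupp.support_add) _ (by simp),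
    Finsupp.sum_of_support_subset e (Finset.subset_union_left (s₂ := f.support)) _ (by simp),
    Finsupp.sum_of_support_subset f (Finset.subset_union_right (s₁ := e.support)) _ (by simp),
    ← Finset.sum_add_distrib]
  refine Finset.sum_le_sum fun s _ => ?_
  rw [← add_mul]
  exact Nat.mul_le_mul_right _ (digits_sum_add_le p _ _)

variable (p n k) [hp : Fact p.Prime] [NeZero n] [NeZero k]

/-- The submodule `F^{t,M}` of `S(n,k)` generated by the monomials of internal degree `t` and of May
filtration at most `M`. -/
def filt (t : IDeg p n) (M : ℤ) : Submodule (ZMod p) (MoravaAlg p n k) :=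
  Submodule.span (ZMod p)
    {x | ∃ e : Expo k, expDeg p n k e = t ∧ (expWt p n k e : ℤ) ≤ M ∧ mono p n k e = x}

variable {p n k}

theorem one_mem_filt : (1 : MoravaAlg p n k) ∈ filt p n k 0 0 :=
  Submodule.subset_span ⟨0, by simp [expDeg], by simp [expWt], by simp [mono]⟩

theorem mul_mem_filt {t t' : IDeg p n} {M M' : ℤ} {x y : MoravaAlg p n k}
    (hx : x ∈ filt p n k t M) (hy : y ∈ filt p n k t' M') :
    x * y ∈ filt p n k (t + t') (M + M') := by
  have h : filt p n k t M * filt p n k t' M' ≤ filt p n k (t + t') (M + M') := by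
    unfold filt
    rw [Submodule.span_mul_span]
    apply Submodule.span_mono
    rintro _ ⟨_, ⟨e, he1, he2, rfl⟩, _, ⟨f, hf1, hf2, rfl⟩, rfl⟩
    have := expWt_add_le (p := p) (n := n) e f
    exact ⟨e + f, by rw [expDeg_add, he1, hf1], by omega, mono_add e f⟩
  exact h (Submodule.mul_mem_mul hx hy)

variable (p n k)

/-- The associated bigraded algebra of `S(n,k)`, with components `F^{t,M} / F^{t,M-1}` in bidegree
`(t, M)`. -/
def grSystem : SubquotientSystem (ZMod p) (MoravaAlg p n k) (IDeg p n × ℤ) where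
  Z i := filt p n k i.1 i.2
  B i := filt p n k i.1 (i.2 - 1)
  one_mem := one_mem_filt
  mul_mem hx hy := mul_mem_filt hx hy
  mul_mem_left {i j x y} hx _ hy := by
    have := mul_mem_filt hx hy
    rwa [show i.2 + (j.2 - 1) = (i + j).2 - 1 by rw [Prod.snd_add]; ring] at this
  mul_mem_right {i j x y} _ hy hx := by
    have := mul_mem_filt hx hy
    rwa [show (i.2 - 1) + j.2 = (i + j).2 - 1 by rw [Prod.snd_add]; ring] at this

/-- The submodule `FC^{s,t,M}` of the cobar complex generated by the `[α₁|…|α_s]`, the `α_i` being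
monomials different from `1`, of total internal degree `t` and total May filtration at most `M`. -/
def cobarFilt (s : ℕ) (t : IDeg p n) (M : ℤ) : Submodule (ZMod p) (Cobar p n k) :=
  Submodule.span (ZMod p)
    {x | ∃ l : List (Expo k), l.length = s ∧ (∀ e ∈ l, e ≠ 0) ∧ (l.map (expDeg p n k)).sum = t ∧
      ((l.map (expWt p n k)).sum : ℤ) ≤ M ∧ (l.map fun e => bar p n k (mono p n k e)).prod = x}

variable {p n k}

theorem one_mem_cobarFilt : (1 : Cobar p n k) ∈ cobarFilt p n k 0 0 0 :=
  Submodule.subset_span ⟨[], by simp⟩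

theorem cobarFilt_mono {s : ℕ} {t : IDeg p n} {M M' : ℤ} (h : M ≤ M') :
    cobarFilt p n k s t M ≤ cobarFilt p n k s t M' := by
  apply Submodule.span_mono
  rintro _ ⟨l, h1, h2, h3, h4, h5⟩
  exact ⟨l, h1, h2, h3, h4.trans h, h5⟩

theorem mul_mem_cobarFilt {s s' : ℕ} {t t' : IDeg p n} {M M' : ℤ} {x y : Cobar p n k}
    (hx : x ∈ cobarFilt p n k s t M) (hy : y ∈ cobarFilt p n k s' t' M') :
    x * y ∈ cobarFilt p n k (s + s') (t + t') (M + M') := by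
  have h : cobarFilt p n k s t M * cobarFilt p n k s' t' M' ≤
      cobarFilt p n k (s + s') (t + t') (M + M') := by
    unfold cobarFilt
    rw [Submodule.span_mul_span]
    apply Submodule.span_mono
    rintro _ ⟨_, ⟨l, h1, h2, h3, h4, rfl⟩, _, ⟨l', h1', h2', h3', h4', rfl⟩, rfl⟩
    refine ⟨l ++ l', by simp [h1, h1'], ?_, by simp [h3, h3'], ?_, by simp⟩
    · intro e he
      rcases List.mem_append.mp he with he | he
      · exact h2 e he
      · exact h2' e he
    · rw [List.map_append, List.sum_append, Nat.cast_add]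
      exact add_le_add h4 h4'
  exact h (Submodule.mul_mem_mul hx hy)

theorem cobarSgn_of_mem {s : ℕ} {t : IDeg p n} {M : ℤ} {x : Cobar p n k}
    (hx : x ∈ cobarFilt p n k s t M) : cobarSgn p n k x = (-1) ^ s * x := by
  induction hx using Submodule.span_induction with
  | mem x h =>
    obtain ⟨l, rfl, h1, h2, h3, rfl⟩ := h
    clear h1 h2 h3
    induction l with
    | nil => simp
    | cons e l ih =>
      rw [List.map_cons, List.prod_cons, map_mul, ih, cobarSgn_bar, List.length_cons, pow_succ']
      have := (Commute.neg_one_left (bar p n k (mono p n k e))).pow_left l.length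
      rw [neg_mul, neg_mul, ← mul_assoc, ← this.eq]
      simp [mul_assoc]
  | zero => simp
  | add x y _ _ hx hy => rw [map_add, hx, hy, mul_add]
  | smul c x _ hx => rw [map_smul, hx, mul_smul_comm]

theorem sgn_mul_mem {N : Submodule (ZMod p) (Cobar p n k)} {x : Cobar p n k} (s : ℕ) (hx : x ∈ N) :
    (-1) ^ s * x ∈ N := by
  rcases neg_one_pow_eq_or (Cobar p n k) s with h | h
  · rwa [h, one_mul]
  · rw [h, neg_one_mul]; exact N.neg_mem hx

/-- The Leibniz rule in the cobar complex. -/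
theorem cobarD_mul_of_mem {s : ℕ} {t : IDeg p n} {M : ℤ} {x : Cobar p n k}
    (hx : x ∈ cobarFilt p n k s t M) (y : Cobar p n k) :
    cobarD p n k (x * y) = cobarD p n k x * y + (-1) ^ s * (x * cobarD p n k y) := by
  rw [cobarD_mul, cobarSgn_of_mem hx, mul_assoc]

/-- Tridegrees `(s, t, M)`. -/
abbrev Tri (p n : ℕ) : Type := ℕ × IDeg p n × ℤ

variable (p n k)

/-- `Z_r^{s,t,M}`: the elements of `FC^{s,t,M}` whose differential is in `FC^{s+1,t,M-r}`. -/
def pageZ (r : ℤ) (i : Tri p n) : Submodule (ZMod p) (Cobar p n k) :=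
  cobarFilt p n k i.1 i.2.1 i.2.2 ⊓
    (cobarFilt p n k (i.1 + 1) i.2.1 (i.2.2 - r)).comap (cobarD p n k)

/-- `B_r^{s,t,M} = Z_{r-1}^{s,t,M-1} + d Z_{r-1}^{s-1,t,M+r-1}` (without the last term if `s = 0`). -/
def pageB (r : ℤ) : Tri p n → Submodule (ZMod p) (Cobar p n k)
  | (0, t, M) => pageZ p n k (r - 1) (0, t, M - 1)
  | (s + 1, t, M) => pageZ p n k (r - 1) (s + 1, t, M - 1) ⊔
      (pageZ p n k (r - 1) (s, t, M + (r - 1))).map (cobarD p n k)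

variable {p n k}

theorem mem_pageZ {r : ℤ} {s : ℕ} {t : IDeg p n} {M : ℤ} {x : Cobar p n k} :
    x ∈ pageZ p n k r (s, t, M) ↔ x ∈ cobarFilt p n k s t M ∧
      cobarD p n k x ∈ cobarFilt p n k (s + 1) t (M - r) := Iff.rfl

theorem mem_pageB {r : ℤ} {s : ℕ} {t : IDeg p n} {M : ℤ} {x : Cobar p n k} :
    x ∈ pageB p n k r (s, t, M) ↔ ∃ y ∈ pageZ p n k (r - 1) (s, t, M - 1), ∃ w : Cobar p n k,
      (w = 0 ∨ ∃ s', s' + 1 = s ∧ w ∈ pageZ p n k (r - 1) (s', t, M + (r - 1))) ∧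
      y + cobarD p n k w = x := by
  cases s with
  | zero =>
    constructor
    · intro h
      exact ⟨x, h, 0, Or.inl rfl, by simp⟩
    · rintro ⟨y, hy, w, hw | ⟨s', hs', _⟩, rfl⟩
      · rw [hw, map_zero, add_zero]; exact hy
      · omega
  | succ s =>
    rw [pageB, Submodule.mem_sup]
    constructor
    · rintro ⟨y, hy, _, ⟨w, hw, rfl⟩, rfl⟩
      exact ⟨y, hy, w, Or.inr ⟨s, rfl, hw⟩, rfl⟩
    · rintro ⟨y, hy, w, hw | ⟨s', hs', hw⟩, rfl⟩
      · exact ⟨y, hy, 0, Submodule.zero_mem _, by simp [hw]⟩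
      · obtain rfl : s' = s := by omega
        exact ⟨y, hy, _, ⟨w, hw, rfl⟩, rfl⟩

theorem pageZ_mul {r r' : ℤ} {s s' : ℕ} {t t' : IDeg p n} {M M' : ℤ} {x y : Cobar p n k}
    (hx : x ∈ pageZ p n k r (s, t, M)) (hy : y ∈ pageZ p n k r' (s', t', M')) (R : ℤ)
    (hr : R ≤ r) (hr' : R ≤ r') : x * y ∈ pageZ p n k R (s + s', t + t', M + M') := by
  rw [mem_pageZ] at hx hy
  refine mem_pageZ.mpr ⟨mul_mem_cobarFilt hx.1 hy.1, ?_⟩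
  rw [cobarD_mul_of_mem hx.1]
  refine Submodule.add_mem _ ?_ (sgn_mul_mem _ ?_)
  · have := mul_mem_cobarFilt hx.2 hy.1
    rw [show s + 1 + s' = s + s' + 1 by ring] at this
    exact cobarFilt_mono (by omega) this
  · have := mul_mem_cobarFilt hx.1 hy.2
    exact cobarFilt_mono (by omega) this

theorem pageB_mul_left {r : ℤ} {s s' : ℕ} {t t' : IDeg p n} {M M' : ℤ} {x y : Cobar p n k}
    (hx : x ∈ pageZ p n k r (s, t, M)) (hy : y ∈ pageB p n k r (s', t', M')) :
    x * y ∈ pageB p n k r (s + s', t + t', M + M') := by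
  rw [mem_pageB] at hy
  obtain ⟨y, hy, w, hw, rfl⟩ := hy
  rw [mul_add]
  refine Submodule.add_mem _ ?_ ?_
  · refine mem_pageB.mpr ⟨x * y, ?_, 0, Or.inl rfl, by simp⟩
    have := pageZ_mul hx hy (r - 1) (by omega) le_rfl
    rwa [← add_sub_assoc] at this
  · rcases hw with rfl | ⟨s'', rfl, hw⟩
    · simp
    · rw [mem_pageZ] at hx
      have hwZ := hw
      rw [mem_pageZ] at hw
      have e : x * cobarD p n k w = (-1) ^ s * (cobarD p n k (x * w) - cobarD p n k x * w) := by
        rw [cobarD_mul_of_mem hx.1, add_sub_cancel_left, ← mul_assoc, ← pow_add,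
          Even.neg_one_pow ⟨s, rfl⟩, one_mul]
      rw [e]
      refine sgn_mul_mem _ (Submodule.sub_mem _ ?_ ?_)
      · refine mem_pageB.mpr ⟨0, Submodule.zero_mem _, x * w, Or.inr ⟨s + s'', by ring, ?_⟩, by simp⟩
        have := pageZ_mul (mem_pageZ.mpr hx) hwZ (r - 1) (by omega) le_rfl
        rwa [← add_assoc M] at this
      · refine mem_pageB.mpr ⟨_, mem_pageZ.mpr ⟨?_, ?_⟩, 0, Or.inl rfl, by rw [map_zero, add_zero]⟩
        · have := mul_mem_cobarFilt hx.2 hw.1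
          rwa [show s + 1 + s'' = s + (s'' + 1) by ring,
            show M - r + (M' + (r - 1)) = M + M' - 1 by ring] at this
        · rw [cobarD_mul_of_mem hx.2, cobarD_cobarD, zero_mul, zero_add]
          refine sgn_mul_mem _ ?_
          have := mul_mem_cobarFilt hx.2 hw.2
          rwa [show s + 1 + (s'' + 1) = s + (s'' + 1) + 1 by ring,
            show M - r + (M' + (r - 1) - (r - 1)) = M + M' - 1 - (r - 1) by ring] at this

theorem pageB_mul_right {r : ℤ} {s s' : ℕ} {t t' : IDeg p n} {M M' : ℤ} {x y : Cobar p n k}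
    (hx : x ∈ pageB p n k r (s, t, M)) (hy : y ∈ pageZ p n k r (s', t', M')) :
    x * y ∈ pageB p n k r (s + s', t + t', M + M') := by
  rw [mem_pageB] at hx
  obtain ⟨x, hx, w, hw, rfl⟩ := hx
  rw [add_mul]
  refine Submodule.add_mem _ ?_ ?_
  · refine mem_pageB.mpr ⟨x * y, ?_, 0, Or.inl rfl, by simp⟩
    have := pageZ_mul hx hy (r - 1) le_rfl (by omega)
    rwa [show M - 1 + M' = M + M' - 1 by ring] at this
  · rcases hw with rfl | ⟨s'', rfl, hw⟩
    · simp
    · rw [mem_pageZ] at hy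
      have hwZ := hw
      rw [mem_pageZ] at hw
      have e : cobarD p n k w * y =
          cobarD p n k (w * y) - (-1) ^ s'' * (w * cobarD p n k y) := by
        rw [cobarD_mul_of_mem hw.1, add_sub_cancel_right]
      rw [e]
      refine Submodule.sub_mem _ ?_ (sgn_mul_mem _ ?_)
      · refine mem_pageB.mpr ⟨0, Submodule.zero_mem _, w * y, Or.inr ⟨s'' + s', by ring, ?_⟩, by simp⟩
        have := pageZ_mul hwZ (mem_pageZ.mpr hy) (r - 1) le_rfl (by omega)
        rwa [show M + (r - 1) + M' = M + M' + (r - 1) by ring] at this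
      · refine mem_pageB.mpr ⟨_, mem_pageZ.mpr ⟨?_, ?_⟩, 0, Or.inl rfl, by rw [map_zero, add_zero]⟩
        · have := mul_mem_cobarFilt hw.1 hy.2
          rwa [show s'' + (s' + 1) = s'' + 1 + s' by ring,
            show M + (r - 1) + (M' - r) = M + M' - 1 by ring] at this
        · rw [cobarD_mul_of_mem hw.1, cobarD_cobarD, mul_zero, mul_zero,
            add_zero]
          have := mul_mem_cobarFilt hw.2 hy.2
          rwa [show s'' + 1 + (s' + 1) = s'' + 1 + s' + 1 by ring,
            show M + (r - 1) - (r - 1) + (M' - r) = M + M' - 1 - (r - 1) by ring] at this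

variable (p n k)

/-- The page `E_r` of the May spectral sequence, the spectral sequence of the filtered cobar complex:
`E_r^{s,t,M} = Z_r^{s,t,M} / B_r^{s,t,M}`, with multiplication induced by that of the cobar complex. -/
def page (r : ℕ) : SubquotientSystem (ZMod p) (Cobar p n k) (Tri p n) where
  Z := pageZ p n k r
  B := pageB p n k r
  one_mem := mem_pageZ.mpr ⟨one_mem_cobarFilt, by rw [cobarD_one]; exact Submodule.zero_mem _⟩
  mul_mem hx hy := pageZ_mul hx hy _ le_rfl le_rfl
  mul_mem_left hx _ hy := pageB_mul_left hx hy
  mul_mem_right _ hy hx := pageB_mul_right hx hy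

variable {p n k}

theorem cobarD_mem_pageZ {r : ℤ} {i : Tri p n} {x : Cobar p n k} (hx : x ∈ pageZ p n k r i) :
    cobarD p n k x ∈ pageZ p n k r (i.1 + 1, i.2.1, i.2.2 - r) :=
  mem_pageZ.mpr ⟨hx.2, by rw [cobarD_cobarD]; exact Submodule.zero_mem _⟩

theorem cobarD_mem_pageB {r : ℤ} {i : Tri p n} {x : Cobar p n k} (hx : x ∈ pageB p n k r i) :
    cobarD p n k x ∈ pageB p n k r (i.1 + 1, i.2.1, i.2.2 - r) := by
  obtain ⟨s, t, M⟩ := i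
  obtain ⟨y, hy, w, hw, rfl⟩ := mem_pageB.mp hx
  refine mem_pageB.mpr ⟨0, Submodule.zero_mem _, y, Or.inr ⟨s, rfl, ?_⟩, ?_⟩
  · rwa [show M - r + (r - 1) = M - 1 by ring]
  · rw [map_add, cobarD_cobarD]; simp

variable (p n k)

/-- The cobar differential from `Z_r^{s,t,M}` to `Z_r^{s+1,t,M-r}`. -/
def pageDCycles (r : ℕ) (s : ℕ) (t : IDeg p n) (M : ℤ) :
    (page p n k r).Z (s, t, M) →ₗ[ZMod p] (page p n k r).Z (s + 1, t, M - r) :=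
  ((cobarD p n k).comp (Submodule.subtype _)).codRestrict _
    fun x => cobarD_mem_pageZ (i := (s, t, M)) x.2

/-- The differential `d_r : E_r^{s,t,M} → E_r^{s+1,t,M-r}`, `[z] ↦ [dz]`. -/
def pageDPiece (r : ℕ) (s : ℕ) (t : IDeg p n) (M : ℤ) :
    (page p n k r).Piece (s, t, M) →ₗ[ZMod p] (page p n k r).Piece (s + 1, t, M - r) :=
  Submodule.mapQ ((page p n k r).B (s, t, M) |>.submoduleOf _)
    ((page p n k r).B (s + 1, t, M - r) |>.submoduleOf _) (pageDCycles p n k r s t M)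
    (fun _ hx => cobarD_mem_pageB (i := (s, t, M)) hx)

/-- The differential `d_r` on the whole page `E_r`. -/
def pageD (r : ℕ) : (page p n k r).Total →ₗ[ZMod p] (page p n k r).Total :=
  DirectSum.toModule (ZMod p) (Tri p n) _ fun i =>
    (DirectSum.lof (ZMod p) (Tri p n) (page p n k r).Piece (i.1 + 1, i.2.1, i.2.2 - r)).comp
      (pageDPiece p n k r i.1 i.2.1 i.2.2)

end Filtration


section Results

/-- A Hopf algebra structure on a given algebra. -/
structure HopfData (R A : Type*) [CommRing R] [Ring A] [Algebra R A] where
  comul : A →ₐ[R] A ⊗[R] A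
  counit : A →ₐ[R] R
  antipode : A →ₗ[R] A
  coassoc : (Algebra.TensorProduct.assoc R R R A A A).toAlgHom.comp
    ((Algebra.TensorProduct.map comul (.id R A)).comp comul) =
      (Algebra.TensorProduct.map (.id R A) comul).comp comul
  counit_left : (Algebra.TensorProduct.map counit (.id R A)).comp comul =
    (Algebra.TensorProduct.lid R A).symm
  counit_right : (Algebra.TensorProduct.map (.id R A) counit).comp comul =
    (Algebra.TensorProduct.rid R R A).symm
  antipode_left : LinearMap.mul' R A ∘ₗ antipode.rTensor A ∘ₗ comul.toLinearMap =
    (Algebra.linearMap R A) ∘ₗ counit.toLinearMap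
  antipode_right : LinearMap.mul' R A ∘ₗ antipode.lTensor A ∘ₗ comul.toLinearMap =
    (Algebra.linearMap R A) ∘ₗ counit.toLinearMap

/-- The corresponding Hopf algebra in the sense of Mathlib. -/
@[reducible] def HopfData.toHopfAlgebra {R A : Type*} [CommRing R] [Ring A] [Algebra R A]
    (D : HopfData R A) : HopfAlgebra R A :=
  { Bialgebra.ofAlgHom D.comul D.counit D.coassoc D.counit_left D.counit_right with
    antipode := D.antipode
    mul_antipode_rTensor_comul := D.antipode_left
    mul_antipode_lTensor_comul := D.antipode_right }

/-- The tensor product over `s ≥ k` of the truncated polynomial algebras `T[t_s^{p^j} | j ∈ ℤ/n]` of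
height `p`; the generator `(s, j)` stands for `t_s^{p^j}`. -/
abbrev TruncAlg (p n k : ℕ) : Type :=
  MvPolynomial (Idx k × ZMod n) (ZMod p) ⧸
    Ideal.span (Set.range fun a : Idx k × ZMod n =>
      (MvPolynomial.X a ^ p : MvPolynomial (Idx k × ZMod n) (ZMod p)))

/-- The generators of the truncated polynomial algebra. -/
def truncGen (p n k : ℕ) (a : Idx k × ZMod n) : TruncAlg p n k :=
  Ideal.Quotient.mk _ (MvPolynomial.X a)

variable (p n k : ℕ) [hp : Fact p.Prime] [NeZero n] [NeZero k]

/-- The associated bigraded algebra of `S(n,k)`. -/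
abbrev GrS : Type := (grSystem p n k).Total

/-- `Δ` is the diagonal which the associated bigraded algebra inherits from the one of `S(n,k)`: for
`x` in `F^{t,M}`, the diagonal of `x` can be written as a sum of `y ⊗ z` with `y`, `z` in filtration
submodules whose bidegrees add up to `(t, M)`, and `Δ[x]` is the sum of the `[y] ⊗ [z]`. -/
def IsInducedComul (Δ : GrS p n k →ₐ[ZMod p] GrS p n k ⊗[ZMod p] GrS p n k) : Prop :=
  ∀ (i : IDeg p n × ℤ) (x : (grSystem p n k).Z i),
    ∃ (m : ℕ) (a b : Fin m → IDeg p n × ℤ)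
      (y : ∀ l, (grSystem p n k).Z (a l)) (z : ∀ l, (grSystem p n k).Z (b l)),
      (∀ l, a l + b l = i) ∧
      Coalgebra.comul (R := ZMod p) (x : MoravaAlg p n k) =
        ∑ l, (y l : MoravaAlg p n k) ⊗ₜ[ZMod p] (z l : MoravaAlg p n k) ∧
      Δ ((grSystem p n k).sym i x) =
        ∑ l, (grSystem p n k).sym (a l) (y l) ⊗ₜ[ZMod p] (grSystem p n k).sym (b l) (z l)

/-- The element `t_s^{p^j}`, for `s ≥ k` and `j ∈ ℤ/n`. -/
def genPow (a : Idx k × ZMod n) : MoravaAlg p n k := gen p n k a.1 ^ p ^ a.2.val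

/-- The page `E_r`, the direct sum of all the `E_r^{s,t,M}`. -/
abbrev PageTotal (r : ℕ) : Type := (page p n k r).Total

/-- The part `C^{s,t}` of the cobar complex. -/
def cobarDeg (s : ℕ) (t : IDeg p n) : Submodule (ZMod p) (Cobar p n k) :=
  ⨆ M : ℤ, cobarFilt p n k s t M

/-- The cocycles in `C^{s,t}`. -/
def cobarCocycles (s : ℕ) (t : IDeg p n) : Submodule (ZMod p) (Cobar p n k) :=
  cobarDeg p n k s t ⊓ LinearMap.ker (cobarD p n k)

/-- The coboundaries in `C^{s,t}`. -/
def cobarBoundaries : ℕ → IDeg p n → Submodule (ZMod p) (Cobar p n k)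
  | 0, _ => ⊥
  | s + 1, t => (cobarDeg p n k s t).map (cobarD p n k)

/-- `H^{s,t} S(n,k) = Ext^{s,t}(ℤ/p, ℤ/p)`, the cohomology of the cobar complex. -/
abbrev ExtGroup (s : ℕ) (t : IDeg p n) : Type :=
  cobarCocycles p n k s t ⧸ (cobarBoundaries p n k s t).submoduleOf (cobarCocycles p n k s t)

/-- The filtration of `H^{s,t} S(n,k)`: the classes of the cocycles of May filtration at
most `M`. -/
def extFilt (s : ℕ) (t : IDeg p n) (M : ℤ) : Submodule (ZMod p) (ExtGroup p n k s t) :=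
  ((cobarFilt p n k s t M).submoduleOf (cobarCocycles p n k s t)).map (Submodule.mkQ _)

/-- The quotient of the `M`-th by the `(M-1)`-st filtration submodule of `H^{s,t} S(n,k)`. -/
abbrev GrExt (s : ℕ) (t : IDeg p n) (M : ℤ) : Type :=
  extFilt p n k s t M ⧸ (extFilt p n k s t (M - 1)).submoduleOf (extFilt p n k s t M)

variable {p n k}

theorem mem_cobarCocycles {s : ℕ} {t : IDeg p n} {M : ℤ} {z : Cobar p n k}
    (hz : z ∈ cobarFilt p n k s t M) (hd : cobarD p n k z = 0) : z ∈ cobarCocycles p n k s t :=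
  ⟨(le_iSup (fun M : ℤ => cobarFilt p n k s t M) M) hz, hd⟩

theorem mem_page_of_cocycle (r : ℕ) {s : ℕ} {t : IDeg p n} {M : ℤ} {z : Cobar p n k}
    (hz : z ∈ cobarFilt p n k s t M) (hd : cobarD p n k z = 0) : z ∈ (page p n k r).Z (s, t, M) :=
  mem_pageZ.mpr ⟨hz, by rw [hd]; exact Submodule.zero_mem _⟩

/-- The class of a cocycle of May filtration at most `M`. -/
def grExtClass {s : ℕ} {t : IDeg p n} {M : ℤ} (z : Cobar p n k)
    (hz : z ∈ cobarFilt p n k s t M) (hd : cobarD p n k z = 0) : GrExt p n k s t M :=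
  Submodule.Quotient.mk ⟨Submodule.Quotient.mk ⟨z, mem_cobarCocycles hz hd⟩,
    ⟨_, hz, rfl⟩⟩

variable (p n k)

/-- The cohomology of `(E_r, d_r)`. -/
abbrev PageHomology (r : ℕ) : Type :=
  LinearMap.ker (pageD p n k r) ⧸
    (LinearMap.range (pageD p n k r)).submoduleOf (LinearMap.ker (pageD p n k r))

/-- The element `∑_{0 < m < p} (p choose m)/p [t_s^{m p^j}|t_s^{(p-m) p^j}]`. -/
def bCocycle (a : Idx k × ZMod n) : Cobar p n k :=
  ∑ m ∈ Finset.Ioo 0 p, ((p.choose m / p : ℕ) : ZMod p) •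
    (bar p n k (genPow p n k a ^ m) * bar p n k (genPow p n k a ^ (p - m)))

/-- The internal degree `2(p^i - 1) p^j` of `h_{i,j}`. -/
def hDeg (a : Idx k × ZMod n) : IDeg p n := ((2 * (p ^ a.1.1 - 1) * p ^ a.2.val : ℕ) : IDeg p n)

/-- The internal degree `2(p^i - 1) p^{j+1}` of `b_{i,j}`. -/
def bDeg (a : Idx k × ZMod n) : IDeg p n :=
  ((2 * (p ^ a.1.1 - 1) * p ^ (a.2.val + 1) : ℕ) : IDeg p n)

/-- The algebra `E[h_{i,j}] ⊗ P[b_{i,j}]`, with `i ≥ k` and `j ∈ ℤ/n`. -/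
abbrev ExtPoly : Type :=
  ExteriorAlgebra (ZMod p) ((Idx k × ZMod n) →₀ ZMod p) ⊗[ZMod p]
    MvPolynomial (Idx k × ZMod n) (ZMod p)

/-- The product of the exterior generators in the list `l` and the polynomial ones in the list `l₂`. -/
def extPolyMon (l l₂ : List (Idx k × ZMod n)) : ExtPoly p n k :=
  (l.map fun a => ExteriorAlgebra.ι (ZMod p) (Finsupp.single a (1 : ZMod p))).prod ⊗ₜ[ZMod p]
    (l₂.map fun a => (MvPolynomial.X a : MvPolynomial (Idx k × ZMod n) (ZMod p))).prod

end Results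

end MaySS

end

open MaySS

/-!
# The May spectral sequence of `S(n,k)`

*The diagonal.* Every `b` in `B = S(n,k) ⊗ S(n,k)` satisfies `b ^ p ^ n = b`, so `B` is perfect, and
the relations defining `D_s` can be read as a congruence modulo `p ^ (⌊s/n⌋ + 1)` between sums of
Teichmüller representatives in `W(B)` (`teichmuller_congr`). Its component of index `⌊s/n⌋`
expresses `D_s` as `∑ x_i y_j^{p^i}` plus carries. The carries of Witt vector addition are isobaric
(`wittAdd_sub_mem`), and the May weights satisfy `p M(t_{s-n}) + 1 ≤ M(t_s)`, so that the carries
have lower filtration; since moreover `M(t_i) + M(t_j) < M(t_{i+j})`, the products `t_i ⊗ t_j^{p^i}`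
with `i, j > 0` have lower filtration too. Hence the `t_s^{p^j}` are primitive up to lower
filtration (`comulHom_genPow_sub_mem`). As the monomials in the `t_s^{p^j}` with exponents less than
`p` form a basis adapted to the filtration, the associated graded Hopf algebra is the primitively
generated truncated polynomial algebra (`exists_grS_hopfData`).

*The cobar complex.* Let `y_e` be the monomial `∏ (t_s^{p^j})^{e(s,j)}`, divided by `∏ e(s,j)!`. The
words in the `y_e` with `e ≠ 0` form a basis of the cobar complex, and up to lower filtration the
differential replaces a letter `y_e` by `∑_{e' + e'' = e} [y_{e'}|y_{e''}]`, with signs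
(`cobarD_wordCob_sub_mem`). This shows that the May filtration is one by subcomplexes. The
properties of the pages are then formal (`exists_page_succ_equiv`), and the spectral sequence
converges because each `FC^{s,t,M}` has finite dimension (`exists_page_equiv_grExt`).

*The first page.* `E_1` is the cohomology of the cobar complex of words with only the leading part
of the differential. It is computed by the minimal resolution of a truncated polynomial Hopf
algebra, the tensor product over all generators `a` of complexes with basis `y_e γ_m` (`e < p`, `m ≥
0`), in which `γ_m` stands for `b_a^{m/2}` if `m` is even and for `h_a b_a^{(m-1)/2}` if `m` is odd,
with `d(y_e γ_m) = y_{e-1} γ_{m+1}` if `m` is even and `d(y_e γ_m) = y_{e-p+1} γ_{m+1}` if `m` is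
odd. The cobar module with coefficients in this resolution (`KMod`) contracts both onto the cobar
complex (`topS_homotopy`) and onto the span of the `γ_N` (`lastS_homotopy`), in each case up to
error terms that lower a second grading; by `exists_sub_mem_range_of_contraction` and
`mem_range_of_contraction` this is enough to match cocycles with combinations of the `γ_N`
(`CobRel`). So `E_1` has the `γ_N` as a basis (`firstPageMap_injective`, `firstPageMap_surjective`).
The matching is compatible with left multiplication by `[t_s^{p^j}]` and by the cocycle of `b_{s,j}`
(`cobRel_ltr`, `cobRel_betaL`), which act on the `γ_N` by explicit operators; the relations between
the `h_{i,j}` and `b_{i,j}`, and the basis of their products, can be read off from these.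
-/

noncomputable section

namespace MaySS

/-! ### Contractions with an error term -/

section Perturbation

variable {K T A : Type*} [CommRing K] [AddCommGroup T] [Module K T] [AddCommGroup A] [Module K A]
  {D s : T →ₗ[K] T} {φ : A →ₗ[K] T} {dA : A →ₗ[K] A} {π : T →ₗ[K] A} {G : ℕ → Submodule K T}

/-- Let `φ` embed the complex `A` into `T`, and let `s` be a homotopy from the identity of `T` to `φ
π` up to an error that lowers the filtration `G`. Then every cocycle of `T` is cohomologous to one
from `A`. -/
theorem exists_sub_mem_range_of_contraction (hG0 : G 0 = ⊥) (hDD : ∀ z, D (D z) = 0)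
    (hφ : ∀ a, D (φ a) = φ (dA a)) (hs : ∀ a, s (φ a) = 0)
    (herr : ∀ n, ∀ z ∈ G (n + 1), D (s z) + s (D z) - z + φ (π z) ∈ G n)
    (n : ℕ) : ∀ (a : A) (e : T), e ∈ G n → D (φ a + e) = 0 →
      ∃ a', φ a + e - φ a' ∈ LinearMap.range D := by
  induction n with
  | zero =>
    intro a e he _
    rw [hG0, Submodule.mem_bot] at he
    exact ⟨a, by simp [he]⟩
  | succ n ih =>
    intro a e he hD
    have h1 := herr n e he
    have h2 : D e = -φ (dA a) := by
      rw [map_add, hφ] at hD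
      exact eq_neg_of_add_eq_zero_right hD
    rw [h2, map_neg, hs, neg_zero, add_zero] at h1
    have hD2 : D (φ (a + π e) + -(D (s e) - e + φ (π e))) = -D (D (s e)) := by
      have : φ (a + π e) + -(D (s e) - e + φ (π e)) = φ a + e - D (s e) := by
        rw [map_add]; abel
      rw [this, map_sub, hD, zero_sub]
    rw [hDD, neg_zero] at hD2
    obtain ⟨a', y, hy⟩ := ih _ _ (Submodule.neg_mem _ h1) hD2
    refine ⟨a', y + s e, ?_⟩
    rw [map_add, hy, map_add]
    abel

/-- In the situation of `exists_sub_mem_range_of_contraction`, an element of `A` that becomes a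
coboundary in `T` is a coboundary in `A`. -/
theorem mem_range_of_contraction (hG0 : G 0 = ⊥)
    (hφ : ∀ a, D (φ a) = φ (dA a)) (hinj : Function.Injective φ) (hDD : ∀ z, D (D z) = 0)
    (hs : ∀ a, s (φ a) = 0)
    (herr : ∀ n, ∀ z ∈ G (n + 1), D (s z) + s (D z) - z + φ (π z) ∈ G n)
    (n : ℕ) : ∀ (a : A) (y : T), y ∈ G n → φ a = D y → a ∈ LinearMap.range dA := by
  induction n with
  | zero =>
    intro a y hy h
    rw [hG0, Submodule.mem_bot] at hy
    rw [hy, map_zero] at h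
    rw [hinj (h.trans (map_zero φ).symm)]
    exact Submodule.zero_mem _
  | succ n ih =>
    intro a y hy h
    have h1 := herr n y hy
    rw [← h, hs, add_zero] at h1
    have h2 : φ (a - dA (π y)) = D (-(D (s y) - y + φ (π y))) := by
      rw [map_sub, ← hφ, h, map_neg, map_add, map_sub, hDD]
      abel
    obtain ⟨c, hc⟩ := ih _ _ (Submodule.neg_mem _ h1) h2
    exact ⟨c + π y, by rw [map_add, hc, sub_add_cancel]⟩

end Perturbation

/-! ### Cobar complexes on words -/

section Words

/-- The nonzero exponents of monomials in which all exponents are less than `p`. -/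
abbrev Letter (p : ℕ) (I : Type*) : Type _ := {e : I →₀ ℕ // e ≠ 0 ∧ ∀ a, e a < p}

/-- The cobar module with letters from `Letter p I` and coefficients in the free module on `Y`. -/
abbrev WordMod (p : ℕ) (I Y K : Type*) [CommRing K] : Type _ := List (Letter p I) × Y →₀ K

variable {p : ℕ} {I Y K : Type*} [CommRing K]

variable (K Y) in
/-- Concatenation of a letter on the left. -/
def consL (x : Letter p I) : WordMod p I Y K →ₗ[K] WordMod p I Y K :=
  Finsupp.lmapDomain K K fun q => (x :: q.1, q.2)

theorem consL_single (x : Letter p I) (l : List (Letter p I)) (y : Y) (c : K) :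
    consL Y K x (Finsupp.single (l, y) c) = Finsupp.single (x :: l, y) c := by
  simp [consL]

open Classical in
variable (p K Y) in
/-- Concatenation of the letter with exponent `f` on the left; zero if `f` is not a letter. -/
def ltr (f : I →₀ ℕ) : WordMod p I Y K →ₗ[K] WordMod p I Y K :=
  if h : f ≠ 0 ∧ ∀ a, f a < p then consL Y K ⟨f, h⟩ else 0

theorem ltr_coe (x : Letter p I) : ltr p Y K x.1 = consL Y K x := by
  rw [ltr, dif_pos x.2]

theorem ltr_zero : ltr p Y K (0 : I →₀ ℕ) = 0 := by
  rw [ltr, dif_neg (by simp)]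

theorem ltr_eq_zero_of_not {f : I →₀ ℕ} (h : ¬ ∀ a, f a < p) : ltr p Y K f = 0 := by
  rw [ltr, dif_neg fun h' => h h'.2]

theorem ltr_cases (f : I →₀ ℕ) : ltr p Y K f = 0 ∨ ∃ x : Letter p I, x.1 = f := by
  by_cases h : f ≠ 0 ∧ ∀ a, f a < p
  · exact Or.inr ⟨⟨f, h⟩, rfl⟩
  · left; rw [ltr, dif_neg h]

/-- Linear extension to words of an operator that is defined on words. -/
def wordLift (F : List (Letter p I) → Y → WordMod p I Y K) :
    WordMod p I Y K →ₗ[K] WordMod p I Y K :=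
  Finsupp.linearCombination K fun q => F q.1 q.2

theorem wordLift_single (F : List (Letter p I) → Y → WordMod p I Y K) (l : List (Letter p I))
    (y : Y) : wordLift F (Finsupp.single (l, y) 1) = F l y := by
  simp [wordLift]

theorem wordMod_ext {M : Type*} [AddCommGroup M] [Module K M] {f g : WordMod p I Y K →ₗ[K] M}
    (h : ∀ l y, f (Finsupp.single (l, y) 1) = g (Finsupp.single (l, y) 1)) : f = g := by
  apply Finsupp.lhom_ext'
  rintro ⟨l, y⟩
  ext
  exact h l y

variable [DecidableEq I]

/-- The part of the cobar differential of a letter: the sum of the `[i|j]` with `i + j = f`. -/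
def splitL (f : I →₀ ℕ) : WordMod p I Y K →ₗ[K] WordMod p I Y K :=
  ∑ ij ∈ Finset.HasAntidiagonal.antidiagonal f, (ltr p Y K ij.1).comp (ltr p Y K ij.2)

theorem splitL_apply (f : I →₀ ℕ) (z : WordMod p I Y K) : splitL f z =
    ∑ ij ∈ Finset.HasAntidiagonal.antidiagonal f, ltr p Y K ij.1 (ltr p Y K ij.2 z) := by
  simp [splitL, LinearMap.sum_apply]

/-- The differential on words, given its values `g` on the generators of the cobar module. -/
def wordDAux (g : Y → WordMod p I Y K) : List (Letter p I) → Y → WordMod p I Y K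
  | [], y => g y
  | x :: l, y => -splitL x.1 (Finsupp.single (l, y) 1) - consL Y K x (wordDAux g l y)

/-- The differential of the cobar module with values `g` on the generators: on a letter `f` it is
`-∑_{i + j = f} [i|j]`, and it satisfies the Leibniz rule. -/
def wordD (g : Y → WordMod p I Y K) : WordMod p I Y K →ₗ[K] WordMod p I Y K := wordLift (wordDAux g)

theorem wordD_nil (g : Y → WordMod p I Y K) (y : Y) :
    wordD g (Finsupp.single ([], y) 1) = g y := by
  simp [wordD, wordLift_single, wordDAux]

theorem wordD_consL (g : Y → WordMod p I Y K) (x : Letter p I) (z : WordMod p I Y K) :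
    wordD g (consL Y K x z) = -splitL x.1 z - consL Y K x (wordD g z) := by
  have : (wordD g).comp (consL Y K x) =
      -(splitL x.1 : WordMod p I Y K →ₗ[K] _) - (consL Y K x).comp (wordD g) := by
    apply wordMod_ext
    intro l y
    simp [wordD, wordLift_single, wordDAux, consL_single]
  exact LinearMap.congr_fun this z

/-- The rule for the differential of a word also holds for the exponent zero, which is not a letter:
both sides are then zero. -/
theorem wordD_ltr (g : Y → WordMod p I Y K) (f : I →₀ ℕ) (hf : ∀ a, f a < p)
    (z : WordMod p I Y K) :
    wordD g (ltr p Y K f z) = -splitL f z - ltr p Y K f (wordD g z) := by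
  by_cases h0 : f = 0
  · subst h0
    simp [ltr_zero, splitL_apply]
  · rw [ltr, dif_pos ⟨h0, hf⟩, wordD_consL]

theorem lt_of_mem_antidiagonal {f : I →₀ ℕ} (hf : ∀ a, f a < p) {ij : (I →₀ ℕ) × (I →₀ ℕ)}
    (h : ij ∈ Finset.HasAntidiagonal.antidiagonal f) : (∀ a, ij.1 a < p) ∧ ∀ a, ij.2 a < p := by
  rw [Finset.HasAntidiagonal.mem_antidiagonal] at h
  subst h
  constructor <;> intro a <;> have := hf a <;> rw [Finsupp.add_apply] at this <;> omega

/-- Coassociativity: both iterated splittings are sums over all `i + j + l = f`. -/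
theorem sum_antidiagonal_assoc {M : Type*} [AddCommMonoid M]
    (F : (I →₀ ℕ) → (I →₀ ℕ) → (I →₀ ℕ) → M) (f : I →₀ ℕ) :
    ∑ ij ∈ Finset.HasAntidiagonal.antidiagonal f,
      ∑ uv ∈ Finset.HasAntidiagonal.antidiagonal ij.1, F uv.1 uv.2 ij.2 =
    ∑ ij ∈ Finset.HasAntidiagonal.antidiagonal f,
      ∑ uv ∈ Finset.HasAntidiagonal.antidiagonal ij.2, F ij.1 uv.1 uv.2 := by
  rw [Finset.sum_sigma', Finset.sum_sigma']
  refine Finset.sum_bij' (fun q _ => ⟨(q.2.1, q.2.2 + q.1.2), (q.2.2, q.1.2)⟩)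
    (fun q _ => ⟨(q.1.1 + q.2.1, q.2.2), (q.1.1, q.2.1)⟩) ?_ ?_ ?_ ?_ ?_
  all_goals
    rintro ⟨⟨i, j⟩, ⟨u, v⟩⟩ h
    simp only [Finset.mem_sigma, Finset.HasAntidiagonal.mem_antidiagonal] at h
    obtain ⟨h1, h2⟩ := h
    subst h1 h2
    simp [add_assoc]

/-- The differential commutes with `splitL f`, by coassociativity. The hypothesis on `f` also allows
for a multiple `p δ_a` of a unit vector, which has an entry that is not less than `p`. -/
theorem wordD_splitL (g : Y → WordMod p I Y K) (f : I →₀ ℕ)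
    (hf : ∀ ij ∈ Finset.HasAntidiagonal.antidiagonal f,
      ((∀ a, ij.1 a < p) ∧ ∀ a, ij.2 a < p) ∨ ij.1 = 0 ∨ ij.2 = 0)
    (z : WordMod p I Y K) : wordD g (splitL f z) = splitL f (wordD g z) := by
  rw [splitL_apply, map_sum, splitL_apply]
  have h : ∀ ij ∈ Finset.HasAntidiagonal.antidiagonal f,
      wordD g (ltr p Y K ij.1 (ltr p Y K ij.2 z)) =
        (∑ uv ∈ Finset.HasAntidiagonal.antidiagonal ij.2,
          ltr p Y K ij.1 (ltr p Y K uv.1 (ltr p Y K uv.2 z)) -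
        ∑ uv ∈ Finset.HasAntidiagonal.antidiagonal ij.1,
          ltr p Y K uv.1 (ltr p Y K uv.2 (ltr p Y K ij.2 z))) +
        ltr p Y K ij.1 (ltr p Y K ij.2 (wordD g z)) := by
    intro ij hij
    rcases hf ij hij with ⟨h1, h2⟩ | h0 | h0
    · rw [wordD_ltr g _ h1, wordD_ltr g _ h2, splitL_apply, splitL_apply, map_sub, map_neg, map_sum]
      abel
    · simp [h0, ltr_zero]
    · simp [h0, ltr_zero]
  rw [Finset.sum_congr rfl h, Finset.sum_add_distrib, Finset.sum_sub_distrib,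
    sum_antidiagonal_assoc (fun a b c => ltr p Y K a (ltr p Y K b (ltr p Y K c z))), sub_self,
    zero_add]

theorem wordD_wordD (g : Y → WordMod p I Y K) (hg : ∀ y, wordD g (g y) = 0)
    (z : WordMod p I Y K) : wordD g (wordD g z) = 0 := by
  have : (wordD g).comp (wordD g) = 0 := by
    apply wordMod_ext
    intro l y
    rw [LinearMap.comp_apply, LinearMap.zero_apply]
    induction l with
    | nil => rw [wordD_nil, hg]
    | cons x l ih =>
      rw [← consL_single, wordD_consL, map_sub, map_neg, wordD_splitL g _
        (fun ij h => Or.inl (lt_of_mem_antidiagonal x.2.2 h)), wordD_consL, ih,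
        map_zero]
      abel
  exact LinearMap.congr_fun this z

end Words

/-! ### The cobar module of the minimal resolution -/

section Koszul

variable {p : ℕ} {I K : Type*} [CommRing K]

/-- Exponents with all entries less than `p`. -/
abbrev Red (p : ℕ) (I : Type*) : Type _ := {e : I →₀ ℕ // ∀ a, e a < p}

/-- The cobar module of the Koszul-type resolution: its generators are the `y_e γ_N`, where `y_e` is
a divided monomial with exponents less than `p` and `γ_N` runs through a basis of
`E[h_a] ⊗ P[b_a]`: with `N_a = 2m + ε`, the factor at `a` is `h_a^ε b_a^m`. -/
abbrev KMod (p : ℕ) (I K : Type*) [CommRing K] : Type _ := WordMod p I (Red p I × (I →₀ ℕ)) K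

/-- The order of the derivative in the one-variable resolution that leads from `γ_m` to
`γ_{m+1}`. -/
def par (p m : ℕ) : ℕ := if Even m then 1 else p - 1

theorem par_add (hp : 2 ≤ p) (m : ℕ) : par p m + par p (m + 1) = p := by
  unfold par
  by_cases h : Even m
  · rw [if_pos h, if_neg (by simpa [Nat.even_add_one] using h)]; omega
  · rw [if_neg h, if_pos (by simpa [Nat.even_add_one] using h)]; omega

theorem one_le_par (hp : 2 ≤ p) (m : ℕ) : 1 ≤ par p m := by
  unfold par; split_ifs <;> omega

open Classical in
variable (p K) in
/-- The generator `y_e γ_N`, zero if some entry of `e` is at least `p`. -/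
def kap (e N : I →₀ ℕ) : KMod p I K :=
  if h : ∀ a, e a < p then Finsupp.single ([], (⟨e, h⟩, N)) 1 else 0

variable [LinearOrder I]

/-- The sum of the `N_b` with `b ≤ a`. -/
def sgExp (a : I) : (I →₀ ℕ) →+ ℕ :=
  Finsupp.liftAddHom fun b => if b ≤ a then AddMonoidHom.id ℕ else 0

variable (K) in
/-- The Koszul sign of the variable `a`. -/
def sg (a : I) (N : I →₀ ℕ) : K := (-1) ^ sgExp a N

theorem sgExp_single (a b : I) : sgExp a (Finsupp.single b 1) = if b ≤ a then 1 else 0 := by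
  rw [sgExp, Finsupp.liftAddHom_apply_single]
  split_ifs <;> rfl

theorem sg_add_single_le {a b : I} (h : b ≤ a) (N : I →₀ ℕ) :
    sg K a (N + Finsupp.single b 1) = -sg K a N := by
  rw [sg, map_add, sgExp_single, if_pos h, pow_succ, mul_neg_one, sg]

theorem sg_add_single_not_le {a b : I} (h : ¬ b ≤ a) (N : I →₀ ℕ) :
    sg K a (N + Finsupp.single b 1) = sg K a N := by
  rw [sg, map_add, sgExp_single, if_neg h, add_zero, sg]

theorem sg_mul_self (a : I) (N : I →₀ ℕ) : sg K a N * sg K a N = 1 := by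
  rw [sg, ← mul_pow]; simp

variable (p K) in
/-- The contribution of the variable `a` to the differential of the resolution. -/
def kosT (a : I) (e N : I →₀ ℕ) : KMod p I K :=
  if par p (N a) ≤ e a then
    sg K a N • kap p K (e - Finsupp.single a (par p (N a))) (N + Finsupp.single a 1)
  else 0

variable (p I K) in
/-- The differential of a generator of the cobar module of the resolution. -/
def kosG (y : Red p I × (I →₀ ℕ)) : KMod p I K :=
  -∑ ij ∈ Finset.HasAntidiagonal.antidiagonal y.1.1, ltr p _ K ij.1 (kap p K ij.2 y.2) +
    ∑ a ∈ y.1.1.support, kosT p K a y.1.1 y.2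

variable (p I K) in
/-- The differential of the cobar module of the resolution. -/
def kosD : KMod p I K →ₗ[K] KMod p I K := wordD (kosG p I K)

theorem sum_kosT (hp : 2 ≤ p) (e N : I →₀ ℕ) (J : Finset I) (hJ : e.support ⊆ J) :
    ∑ a ∈ e.support, kosT p K a e N = ∑ a ∈ J, kosT p K a e N := by
  refine Finset.sum_subset hJ fun a _ ha => ?_
  rw [Finsupp.notMem_support_iff] at ha
  rw [kosT, if_neg]
  have := one_le_par hp (N a)
  omega

theorem kosD_kap (hp : 2 ≤ p) (e N : I →₀ ℕ) (he : ∀ a, e a < p) (J : Finset I)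
    (hJ : e.support ⊆ J) : kosD p I K (kap p K e N) =
      -∑ ij ∈ Finset.HasAntidiagonal.antidiagonal e, ltr p _ K ij.1 (kap p K ij.2 N) +
        ∑ a ∈ J, kosT p K a e N := by
  rw [kap, dif_pos he, kosD, wordD_nil, kosG, ← sum_kosT hp e N J hJ]

/-- Lowering the second exponent of a splitting of `e` gives the splittings of the lowered exponent.
-/
theorem sum_antidiagonal_sub {M : Type*} [AddCommMonoid M] (F : (I →₀ ℕ) → (I →₀ ℕ) → M)
    (e : I →₀ ℕ) (a : I) (m : ℕ) :
    ∑ ij ∈ Finset.HasAntidiagonal.antidiagonal e,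
      (if m ≤ ij.2 a then F ij.1 (ij.2 - Finsupp.single a m) else 0) =
    if m ≤ e a then ∑ ij ∈ Finset.HasAntidiagonal.antidiagonal (e - Finsupp.single a m),
      F ij.1 ij.2 else 0 := by
  split_ifs with h
  · rw [← Finset.sum_filter]
    refine Finset.sum_bij' (fun ij _ => (ij.1, ij.2 - Finsupp.single a m))
      (fun ij _ => (ij.1, ij.2 + Finsupp.single a m)) ?_ ?_ ?_ ?_ ?_
    · rintro ⟨i, j⟩ hij
      simp only [Finset.mem_filter, Finset.HasAntidiagonal.mem_antidiagonal] at hij ⊢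
      rw [← hij.1, add_tsub_assoc_of_le (Finsupp.single_le_iff.mpr hij.2)]
    · rintro ⟨i, j⟩ hij
      simp only [Finset.mem_filter, Finset.HasAntidiagonal.mem_antidiagonal] at hij ⊢
      refine ⟨?_, by simp⟩
      rw [← add_assoc, hij, tsub_add_cancel_of_le (Finsupp.single_le_iff.mpr h)]
    · rintro ⟨i, j⟩ hij
      simp only [Finset.mem_filter] at hij
      simp only [Prod.mk.injEq, true_and]
      exact tsub_add_cancel_of_le (Finsupp.single_le_iff.mpr hij.2)
    · rintro ⟨i, j⟩ hij
      simp
    · intros; rfl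
  · refine Finset.sum_eq_zero fun ij hij => if_neg fun h' => h ?_
    rw [Finset.HasAntidiagonal.mem_antidiagonal] at hij
    rw [← hij, Finsupp.add_apply]
    omega

/-- The second-order terms of the differential of the resolution. -/
def kosTT (p : ℕ) (K : Type*) [CommRing K] (b a : I) (e N : I →₀ ℕ) : KMod p I K :=
  if par p (N a) ≤ e a then
    sg K a N • kosT p K b (e - Finsupp.single a (par p (N a))) (N + Finsupp.single a 1)
  else 0

/-- The square of the differential in one variable vanishes: it lowers the exponent by
`par m + par (m + 1) = p`, and exponents are less than `p`. -/
theorem kosTT_self (hp : 2 ≤ p) (a : I) (e N : I →₀ ℕ) (he : ∀ a, e a < p) :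
    kosTT p K a a e N = 0 := by
  rw [kosTT, kosT]
  have h1 := par_add hp (N a)
  have h2 := he a
  simp only [Finsupp.add_apply, Finsupp.single_eq_same, Finsupp.tsub_apply]
  by_cases h3 : par p (N a) ≤ e a
  · rw [if_neg (show ¬ (par p (N a + 1) ≤ e a - par p (N a)) by omega)]
    simp
  · rw [if_neg h3]

/-- The differentials in two variables anticommute, by the choice of the Koszul signs. -/
theorem kosTT_swap {a b : I} (hab : a < b) (e N : I →₀ ℕ) :
    kosTT p K b a e N + kosTT p K a b e N = 0 := by
  rw [kosTT, kosTT, kosT, kosT]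
  simp only [Finsupp.add_apply, Finsupp.single_eq_of_ne hab.ne, Finsupp.single_eq_of_ne hab.ne',
    Finsupp.tsub_apply, add_zero, tsub_zero]
  by_cases h1 : par p (N a) ≤ e a
  · by_cases h2 : par p (N b) ≤ e b
    · simp only [h1, h2, if_true, sg_add_single_le hab.le, sg_add_single_not_le (not_le.mpr hab)]
      rw [tsub_right_comm, add_right_comm N, smul_smul, smul_smul, mul_comm (sg K b N), ← add_smul]
      rw [mul_neg, neg_add_cancel, zero_smul]
    · simp [h2]
  · simp [h1]

theorem sum_kosTT (hp : 2 ≤ p) (e N : I →₀ ℕ) (he : ∀ a, e a < p) (J : Finset I) :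
    ∑ a ∈ J, ∑ b ∈ J, kosTT p K b a e N = 0 := by
  rw [← Finset.sum_product']
  refine Finset.sum_involution (fun q _ => (q.2, q.1)) ?_ ?_ ?_ ?_
  · rintro ⟨a, b⟩ _
    rcases lt_trichotomy a b with h | h | h
    · exact kosTT_swap h e N
    · subst h; simp [kosTT_self hp _ _ _ he]
    · simp only; rw [add_comm]; exact kosTT_swap h e N
  · rintro ⟨a, b⟩ _ h h'
    simp only [Prod.mk.injEq] at h'
    rw [h'.1] at h
    exact h (kosTT_self hp _ _ _ he)
  · rintro ⟨a, b⟩ h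
    simp only [Finset.mem_product] at h ⊢
    exact h.symm
  · rintro ⟨a, b⟩ _; rfl

theorem kosD_kosG (hp : 2 ≤ p) (y : Red p I × (I →₀ ℕ)) : kosD p I K (kosG p I K y) = 0 := by
  obtain ⟨⟨e, he⟩, N⟩ := y
  have hsub : ∀ (a : I) (m : ℕ) (b : I), (e - Finsupp.single a m : I →₀ ℕ) b < p := fun a m b => by
    have := he b
    rw [Finsupp.tsub_apply]; omega
  have hsupp : ∀ (a : I) (m : ℕ), (e - Finsupp.single a m : I →₀ ℕ).support ⊆ e.support :=
      fun a m b => by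
    simp only [Finsupp.mem_support_iff, Finsupp.tsub_apply]; omega
  rw [kosG, map_add, map_neg, map_sum, map_sum]
  have h1 : ∀ ij ∈ Finset.HasAntidiagonal.antidiagonal e,
      kosD p I K (ltr p _ K ij.1 (kap p K ij.2 N)) =
        (∑ uv ∈ Finset.HasAntidiagonal.antidiagonal ij.2,
          ltr p _ K ij.1 (ltr p _ K uv.1 (kap p K uv.2 N)) -
        ∑ uv ∈ Finset.HasAntidiagonal.antidiagonal ij.1,
          ltr p _ K uv.1 (ltr p _ K uv.2 (kap p K ij.2 N))) -
        ∑ a ∈ e.support, ltr p _ K ij.1 (kosT p K a ij.2 N) := by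
    intro ij hij
    obtain ⟨h1, h2⟩ := lt_of_mem_antidiagonal he hij
    have h3 : ij.2.support ⊆ e.support := by
      rw [Finset.HasAntidiagonal.mem_antidiagonal] at hij
      intro b
      rw [← hij]
      simp only [Finsupp.mem_support_iff, Finsupp.add_apply]; omega
    rw [kosD, wordD_ltr _ _ h1, splitL_apply, ← kosD, kosD_kap hp _ _ h2 _ h3, map_add, map_neg,
      map_sum, map_sum]
    abel
  have h2 : ∀ a ∈ e.support, kosD p I K (kosT p K a e N) =
      -∑ ij ∈ Finset.HasAntidiagonal.antidiagonal e, ltr p _ K ij.1 (kosT p K a ij.2 N) +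
        ∑ b ∈ e.support, kosTT p K b a e N := by
    intro a _
    have h3 := sum_antidiagonal_sub (fun i j => ltr p _ K i (sg K a N • kap p K j
      (N + Finsupp.single a 1))) e a (par p (N a))
    have h4 : ∀ i j : I →₀ ℕ, ltr p _ K i (kosT p K a j N) =
        if par p (N a) ≤ j a then ltr p _ K i (sg K a N • kap p K (j - Finsupp.single a
          (par p (N a))) (N + Finsupp.single a 1)) else 0 := fun i j => by
      rw [kosT]; split_ifs <;> simp
    simp only [h4]
    rw [h3]
    by_cases h5 : par p (N a) ≤ e a
    · simp only [kosT, kosTT, h5, if_true]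
      rw [map_smul, kosD_kap hp _ _ (hsub _ _) _ (hsupp _ _), smul_add, smul_neg, Finset.smul_sum,
        Finset.smul_sum]
      simp only [map_smul, kosT]
    · simp [kosT, kosTT, h5]
  rw [Finset.sum_congr rfl h1, Finset.sum_congr rfl h2, Finset.sum_sub_distrib,
    Finset.sum_sub_distrib, Finset.sum_add_distrib, sum_kosTT hp _ _ he, Finset.sum_neg_distrib,
    sum_antidiagonal_assoc (fun a b c => ltr p _ K a (ltr p _ K b (kap p K c N))),
    Finset.sum_comm]
  abel

theorem kosD_kosD (hp : 2 ≤ p) (z : KMod p I K) : kosD p I K (kosD p I K z) = 0 :=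
  wordD_wordD _ (kosD_kosG hp) z

end Koszul

/-! ### Contraction onto the cobar complex -/

section TopContraction

variable {p : ℕ} {I K : Type*} [CommRing K]

theorem map_mem_of_supported {X M : Type*} [AddCommGroup M] [Module K M] (Φ : (X →₀ K) →ₗ[K] M)
    (S : Set X) (Q : Submodule K M) (h : ∀ q ∈ S, Φ (Finsupp.single q 1) ∈ Q) (z : X →₀ K)
    (hz : z ∈ Finsupp.supported K K S) : Φ z ∈ Q := by
  rw [Finsupp.supported_eq_span_single] at hz
  have : Submodule.span K ((fun i => Finsupp.single i (1 : K)) '' S) ≤ Q.comap Φ := by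
    rw [Submodule.span_le]
    rintro _ ⟨q, hq, rfl⟩
    exact h q hq
  exact this hz

/-- The span of the words whose generator has polynomial degree less than `n`. -/
def degLt (p : ℕ) (I K : Type*) [CommRing K] (n : ℕ) : Submodule K (KMod p I K) :=
  Finsupp.supported K K {q | q.2.2.degree < n}

theorem degLt_zero : degLt p I K 0 = ⊥ := by
  simp [degLt]

theorem exists_mem_degLt (z : KMod p I K) : ∃ n, z ∈ degLt p I K n := by
  refine ⟨z.support.sup (fun q => q.2.2.degree) + 1, ?_⟩
  rw [degLt, Finsupp.mem_supported]
  intro q hq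
  exact Nat.lt_succ_of_le (Finset.le_sup (f := fun q => q.2.2.degree) hq)

theorem consL_mem_degLt (x : Letter p I) {n : ℕ} {z : KMod p I K} (hz : z ∈ degLt p I K n) :
    consL _ K x z ∈ degLt p I K n :=
  map_mem_of_supported (consL _ K x) _ _ (fun q hq => by
    obtain ⟨l, y⟩ := q
    rw [consL_single]
    exact Finsupp.single_mem_supported K _ hq) z hz

theorem ltr_mem_degLt (f : I →₀ ℕ) {n : ℕ} {z : KMod p I K} (hz : z ∈ degLt p I K n) :
    ltr p _ K f z ∈ degLt p I K n := by
  rcases ltr_cases (p := p) (Y := Red p I × (I →₀ ℕ)) (K := K) f with h | ⟨x, rfl⟩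
  · rw [h]; exact Submodule.zero_mem _
  · rw [ltr_coe]; exact consL_mem_degLt x hz

theorem kap_mem_degLt (e N : I →₀ ℕ) (n : ℕ) (h : N.degree < n) :
    kap p K e N ∈ degLt p I K n := by
  rw [kap]
  split_ifs with he
  · exact Finsupp.single_mem_supported K _ h
  · exact Submodule.zero_mem _

/-- The operator on words with values `u` on the generators that anticommutes with letters. -/
def wordS {Y : Type*} (u : Y → WordMod p I Y K) : WordMod p I Y K →ₗ[K] WordMod p I Y K :=
  wordLift fun l y => ((-1 : K) ^ l.length) • (l.foldr (fun x z => consL Y K x z) (u y))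

theorem wordS_nil {Y : Type*} (u : Y → WordMod p I Y K) (y : Y) :
    wordS u (Finsupp.single ([], y) 1) = u y := by
  simp [wordS, wordLift_single]

theorem wordS_consL {Y : Type*} (u : Y → WordMod p I Y K) (x : Letter p I)
    (z : WordMod p I Y K) : wordS u (consL Y K x z) = -consL Y K x (wordS u z) := by
  have : (wordS u).comp (consL Y K x) = -(consL Y K x).comp (wordS u) := by
    apply wordMod_ext
    intro l y
    simp [wordS, wordLift_single, consL_single, pow_succ]
  exact LinearMap.congr_fun this z

theorem wordS_ltr {Y : Type*} (u : Y → WordMod p I Y K) (f : I →₀ ℕ)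
    (z : WordMod p I Y K) : wordS u (ltr p Y K f z) = -ltr p Y K f (wordS u z) := by
  rcases ltr_cases (p := p) (Y := Y) (K := K) f with h | ⟨x, rfl⟩
  · simp [h]
  · rw [ltr_coe, wordS_consL]

variable [LinearOrder I]

theorem wordS_splitL {Y : Type*} (u : Y → WordMod p I Y K) (f : I →₀ ℕ)
    (z : WordMod p I Y K) : wordS u (splitL f z) = splitL f (wordS u z) := by
  simp [splitL_apply, wordS_ltr]

variable (p K) in
/-- The contraction of the one-variable resolution in the variable `a`. -/
def kosU (a : I) (e N : I →₀ ℕ) : KMod p I K :=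
  if 1 ≤ N a ∧ e a + par p (N a - 1) < p then
    sg K a (N - Finsupp.single a 1) •
      kap p K (e + Finsupp.single a (par p (N a - 1))) (N - Finsupp.single a 1)
  else 0

variable (p K) in
/-- The contraction of the resolution: the one in the largest variable that occurs. -/
def kosS (e N : I →₀ ℕ) : KMod p I K :=
  if h : (e.support ∪ N.support).Nonempty then
    kosU p K ((e.support ∪ N.support).max' h) e N else 0

theorem kosS_eq {a : I} {e N : I →₀ ℕ} (ha : e a ≠ 0 ∨ N a ≠ 0)
    (hle : ∀ c, e c ≠ 0 ∨ N c ≠ 0 → c ≤ a) : kosS p K e N = kosU p K a e N := by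
  have hmem : ∀ c, c ∈ e.support ∪ N.support ↔ e c ≠ 0 ∨ N c ≠ 0 := fun c => by
    simp
  have h : (e.support ∪ N.support).Nonempty := ⟨a, (hmem a).mpr ha⟩
  rw [kosS, dif_pos h]
  congr 1
  refine le_antisymm (Finset.max'_le _ _ _ fun c hc => hle c ((hmem c).mp hc)) ?_
  exact Finset.le_max' _ _ ((hmem a).mpr ha)

theorem kosU_mem_degLt (a : I) (e N : I →₀ ℕ) (n : ℕ) (h : N.degree < n + 1) :
    kosU p K a e N ∈ degLt p I K n := by
  rw [kosU]
  split_ifs with h1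
  · refine Submodule.smul_mem _ _ (kap_mem_degLt _ _ _ ?_)
    have : N.degree = (N - Finsupp.single a 1).degree + 1 := by
      conv_lhs => rw [← tsub_add_cancel_of_le (Finsupp.single_le_iff.mpr h1.1)]
      rw [map_add, Finsupp.degree_single]
    omega
  · exact Submodule.zero_mem _

theorem kosS_mem_degLt (e N : I →₀ ℕ) (n : ℕ) (h : N.degree < n + 1) :
    kosS p K e N ∈ degLt p I K n := by
  rw [kosS]
  split_ifs
  · exact kosU_mem_degLt _ _ _ _ h
  · exact Submodule.zero_mem _

theorem kosS_zero : kosS p K (0 : I →₀ ℕ) 0 = 0 := by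
  rw [kosS, dif_neg (by simp)]

/-- The part of the differential of `kosU a` of a generator which belongs to the variable `b`. -/
def kosTU (p : ℕ) (K : Type*) [CommRing K] (b a : I) (e N : I →₀ ℕ) : KMod p I K :=
  if 1 ≤ N a ∧ e a + par p (N a - 1) < p then
    sg K a (N - Finsupp.single a 1) •
      kosT p K b (e + Finsupp.single a (par p (N a - 1))) (N - Finsupp.single a 1)
  else 0

/-- The contraction `kosU a`, applied to the part of the differential of a generator which belongs
to the variable `b`. -/
def kosUT (p : ℕ) (K : Type*) [CommRing K] (a b : I) (e N : I →₀ ℕ) : KMod p I K :=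
  if par p (N b) ≤ e b then
    sg K b N • kosU p K a (e - Finsupp.single b (par p (N b))) (N + Finsupp.single b 1)
  else 0

/-- In the variable of the contraction, the homotopy formula of the one-variable resolution: exactly
one of the two terms is nonzero. -/
theorem kosTU_add_kosUT_self (hp : 2 ≤ p) (a : I) (e N : I →₀ ℕ) (he : ∀ a, e a < p)
    (ha : e a ≠ 0 ∨ N a ≠ 0) :
    kosTU p K a a e N + kosUT p K a a e N = kap p K e N := by
  have hTU : (1 ≤ N a ∧ e a + par p (N a - 1) < p) → kosTU p K a a e N = kap p K e N := by
    intro h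
    rw [kosTU, if_pos h, kosT]
    simp only [Finsupp.add_apply, Finsupp.tsub_apply, Finsupp.single_eq_same]
    rw [if_pos (by omega), smul_smul, sg_mul_self, one_smul, add_tsub_cancel_right,
      tsub_add_cancel_of_le (Finsupp.single_le_iff.mpr h.1)]
  have hUT : par p (N a) ≤ e a → kosUT p K a a e N = kap p K e N := by
    intro h
    rw [kosUT, if_pos h, kosU]
    simp only [Finsupp.add_apply, Finsupp.tsub_apply, Finsupp.single_eq_same]
    have := he a
    rw [if_pos (by rw [Nat.add_sub_cancel]; omega), add_tsub_cancel_right, Nat.add_sub_cancel,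
      tsub_add_cancel_of_le (Finsupp.single_le_iff.mpr h), smul_smul, sg_mul_self, one_smul]
  have hpar : 1 ≤ N a → par p (N a - 1) + par p (N a) = p := fun h => by
    have := par_add hp (N a - 1)
    rwa [Nat.sub_add_cancel h] at this
  by_cases h1 : par p (N a) ≤ e a
  · rw [hUT h1, kosTU, if_neg (fun h => by have := hpar h.1; omega), zero_add]
  · have h2 : 1 ≤ N a := by
      by_contra h2
      have h3 : N a = 0 := by omega
      rw [h3] at h1 ha
      simp [par] at h1
      omega
    have := hpar h2
    rw [hTU ⟨h2, by omega⟩, kosUT, if_neg h1, add_zero]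

/-- The contraction in the largest variable `a` anticommutes with the differential in a smaller one.
-/
theorem kosTU_add_kosUT {a b : I} (hab : b < a) (e N : I →₀ ℕ) :
    kosTU p K b a e N + kosUT p K a b e N = 0 := by
  rw [kosTU, kosUT, kosT, kosU]
  simp only [Finsupp.add_apply, Finsupp.single_eq_of_ne hab.ne, Finsupp.single_eq_of_ne hab.ne',
    Finsupp.tsub_apply, add_zero, tsub_zero]
  by_cases h1 : 1 ≤ N a ∧ e a + par p (N a - 1) < p
  · by_cases h2 : par p (N b) ≤ e b
    · have h3 : N + Finsupp.single b 1 - Finsupp.single a 1 =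
          N - Finsupp.single a 1 + Finsupp.single b 1 :=
        tsub_add_eq_add_tsub (Finsupp.single_le_iff.mpr h1.1) |>.symm
      have h4 : e - Finsupp.single b (par p (N b)) + Finsupp.single a (par p (N a - 1)) =
          e + Finsupp.single a (par p (N a - 1)) - Finsupp.single b (par p (N b)) :=
        tsub_add_eq_add_tsub (Finsupp.single_le_iff.mpr h2)
      have h5 : sg K b N = sg K b (N - Finsupp.single a 1) := by
        conv_lhs => rw [← tsub_add_cancel_of_le (Finsupp.single_le_iff.mpr h1.1)]
        exact sg_add_single_not_le (not_le.mpr hab) _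
      rw [if_pos h1, if_pos h2, if_pos h2, if_pos h1, h3, h4, h5, sg_add_single_le hab.le,
        smul_smul, smul_smul, ← add_smul]
      rw [mul_neg, mul_comm, add_neg_cancel, zero_smul]
    · simp [h2]
  · simp [h1]

variable (p I K) in
/-- The contraction of the cobar module along the resolution. -/
def topS : KMod p I K →ₗ[K] KMod p I K := wordS fun y => kosS p K y.1.1 y.2

theorem topS_kap (e N : I →₀ ℕ) (he : ∀ a, e a < p) :
    topS p I K (kap p K e N) = kosS p K e N := by
  rw [kap, dif_pos he, topS, wordS_nil]

theorem sum_kosT_topS (hp : 2 ≤ p) (e N : I →₀ ℕ) (he : ∀ a, e a < p) (a : I)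
    (ha : e a ≠ 0 ∨ N a ≠ 0) (hle : ∀ c, e c ≠ 0 ∨ N c ≠ 0 → c ≤ a) :
    ∑ b ∈ e.support ∪ N.support, kosTU p K b a e N +
      ∑ b ∈ e.support ∪ N.support, topS p I K (kosT p K b e N) = kap p K e N := by
  rw [← Finset.sum_add_distrib]
  have hmem : ∀ c, c ∈ e.support ∪ N.support ↔ e c ≠ 0 ∨ N c ≠ 0 := fun c => by simp
  have hterm : ∀ b ∈ e.support ∪ N.support,
      topS p I K (kosT p K b e N) = kosUT p K a b e N := by
    intro b hb
    rw [kosT, kosUT]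
    split_ifs with h1
    · rw [map_smul, topS_kap _ _ (fun c => by have := he c; rw [Finsupp.tsub_apply]; omega),
        kosS_eq (a := a)]
      · by_cases hba : a = b
        · subst hba; right; simp
        · simpa [Finsupp.single_eq_of_ne hba] using ha
      · intro c hc
        by_cases hbc : c = b
        · subst hbc; exact hle c ((hmem c).mp hb)
        · exact hle c (by simpa [Finsupp.single_eq_of_ne hbc] using hc)
    · simp
  rw [Finset.sum_eq_single a]
  · rw [hterm a ((hmem a).mpr ha), kosTU_add_kosUT_self hp a e N he ha]
  · intro b hb hba
    rw [hterm b hb]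
    exact kosTU_add_kosUT (lt_of_le_of_ne (hle b ((hmem b).mp hb)) hba) e N
  · intro h; exact absurd ((hmem a).mpr ha) h

/-- On generators, the contraction is a homotopy from the identity to the augmentation, up to terms
of lower polynomial degree. -/
theorem topS_homotopy_kap (hp : 2 ≤ p) (e N : I →₀ ℕ) (he : ∀ a, e a < p) (n : ℕ)
    (hn : N.degree < n + 1) :
    kosD p I K (topS p I K (kap p K e N)) + topS p I K (kosD p I K (kap p K e N)) - kap p K e N +
      (if e = 0 ∧ N = 0 then kap p K 0 0 else 0) ∈ degLt p I K n := by
  by_cases h0 : e = 0 ∧ N = 0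
  · obtain ⟨rfl, rfl⟩ := h0
    rw [kosD_kap hp _ _ he ∅ (by simp)]
    simp [topS_kap _ _ he, kosS_zero, ltr_zero]
  · rw [if_neg h0, add_zero]
    have hne : (e.support ∪ N.support).Nonempty := by
      rw [Finset.nonempty_iff_ne_empty]
      intro h
      rw [Finset.union_eq_empty, Finsupp.support_eq_empty, Finsupp.support_eq_empty] at h
      exact h0 h
    have hmem : ∀ c, c ∈ e.support ∪ N.support ↔ e c ≠ 0 ∨ N c ≠ 0 := fun c => by simp
    set a := (e.support ∪ N.support).max' hne with ha_def
    have ha : e a ≠ 0 ∨ N a ≠ 0 := (hmem a).mp (Finset.max'_mem _ _)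
    have hle : ∀ c, e c ≠ 0 ∨ N c ≠ 0 → c ≤ a := fun c hc =>
      Finset.le_max' _ _ ((hmem c).mpr hc)
    have h1 : kosD p I K (topS p I K (kap p K e N)) -
        ∑ b ∈ e.support ∪ N.support, kosTU p K b a e N ∈ degLt p I K n := by
      rw [topS_kap _ _ he, kosS_eq ha hle, kosU]
      simp only [kosTU]
      split_ifs with h2
      · rw [map_smul, kosD_kap hp _ _ _ (e.support ∪ N.support), smul_add, Finset.smul_sum,
          add_sub_cancel_right]
        · refine Submodule.smul_mem _ _ (Submodule.neg_mem _ (Submodule.sum_mem _ fun ij _ =>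
            ltr_mem_degLt _ (kap_mem_degLt _ _ _ ?_)))
          have : N.degree = (N - Finsupp.single a 1).degree + 1 := by
            conv_lhs => rw [← tsub_add_cancel_of_le (Finsupp.single_le_iff.mpr h2.1)]
            rw [map_add, Finsupp.degree_single]
          omega
        · intro c hc
          rw [hmem]
          by_cases hca : c = a
          · rw [hca]; exact ha
          · left
            simpa [Finsupp.single_eq_of_ne hca] using hc
        · intro c
          by_cases hc : c = a
          · rw [hc]; simpa using h2.2
          · simpa [Finsupp.single_eq_of_ne hc] using he c
      · simp
    have h2 : topS p I K (kosD p I K (kap p K e N)) -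
        ∑ b ∈ e.support ∪ N.support, topS p I K (kosT p K b e N) ∈ degLt p I K n := by
      rw [kosD_kap hp _ _ he _ Finset.subset_union_left, map_add, map_neg, map_sum, map_sum,
        add_sub_cancel_right]
      refine Submodule.neg_mem _ (Submodule.sum_mem _ fun ij hij => ?_)
      rw [topS, wordS_ltr, ← topS, topS_kap _ _ (lt_of_mem_antidiagonal he hij).2]
      exact Submodule.neg_mem _ (ltr_mem_degLt _ (kosS_mem_degLt _ _ _ hn))
    have h3 := sum_kosT_topS (K := K) hp e N he a ha hle
    have key : ∀ X Y A B k : KMod p I K, A + B = k → X + Y - k = (X - A) + (Y - B) := by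
      rintro X Y A B _ rfl; abel
    rw [key _ _ _ _ _ h3]
    exact Submodule.add_mem _ h1 h2

variable (p I K) in
/-- The projection of the cobar module onto the cobar complex. -/
def wordAug : KMod p I K →ₗ[K] WordMod p I Unit K :=
  Finsupp.linearCombination K fun q =>
    if q.2.1.1 = 0 ∧ q.2.2 = 0 then Finsupp.single (q.1, ()) 1 else 0

variable (I K) in
/-- The inclusion of the cobar complex into the cobar module. -/
def wordIncl (hp : 2 ≤ p) : WordMod p I Unit K →ₗ[K] KMod p I K :=
  Finsupp.lmapDomain K K fun q => (q.1, (⟨0, fun _ => by simp; omega⟩, 0))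

variable (p I K) in
/-- The differential of the cobar complex. -/
def cobD : WordMod p I Unit K →ₗ[K] WordMod p I Unit K := wordD fun _ => 0

theorem wordIncl_nil (hp : 2 ≤ p) :
    wordIncl I K hp (Finsupp.single ([], ()) 1) = kap p K 0 0 := by
  rw [kap, dif_pos (fun _ => by simp; omega)]
  simp [wordIncl]

theorem wordIncl_consL (hp : 2 ≤ p) (x : Letter p I) (z : WordMod p I Unit K) :
    wordIncl I K hp (consL _ K x z) = consL _ K x (wordIncl I K hp z) := by
  have : (wordIncl I K hp).comp (consL _ K x) = (consL _ K x).comp (wordIncl I K hp) := by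
    apply wordMod_ext
    intro l y
    simp [wordIncl, consL_single]
  exact LinearMap.congr_fun this z

theorem wordIncl_ltr (hp : 2 ≤ p) (f : I →₀ ℕ) (z : WordMod p I Unit K) :
    wordIncl I K hp (ltr p _ K f z) = ltr p _ K f (wordIncl I K hp z) := by
  by_cases h : f ≠ 0 ∧ ∀ a, f a < p
  · rw [ltr, ltr, dif_pos h, dif_pos h, wordIncl_consL]
  · rw [ltr, ltr, dif_neg h, dif_neg h]; simp

theorem wordIncl_splitL (hp : 2 ≤ p) (f : I →₀ ℕ) (z : WordMod p I Unit K) :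
    wordIncl I K hp (splitL f z) = splitL f (wordIncl I K hp z) := by
  simp [splitL_apply, wordIncl_ltr]

theorem kosD_kap_zero (hp : 2 ≤ p) (N : I →₀ ℕ) : kosD p I K (kap p K 0 N) = 0 := by
  rw [kosD_kap hp _ _ (fun _ => by simp; omega) ∅ (by simp)]
  simp [ltr_zero]

theorem kosD_wordIncl (hp : 2 ≤ p) (z : WordMod p I Unit K) :
    kosD p I K (wordIncl I K hp z) = wordIncl I K hp (cobD p I K z) := by
  have : (kosD p I K).comp (wordIncl I K hp) = (wordIncl I K hp).comp (cobD p I K) := by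
    apply wordMod_ext
    rintro l ⟨⟩
    simp only [LinearMap.comp_apply]
    induction l with
    | nil => rw [wordIncl_nil, kosD_kap_zero hp, cobD, wordD_nil, map_zero]
    | cons x l ih =>
      rw [← consL_single, wordIncl_consL, kosD, wordD_consL, ← kosD, ih, cobD, wordD_consL, map_sub,
        map_neg, wordIncl_splitL, wordIncl_consL]
  exact LinearMap.congr_fun this z

theorem wordIncl_injective (hp : 2 ≤ p) : Function.Injective (wordIncl I K hp) :=
  Finsupp.mapDomain_injective fun q q' h => by
    simp only [Prod.mk.injEq, and_true] at h
    exact Prod.ext h rfl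

theorem topS_wordIncl (hp : 2 ≤ p) (z : WordMod p I Unit K) :
    topS p I K (wordIncl I K hp z) = 0 := by
  have : (topS p I K).comp (wordIncl I K hp) = 0 := by
    apply wordMod_ext
    rintro l ⟨⟩
    simp only [LinearMap.comp_apply, LinearMap.zero_apply]
    induction l with
    | nil => rw [wordIncl_nil, topS_kap _ _ (fun _ => by simp; omega), kosS_zero]
    | cons x l ih => rw [← consL_single, wordIncl_consL, topS, wordS_consL, ← topS, ih]; simp
  exact LinearMap.congr_fun this z

/-- The contraction along the resolution is a homotopy from the identity to the projection onto the
cobar complex, up to terms of lower polynomial degree. -/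
theorem topS_homotopy (hp : 2 ≤ p) (n : ℕ) (z : KMod p I K) (hz : z ∈ degLt p I K (n + 1)) :
    kosD p I K (topS p I K z) + topS p I K (kosD p I K z) - z +
      wordIncl I K hp (wordAug p I K z) ∈ degLt p I K n := by
  refine map_mem_of_supported ((kosD p I K).comp (topS p I K) + (topS p I K).comp (kosD p I K) -
    LinearMap.id + (wordIncl I K hp).comp (wordAug p I K)) _ _ ?_ z hz
  rintro ⟨l, ⟨⟨e, he⟩, N⟩⟩ hN
  simp only [LinearMap.add_apply, LinearMap.sub_apply, LinearMap.comp_apply, LinearMap.id_apply]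
  induction l with
  | nil =>
    have := topS_homotopy_kap (K := K) hp e N he n hN
    have h2 : wordIncl I K hp (wordAug p I K (kap p K e N)) =
        if e = 0 ∧ N = 0 then kap p K 0 0 else 0 := by
      rw [kap, dif_pos he]
      simp only [wordAug, Finsupp.linearCombination_single, one_smul]
      split_ifs
      · rw [wordIncl_nil]
      · simp
    rw [← h2, kap, dif_pos he] at this
    exact this
  | cons x l ih =>
    have h1 : ∀ z : KMod p I K, wordAug p I K (consL _ K x z) = consL _ K x (wordAug p I K z) := by
      intro z
      have : (wordAug p I K).comp (consL _ K x) = (consL _ K x).comp (wordAug p I K) := by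
        apply wordMod_ext
        intro l y
        simp only [LinearMap.comp_apply, consL_single, wordAug, Finsupp.linearCombination_single,
          one_smul]
        split_ifs
        · rw [consL_single]
        · simp
      exact LinearMap.congr_fun this z
    have := consL_mem_degLt x (ih hN)
    rw [← consL_single, h1, wordIncl_consL, topS, wordS_consL, ← topS, map_neg, kosD, wordD_consL,
      wordD_consL, map_sub, map_neg, ← kosD, topS, wordS_consL, wordS_splitL, ← topS]
    simp only [map_add, map_sub] at this
    convert this using 1
    abel

end TopContraction

/-! ### Contraction onto the span of the `γ_N` -/

section LastContraction

variable {p : ℕ} {I K : Type*} [CommRing K] [LinearOrder I]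

/-- The span of the words with fewer than `n` letters. -/
def lenLt (p : ℕ) (I K : Type*) [CommRing K] (n : ℕ) : Submodule K (KMod p I K) :=
  Finsupp.supported K K {q | q.1.length < n}

theorem lenLt_zero : lenLt p I K 0 = ⊥ := by
  simp [lenLt]

theorem exists_mem_lenLt (z : KMod p I K) : ∃ n, z ∈ lenLt p I K n := by
  refine ⟨z.support.sup (fun q => q.1.length) + 1, ?_⟩
  rw [lenLt, Finsupp.mem_supported]
  intro q hq
  exact Nat.lt_succ_of_le (Finset.le_sup (f := fun q => q.1.length) hq)

theorem lenLt_mono {m n : ℕ} (h : m ≤ n) : lenLt p I K m ≤ lenLt p I K n :=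
  Finsupp.supported_mono fun _ hq => lt_of_lt_of_le hq h

theorem consL_mem_lenLt (x : Letter p I) {n : ℕ} {z : KMod p I K} (hz : z ∈ lenLt p I K n) :
    consL _ K x z ∈ lenLt p I K (n + 1) :=
  map_mem_of_supported (consL _ K x) _ _ (fun q hq => by
    obtain ⟨l, y⟩ := q
    rw [consL_single]
    exact Finsupp.single_mem_supported K _ (Nat.succ_lt_succ hq)) z hz

theorem kap_mem_lenLt (e N : I →₀ ℕ) : kap p K e N ∈ lenLt p I K 1 := by
  rw [kap]
  split_ifs with he
  · exact Finsupp.single_mem_supported K _ (by simp)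
  · exact Submodule.zero_mem _

variable (p K) in
/-- The operator `γ_N ↦ y_f γ_N` on the generators `γ_N`, and zero on all other words. -/
def lastP (f : I →₀ ℕ) : KMod p I K →ₗ[K] KMod p I K :=
  Finsupp.linearCombination K fun q =>
    if q.1 = [] ∧ q.2.1.1 = 0 ∧ f ≠ 0 then kap p K f q.2.2 else 0

theorem lastP_mem_lenLt (f : I →₀ ℕ) (z : KMod p I K) : lastP p K f z ∈ lenLt p I K 1 := by
  refine map_mem_of_supported (lastP p K f) Set.univ (lenLt p I K 1) (fun q _ => ?_) z (by simp)
  rw [lastP, Finsupp.linearCombination_single, one_smul]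
  split_ifs
  · exact kap_mem_lenLt _ _
  · exact Submodule.zero_mem _

theorem lastP_consL (f : I →₀ ℕ) (x : Letter p I) (z : KMod p I K) :
    lastP p K f (consL _ K x z) = 0 := by
  have : (lastP p K f).comp (consL _ K x) = 0 := by
    apply wordMod_ext
    intro l y
    simp [lastP, consL_single]
  exact LinearMap.congr_fun this z

theorem lastP_ltr (f g : I →₀ ℕ) (z : KMod p I K) : lastP p K f (ltr p _ K g z) = 0 := by
  rcases ltr_cases (p := p) (Y := Red p I × (I →₀ ℕ)) (K := K) g with h | ⟨x, rfl⟩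
  · simp [h]
  · rw [ltr_coe, lastP_consL]

theorem lastP_kap (hp : 2 ≤ p) (f N : I →₀ ℕ) :
    lastP p K f (kap p K 0 N) = if f = 0 then 0 else kap p K f N := by
  rw [kap, dif_pos (fun _ => by simp; omega)]
  simp [lastP]

/-- The last letter of a word becomes the monomial in front of `γ_N`. -/
def lastSAux : List (Letter p I) → Red p I × (I →₀ ℕ) → KMod p I K
  | [], _ => 0
  | x :: l, y => -consL _ K x (lastSAux l y) - lastP p K x.1 (Finsupp.single (l, y) 1)

variable (p I K) in
/-- The contraction of the cobar module along words. -/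
def lastS : KMod p I K →ₗ[K] KMod p I K := wordLift lastSAux

theorem lastS_nil (y : Red p I × (I →₀ ℕ)) :
    lastS p I K (Finsupp.single ([], y) 1) = 0 := by
  simp [lastS, wordLift_single, lastSAux]

theorem lastS_kap (e N : I →₀ ℕ) : lastS p I K (kap p K e N) = 0 := by
  rw [kap]
  split_ifs
  · rw [lastS_nil]
  · simp

theorem lastS_consL (x : Letter p I) (z : KMod p I K) :
    lastS p I K (consL _ K x z) = -consL _ K x (lastS p I K z) - lastP p K x.1 z := by
  have : (lastS p I K).comp (consL _ K x) =
      -(consL _ K x).comp (lastS p I K) - lastP p K x.1 := by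
    apply wordMod_ext
    intro l y
    simp [lastS, wordLift_single, lastSAux, consL_single]
  exact LinearMap.congr_fun this z

theorem lastS_ltr (f : I →₀ ℕ) (z : KMod p I K) :
    lastS p I K (ltr p _ K f z) = -ltr p _ K f (lastS p I K z) - lastP p K f z := by
  by_cases h : f ≠ 0 ∧ ∀ a, f a < p
  · obtain ⟨x, rfl⟩ : ∃ x : Letter p I, x.1 = f := ⟨⟨f, h⟩, rfl⟩
    rw [ltr_coe, lastS_consL]
  · have h1 : lastP p K f = 0 := by
      apply wordMod_ext
      intro l y
      by_cases h0 : f = 0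
      · simp [lastP, h0]
      · simp [lastP, kap, show ¬ ∀ a, f a < p from fun h1 => h ⟨h0, h1⟩]
    simp [ltr, h, h1]

variable (p I K) in
/-- The projection of the cobar module onto the span of the `γ_N`. -/
def gamProj : KMod p I K →ₗ[K] ((I →₀ ℕ) →₀ K) :=
  Finsupp.linearCombination K fun q =>
    if q.1 = [] ∧ q.2.1.1 = 0 then Finsupp.single q.2.2 1 else 0

variable (p I K) in
/-- The inclusion of the span of the `γ_N` into the cobar module. -/
def gamIncl : ((I →₀ ℕ) →₀ K) →ₗ[K] KMod p I K :=
  Finsupp.linearCombination K fun N => kap p K 0 N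

theorem gamIncl_single (N : I →₀ ℕ) : gamIncl p I K (Finsupp.single N 1) = kap p K 0 N := by
  simp [gamIncl]

theorem gamProj_consL (x : Letter p I) (z : KMod p I K) : gamProj p I K (consL _ K x z) = 0 := by
  have : (gamProj p I K).comp (consL _ K x) = 0 := by
    apply wordMod_ext
    intro l y
    simp [gamProj, consL_single]
  exact LinearMap.congr_fun this z

theorem gamProj_kap (e N : I →₀ ℕ) (he : ∀ a, e a < p) :
    gamProj p I K (kap p K e N) = if e = 0 then Finsupp.single N 1 else 0 := by
  rw [kap, dif_pos he]
  simp [gamProj]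

theorem lt_of_two_le (hp : 2 ≤ p) : ∀ a : I, (0 : I →₀ ℕ) a < p := fun _ => by simp; omega

theorem gamIncl_injective (hp : 2 ≤ p) : Function.Injective (gamIncl p I K) := by
  have : (gamProj p I K).comp (gamIncl p I K) = LinearMap.id := by
    apply Finsupp.lhom_ext'
    intro N
    ext1
    simp [gamIncl, gamProj_kap _ _ (lt_of_two_le hp)]
  exact (LinearMap.injective_of_comp_eq_id _ _ this)

theorem kosD_gamIncl (hp : 2 ≤ p) (w : (I →₀ ℕ) →₀ K) :
    kosD p I K (gamIncl p I K w) = gamIncl p I K ((0 : ((I →₀ ℕ) →₀ K) →ₗ[K] _) w) := by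
  have : (kosD p I K).comp (gamIncl p I K) = 0 := by
    apply Finsupp.lhom_ext'
    intro N
    ext1
    simp [gamIncl, kosD_kap_zero hp]
  rw [LinearMap.zero_apply, map_zero]
  exact LinearMap.congr_fun this w

theorem lastS_gamIncl (w : (I →₀ ℕ) →₀ K) : lastS p I K (gamIncl p I K w) = 0 := by
  have : (lastS p I K).comp (gamIncl p I K) = 0 := by
    apply Finsupp.lhom_ext'
    intro N
    ext1
    simp [gamIncl, lastS_kap]
  exact LinearMap.congr_fun this w

theorem lastS_splitL (f : I →₀ ℕ) (z : KMod p I K) :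
    lastS p I K (splitL f z) = splitL f (lastS p I K z) +
      ∑ ij ∈ Finset.HasAntidiagonal.antidiagonal f, ltr p _ K ij.1 (lastP p K ij.2 z) := by
  rw [splitL_apply, map_sum, splitL_apply, ← Finset.sum_add_distrib]
  refine Finset.sum_congr rfl fun ij _ => ?_
  rw [lastS_ltr, lastS_ltr, lastP_ltr, map_sub, map_neg]
  abel

variable (p I K) in
/-- The deviation of the contraction along words from being a homotopy between the identity and the
augmentation. -/
def lastErr : KMod p I K →ₗ[K] KMod p I K :=
  (kosD p I K).comp (lastS p I K) + (lastS p I K).comp (kosD p I K) -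
    LinearMap.id + (gamIncl p I K).comp (gamProj p I K)

theorem lastErr_apply (z : KMod p I K) : lastErr p I K z = kosD p I K (lastS p I K z) +
    lastS p I K (kosD p I K z) - z + gamIncl p I K (gamProj p I K z) := rfl

theorem lastErr_consL (x : Letter p I) (z : KMod p I K) :
    lastErr p I K (consL _ K x z) = consL _ K x (lastErr p I K z) +
      (lastP p K x.1 (kosD p I K z) - kosD p I K (lastP p K x.1 z) -
      consL _ K x (gamIncl p I K (gamProj p I K z)) -
      ∑ ij ∈ Finset.HasAntidiagonal.antidiagonal x.1, ltr p _ K ij.1 (lastP p K ij.2 z)) := by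
  rw [lastErr_apply, lastErr_apply, lastS_consL, gamProj_consL, map_sub, map_neg, kosD,
    wordD_consL, wordD_consL, ← kosD, map_sub, map_neg, lastS_splitL, lastS_consL]
  simp only [map_add, map_sub, map_zero]
  abel

theorem lastErr_mem (hp : 2 ≤ p) (l : List (Letter p I)) (y : Red p I × (I →₀ ℕ)) :
    lastErr p I K (Finsupp.single (l, y) 1) ∈ lenLt p I K l.length := by
  obtain ⟨⟨e, he⟩, N⟩ := y
  have hk : Finsupp.single ([], ((⟨e, he⟩ : Red p I), N)) 1 = kap p K e N := by
    rw [kap, dif_pos he]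
  induction l with
  | nil =>
    rw [hk, List.length_nil, lenLt_zero, Submodule.mem_bot, lastErr_apply, lastS_kap,
      kosD_kap hp _ _ he _ subset_rfl, gamProj_kap _ _ he, map_add, map_neg, map_sum, map_sum]
    have h1 : ∀ a ∈ e.support, lastS p I K (kosT p K a e N) = 0 := fun a _ => by
      rw [kosT]; split_ifs <;> simp [lastS_kap]
    have h2 : ∀ ij ∈ Finset.HasAntidiagonal.antidiagonal e,
        lastS p I K (ltr p _ K ij.1 (kap p K ij.2 N)) =
          if ij = (e, 0) then (if e = 0 then 0 else -kap p K e N) else 0 := by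
      rintro ⟨i, j⟩ hij
      rw [lastS_ltr, lastS_kap, map_zero, neg_zero, zero_sub]
      rw [Finset.HasAntidiagonal.mem_antidiagonal] at hij
      simp only at hij
      by_cases hj : j = 0
      · subst hj
        rw [add_zero] at hij
        subst hij
        rw [lastP_kap hp, if_pos rfl]
        split_ifs <;> simp
      · rw [if_neg (by simp [hj])]
        rw [kap]
        split_ifs
        · simp [lastP, hj]
        · simp
    rw [Finset.sum_eq_zero h1, Finset.sum_congr rfl h2, Finset.sum_ite_eq', if_pos (by simp)]
    by_cases h0 : e = 0
    · simp [h0, gamIncl_single]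
    · simp [h0]
  | cons x l ih =>
    rw [← consL_single, lastErr_consL, List.length_cons]
    refine Submodule.add_mem (lenLt p I K (l.length + 1)) (consL_mem_lenLt x ih) ?_
    cases l with
    | cons x' l =>
      rw [← consL_single, kosD, wordD_consL]
      simp [gamProj_consL, lastP_consL, splitL_apply, lastP_ltr]
    | nil =>
      rw [hk]
      by_cases h0 : e = 0
      · subst h0
        have hx := x.2.1
        rw [kosD_kap_zero hp, gamProj_kap _ _ he, if_pos rfl, gamIncl_single, lastP_kap hp,
          if_neg hx, kosD_kap hp _ _ x.2.2 _ subset_rfl, map_zero]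
        have h3 : ∀ ij ∈ Finset.HasAntidiagonal.antidiagonal x.1,
            ltr p _ K ij.1 (lastP p K ij.2 (kap p K 0 N)) = ltr p _ K ij.1 (kap p K ij.2 N) -
              if ij = (x.1, 0) then consL _ K x (kap p K 0 N) else 0 := by
          rintro ⟨i, j⟩ hij
          rw [Finset.HasAntidiagonal.mem_antidiagonal] at hij
          simp only at hij
          rw [lastP_kap hp]
          by_cases hj : j = 0
          · subst hj
            rw [add_zero] at hij
            subst hij
            simp [ltr_coe]
          · simp [hj]
        rw [Finset.sum_congr rfl h3, Finset.sum_sub_distrib, Finset.sum_ite_eq',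
          if_pos (by simp)]
        have h4 : ∑ a ∈ (x.1).support, kosT p K a x.1 N ∈ lenLt p I K 1 :=
          Submodule.sum_mem _ fun a _ => by
            rw [kosT]
            split_ifs
            · exact Submodule.smul_mem _ _ (kap_mem_lenLt _ _)
            · exact Submodule.zero_mem _
        have key : ∀ S T C : KMod p I K, 0 - (-S + T) - C - (S - C) = -T := by
          intros; abel
        rw [key]
        exact Submodule.neg_mem _ h4
      · have h3 : ∀ f : I →₀ ℕ, lastP p K f (kap p K e N) = 0 := fun f => by
          rw [kap, dif_pos he]
          simp [lastP, h0]
        rw [gamProj_kap _ _ he, if_neg h0]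
        simp only [h3, map_zero, sub_zero, Finset.sum_const_zero]
        exact lastP_mem_lenLt _ _

/-- The contraction along words is a homotopy from the identity to the projection onto the span of
the `γ_N`, up to shorter words. -/
theorem lastS_homotopy (hp : 2 ≤ p) (n : ℕ) (z : KMod p I K) (hz : z ∈ lenLt p I K (n + 1)) :
    kosD p I K (lastS p I K z) + lastS p I K (kosD p I K z) - z +
      gamIncl p I K (gamProj p I K z) ∈ lenLt p I K n := by
  rw [← lastErr_apply]
  refine map_mem_of_supported (lastErr p I K) {q | q.1.length < n + 1} (lenLt p I K n) ?_ z hz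
  rintro ⟨l, y⟩ hl
  exact lenLt_mono (Nat.le_of_lt_succ hl) (lastErr_mem hp l y)

end LastContraction

/-! ### The cohomology of the cobar complex of words -/

section Comparison

variable {p : ℕ} {I K : Type*} [CommRing K] [LinearOrder I]

/-- The cocycle `z` of the cobar complex is cohomologous, in the cobar module of the resolution, to
the combination `w` of the `γ_N`. -/
def CobRel (hp : 2 ≤ p) (z : WordMod p I Unit K) (w : (I →₀ ℕ) →₀ K) : Prop :=
  wordIncl I K hp z - gamIncl p I K w ∈ LinearMap.range (kosD p I K)

/-- Every cocycle is related to a combination of the `γ_N`, by the contraction along words. -/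
theorem exists_cobRel (hp : 2 ≤ p) (z : WordMod p I Unit K) (hz : cobD p I K z = 0) :
    ∃ w, CobRel hp z w := by
  obtain ⟨n, hn⟩ := exists_mem_lenLt (wordIncl I K hp z)
  have := exists_sub_mem_range_of_contraction (G := lenLt p I K) lenLt_zero (kosD_kosD hp)
    (kosD_gamIncl hp) lastS_gamIncl (lastS_homotopy hp) n 0 _ hn
    (by rw [map_zero, zero_add, kosD_wordIncl, hz, map_zero])
  rwa [map_zero, zero_add] at this

/-- Every combination of the `γ_N` is related to a cocycle, by the contraction along the resolution.
-/
theorem exists_cocycle_cobRel (hp : 2 ≤ p) (w : (I →₀ ℕ) →₀ K) :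
    ∃ z, cobD p I K z = 0 ∧ CobRel hp z w := by
  obtain ⟨n, hn⟩ := exists_mem_degLt (gamIncl p I K w)
  have hw : kosD p I K (gamIncl p I K w) = 0 := by rw [kosD_gamIncl hp]; simp
  obtain ⟨z, hz⟩ := exists_sub_mem_range_of_contraction (G := degLt p I K) degLt_zero
    (kosD_kosD hp) (kosD_wordIncl hp) (topS_wordIncl hp) (topS_homotopy hp) n 0 _ hn
    (by rw [map_zero, zero_add, hw])
  rw [map_zero, zero_add] at hz
  refine ⟨z, ?_, ?_⟩
  · obtain ⟨y, hy⟩ := hz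
    have := congrArg (kosD p I K) hy
    rw [kosD_kosD hp, map_sub, hw, zero_sub, kosD_wordIncl, eq_comm, neg_eq_zero] at this
    exact wordIncl_injective hp (this.trans (map_zero _).symm)
  · rw [CobRel, ← neg_sub]
    exact Submodule.neg_mem _ hz

theorem cobRel_add (hp : 2 ≤ p) {z z' : WordMod p I Unit K} {w w' : (I →₀ ℕ) →₀ K}
    (h : CobRel hp z w) (h' : CobRel hp z' w') : CobRel hp (z + z') (w + w') := by
  rw [CobRel, map_add, map_add, add_sub_add_comm]
  exact Submodule.add_mem _ h h'

theorem cobRel_smul (hp : 2 ≤ p) {z : WordMod p I Unit K} {w : (I →₀ ℕ) →₀ K} (c : K)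
    (h : CobRel hp z w) : CobRel hp (c • z) (c • w) := by
  rw [CobRel, map_smul, map_smul, ← smul_sub]
  exact Submodule.smul_mem _ _ h

theorem eq_zero_of_cobRel (hp : 2 ≤ p) {w : (I →₀ ℕ) →₀ K}
    (h : CobRel hp 0 w) : w = 0 := by
  obtain ⟨y, hy⟩ := h
  obtain ⟨n, hn⟩ := exists_mem_lenLt (-y)
  have := mem_range_of_contraction (G := lenLt p I K) lenLt_zero
    (kosD_gamIncl hp) (gamIncl_injective hp) (kosD_kosD hp) lastS_gamIncl (lastS_homotopy hp)
    n w (-y) hn (by rw [map_neg, hy]; simp)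
  obtain ⟨v, hv⟩ := this
  exact hv.symm

/-- The combination of the `γ_N` related to a cocycle is unique. -/
theorem eq_of_cobRel (hp : 2 ≤ p) {z : WordMod p I Unit K} {w w' : (I →₀ ℕ) →₀ K}
    (h : CobRel hp z w) (h' : CobRel hp z w') : w = w' := by
  have := cobRel_add hp h (cobRel_smul hp (-1) h')
  rw [neg_one_smul, neg_one_smul, add_neg_cancel] at this
  exact eq_of_sub_eq_zero ((sub_eq_add_neg _ _).trans (eq_zero_of_cobRel hp this))

/-- A cocycle related to zero is a coboundary. -/
theorem mem_range_of_cobRel_zero (hp : 2 ≤ p) {z : WordMod p I Unit K}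
    (h : CobRel hp z 0) : z ∈ LinearMap.range (cobD p I K) := by
  obtain ⟨y, hy⟩ := h
  obtain ⟨n, hn⟩ := exists_mem_degLt y
  exact mem_range_of_contraction (G := degLt p I K) degLt_zero
    (kosD_wordIncl hp) (wordIncl_injective hp) (kosD_kosD hp) (topS_wordIncl hp) (topS_homotopy hp)
    n z y hn (by rw [hy]; simp)

theorem cobRel_cobD (hp : 2 ≤ p) (z : WordMod p I Unit K) : CobRel hp (cobD p I K z) 0 := by
  rw [CobRel, ← kosD_wordIncl, map_zero, sub_zero]
  exact ⟨_, rfl⟩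

theorem cobRel_one (hp : 2 ≤ p) :
    CobRel (K := K) hp (Finsupp.single (([] : List (Letter p I)), ()) 1) (Finsupp.single 0 1) := by
  rw [CobRel, wordIncl_nil, gamIncl_single, sub_self]
  exact Submodule.zero_mem _

end Comparison

/-! ### Left multiplication by `h_a` and `b_a` -/

section Action

variable {p : ℕ} {I K : Type*} [CommRing K] [LinearOrder I]

variable (p K) in
/-- The action of `h_a` on the span of the `γ_N`: it multiplies by `h_a`, with `h_a^2 = 0` unless
`p = 2`. -/
def opH (a : I) : ((I →₀ ℕ) →₀ K) →ₗ[K] ((I →₀ ℕ) →₀ K) :=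
  Finsupp.linearCombination K fun N =>
    if par p (N a) ≤ 1 then sg K a N • Finsupp.single (N + Finsupp.single a 1) 1 else 0

variable (K) in
/-- The action of `b_a` on the span of the `γ_N`. -/
def opB (a : I) : ((I →₀ ℕ) →₀ K) →ₗ[K] ((I →₀ ℕ) →₀ K) :=
  Finsupp.linearCombination K fun N => Finsupp.single (N + Finsupp.single a 2) 1

theorem opH_single (a : I) (N : I →₀ ℕ) : opH p K a (Finsupp.single N 1) =
    if par p (N a) ≤ 1 then sg K a N • Finsupp.single (N + Finsupp.single a 1) 1 else 0 := by
  simp [opH]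

theorem opB_single (a : I) (N : I →₀ ℕ) :
    opB K a (Finsupp.single N 1) = Finsupp.single (N + Finsupp.single a 2) 1 := by
  simp [opB]

/-- The sum of the words `[y_a^{(m)}|y_a^{(p-m)}]` with `0 < m < p`, up to sign: it is the cocycle
representing `b_a`, for divided powers. -/
def betaL {Y : Type*} (a : I) : WordMod p I Y K →ₗ[K] WordMod p I Y K :=
  -(splitL (Finsupp.single a p) : WordMod p I Y K →ₗ[K] _)

theorem antidiagonal_single_cases {a : I} {m : ℕ} {ij : (I →₀ ℕ) × (I →₀ ℕ)}
    (h : ij ∈ Finset.HasAntidiagonal.antidiagonal (Finsupp.single a m)) :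
    ((∀ b, ij.1 b < m) ∧ ∀ b, ij.2 b < m) ∨ ij = (0, Finsupp.single a m) ∨
      ij = (Finsupp.single a m, 0) := by
  obtain ⟨i, j⟩ := ij
  rw [Finset.HasAntidiagonal.mem_antidiagonal] at h
  simp only at h
  by_cases hm : m = 0
  · subst hm
    rw [Finsupp.single_zero] at h
    obtain ⟨rfl, rfl⟩ := add_eq_zero.mp h
    simp
  by_cases hi : i = 0
  · subst hi; rw [zero_add] at h; subst h; simp
  by_cases hj : j = 0
  · subst hj; rw [add_zero] at h; subst h; simp
  left
  have hb : ∀ b, i b + j b = if a = b then m else 0 := fun b => by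
    rw [← Finsupp.add_apply, h, Finsupp.single_apply]
  have hia : i a ≠ 0 := fun h0 => hi (by
    ext b
    by_cases hab : a = b
    · subst hab; simpa using h0
    · have := hb b; rw [if_neg hab] at this; simp; omega)
  have hja : j a ≠ 0 := fun h0 => hj (by
    ext b
    by_cases hab : a = b
    · subst hab; simpa using h0
    · have := hb b; rw [if_neg hab] at this; simp; omega)
  have haa := hb a
  rw [if_pos rfl] at haa
  constructor <;> intro b <;> by_cases hab : a = b
  · subst hab; simp only; omega
  · have := hb b; rw [if_neg hab] at this; simp only; omega
  · subst hab; simp only; omega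
  · have := hb b; rw [if_neg hab] at this; simp only; omega

theorem single_lt {a : I} {m : ℕ} (hm : m < p) : ∀ b, Finsupp.single a m b < p := fun b => by
  rw [Finsupp.single_apply]; split_ifs <;> omega

theorem splitL_single_one {Y : Type*} (a : I) :
    (splitL (Finsupp.single a 1) : WordMod p I Y K →ₗ[K] _) = 0 := by
  rw [splitL]
  refine Finset.sum_eq_zero fun ij hij => ?_
  rcases antidiagonal_single_cases hij with ⟨h1, _⟩ | h | h
  · have : ij.1 = 0 := by ext b; have := h1 b; simp; omega
    rw [this, ltr_zero, LinearMap.zero_comp]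
  · rw [h, ltr_zero, LinearMap.zero_comp]
  · rw [h, ltr_zero, LinearMap.comp_zero]

theorem ltr_single_anticomm {Y : Type*} (hp : 2 ≤ p) (g : Y → WordMod p I Y K) (a : I)
    (z : WordMod p I Y K) : wordD g (ltr p Y K (Finsupp.single a 1) z) =
      -ltr p Y K (Finsupp.single a 1) (wordD g z) := by
  rw [wordD_ltr g _ (single_lt (by omega)), splitL_single_one]
  simp

theorem betaL_comm {Y : Type*} (g : Y → WordMod p I Y K) (a : I) (z : WordMod p I Y K) :
    wordD g (betaL a z) = betaL a (wordD g z) := by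
  rw [betaL, LinearMap.neg_apply, LinearMap.neg_apply, map_neg, wordD_splitL]
  intro ij hij
  rcases antidiagonal_single_cases hij with h | h | h
  · exact Or.inl h
  · right; left; rw [h]
  · right; right; rw [h]

/-- `[y_a] γ_N` is cohomologous to `h_a γ_N`. -/
theorem ltr_gamIncl_sub (hp : 2 ≤ p) (a : I) (w : (I →₀ ℕ) →₀ K) :
    ltr p _ K (Finsupp.single a 1) (gamIncl p I K w) - gamIncl p I K (opH p K a w) ∈
      LinearMap.range (kosD p I K) := by
  refine map_mem_of_supported ((ltr p _ K (Finsupp.single a 1)).comp (gamIncl p I K) -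
    (gamIncl p I K).comp (opH p K a)) Set.univ (LinearMap.range (kosD p I K)) ?_ w (by simp)
  rintro N -
  refine ⟨-kap p K (Finsupp.single a 1) N, ?_⟩
  have hs : ∑ ij ∈ Finset.HasAntidiagonal.antidiagonal (Finsupp.single a 1),
      ltr p _ K ij.1 (kap p K ij.2 N) = ltr p _ K (Finsupp.single a 1) (kap p K 0 N) := by
    refine Finset.sum_eq_single (Finsupp.single a 1, 0) (fun ij hij hne => ?_) (by simp)
    rcases antidiagonal_single_cases hij with ⟨h1, _⟩ | h | h
    · have : ij.1 = 0 := by ext b; have := h1 b; simp; omega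
      rw [this, ltr_zero, LinearMap.zero_apply]
    · rw [h, ltr_zero, LinearMap.zero_apply]
    · exact absurd h hne
  rw [map_neg, kosD_kap hp _ _ (single_lt (by omega)) {a}
    (Finsupp.support_single_subset), hs, Finset.sum_singleton, kosT]
  simp only [LinearMap.sub_apply, LinearMap.comp_apply, gamIncl_single, opH_single,
    Finsupp.single_eq_same]
  have h1 := one_le_par hp (N a)
  by_cases h2 : par p (N a) ≤ 1
  · rw [if_pos h2, if_pos h2, map_smul, gamIncl_single, le_antisymm h2 h1, tsub_self]
    abel
  · rw [if_neg h2, if_neg h2, map_zero]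
    abel

/-- The cocycle `-∑ [y_a^{(m)}|y_a^{(p-m)}]`, times `γ_N`, is cohomologous to `b_a γ_N`. -/
theorem betaL_gamIncl_sub (hp : 2 ≤ p) (a : I) (w : (I →₀ ℕ) →₀ K) :
    betaL a (gamIncl p I K w) - gamIncl p I K (opB K a w) ∈ LinearMap.range (kosD p I K) := by
  refine map_mem_of_supported ((betaL a).comp (gamIncl p I K) -
    (gamIncl p I K).comp (opB K a)) Set.univ (LinearMap.range (kosD p I K)) ?_ w (by simp)
  rintro N -
  have hpar := par_add hp (N a)
  have h1p := one_le_par hp (N a)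
  set f := Finsupp.single a p with hf
  set N' := N + Finsupp.single a 1 with hN'
  have hN'a : N' a = N a + 1 := by simp [hN']
  have ho : par p (N' a) < p := by rw [hN'a]; omega
  -- the differential of `∑ [y_i] y_j γ_N`
  have h1 : ∀ ij ∈ Finset.HasAntidiagonal.antidiagonal f,
      kosD p I K (ltr p _ K ij.1 (kap p K ij.2 N)) =
        (∑ uv ∈ Finset.HasAntidiagonal.antidiagonal ij.2,
          ltr p _ K ij.1 (ltr p _ K uv.1 (kap p K uv.2 N)) -
        ∑ uv ∈ Finset.HasAntidiagonal.antidiagonal ij.1,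
          ltr p _ K uv.1 (ltr p _ K uv.2 (kap p K ij.2 N))) -
        ltr p _ K ij.1 (kosT p K a ij.2 N) -
        if ij = (f, 0) then betaL a (kap p K 0 N) else 0 := by
    intro ij hij
    rcases antidiagonal_single_cases hij with ⟨h1, h2⟩ | h | h
    · have hs : ij.2.support ⊆ {a} := by
        rw [Finset.HasAntidiagonal.mem_antidiagonal] at hij
        intro b hb
        rw [Finset.mem_singleton]
        by_contra hba
        have := congrArg (fun g => g b) hij
        simp only [Finsupp.add_apply, hf, Finsupp.single_eq_of_ne hba] at this
        rw [Finsupp.mem_support_iff] at hb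
        omega
      rw [kosD, wordD_ltr _ _ h1, ← kosD, kosD_kap hp _ _ h2 _ hs, map_add, map_neg, map_sum,
        splitL_apply, Finset.sum_singleton, if_neg]
      · abel
      · intro h
        have := h1 a
        rw [h] at this
        simp [hf] at this
    · have hne : ((0 : I →₀ ℕ), f) ≠ (f, 0) := fun h' => by
        have := congrArg (fun g => g a) (Prod.ext_iff.mp h').2
        simp [hf] at this
        omega
      rw [h, if_neg hne]
      simp only [ltr_zero, LinearMap.zero_apply, map_zero, Finset.sum_const_zero]
      rw [Finset.sum_eq_zero fun uv huv => ?_]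
      · simp
      · rw [Finset.HasAntidiagonal.mem_antidiagonal] at huv
        rw [(add_eq_zero.mp huv).1, ltr_zero, LinearMap.zero_apply]
    · have hl : ltr p (Red p I × (I →₀ ℕ)) K f = 0 :=
        ltr_eq_zero_of_not fun h' => by have := h' a; simp [hf] at this
      rw [h, if_pos rfl, hl, betaL, LinearMap.neg_apply, splitL_apply]
      simp
  have h2 : kosD p I K (∑ ij ∈ Finset.HasAntidiagonal.antidiagonal f,
      ltr p _ K ij.1 (kap p K ij.2 N)) =
        -∑ ij ∈ Finset.HasAntidiagonal.antidiagonal f, ltr p _ K ij.1 (kosT p K a ij.2 N) -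
          betaL a (kap p K 0 N) := by
    rw [map_sum, Finset.sum_congr rfl h1, Finset.sum_sub_distrib, Finset.sum_sub_distrib,
      Finset.sum_sub_distrib,
      sum_antidiagonal_assoc (fun a b c => ltr p _ K a (ltr p _ K b (kap p K c N))),
      Finset.sum_ite_eq', if_pos (by simp)]
    abel
  have h3 : ∑ ij ∈ Finset.HasAntidiagonal.antidiagonal f, ltr p _ K ij.1 (kosT p K a ij.2 N) =
      sg K a N • ∑ ij ∈ Finset.HasAntidiagonal.antidiagonal (Finsupp.single a (par p (N' a))),
        ltr p _ K ij.1 (kap p K ij.2 N') := by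
    have h4 : ∀ i j : I →₀ ℕ, ltr p _ K i (kosT p K a j N) =
        if par p (N a) ≤ j a then ltr p _ K i (sg K a N • kap p K (j - Finsupp.single a
          (par p (N a))) (N + Finsupp.single a 1)) else 0 := fun i j => by
      rw [kosT]; split_ifs <;> simp
    simp only [h4]
    rw [sum_antidiagonal_sub (fun i j => ltr p _ K i (sg K a N • kap p K j
      (N + Finsupp.single a 1))) f a (par p (N a)), if_pos (by simp [hf]; omega),
      show f - Finsupp.single a (par p (N a)) = Finsupp.single a (par p (N' a)) by
        rw [hf, ← Finsupp.single_tsub, hN'a]; congr 1; omega]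
    simp [Finset.smul_sum, hN']
  have h5 := kosD_kap (K := K) hp (Finsupp.single a (par p (N' a))) N' (single_lt ho) {a}
    Finsupp.support_single_subset
  have e1 : N' + Finsupp.single a 1 = N + Finsupp.single a 2 := by
    rw [hN', add_assoc, ← Finsupp.single_add]
  have e2 : sg K a N' = -sg K a N := sg_add_single_le le_rfl N
  rw [Finset.sum_singleton, kosT, if_pos (by simp), tsub_self, e1, e2] at h5
  refine ⟨sg K a N • kap p K (Finsupp.single a (par p (N' a))) N' -
    ∑ ij ∈ Finset.HasAntidiagonal.antidiagonal f, ltr p _ K ij.1 (kap p K ij.2 N), ?_⟩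
  rw [map_sub, map_smul, h2, h3, h5]
  simp only [LinearMap.sub_apply, LinearMap.comp_apply, gamIncl_single, opB_single]
  rw [smul_add, smul_neg, smul_smul, mul_neg, sg_mul_self, neg_one_smul]
  abel

theorem cobRel_ltr (hp : 2 ≤ p) (a : I) {z : WordMod p I Unit K} {w : (I →₀ ℕ) →₀ K}
    (h : CobRel hp z w) : CobRel hp (ltr p _ K (Finsupp.single a 1) z) (opH p K a w) := by
  obtain ⟨y, hy⟩ := h
  have h1 := ltr_gamIncl_sub (K := K) hp a w
  have h2 : kosD p I K (-ltr p _ K (Finsupp.single a 1) y) =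
      ltr p _ K (Finsupp.single a 1) (wordIncl I K hp z) -
        ltr p _ K (Finsupp.single a 1) (gamIncl p I K w) := by
    rw [map_neg, kosD, ltr_single_anticomm hp, ← kosD, hy, neg_neg, map_sub]
  have := Submodule.add_mem _ h1 ⟨_, h2⟩
  rw [CobRel, wordIncl_ltr]
  convert this using 1
  abel

theorem cobRel_betaL (hp : 2 ≤ p) (a : I) {z : WordMod p I Unit K} {w : (I →₀ ℕ) →₀ K}
    (h : CobRel hp z w) : CobRel hp (betaL a z) (opB K a w) := by
  obtain ⟨y, hy⟩ := h
  have h1 := betaL_gamIncl_sub (K := K) hp a w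
  have h2 : kosD p I K (betaL a y) =
      betaL a (wordIncl I K hp z) - betaL a (gamIncl p I K w) := by
    rw [kosD, betaL_comm, ← kosD, hy, map_sub]
  have := Submodule.add_mem _ h1 ⟨_, h2⟩
  have h3 : wordIncl I K hp (betaL a z) = betaL a (wordIncl I K hp z) := by
    rw [betaL, LinearMap.neg_apply, map_neg, wordIncl_splitL, betaL, LinearMap.neg_apply]
  rw [CobRel, h3]
  convert this using 1
  abel

variable (I K) in
/-- The class of a cocycle of the cobar complex, as a combination of the `γ_N`. -/
def cobClass (hp : 2 ≤ p) : LinearMap.ker (cobD p I K) →ₗ[K] ((I →₀ ℕ) →₀ K) where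
  toFun z := (exists_cobRel hp z.1 z.2).choose
  map_add' z z' := eq_of_cobRel hp (exists_cobRel hp _ (z + z').2).choose_spec
    (cobRel_add hp (exists_cobRel hp z.1 z.2).choose_spec (exists_cobRel hp z'.1 z'.2).choose_spec)
  map_smul' c z := eq_of_cobRel hp (exists_cobRel hp _ (c • z).2).choose_spec
    (cobRel_smul hp c (exists_cobRel hp z.1 z.2).choose_spec)

theorem cobRel_cobClass (hp : 2 ≤ p) (z : LinearMap.ker (cobD p I K)) :
    CobRel hp z.1 (cobClass I K hp z) := (exists_cobRel hp z.1 z.2).choose_spec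

end Action

/-! ### Bases of `S(n,k)` -/

section MonomialBasis

variable (p n k : ℕ)

/-- The indices of the generators `t_s^{p^j}`. -/
abbrev GIdx (n k : ℕ) : Type := Idx k × ZMod n

/-- The exponent `∑_j e(s,j) p^j` of `t_s` in the monomial with exponents `e`. -/
def toExpo : (GIdx n k →₀ ℕ) →+ Expo k :=
  Finsupp.liftAddHom fun a =>
    (Finsupp.singleAddHom a.1).comp (AddMonoidHom.mulRight (p ^ a.2.val))

variable {p n k}

theorem toExpo_single (a : GIdx n k) (m : ℕ) :
    toExpo p n k (Finsupp.single a m) = Finsupp.single a.1 (m * p ^ a.2.val) := by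
  simp [toExpo]

theorem toExpo_apply [NeZero n] (e : GIdx n k →₀ ℕ) (s : Idx k) :
    toExpo p n k e s = ∑ j : ZMod n, e (s, j) * p ^ j.val := by
  induction e using Finsupp.induction_linear with
  | zero => simp
  | add f g hf hg =>
    rw [map_add, Finsupp.add_apply, hf, hg, ← Finset.sum_add_distrib]
    exact Finset.sum_congr rfl fun j _ => by rw [Finsupp.add_apply, add_mul]
  | single a m =>
    obtain ⟨s', j'⟩ := a
    rw [toExpo_single]
    by_cases h : s' = s
    · subst h
      rw [Finsupp.single_eq_same, Finset.sum_eq_single j']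
      · simp
      · intro j _ hj
        rw [Finsupp.single_eq_of_ne (by simpa using hj), zero_mul]
      · simp
    · rw [Finsupp.single_eq_of_ne (fun h' => h h'.symm), eq_comm]
      refine Finset.sum_eq_zero fun j _ => ?_
      rw [Finsupp.single_eq_of_ne (by
        intro h'; exact h (Prod.ext_iff.mp h').1.symm), zero_mul]

theorem sum_digits_div_mod (hp : 1 < p) (d : ℕ → ℕ) (hd : ∀ i, d i < p) (n i : ℕ) (hi : i < n) :
    ((∑ j ∈ Finset.range n, d j * p ^ j) / p ^ i) % p = d i := by
  induction n generalizing d i with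
  | zero => omega
  | succ n ih =>
    have h1 : ∑ j ∈ Finset.range (n + 1), d j * p ^ j =
        d 0 + p * ∑ j ∈ Finset.range n, d (j + 1) * p ^ j := by
      rw [Finset.sum_range_succ', Finset.mul_sum, pow_zero, mul_one, add_comm]
      congr 1
      exact Finset.sum_congr rfl fun j _ => by ring
    rw [h1]
    cases i with
    | zero =>
      rw [pow_zero, Nat.div_one, Nat.add_mul_mod_self_left, Nat.mod_eq_of_lt (hd 0)]
    | succ i =>
      rw [pow_succ', ← Nat.div_div_eq_div_mul, Nat.add_mul_div_left _ _ (by omega),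
        Nat.div_eq_of_lt (hd 0), zero_add]
      exact ih (fun j => d (j + 1)) (fun j => hd _) i (by omega)

theorem sum_digits_lt (hp : 1 < p) (d : ℕ → ℕ) (hd : ∀ i, d i < p) (n : ℕ) :
    ∑ j ∈ Finset.range n, d j * p ^ j < p ^ n := by
  induction n with
  | zero => simp
  | succ n ih =>
    rw [Finset.sum_range_succ, pow_succ']
    have : d n * p ^ n ≤ (p - 1) * p ^ n := Nat.mul_le_mul_right _ (by have := hd n; omega)
    have h2 : (p - 1) * p ^ n + p ^ n = p * p ^ n := by
      rw [← Nat.succ_mul]; congr 1; omega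
    omega

theorem sum_zmod_eq [NeZero n] (F : ℕ → ℕ) :
    ∑ j : ZMod n, F j.val = ∑ i ∈ Finset.range n, F i := by
  refine Finset.sum_nbij' (fun j => j.val) (fun i => (i : ZMod n)) ?_ ?_ ?_ ?_ ?_
  · intro j _; simpa using ZMod.val_lt j
  · intro i _; simp
  · intro j _; simp
  · intro i hi; exact ZMod.val_cast_of_lt (by simpa using hi)
  · intro j _; rfl

theorem toExpo_eq_sum_range [NeZero n] (e : GIdx n k →₀ ℕ) (s : Idx k) :
    toExpo p n k e s = ∑ i ∈ Finset.range n, e (s, (i : ZMod n)) * p ^ i := by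
  rw [toExpo_apply, ← sum_zmod_eq (fun i => e (s, (i : ZMod n)) * p ^ i)]
  exact Finset.sum_congr rfl fun j _ => by simp

variable (p n) in
/-- The exponent between `1` and `p^n - 1` (or zero, for the exponent zero) that gives the same
power of a generator of `S(n,k)`. -/
def redExp (a : ℕ) : ℕ := if a = 0 then 0 else (a - 1) % (p ^ n - 1) + 1

theorem redExp_of_lt {a : ℕ} (ha : a < p ^ n) : redExp p n a = a := by
  unfold redExp
  split_ifs with h
  · exact h.symm
  · rw [Nat.mod_eq_of_lt (by omega)]; omega

theorem redExp_add (hq : 1 < p ^ n) (a : ℕ) : redExp p n (a + p ^ n) = redExp p n (a + 1) := by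
  unfold redExp
  rw [if_neg (by omega), if_neg (by omega), Nat.add_sub_cancel,
    show a + p ^ n - 1 = a + (p ^ n - 1) by omega, Nat.add_mod_right]

variable [hp : Fact p.Prime] [NeZero n] [NeZero k]

theorem one_lt_q : 1 < p ^ n := Nat.one_lt_pow (NeZero.ne n) hp.out.one_lt

variable (p n k) in
/-- The base-`p` digits of the reduced exponents of a monomial. -/
def digitFn (f : Expo k) (a : GIdx n k) : ℕ := (redExp p n (f a.1) / p ^ a.2.val) % p

variable (p n k) in
/-- The normal form of a polynomial, as a combination of reduced exponents. -/
def normalForm : MvPolynomial (Idx k) (ZMod p) →ₗ[ZMod p] ((GIdx n k → ℕ) →₀ ZMod p) :=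
  (MvPolynomial.basisMonomials (Idx k) (ZMod p)).constr (ZMod p) fun f =>
    Finsupp.single (digitFn p n k f) 1

theorem normalForm_monomial (f : Expo k) :
    normalForm p n k (MvPolynomial.monomial f 1) = Finsupp.single (digitFn p n k f) 1 := by
  have := (MvPolynomial.basisMonomials (Idx k) (ZMod p)).constr_basis (ZMod p)
    (fun f => Finsupp.single (digitFn p n k f) (1 : ZMod p)) f
  rwa [MvPolynomial.coe_basisMonomials] at this

theorem digitFn_add (f : Expo k) (s : Idx k) :
    digitFn p n k (f + Finsupp.single s (p ^ n)) = digitFn p n k (f + Finsupp.single s 1) := by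
  funext a
  unfold digitFn
  by_cases h : a.1 = s
  · rw [Finsupp.add_apply, Finsupp.add_apply, h, Finsupp.single_eq_same, Finsupp.single_eq_same,
      redExp_add one_lt_q]
  · rw [Finsupp.add_apply, Finsupp.add_apply, Finsupp.single_eq_of_ne h,
      Finsupp.single_eq_of_ne h]

theorem normalForm_mul_relation (f : MvPolynomial (Idx k) (ZMod p)) (s : Idx k) :
    normalForm p n k (f * (MvPolynomial.X s ^ p ^ n - MvPolynomial.X s)) = 0 := by
  have h : (normalForm p n k) ∘ₗ
      (LinearMap.mulRight (ZMod p) (MvPolynomial.X s ^ p ^ n - MvPolynomial.X s)) = 0 := by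
    refine (MvPolynomial.basisMonomials (Idx k) (ZMod p)).ext fun e => ?_
    rw [MvPolynomial.coe_basisMonomials, LinearMap.comp_apply, LinearMap.mulRight_apply, mul_sub,
      MvPolynomial.X_pow_eq_monomial, MvPolynomial.X, MvPolynomial.monomial_mul,
      MvPolynomial.monomial_mul, one_mul, map_sub, normalForm_monomial, normalForm_monomial,
      digitFn_add, sub_self, LinearMap.zero_apply]
  exact LinearMap.congr_fun h f

/-- The normal form is well defined on `S(n,k)`. -/
theorem normalForm_eq_zero {x : MvPolynomial (Idx k) (ZMod p)} (hx : mkHom p n k x = 0) :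
    normalForm p n k x = 0 := by
  have hx' : x ∈ Ideal.span (Set.range fun s : Idx k =>
      (MvPolynomial.X s ^ p ^ n - MvPolynomial.X s : MvPolynomial (Idx k) (ZMod p))) :=
    Ideal.Quotient.eq_zero_iff_mem.mp hx
  suffices h : ∀ y, normalForm p n k (y * x) = 0 by simpa using h 1
  clear hx
  induction hx' using Submodule.span_induction with
  | mem x hx =>
    obtain ⟨s, rfl⟩ := hx
    exact fun y => normalForm_mul_relation y s
  | zero => simp
  | add x x' _ _ h h' => intro y; rw [mul_add, map_add, h, h', add_zero]
  | smul c x _ h => intro y; rw [smul_eq_mul, ← mul_assoc]; exact h _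

variable (p n k) in
/-- The monomial `∏ t_s^{e(s,j) p^j}`. -/
def gmono (e : GIdx n k →₀ ℕ) : MoravaAlg p n k := mono p n k (toExpo p n k e)

theorem gmono_add (e f : GIdx n k →₀ ℕ) :
    gmono p n k (e + f) = gmono p n k e * gmono p n k f := by
  rw [gmono, map_add, mono_add, gmono, gmono]

theorem gmono_zero : gmono p n k 0 = 1 := by simp [gmono, mono]

theorem gmono_single (a : GIdx n k) (m : ℕ) :
    gmono p n k (Finsupp.single a m) = genPow p n k a ^ m := by
  rw [gmono, toExpo_single, mono, genPow, ← pow_mul, mul_comm]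
  exact Finsupp.prod_single_index (pow_zero _)

theorem mono_eq_mkHom (f : Expo k) : mono p n k f = mkHom p n k (MvPolynomial.monomial f 1) := by
  rw [MvPolynomial.monomial_eq, map_mul, map_one, map_one, one_mul, Finsupp.prod, map_prod]
  exact Finset.prod_congr rfl fun s _ => by rw [map_pow]; rfl

theorem digitFn_toExpo (e : Red p (GIdx n k)) : digitFn p n k (toExpo p n k e.1) = e.1 := by
  funext a
  obtain ⟨s, j⟩ := a
  have h1 : toExpo p n k e.1 s < p ^ n := by
    rw [toExpo_eq_sum_range]
    exact sum_digits_lt hp.out.one_lt (fun i => e.1 (s, (i : ZMod n))) (fun i => e.2 _) n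
  rw [digitFn, redExp_of_lt h1, toExpo_eq_sum_range,
    sum_digits_div_mod hp.out.one_lt (fun i => e.1 (s, (i : ZMod n))) (fun i => e.2 _) n _
      (ZMod.val_lt j)]
  simp

theorem linearIndependent_gmono :
    LinearIndependent (ZMod p) fun e : Red p (GIdx n k) => gmono p n k e.1 := by
  have h1 : LinearIndependent (ZMod p) fun e : Red p (GIdx n k) =>
      (Finsupp.single (e.1 : GIdx n k → ℕ) 1 : (GIdx n k → ℕ) →₀ ZMod p) := by
    have h2 := Finsupp.linearIndependent_single_one (ZMod p) (GIdx n k → ℕ)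
    exact h2.comp (fun e : Red p (GIdx n k) => (e.1 : GIdx n k → ℕ))
      (fun e f h => Subtype.ext (DFunLike.coe_injective h))
  rw [linearIndependent_iff] at h1 ⊢
  intro l hl
  apply h1
  have h3 : mkHom p n k (Finsupp.linearCombination (ZMod p)
      (fun e : Red p (GIdx n k) => (MvPolynomial.monomial (toExpo p n k e.1) (1 : ZMod p) :
        MvPolynomial (Idx k) (ZMod p))) l) = 0 := by
    rw [← hl, ← AlgHom.coe_toLinearMap, Finsupp.apply_linearCombination]
    congr 2
    funext e
    exact (mono_eq_mkHom _).symm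
  have h4 := normalForm_eq_zero h3
  rw [Finsupp.apply_linearCombination] at h4
  rw [← h4]
  congr 2
  funext e
  rw [Function.comp_apply, normalForm_monomial, digitFn_toExpo]

variable (p n k) in
/-- The internal degree of the monomial with exponents `e`. -/
def eDeg : (GIdx n k →₀ ℕ) →+ IDeg p n :=
  Finsupp.liftAddHom fun a => multiplesHom _ (hDeg p n k a)

variable (p n k) in
/-- The weight `∑ e(s,j) M(t_s)` of the exponent `e`. -/
def eWt : (GIdx n k →₀ ℕ) →+ ℕ :=
  Finsupp.liftAddHom fun a => AddMonoidHom.mulRight (genWt p n k a.1)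

theorem eDeg_single (a : GIdx n k) (m : ℕ) :
    eDeg p n k (Finsupp.single a m) = m • hDeg p n k a := by simp [eDeg]

theorem eWt_single (a : GIdx n k) (m : ℕ) :
    eWt p n k (Finsupp.single a m) = m * genWt p n k a.1 := by simp [eWt]

theorem expDeg_single (s : Idx k) (m : ℕ) :
    expDeg p n k (Finsupp.single s m) = ((m * (2 * (p ^ s.1 - 1)) : ℕ) : IDeg p n) :=
  Finsupp.sum_single_index (by simp)

theorem expWt_single (s : Idx k) (m : ℕ) :
    expWt p n k (Finsupp.single s m) = (p.digits m).sum * genWt p n k s :=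
  Finsupp.sum_single_index (by simp)

theorem digits_sum_mul_pow (m j : ℕ) (hm : m < p) : (p.digits (m * p ^ j)).sum = m := by
  rcases Nat.eq_zero_or_pos m with rfl | h0
  · simp
  · rw [mul_comm, Nat.digits_base_pow_mul hp.out.one_lt h0, Nat.digits_of_lt p m h0.ne' hm]
    simp

theorem expDeg_toExpo (e : GIdx n k →₀ ℕ) : expDeg p n k (toExpo p n k e) = eDeg p n k e := by
  induction e using Finsupp.induction_linear with
  | zero => simp [expDeg]
  | add f g hf hg => rw [map_add, expDeg_add, hf, hg, map_add]
  | single a m =>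
    rw [toExpo_single, expDeg_single, eDeg_single, hDeg, nsmul_eq_mul]
    push_cast
    ring

theorem expWt_toExpo_le (e : GIdx n k →₀ ℕ) :
    expWt p n k (toExpo p n k e) ≤ eWt p n k e := by
  induction e using Finsupp.induction_linear with
  | zero => simp [expWt]
  | add f g hf hg =>
    rw [map_add, map_add]
    exact (expWt_add_le _ _).trans (add_le_add hf hg)
  | single a m =>
    rw [toExpo_single, expWt_single, eWt_single]
    refine Nat.mul_le_mul_right _ ?_
    induction m with
    | zero => simp
    | succ m ih =>
      rw [add_mul, one_mul]
      refine (digits_sum_add_le p _ _).trans (add_le_add ih ?_)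
      have := digits_sum_mul_pow (p := p) 1 a.2.val hp.out.one_lt
      rw [one_mul] at this
      exact this.le

variable (n k) in
/-- The shift `t_s^{p^j} ↦ t_s^{p^{j+1}}` of the generators. -/
def shift (a : GIdx n k) : GIdx n k := (a.1, a.2 + 1)

theorem val_add_one {j : ZMod n} (h : j.val + 1 < n) : (j + 1).val = j.val + 1 := by
  have : j + 1 = ((j.val + 1 : ℕ) : ZMod n) := by simp
  rw [this, ZMod.val_cast_of_lt h]

theorem frob_congr {R : Type*} [Monoid R] {x : R} (hx : x ^ p ^ n = x) (j : ZMod n) :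
    x ^ p ^ (j + 1).val = (x ^ p ^ j.val) ^ p := by
  rw [← pow_mul, ← pow_succ]
  by_cases h : j.val + 1 < n
  · rw [val_add_one h]
  · have h1 : j.val + 1 = n := by have := ZMod.val_lt j; omega
    have h2 : j + 1 = 0 := by
      have : ((j.val + 1 : ℕ) : ZMod n) = 0 := by rw [h1]; simp
      simpa using this
    rw [h1, h2, hx, ZMod.val_zero, pow_zero, pow_one]

theorem genPow_shift (a : GIdx n k) : genPow p n k (shift n k a) = genPow p n k a ^ p :=
  frob_congr (gen_pow a.1) a.2

theorem hDeg_shift (a : GIdx n k) : hDeg p n k (shift n k a) = p • hDeg p n k a := by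
  have hq := one_lt_q (p := p) (n := n)
  have key : ∀ m : ℕ, ((2 * m * p ^ n : ℕ) : IDeg p n) = ((2 * m : ℕ) : IDeg p n) := by
    intro m
    have : 2 * m * p ^ n = 2 * m + m * (2 * (p ^ n - 1)) := by
      zify [hq.le]; ring
    rw [this, Nat.cast_add, Nat.cast_mul m, ZMod.natCast_self, mul_zero, add_zero]
  rw [hDeg, hDeg, shift, nsmul_eq_mul, ← Nat.cast_mul]
  by_cases h : a.2.val + 1 < n
  · rw [val_add_one h]; congr 1; ring
  · have h1 : a.2.val + 1 = n := by have := ZMod.val_lt a.2; omega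
    have h2 : a.2 + 1 = 0 := by
      have : ((a.2.val + 1 : ℕ) : ZMod n) = 0 := by rw [h1]; simp
      simpa using this
    have h3 : p * (2 * (p ^ a.1.1 - 1) * p ^ a.2.val) = 2 * (p ^ a.1.1 - 1) * p ^ n := by
      have : p ^ n = p ^ a.2.val * p := by rw [← pow_succ, h1]
      rw [this]; ring
    rw [h3, key, h2, ZMod.val_zero, pow_zero, mul_one]

/-- If some exponent is at least `p`, the rule `(t_s^{p^j})^p = t_s^{p^{j+1}}` gives the same
monomial with a smaller sum of exponents. -/
theorem exists_red_gmono (e : GIdx n k →₀ ℕ) : ∃ e' : Red p (GIdx n k),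
    gmono p n k e'.1 = gmono p n k e ∧ eDeg p n k e'.1 = eDeg p n k e ∧
      eWt p n k e'.1 ≤ eWt p n k e ∧ (e ≠ 0 → e'.1 ≠ 0) := by
  induction hN : e.degree using Nat.strong_induction_on generalizing e with
  | _ N ih =>
    by_cases h : ∀ a, e a < p
    · exact ⟨⟨e, h⟩, rfl, rfl, le_rfl, id⟩
    · push Not at h
      obtain ⟨a, ha⟩ := h
      obtain ⟨f, rfl⟩ : ∃ f, e = Finsupp.single a p + f :=
        exists_add_of_le (Finsupp.single_le_iff.mpr ha)
      have hp1 := hp.out.one_lt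
      obtain ⟨e', h1, h2, h3, h4⟩ := ih (Finsupp.single (shift n k a) 1 + f).degree (by
        rw [← hN, map_add, map_add, Finsupp.degree_single, Finsupp.degree_single]; omega) _ rfl
      refine ⟨e', ?_, ?_, h3.trans ?_, fun _ => h4 ?_⟩
      · rw [h1, gmono_add, gmono_add, gmono_single, gmono_single, genPow_shift, pow_one]
      · rw [h2, map_add, map_add, eDeg_single, eDeg_single, hDeg_shift, one_smul]
      · rw [map_add, map_add, eWt_single, eWt_single]
        exact Nat.add_le_add_right (Nat.mul_le_mul_right _ hp1.le) _
      · intro h0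
        have := DFunLike.congr_fun h0 (shift n k a)
        rw [Finsupp.add_apply, Finsupp.single_eq_same, Finsupp.zero_apply] at this
        omega

theorem exists_gmono_single (s : Idx k) (m : ℕ) : ∃ e : GIdx n k →₀ ℕ,
    gmono p n k e = gen p n k s ^ m ∧ eDeg p n k e = ((m * (2 * (p ^ s.1 - 1)) : ℕ) : IDeg p n) ∧
      eWt p n k e = (p.digits m).sum * genWt p n k s ∧ (m ≠ 0 → e ≠ 0) := by
  have hp1 := hp.out.one_lt
  have hinj : Function.Injective (shift n k) := fun a b h => by
    simpa [shift, Prod.ext_iff] using h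
  induction m using Nat.strong_induction_on with
  | _ m ih =>
    rcases Nat.eq_zero_or_pos m with rfl | hm
    · exact ⟨0, by simp [gmono_zero], by simp, by simp, by simp⟩
    · obtain ⟨e, h1, h2, h3, h4⟩ := ih (m / p) (Nat.div_lt_self hm hp1)
      have hsh : ∀ e : GIdx n k →₀ ℕ, gmono p n k (e.mapDomain (shift n k)) = gmono p n k e ^ p ∧
          eDeg p n k (e.mapDomain (shift n k)) = p • eDeg p n k e ∧
          eWt p n k (e.mapDomain (shift n k)) = eWt p n k e := by
        intro e
        induction e using Finsupp.induction_linear with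
        | zero => simp [gmono_zero]
        | add f g hf hg =>
          rw [Finsupp.mapDomain_add, gmono_add, gmono_add, map_add, map_add, map_add, map_add,
            hf.1, hf.2.1, hf.2.2, hg.1, hg.2.1, hg.2.2, mul_pow, smul_add]
          exact ⟨rfl, rfl, rfl⟩
        | single a m =>
          rw [Finsupp.mapDomain_single, gmono_single, gmono_single, eDeg_single, eDeg_single,
            eWt_single, eWt_single, genPow_shift, hDeg_shift]
          exact ⟨by rw [← pow_mul, ← pow_mul, mul_comm], smul_comm _ _ _, rfl⟩
      obtain ⟨g1, g2, g3⟩ := hsh e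
      have hdm := Nat.mod_add_div m p
      refine ⟨Finsupp.single (s, 0) (m % p) + e.mapDomain (shift n k), ?_, ?_, ?_, ?_⟩
      · rw [gmono_add, g1, h1, gmono_single, genPow, ZMod.val_zero, pow_zero, pow_one, ← pow_mul,
          ← pow_add, mul_comm (m / p), hdm]
      · rw [map_add, g2, h2, eDeg_single, hDeg, ZMod.val_zero, pow_zero, mul_one, nsmul_eq_mul,
          nsmul_eq_mul, ← Nat.cast_mul, ← Nat.cast_mul, ← Nat.cast_add]
        congr 1
        conv_rhs => rw [← hdm]
        ring
      · rw [map_add, g3, h3, eWt_single, Nat.digits_def' hp1 hm, List.sum_cons, add_mul]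
      · intro _ h0
        rw [add_eq_zero] at h0
        have hmod : m % p = 0 := by simpa using h0.1
        have he : e = 0 := Finsupp.mapDomain_injective hinj (by rw [h0.2, Finsupp.mapDomain_zero])
        refine h4 ?_ he
        intro h
        rw [h, hmod] at hdm
        omega

theorem exists_gmono (f : Expo k) : ∃ e : GIdx n k →₀ ℕ,
    gmono p n k e = mono p n k f ∧ eDeg p n k e = expDeg p n k f ∧
      eWt p n k e = expWt p n k f ∧ (f ≠ 0 → e ≠ 0) := by
  induction f using Finsupp.induction with
  | zero => exact ⟨0, by simp [gmono_zero, mono], by simp [expDeg], by simp [expWt], by simp⟩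
  | single_add s m f hs hm ih =>
    obtain ⟨e, h1, h2, h3, -⟩ := ih
    obtain ⟨e', h1', h2', h3', h4'⟩ := exists_gmono_single (p := p) (n := n) s m
    refine ⟨e' + e, ?_, ?_, ?_, fun _ h0 => h4' hm (add_eq_zero.mp h0).1⟩
    · rw [gmono_add, h1, h1', mono_add]
      congr 1
      exact (Finsupp.prod_single_index (h := fun s a => gen p n k s ^ a) (pow_zero _)).symm
    · rw [map_add, h2, h2', expDeg_add, expDeg_single]
    · rw [map_add, h3, h3', ← expWt_single]
      refine (Finsupp.sum_add_index_of_disjoint ?_ _).symm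
      rw [Finset.disjoint_left]
      intro a ha
      have := Finsupp.support_single_subset ha
      rw [Finset.mem_singleton] at this
      rwa [this]

/-- A monomial is equal to a monomial in the `t_s^{p^j}` with exponents less than `p`, of the same
degree and of at most the same filtration. -/
theorem exists_red (f : Expo k) : ∃ e : Red p (GIdx n k),
    gmono p n k e.1 = mono p n k f ∧ eDeg p n k e.1 = expDeg p n k f ∧
      eWt p n k e.1 ≤ expWt p n k f ∧ (f ≠ 0 → e.1 ≠ 0) := by
  obtain ⟨e, h1, h2, h3, h4⟩ := exists_gmono (p := p) (n := n) f
  obtain ⟨e', g1, g2, g3, g4⟩ := exists_red_gmono (p := p) e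
  exact ⟨e', g1.trans h1, g2.trans h2, g3.trans h3.le, fun h => g4 (h4 h)⟩

variable (p n k) in
/-- The divided monomial `∏ (t_s^{p^j})^{e(s,j)} / e(s,j)!`; it is zero if some exponent is
at least `p`. -/
def divMono (e : GIdx n k →₀ ℕ) : MoravaAlg p n k :=
  (e.prod fun _ m => ((m.factorial : ℕ) : ZMod p))⁻¹ • gmono p n k e

theorem factorial_ne_zero_of_lt {m : ℕ} (h : m < p) : ((m.factorial : ℕ) : ZMod p) ≠ 0 := by
  rw [Ne, ZMod.natCast_eq_zero_iff, hp.out.dvd_factorial]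
  omega

theorem prod_factorial_ne_zero (e : Red p (GIdx n k)) :
    (e.1.prod fun _ m => ((m.factorial : ℕ) : ZMod p)) ≠ 0 :=
  Finset.prod_ne_zero_iff.mpr fun a _ => factorial_ne_zero_of_lt (e.2 a)

theorem divMono_eq_zero {e : GIdx n k →₀ ℕ} (he : ¬ ∀ a, e a < p) : divMono p n k e = 0 := by
  push Not at he
  obtain ⟨a, ha⟩ := he
  have : (e.prod fun _ m => ((m.factorial : ℕ) : ZMod p)) = 0 := by
    refine Finset.prod_eq_zero (i := a) ?_ ?_
    · rw [Finsupp.mem_support_iff]; have := hp.out.pos; omega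
    · exact (ZMod.natCast_eq_zero_iff _ _).mpr (hp.out.dvd_factorial.mpr ha)
  rw [divMono, this, inv_zero, zero_smul]

theorem divMono_zero : divMono p n k 0 = 1 := by
  simp [divMono, gmono_zero]

theorem divMono_single (a : GIdx n k) (m : ℕ) :
    divMono p n k (Finsupp.single a m) =
      ((m.factorial : ℕ) : ZMod p)⁻¹ • genPow p n k a ^ m := by
  rw [divMono, gmono_single]
  congr 2
  exact Finsupp.prod_single_index (by simp)

theorem gmono_eq_smul (e : Red p (GIdx n k)) : gmono p n k e.1 =
    (e.1.prod fun _ m => ((m.factorial : ℕ) : ZMod p)) • divMono p n k e.1 := by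
  rw [divMono, smul_smul, mul_inv_cancel₀ (prod_factorial_ne_zero e), one_smul]

theorem linearIndependent_divMono :
    LinearIndependent (ZMod p) fun e : Red p (GIdx n k) => divMono p n k e.1 := by
  have := (linearIndependent_gmono (p := p) (n := n) (k := k)).units_smul
    fun e => (Units.mk0 _ (prod_factorial_ne_zero e))⁻¹
  convert this using 1
  funext e
  rw [Pi.smul_apply', Units.smul_def]
  simp [divMono]

theorem mem_span_divMono {t : IDeg p n} {M : ℤ} (f : Expo k) (h1 : expDeg p n k f = t)
    (h2 : (expWt p n k f : ℤ) ≤ M) : mono p n k f ∈ Submodule.span (ZMod p)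
      {x | ∃ e : Red p (GIdx n k), eDeg p n k e.1 = t ∧ (eWt p n k e.1 : ℤ) ≤ M ∧
        divMono p n k e.1 = x} := by
  obtain ⟨e, g1, g2, g3, -⟩ := exists_red (p := p) (n := n) f
  rw [← g1, gmono_eq_smul]
  exact Submodule.smul_mem _ _ (Submodule.subset_span ⟨e, g2.trans h1, by omega, rfl⟩)

theorem gmono_mem_filt {t : IDeg p n} {M : ℤ} (e : GIdx n k →₀ ℕ) (h1 : eDeg p n k e = t)
    (h2 : (eWt p n k e : ℤ) ≤ M) : gmono p n k e ∈ filt p n k t M :=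
  Submodule.subset_span ⟨toExpo p n k e, by rw [expDeg_toExpo, h1],
    by have := expWt_toExpo_le (p := p) e; omega, rfl⟩

theorem divMono_mem_filt {t : IDeg p n} {M : ℤ} (e : GIdx n k →₀ ℕ) (h1 : eDeg p n k e = t)
    (h2 : (eWt p n k e : ℤ) ≤ M) : divMono p n k e ∈ filt p n k t M :=
  Submodule.smul_mem _ _ (gmono_mem_filt e h1 h2)

/-- The filtration is spanned by divided monomials. -/
theorem filt_eq_span (t : IDeg p n) (M : ℤ) : filt p n k t M = Submodule.span (ZMod p)
      {x | ∃ e : Red p (GIdx n k), eDeg p n k e.1 = t ∧ (eWt p n k e.1 : ℤ) ≤ M ∧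
        divMono p n k e.1 = x} := by
  refine le_antisymm (Submodule.span_le.mpr ?_) (Submodule.span_le.mpr ?_)
  · rintro _ ⟨f, h1, h2, rfl⟩
    exact mem_span_divMono f h1 h2
  · rintro _ ⟨e, h1, h2, rfl⟩
    exact divMono_mem_filt e.1 h1 h2

theorem span_divMono :
    ⊤ ≤ Submodule.span (ZMod p) (Set.range fun e : Red p (GIdx n k) => divMono p n k e.1) := by
  rintro x -
  obtain ⟨f, rfl⟩ : ∃ f, mkHom p n k f = x := Ideal.Quotient.mk_surjective x
  rw [← Module.Basis.linearCombination_repr (MvPolynomial.basisMonomials (Idx k) (ZMod p)) f,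
    ← AlgHom.coe_toLinearMap, Finsupp.apply_linearCombination, Finsupp.linearCombination_apply]
  refine Submodule.sum_mem _ fun e _ => Submodule.smul_mem _ _ ?_
  rw [Function.comp_apply, MvPolynomial.coe_basisMonomials, AlgHom.coe_toLinearMap,
    ← mono_eq_mkHom]
  refine Submodule.span_mono ?_ (mem_span_divMono e rfl le_rfl)
  rintro _ ⟨e, -, -, rfl⟩
  exact ⟨e, rfl⟩

variable (p n k) in
/-- The basis of `S(n,k)` consisting of the divided monomials. -/
def divBasis : Module.Basis (Red p (GIdx n k)) (ZMod p) (MoravaAlg p n k) :=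
  Module.Basis.mk linearIndependent_divMono span_divMono

theorem divBasis_apply (e : Red p (GIdx n k)) : divBasis p n k e = divMono p n k e.1 :=
  Module.Basis.mk_apply _ _ _

end MonomialBasis

/-! ### Weighted homogeneity of the carries in Witt vector addition -/

section WittAddition

variable (p : ℕ) [hp : Fact p.Prime]

/-- The polynomials in the variables `(b, i)` with `i < m` that are isobaric of weight `p^j`, where
`(b, i)` has weight `p^i`. -/
def isobaric (m j : ℕ) : Submodule ℤ (MvPolynomial (Fin 2 × ℕ) ℤ) :=
  MvPolynomial.weightedHomogeneousSubmodule ℤ (fun v : Fin 2 × ℕ => p ^ v.2) (p ^ j) ⊓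
    Subalgebra.toSubmodule (MvPolynomial.supported ℤ {v : Fin 2 × ℕ | v.2 < m})

variable {p}

theorem X_mem_isobaric {m i : ℕ} (b : Fin 2) (hi : i < m) :
    MvPolynomial.X (b, i) ∈ isobaric p m i :=
  ⟨MvPolynomial.isWeightedHomogeneous_X ℤ (fun v : Fin 2 × ℕ => p ^ v.2) (b, i),
    MvPolynomial.X_mem_supported.mpr hi⟩

theorem pow_mem_isobaric {m i j : ℕ} {f : MvPolynomial (Fin 2 × ℕ) ℤ} (hf : f ∈ isobaric p m i)
    (hij : i ≤ j) : f ^ p ^ (j - i) ∈ isobaric p m j := by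
  refine ⟨?_, Subalgebra.pow_mem _ hf.2 _⟩
  have := MvPolynomial.IsWeightedHomogeneous.pow hf.1 (p ^ (j - i))
  rw [smul_eq_mul, ← pow_add, Nat.sub_add_cancel hij] at this
  exact this

theorem C_mul_mem_isobaric {m j : ℕ} (c : ℤ) {f : MvPolynomial (Fin 2 × ℕ) ℤ}
    (hf : f ∈ isobaric p m j) : MvPolynomial.C c * f ∈ isobaric p m j := by
  rw [← MvPolynomial.smul_eq_C_mul]
  exact Submodule.smul_mem _ _ hf

theorem isobaric_mono {m m' j : ℕ} (h : m ≤ m') : isobaric p m j ≤ isobaric p m' j :=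
  fun _ hf => ⟨hf.1, MvPolynomial.supported_mono (fun _ hv => lt_of_lt_of_le hv h) hf.2⟩

theorem mem_isobaric_of_C_mul {m j : ℕ} {c : ℤ} (hc : c ≠ 0) {f : MvPolynomial (Fin 2 × ℕ) ℤ}
    (hf : MvPolynomial.C c * f ∈ isobaric p m j) : f ∈ isobaric p m j := by
  have hs : (MvPolynomial.C c * f).support = f.support := by
    ext d
    rw [MvPolynomial.mem_support_iff, MvPolynomial.mem_support_iff, MvPolynomial.coeff_C_mul]
    simp [hc]
  refine ⟨fun d hd => hf.1 (d := d) ?_, ?_⟩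
  · rw [MvPolynomial.coeff_C_mul]; exact mul_ne_zero hc hd
  · have h2 : ((MvPolynomial.C c * f).vars : Set (Fin 2 × ℕ)) ⊆ {v | v.2 < m} :=
      MvPolynomial.mem_supported.mp hf.2
    refine MvPolynomial.mem_supported.mpr fun v hv => h2 ?_
    rw [Finset.mem_coe, MvPolynomial.mem_vars_iff_mem_support] at hv ⊢
    rwa [hs]

/-- Modulo the sum of the two variables of index `m`, the `m`-th Witt addition polynomial is an
isobaric polynomial in the variables of smaller index. -/
theorem wittAdd_sub_mem (m : ℕ) : WittVector.wittAdd p m -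
    (MvPolynomial.X (0, m) + MvPolynomial.X (1, m)) ∈ isobaric p m m := by
  induction m using Nat.strong_induction_on with
  | _ m ih =>
    have h := wittStructureInt_prop p
      (MvPolynomial.X 0 + MvPolynomial.X 1 : MvPolynomial (Fin 2) ℤ) m
    rw [map_add, MvPolynomial.bind₁_X_right, MvPolynomial.bind₁_X_right,
      wittPolynomial_eq_sum_C_mul_X_pow, map_sum, map_sum, map_sum] at h
    simp only [map_mul, map_pow, MvPolynomial.bind₁_X_right, MvPolynomial.rename_X,
      MvPolynomial.rename_C, MvPolynomial.bind₁_C_right, Finset.sum_range_succ, Nat.sub_self,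
      pow_zero, pow_one] at h
    rw [← WittVector.wittAdd] at h
    refine mem_isobaric_of_C_mul (c := (p : ℤ) ^ m)
      (pow_ne_zero _ (by exact_mod_cast hp.out.ne_zero)) ?_
    have e : MvPolynomial.C ((p : ℤ) ^ m) * (WittVector.wittAdd p m -
        (MvPolynomial.X (0, m) + MvPolynomial.X (1, m))) =
        ∑ i ∈ Finset.range m, (MvPolynomial.C ((p : ℤ) ^ i) *
            MvPolynomial.X ((0 : Fin 2), i) ^ p ^ (m - i) +
          MvPolynomial.C ((p : ℤ) ^ i) * MvPolynomial.X ((1 : Fin 2), i) ^ p ^ (m - i) -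
          MvPolynomial.C ((p : ℤ) ^ i) * WittVector.wittAdd p i ^ p ^ (m - i)) := by
      rw [Finset.sum_sub_distrib, Finset.sum_add_distrib]
      simp only [map_pow] at h ⊢
      linear_combination h
    rw [e]
    refine Submodule.sum_mem _ fun i hi => ?_
    have hi := Finset.mem_range.mp hi
    refine Submodule.sub_mem _ (Submodule.add_mem _ ?_ ?_) ?_
    · exact C_mul_mem_isobaric _ (pow_mem_isobaric (X_mem_isobaric _ hi) hi.le)
    · exact C_mul_mem_isobaric _ (pow_mem_isobaric (X_mem_isobaric _ hi) hi.le)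
    · refine C_mul_mem_isobaric _ (pow_mem_isobaric ?_ hi.le)
      have := Submodule.add_mem _ (isobaric_mono hi.le (ih i hi)) (Submodule.add_mem _
        (X_mem_isobaric (p := p) 0 hi) (X_mem_isobaric (p := p) 1 hi))
      rwa [sub_add_cancel] at this

variable {A D K : Type*} [CommRing A] [AddCommMonoid D] [CommRing K] [Algebra K A]
  {F : D → ℕ → Submodule K A}

theorem pow_mem_filtration (h1 : (1 : A) ∈ F 0 0)
    (hmul : ∀ t t' M M' x y, x ∈ F t M → y ∈ F t' M' → x * y ∈ F (t + t') (M + M'))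
    {t : D} {M : ℕ} {x : A} (hx : x ∈ F t M) (m : ℕ) : x ^ m ∈ F (m • t) (m * M) := by
  induction m with
  | zero => simpa using h1
  | succ m ih =>
    rw [pow_succ, succ_nsmul, add_mul, one_mul]
    exact hmul _ _ _ _ _ _ ih hx

theorem prod_mem_filtration (h1 : (1 : A) ∈ F 0 0)
    (hmul : ∀ t t' M M' x y, x ∈ F t M → y ∈ F t' M' → x * y ∈ F (t + t') (M + M'))
    {ι : Type*} (s : Finset ι) {t : ι → D} {M : ι → ℕ} {x : ι → A}
    (hx : ∀ i ∈ s, x i ∈ F (t i) (M i)) : ∏ i ∈ s, x i ∈ F (∑ i ∈ s, t i) (∑ i ∈ s, M i) := by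
  classical
  induction s using Finset.induction_on with
  | empty => simpa using h1
  | insert a s ha ih =>
    rw [Finset.prod_insert ha, Finset.sum_insert ha, Finset.sum_insert ha]
    exact hmul _ _ _ _ _ _ (hx a (Finset.mem_insert_self _ _))
      (ih fun i hi => hx i (Finset.mem_insert_of_mem hi))

theorem pow_mul_le_of_mul_le {ω : ℕ → ℕ} (hω : ∀ c, p * ω c ≤ ω (c + 1)) {i m : ℕ} (hi : i ≤ m) :
    p ^ (m - i) * ω i ≤ ω m := by
  induction m, hi using Nat.le_induction with
  | base => simp
  | succ j hj ih =>
    rw [Nat.succ_sub hj, pow_succ', mul_assoc]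
    exact (Nat.mul_le_mul_left p ih).trans (hω j)

theorem aeval_mem_filtration (h1 : (1 : A) ∈ F 0 0)
    (hmul : ∀ t t' M M' x y, x ∈ F t M → y ∈ F t' M' → x * y ∈ F (t + t') (M + M'))
    (hmono : ∀ t M M', M ≤ M' → F t M ≤ F t M')
    {m : ℕ} {f : MvPolynomial (Fin 2 × ℕ) ℤ} (hf : f ∈ isobaric p (m + 1) (m + 1))
    {δ : D} {ω : ℕ → ℕ} (hω : ∀ c, p * ω c ≤ ω (c + 1)) {u : Fin 2 × ℕ → A}
    (hu : ∀ v, u v ∈ F (p ^ v.2 • δ) (ω v.2)) :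
    MvPolynomial.aeval u f ∈ F (p ^ (m + 1) • δ) (p * ω m) := by
  have hω' : ∀ i ≤ m, p ^ (m - i) * ω i ≤ ω m := fun i hi => pow_mul_le_of_mul_le hω hi
  have hvars : ((f.vars : Finset (Fin 2 × ℕ)) : Set (Fin 2 × ℕ)) ⊆ {v | v.2 < m + 1} :=
    MvPolynomial.mem_supported.mp hf.2
  rw [MvPolynomial.aeval_def, MvPolynomial.eval₂_eq]
  refine Submodule.sum_mem _ fun d hd => ?_
  rw [eq_intCast, ← zsmul_eq_mul]
  refine zsmul_mem ?_ _
  have hwt : Finsupp.weight (fun v : Fin 2 × ℕ => p ^ v.2) d = p ^ (m + 1) :=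
    hf.1 (MvPolynomial.mem_support_iff.mp hd)
  rw [Finsupp.weight_apply, Finsupp.sum] at hwt
  have key := prod_mem_filtration (F := F) h1 hmul d.support
    (fun v _ => pow_mem_filtration h1 hmul (hu v) (d v))
  have e : ∑ v ∈ d.support, d v • p ^ v.2 • δ = p ^ (m + 1) • δ := by
    rw [← hwt, Finset.sum_smul]
    exact Finset.sum_congr rfl fun v _ => by rw [smul_eq_mul, mul_smul]
  rw [e] at key
  refine hmono _ _ _ ?_ key
  have h3 : ∀ v ∈ d.support, p ^ m * (d v * ω v.2) ≤ (d v * p ^ v.2) * ω m := by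
    intro v hv
    have hvm : v.2 < m + 1 := hvars (by
      rw [Finset.mem_coe, MvPolynomial.mem_vars_iff_mem_support]; exact ⟨d, hd, hv⟩)
    have h4 := Nat.mul_le_mul_left (d v * p ^ v.2) (hω' v.2 (by omega))
    refine le_trans (le_of_eq ?_) h4
    have : p ^ m = p ^ v.2 * p ^ (m - v.2) := by rw [← pow_add]; congr 1; omega
    rw [this]; ring
  have h5 := Finset.sum_le_sum h3
  rw [← Finset.mul_sum, ← Finset.sum_mul] at h5
  simp only [smul_eq_mul] at hwt
  rw [hwt, pow_succ, mul_assoc] at h5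
  exact Nat.le_of_mul_le_mul_left h5 (pow_pos hp.out.pos _)

/-- Sums of Witt vectors whose components lie in filtration submodules: up to lower filtration, the
components of the sum are the sums of the components. -/
theorem witt_add_mem (h1 : (1 : A) ∈ F 0 0)
    (hmul : ∀ t t' M M' x y, x ∈ F t M → y ∈ F t' M' → x * y ∈ F (t + t') (M + M'))
    (hmono : ∀ t M M', M ≤ M' → F t M ≤ F t M')
    {δ : D} {ω : ℕ → ℕ} (hω : ∀ c, p * ω c ≤ ω (c + 1)) {u v : WittVector p A}
    (hu : ∀ c, u.coeff c ∈ F (p ^ c • δ) (ω c)) (hv : ∀ c, v.coeff c ∈ F (p ^ c • δ) (ω c))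
    (m : ℕ) : (u + v).coeff (m + 1) - (u.coeff (m + 1) + v.coeff (m + 1)) ∈
      F (p ^ (m + 1) • δ) (p * ω m) := by
  have := aeval_mem_filtration h1 hmul hmono (wittAdd_sub_mem (p := p) (m + 1)) hω
    (u := Function.uncurry ![u.coeff, v.coeff]) (by
      rintro ⟨b, c⟩
      fin_cases b
      · exact hu c
      · exact hv c)
  rw [map_sub, map_add, MvPolynomial.aeval_X, MvPolynomial.aeval_X] at this
  rw [WittVector.add_coeff]
  exact this

theorem witt_add_mem' (h1 : (1 : A) ∈ F 0 0)
    (hmul : ∀ t t' M M' x y, x ∈ F t M → y ∈ F t' M' → x * y ∈ F (t + t') (M + M'))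
    (hmono : ∀ t M M', M ≤ M' → F t M ≤ F t M')
    {δ : D} {ω : ℕ → ℕ} (hω : ∀ c, p * ω c ≤ ω (c + 1)) {u v : WittVector p A}
    (hu : ∀ c, u.coeff c ∈ F (p ^ c • δ) (ω c)) (hv : ∀ c, v.coeff c ∈ F (p ^ c • δ) (ω c))
    (c : ℕ) : (u + v).coeff c ∈ F (p ^ c • δ) (ω c) := by
  cases c with
  | zero => rw [WittVector.add_coeff_zero]; exact Submodule.add_mem _ (hu 0) (hv 0)
  | succ m =>
    have := hmono _ _ _ (hω m) (witt_add_mem h1 hmul hmono hω hu hv m)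
    have := Submodule.add_mem _ this (Submodule.add_mem _ (hu (m + 1)) (hv (m + 1)))
    rwa [sub_add_cancel] at this

/-- The analogue of `witt_add_mem` for finite sums. -/
theorem witt_sum_mem (h1 : (1 : A) ∈ F 0 0)
    (hmul : ∀ t t' M M' x y, x ∈ F t M → y ∈ F t' M' → x * y ∈ F (t + t') (M + M'))
    (hmono : ∀ t M M', M ≤ M' → F t M ≤ F t M')
    {δ : D} {ω : ℕ → ℕ} (hω : ∀ c, p * ω c ≤ ω (c + 1)) {ι : Type*} (s : Finset ι)
    {u : ι → WittVector p A} (hu : ∀ i ∈ s, ∀ c, (u i).coeff c ∈ F (p ^ c • δ) (ω c)) :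
    (∀ c, (∑ i ∈ s, u i).coeff c ∈ F (p ^ c • δ) (ω c)) ∧
    (∑ i ∈ s, u i).coeff 0 = ∑ i ∈ s, (u i).coeff 0 ∧
    ∀ m, (∑ i ∈ s, u i).coeff (m + 1) - ∑ i ∈ s, (u i).coeff (m + 1) ∈
      F (p ^ (m + 1) • δ) (p * ω m) := by
  classical
  induction s using Finset.induction_on with
  | empty => simp
  | insert a s ha ih =>
    obtain ⟨i1, i2, i3⟩ := ih fun i hi => hu i (Finset.mem_insert_of_mem hi)
    have h0 := hu a (Finset.mem_insert_self _ _)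
    rw [Finset.sum_insert ha]
    refine ⟨witt_add_mem' h1 hmul hmono hω h0 i1, ?_, fun m => ?_⟩
    · rw [WittVector.add_coeff_zero, i2, Finset.sum_insert ha]
    · rw [Finset.sum_insert ha]
      have := Submodule.add_mem _ (witt_add_mem h1 hmul hmono hω h0 i1 m) (i3 m)
      convert this using 1
      abel

end WittAddition

/-! ### The diagonal modulo lower weights -/

section WittCongruence

variable {p n : ℕ} [hp : Fact p.Prime] [NeZero n] {B : Type*} [CommRing B] [CharP B p]

theorem pow_q_iterate (hB : ∀ b : B, b ^ p ^ n = b) (b : B) (a : ℕ) : b ^ p ^ (a * n) = b := by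
  induction a with
  | zero => simp
  | succ a ih => rw [add_mul, one_mul, pow_add, pow_mul, ih, hB]

theorem perfectRing_of_pow (hB : ∀ b : B, b ^ p ^ n = b) : PerfectRing B p := by
  have hn := Nat.pos_of_ne_zero (NeZero.ne n)
  have h : ∀ b : B, (b ^ p) ^ p ^ (n - 1) = b := fun b => by
    rw [← pow_mul, ← pow_succ', Nat.sub_add_cancel hn, hB]
  refine ⟨fun b c hbc => ?_, fun b => ⟨b ^ p ^ (n - 1), ?_⟩⟩
  · simp only at hbc
    rw [← h b, hbc, h c]
  · simp only
    rw [← pow_mul, mul_comm, pow_mul, h]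

/-- The relation defining `D_s`, for Teichmüller representatives over a ring of characteristic `p`
with `b^{p^n} = b`: it holds modulo `p^(⌊s/n⌋ + 1)`, since `D_m(τx, τy)` is congruent to `τ(D_m(x,
y))` modulo `p`. -/
theorem teichmuller_congr (hB : ∀ b : B, b ^ p ^ n = b) (x y : ℕ → B) (s : ℕ) :
    (p : WittVector p B) ^ (s / n + 1) ∣
      hondaSum p n (fun m _ => WittVector.teichmuller p (coprodEval p n x y m)) s -
      hondaSum p n (fun m _ => ∑ ij ∈ Finset.HasAntidiagonal.antidiagonal m,
        WittVector.teichmuller p (x ij.1 * y ij.2 ^ p ^ ij.1)) s := by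
  have := perfectRing_of_pow hB
  have hn := Nat.pos_of_ne_zero (NeZero.ne n)
  set τ := WittVector.teichmuller p (R := B)
  set X : ℕ → WittVector p B := fun i => τ (x i) with hX
  set Y : ℕ → WittVector p B := fun i => τ (y i) with hY
  have h0 : ∀ m, (p : WittVector p B) ∣ coprodEval p n X Y m - τ (coprodEval p n x y m) := by
    intro m
    rw [← Ideal.mem_span_singleton, WittVector.mem_span_p_iff_coeff_zero_eq_zero,
      ← WittVector.constantCoeff_apply, map_sub, map_coprodEval]
    simp [hX, hY, τ]
  have h1 := hondaSum_dvd p n 1 hn (fun m e => coprodEval p n X Y m ^ p ^ e)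
    (fun m e => τ (coprodEval p n x y m) ^ p ^ e) s
    (fun m _ e => dvd_sub_pow_of_dvd_sub (h0 m) e)
  rw [hondaSum_coprodEval] at h1
  have h2 : hondaSum p n (pairSum p X Y) s = hondaSum p n (fun m _ =>
      ∑ ij ∈ Finset.HasAntidiagonal.antidiagonal m, τ (x ij.1 * y ij.2 ^ p ^ ij.1)) s := by
    unfold hondaSum pairSum
    refine Finset.sum_congr rfl fun a _ => ?_
    congr 1
    refine Finset.sum_congr rfl fun ij _ => ?_
    rw [hX, hY, ← map_pow, ← map_mul, ← map_pow, pow_q_iterate hB]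
  have h3 : hondaSum p n (fun m e => τ (coprodEval p n x y m) ^ p ^ e) s =
      hondaSum p n (fun m _ => τ (coprodEval p n x y m)) s := by
    unfold hondaSum
    refine Finset.sum_congr rfl fun a _ => ?_
    simp only [← map_pow, pow_q_iterate hB]
  rw [h2, h3] at h1
  rwa [dvd_sub_comm]

variable {D K : Type*} [AddCommMonoid D] [CommRing K] [Algebra K B] {F : D → ℕ → Submodule K B}

/-- The `p^⌊s/n⌋`-th power of `D_s(x, y)` is the one of the sum of the `x_i y_j^{p^i}` with `i + j =
s`, up to the carries, which have filtration at most `p W(s - n)` and do not occur for `s < n`. -/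
theorem coprodEval_leading (hB : ∀ b : B, b ^ p ^ n = b) (h1 : (1 : B) ∈ F 0 0)
    (hmul : ∀ t t' M M' x y, x ∈ F t M → y ∈ F t' M' → x * y ∈ F (t + t') (M + M'))
    (hmono : ∀ t M M', M ≤ M' → F t M ≤ F t M')
    (hfrob : ∀ t M x, x ∈ F t M → x ^ p ∈ F (p • t) M)
    {δ : D} {W : ℕ → ℕ} (hW : ∀ m, p * W m ≤ W (m + n)) (x y : ℕ → B) (s : ℕ)
    (hxy : ∀ i j, (i + j) % n = s % n → x i * y j ^ p ^ i ∈ F δ (W (i + j))) :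
    coprodEval p n x y s ^ p ^ (s / n) -
      ∑ ij ∈ Finset.HasAntidiagonal.antidiagonal s, (x ij.1 * y ij.2 ^ p ^ ij.1) ^ p ^ (s / n) ∈
      (if n ≤ s then F (p ^ (s / n) • δ) (p * W (s - n)) else ⊥ : Submodule K B) := by
  have hn := Nat.pos_of_ne_zero (NeZero.ne n)
  have := perfectRing_of_pow hB
  set A := s / n with hA
  set r := s % n with hr
  have hs : r + A * n = s := by rw [hA, hr, mul_comm]; exact Nat.mod_add_div s n
  have hc := (Ideal.mem_span_singleton.mpr (teichmuller_congr hB x y s))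
  rw [WittVector.mem_span_p_pow_iff_le_coeff_eq_zero] at hc
  have hc := WittVector.le_coeff_eq_iff_le_sub_coeff_eq_zero.mpr hc A (Nat.lt_succ_self _)
  -- the left hand side has disjoint components
  have hL : (hondaSum p n (fun m _ => WittVector.teichmuller p (coprodEval p n x y m)) s).coeff A =
      coprodEval p n x y s ^ p ^ A := by
    unfold hondaSum
    rw [WittVector.sum_coeff_eq_coeff_sum, Finset.sum_eq_single 0]
    · rw [Nat.sub_zero, zero_mul, Nat.sub_zero, mul_comm, WittVector.teichmuller_mul_pow_coeff]
    · intro a ha ha0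
      have := Finset.mem_range.mp ha
      rw [mul_comm, WittVector.teichmuller_mul_pow_coeff_of_ne _ (by omega)]
    · intro h; exact absurd (Finset.mem_range.mpr (Nat.succ_pos _)) h
    · intro c
      refine ⟨fun ⟨a, ha, ha'⟩ ⟨b, hb, hb'⟩ => Subtype.ext ?_⟩
      have h3 : c = A - a := by
        by_contra h
        exact ha' (by rw [mul_comm, WittVector.teichmuller_mul_pow_coeff_of_ne _ h])
      have h4 : c = A - b := by
        by_contra h
        exact hb' (by rw [mul_comm, WittVector.teichmuller_mul_pow_coeff_of_ne _ h])
      have := Finset.mem_range.mp ha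
      have := Finset.mem_range.mp hb
      simp only
      omega
  have hfrob' : ∀ t M x, x ∈ F t M → ∀ c, x ^ p ^ c ∈ F (p ^ c • t) M := by
    intro t M x hx c
    induction c with
    | zero => simpa using hx
    | succ c ih => rw [pow_succ, pow_mul, mul_comm, mul_smul]; exact hfrob _ _ _ ih
  have hω : ∀ c, p * W (r + c * n) ≤ W (r + (c + 1) * n) := fun c => by
    rw [add_mul, one_mul, ← add_assoc]; exact hW _
  have hR := witt_sum_mem (F := F) h1 hmul hmono (δ := δ) (ω := fun c => W (r + c * n)) hω
    ((Finset.range (A + 1)).sigma fun a => Finset.HasAntidiagonal.antidiagonal (s - a * n))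
    (u := fun q => (p : WittVector p B) ^ (A - q.1) *
      WittVector.teichmuller p (x q.2.1 * y q.2.2 ^ p ^ q.2.1)) (by
        rintro ⟨a, i, j⟩ hq c
        rw [Finset.mem_sigma, Finset.HasAntidiagonal.mem_antidiagonal] at hq
        have ha : a < A + 1 := Finset.mem_range.mp hq.1
        have hij : i + j = s - a * n := hq.2
        have hAn : s - a * n = r + (A - a) * n := by
          rw [Nat.sub_mul, ← hs]
          have := Nat.mul_le_mul_right n (Nat.lt_succ_iff.mp ha)
          omega
        by_cases hcA : c = A - a
        · subst hcA
          rw [mul_comm (_ ^ _ : WittVector p B), WittVector.teichmuller_mul_pow_coeff]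
          refine hfrob' _ _ _ ?_ _
          have := hxy i j (by rw [hij, hAn, Nat.add_mul_mod_self_right, hr, Nat.mod_mod])
          rwa [hij, hAn] at this
        · rw [mul_comm (_ ^ _ : WittVector p B), WittVector.teichmuller_mul_pow_coeff_of_ne _ hcA]
          exact Submodule.zero_mem _)
  have hRs : hondaSum p n (fun m _ => ∑ ij ∈ Finset.HasAntidiagonal.antidiagonal m,
        WittVector.teichmuller p (x ij.1 * y ij.2 ^ p ^ ij.1)) s =
      ∑ q ∈ (Finset.range (A + 1)).sigma fun a => Finset.HasAntidiagonal.antidiagonal (s - a * n),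
        (p : WittVector p B) ^ (A - q.1) *
          WittVector.teichmuller p (x q.2.1 * y q.2.2 ^ p ^ q.2.1) := by
    unfold hondaSum
    rw [Finset.sum_sigma]
    exact Finset.sum_congr rfl fun a _ => Finset.mul_sum _ _ _
  have hRc : ∑ q ∈ (Finset.range (A + 1)).sigma
      fun a => Finset.HasAntidiagonal.antidiagonal (s - a * n),
        ((p : WittVector p B) ^ (A - q.1) *
          WittVector.teichmuller p (x q.2.1 * y q.2.2 ^ p ^ q.2.1)).coeff A =
      ∑ ij ∈ Finset.HasAntidiagonal.antidiagonal s, (x ij.1 * y ij.2 ^ p ^ ij.1) ^ p ^ A := by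
    rw [Finset.sum_sigma, Finset.sum_eq_single 0]
    · rw [zero_mul, Nat.sub_zero]
      refine Finset.sum_congr rfl fun ij _ => ?_
      rw [Nat.sub_zero, mul_comm, WittVector.teichmuller_mul_pow_coeff]
    · intro a ha ha0
      have := Finset.mem_range.mp ha
      refine Finset.sum_eq_zero fun ij _ => ?_
      rw [mul_comm, WittVector.teichmuller_mul_pow_coeff_of_ne _ (by simp only; omega)]
    · intro h; exact absurd (Finset.mem_range.mpr (Nat.succ_pos _)) h
  rw [hL, hRs] at hc
  rw [hc, ← hRc]
  split_ifs with hns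
  · obtain ⟨A', hA'⟩ : ∃ A', A = A' + 1 :=
      ⟨A - 1, by have := Nat.div_pos hns hn; omega⟩
    have := hR.2.2 A'
    rw [← hA', show r + A' * n = s - n by rw [← hs, hA', add_mul]; omega] at this
    exact this
  · rw [Submodule.mem_bot, sub_eq_zero]
    have : A = 0 := Nat.div_eq_of_lt (not_le.mp hns)
    rw [this] at hR ⊢
    exact hR.2.1

end WittCongruence

/-! ### Inequalities between May weights -/

section Weights

variable {p n k : ℕ} [hp : Fact p.Prime] [NeZero n]

theorem two_mul_sub_one_le_genWt (s : ℕ) : 2 * s - 1 ≤ genWt p n k s := by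
  rw [genWt]
  split_ifs with h
  · exact le_max_left _ _
  · exact le_rfl

theorem mul_genWt_add_one_le {m : ℕ} (hm : k ≤ m) :
    p * genWt p n k m + 1 ≤ genWt p n k (m + n) := by
  conv_rhs => rw [genWt]
  rw [dif_pos (by omega), Nat.add_sub_cancel]
  exact le_max_right _ _

theorem one_le_genWt [NeZero k] {s : ℕ} (hs : k ≤ s) : 1 ≤ genWt p n k s := by
  have := two_mul_sub_one_le_genWt (p := p) (n := n) (k := k) s
  have := Nat.pos_of_ne_zero (NeZero.ne k)
  omega

theorem genWt_cases (s : ℕ) : genWt p n k s = 2 * s - 1 ∨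
    (n + k ≤ s ∧ genWt p n k s = p * genWt p n k (s - n) + 1) := by
  rw [genWt]
  split_ifs with h
  · rcases max_choice (2 * s - 1) (p * genWt p n k (s - n) + 1) with h' | h'
    · exact Or.inl h'
    · exact Or.inr ⟨h, h'⟩
  · exact Or.inl rfl

/-- The filtration of the generators is strictly superadditive. -/
theorem genWt_add_lt [NeZero k] {i j : ℕ} (hi : k ≤ i) (hj : k ≤ j) :
    genWt p n k i + genWt p n k j + 1 ≤ genWt p n k (i + j) := by
  have hn := Nat.pos_of_ne_zero (NeZero.ne n)
  have hk := Nat.pos_of_ne_zero (NeZero.ne k)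
  have hp1 := hp.out.one_lt
  induction hN : i + j using Nat.strong_induction_on generalizing i j with
  | _ N ih =>
    subst hN
    -- the case where the filtration of the first generator comes from the recursion
    have key : ∀ i' j', k ≤ i' → k ≤ j' → i' + j' = i + j → n + k ≤ i' →
        genWt p n k i' = p * genWt p n k (i' - n) + 1 →
        genWt p n k i' + genWt p n k j' + 1 ≤ genWt p n k (i + j) := by
      intro i' j' hi' hj' hij h1 h2
      have h3 := ih (i' - n + j') (by omega) (by omega) hj' rfl
      have h4 := mul_genWt_add_one_le (p := p) (n := n) (k := k) (m := i' - n + j') (by omega)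
      rw [show i' - n + j' + n = i + j by omega] at h4
      have h5 := Nat.mul_le_mul_left p h3
      rw [mul_add, mul_add] at h5
      have h6 : genWt p n k j' ≤ p * genWt p n k j' := Nat.le_mul_of_pos_left _ (by omega)
      omega
    rcases genWt_cases (p := p) (n := n) (k := k) i with h1 | ⟨h1, h1'⟩
    · rcases genWt_cases (p := p) (n := n) (k := k) j with h2 | ⟨h2, h2'⟩
      · have := two_mul_sub_one_le_genWt (p := p) (n := n) (k := k) (i + j)
        omega
      · have := key j i hj hi (add_comm _ _) h2 h2'
        omega
    · exact key i j hi hj rfl h1 h1'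

end Weights

/-! ### The filtration of `S(n,k) ⊗ S(n,k)` -/

section TensorFiltration

theorem gidx_injective (n k : ℕ) [NeZero n] :
    Function.Injective fun a : GIdx n k => toLex (a.1.1, a.2.val) := fun a b h => by
  have h := Prod.mk.injEq _ _ _ _ ▸ toLex.injective h
  exact Prod.ext (Subtype.ext h.1) (ZMod.val_injective n h.2)

/-- The lexicographic order of the generators `t_s^{p^j}`, which fixes the order of the factors in
the monomials of an exterior algebra. -/
instance gidxOrder (n k : ℕ) [NeZero n] : LinearOrder (GIdx n k) where
  le a b := toLex (a.1.1, a.2.val) ≤ toLex (b.1.1, b.2.val)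
  le_refl _ := le_refl _
  le_trans _ _ _ := le_trans
  le_antisymm _ _ h h' := gidx_injective n k (le_antisymm h h')
  le_total _ _ := le_total _ _
  toDecidableLE a b := inferInstanceAs (Decidable (toLex (a.1.1, a.2.val) ≤ toLex (b.1.1, b.2.val)))
  toDecidableEq := instDecidableEqProd

variable (p n k : ℕ) [hp : Fact p.Prime] [NeZero n] [NeZero k]

/-- The filtration of `S(n,k) ⊗ S(n,k)`: the span of the `x ⊗ y` with monomials `x`, `y` of total
internal degree `t` and total filtration at most `M`. -/
def tensorFilt (t : IDeg p n) (M : ℤ) :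
    Submodule (ZMod p) (MoravaAlg p n k ⊗[ZMod p] MoravaAlg p n k) :=
  Submodule.span (ZMod p) {z | ∃ e f : Expo k, expDeg p n k e + expDeg p n k f = t ∧
    (expWt p n k e + expWt p n k f : ℤ) ≤ M ∧ mono p n k e ⊗ₜ[ZMod p] mono p n k f = z}

variable {p n k}

theorem tensorFilt_mono {t : IDeg p n} {M M' : ℤ} (h : M ≤ M') :
    tensorFilt p n k t M ≤ tensorFilt p n k t M' := by
  apply Submodule.span_mono
  rintro _ ⟨e, f, h1, h2, h3⟩
  exact ⟨e, f, h1, h2.trans h, h3⟩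

theorem filt_mono {t : IDeg p n} {M M' : ℤ} (h : M ≤ M') :
    filt p n k t M ≤ filt p n k t M' := by
  apply Submodule.span_mono
  rintro _ ⟨e, h1, h2, h3⟩
  exact ⟨e, h1, h2.trans h, h3⟩

theorem one_mem_tensorFilt :
    (1 : MoravaAlg p n k ⊗[ZMod p] MoravaAlg p n k) ∈ tensorFilt p n k 0 0 :=
  Submodule.subset_span ⟨0, 0, by simp [expDeg], by simp [expWt],
    by simp [mono, Algebra.TensorProduct.one_def]⟩

theorem mul_mem_tensorFilt {t t' : IDeg p n} {M M' : ℤ}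
    {x y : MoravaAlg p n k ⊗[ZMod p] MoravaAlg p n k}
    (hx : x ∈ tensorFilt p n k t M) (hy : y ∈ tensorFilt p n k t' M') :
    x * y ∈ tensorFilt p n k (t + t') (M + M') := by
  have h : tensorFilt p n k t M * tensorFilt p n k t' M' ≤ tensorFilt p n k (t + t') (M + M') := by
    unfold tensorFilt
    rw [Submodule.span_mul_span]
    apply Submodule.span_mono
    rintro _ ⟨_, ⟨e, f, h1, h2, rfl⟩, _, ⟨e', f', h1', h2', rfl⟩, rfl⟩
    have h3 := expWt_add_le (p := p) (n := n) e e'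
    have h4 := expWt_add_le (p := p) (n := n) f f'
    refine ⟨e + e', f + f', ?_, by omega, ?_⟩
    · rw [expDeg_add, expDeg_add, ← h1, ← h1']; abel
    · simp only [Algebra.TensorProduct.tmul_mul_tmul, mono_add]
  exact h (Submodule.mul_mem_mul hx hy)

theorem tmul_mem_tensorFilt {t t' : IDeg p n} {M M' : ℤ} {x y : MoravaAlg p n k}
    (hx : x ∈ filt p n k t M) (hy : y ∈ filt p n k t' M') :
    x ⊗ₜ[ZMod p] y ∈ tensorFilt p n k (t + t') (M + M') := by
  have h : Submodule.map₂ (TensorProduct.mk (ZMod p) (MoravaAlg p n k) (MoravaAlg p n k))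
      (filt p n k t M) (filt p n k t' M') ≤ tensorFilt p n k (t + t') (M + M') := by
    unfold filt tensorFilt
    rw [Submodule.map₂_span_span]
    apply Submodule.span_mono
    rintro _ ⟨_, ⟨e, h1, h2, rfl⟩, _, ⟨f, h1', h2', rfl⟩, rfl⟩
    exact ⟨e, f, by rw [h1, h1'], by omega, rfl⟩
  exact h (Submodule.apply_mem_map₂ _ hx hy)

theorem expDeg_nsmul (m : ℕ) (e : Expo k) : expDeg p n k (m • e) = m • expDeg p n k e := by
  induction m with
  | zero => simp [expDeg]
  | succ m ih => rw [succ_nsmul, expDeg_add, ih, succ_nsmul]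

theorem mono_nsmul (m : ℕ) (e : Expo k) : mono p n k (m • e) = mono p n k e ^ m := by
  induction m with
  | zero => simp [mono]
  | succ m ih => rw [succ_nsmul, mono_add, ih, pow_succ]

theorem expWt_smul (e : Expo k) : expWt p n k (p • e) = expWt p n k e := by
  unfold expWt
  rw [Finsupp.sum_smul_index' (by simp)]
  refine Finset.sum_congr rfl fun s _ => ?_
  simp only [smul_eq_mul]
  congr 1
  rcases Nat.eq_zero_or_pos (e s) with h | h
  · rw [h, mul_zero]
  · have := Nat.digits_base_pow_mul (k := 1) hp.out.one_lt h
    rw [pow_one] at this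
    rw [this]
    simp

theorem add_pow_p {B : Type*} [CommRing B] [Algebra (ZMod p) B] (a b : B) :
    (a + b) ^ p = a ^ p + b ^ p := by
  simpa using add_pow_q (n := 1) a b

theorem pow_p_mem_tensorFilt {t : IDeg p n} {M : ℤ}
    {x : MoravaAlg p n k ⊗[ZMod p] MoravaAlg p n k}
    (hx : x ∈ tensorFilt p n k t M) : x ^ p ∈ tensorFilt p n k (p • t) M := by
  unfold tensorFilt at hx
  induction hx using Submodule.span_induction with
  | mem x h =>
    obtain ⟨e, f, h1, h2, rfl⟩ := h
    refine Submodule.subset_span ⟨p • e, p • f, ?_, ?_, ?_⟩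
    · rw [expDeg_nsmul, expDeg_nsmul, ← smul_add, h1]
    · rwa [expWt_smul, expWt_smul]
    · rw [mono_nsmul, mono_nsmul, Algebra.TensorProduct.tmul_pow]
  | zero => rw [zero_pow hp.out.ne_zero]; exact Submodule.zero_mem _
  | add x y _ _ hx hy => rw [add_pow_p]; exact Submodule.add_mem _ hx hy
  | smul c x _ hx => rw [smul_pow]; exact Submodule.smul_mem _ _ hx

theorem pow_mem_tensorFilt {t : IDeg p n} {M : ℤ}
    {x : MoravaAlg p n k ⊗[ZMod p] MoravaAlg p n k}
    (hx : x ∈ tensorFilt p n k t M) (c : ℕ) : x ^ p ^ c ∈ tensorFilt p n k (p ^ c • t) M := by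
  induction c with
  | zero => simpa using hx
  | succ c ih =>
    have : p ^ (c + 1) • t = p • p ^ c • t := by rw [pow_succ', mul_smul]
    rw [this, pow_succ, pow_mul]
    exact pow_p_mem_tensorFilt ih

instance : CharP (MoravaAlg p n k ⊗[ZMod p] MoravaAlg p n k) p := by
  have : Nontrivial (MoravaAlg p n k ⊗[ZMod p] MoravaAlg p n k) :=
    ((counitHom p n k).comp (Algebra.TensorProduct.lmul' (ZMod p)
      (S := MoravaAlg p n k))).toRingHom.domain_nontrivial
  exact charP_of_injective_algebraMap
    (algebraMap (ZMod p) (MoravaAlg p n k ⊗[ZMod p] MoravaAlg p n k)).injective p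

theorem natCast_mul_q (m : ℕ) : ((2 * m * p ^ n : ℕ) : IDeg p n) = ((2 * m : ℕ) : IDeg p n) := by
  have hq := one_lt_q (p := p) (n := n)
  have : 2 * m * p ^ n = 2 * m + m * (2 * (p ^ n - 1)) := by
    zify [hq.le]; ring
  rw [this, Nat.cast_add, Nat.cast_mul m, ZMod.natCast_self, mul_zero, add_zero]

variable (p n) in
/-- The internal degree `2(p^s - 1)` of `t_s`. -/
def tDeg (s : ℕ) : IDeg p n := ((2 * (p ^ s - 1) : ℕ) : IDeg p n)

theorem q_smul_tDeg (s c : ℕ) : p ^ (c * n) • tDeg p n s = tDeg p n s := by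
  induction c with
  | zero => simp
  | succ c ih =>
    have : p ^ n * (2 * (p ^ s - 1)) = 2 * (p ^ s - 1) * p ^ n := mul_comm _ _
    rw [add_mul, one_mul, pow_add, mul_smul, tDeg, nsmul_eq_mul (p ^ n), ← Nat.cast_mul, this,
      natCast_mul_q]
    exact ih

theorem tDeg_add (i j : ℕ) : tDeg p n i + p ^ i • tDeg p n j = tDeg p n (i + j) := by
  rw [tDeg, tDeg, tDeg, nsmul_eq_mul, ← Nat.cast_mul, ← Nat.cast_add]
  congr 1
  have h1 : 1 ≤ p ^ i := Nat.one_le_pow _ _ hp.out.pos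
  have h2 : 1 ≤ p ^ j := Nat.one_le_pow _ _ hp.out.pos
  have h3 : 1 ≤ p ^ (i + j) := Nat.one_le_pow _ _ hp.out.pos
  zify [h1, h2, h3]
  ring

theorem tDeg_add_mul (s c : ℕ) : tDeg p n (s + c * n) = tDeg p n s := by
  induction c with
  | zero => simp
  | succ c ih =>
    rw [← ih, show s + (c + 1) * n = n + (s + c * n) by ring, ← tDeg_add]
    have h1 := q_smul_tDeg (p := p) (n := n) (s + c * n) 1
    have h2 : tDeg p n n = 0 := ZMod.natCast_self _
    rw [one_mul] at h1
    rw [h1, h2, zero_add]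

theorem tDeg_congr {s s' : ℕ} (h : s % n = s' % n) : tDeg p n s = tDeg p n s' := by
  rw [← Nat.mod_add_div s n, ← Nat.mod_add_div s' n, mul_comm n, mul_comm n, tDeg_add_mul,
    tDeg_add_mul, h]

variable (p n k) in
/-- The filtration of `t_s`, for all `s ≥ 0` (with `t_0 = 1` and `t_s = 0` for `0 < s < k`). -/
def ttWt (s : ℕ) : ℕ := if k ≤ s then genWt p n k s else 0

theorem tt_pow_mem (j i : ℕ) :
    tt p n k j ^ p ^ i ∈ filt p n k (p ^ i • tDeg p n j) (ttWt p n k j) := by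
  by_cases h0 : j = 0
  · subst h0
    rw [tt_zero, one_pow]
    have : p ^ i • tDeg p n 0 = 0 := by simp [tDeg]
    rw [this]
    exact filt_mono (by positivity) one_mem_filt
  · by_cases h : k ≤ j
    · rw [← gen_eq_tt p n k ⟨j, h⟩]
      refine Submodule.subset_span ⟨Finsupp.single ⟨j, h⟩ (p ^ i), ?_, ?_, ?_⟩
      · rw [expDeg_single, tDeg, nsmul_eq_mul, ← Nat.cast_mul]
      · have := digits_sum_mul_pow (p := p) 1 i hp.out.one_lt
        rw [one_mul] at this
        rw [expWt_single, this, one_mul, ttWt, if_pos h]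
      · exact Finsupp.prod_single_index (pow_zero _)
    · rw [tt_lt p n k j h0 (not_le.mp h), zero_pow (pow_pos hp.out.pos _).ne']
      exact Submodule.zero_mem _

theorem tmul_tt (i j : ℕ) : (tt p n k i ⊗ₜ[ZMod p] (1 : MoravaAlg p n k)) *
    ((1 : MoravaAlg p n k) ⊗ₜ[ZMod p] tt p n k j) ^ p ^ i =
      tt p n k i ⊗ₜ[ZMod p] (tt p n k j ^ p ^ i) := by
  rw [Algebra.TensorProduct.tmul_pow, Algebra.TensorProduct.tmul_mul_tmul, one_pow, mul_one,
    one_mul]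

theorem tmul_tt_mem (i j : ℕ) : tt p n k i ⊗ₜ[ZMod p] (tt p n k j ^ p ^ i) ∈
    tensorFilt p n k (tDeg p n (i + j)) ((ttWt p n k i : ℤ) + ttWt p n k j) := by
  have h1 := tt_pow_mem (p := p) (n := n) (k := k) i 0
  rw [pow_zero, pow_one, one_smul] at h1
  have := tmul_mem_tensorFilt h1 (tt_pow_mem (p := p) (n := n) (k := k) j i)
  rwa [tDeg_add] at this

theorem tmul_tt_cases (i j : ℕ) : i = 0 ∨ j = 0 ∨ (k ≤ i ∧ k ≤ j) ∨
    tt p n k i ⊗ₜ[ZMod p] (tt p n k j ^ p ^ i) = 0 := by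
  by_cases hi : i = 0
  · exact Or.inl hi
  · by_cases hj : j = 0
    · exact Or.inr (Or.inl hj)
    · by_cases hik : k ≤ i
      · by_cases hjk : k ≤ j
        · exact Or.inr (Or.inr (Or.inl ⟨hik, hjk⟩))
        · right; right; right
          rw [tt_lt p n k j hj (not_le.mp hjk), zero_pow (pow_pos hp.out.pos _).ne',
            TensorProduct.tmul_zero]
      · right; right; right
        rw [tt_lt p n k i hi (not_le.mp hik), TensorProduct.zero_tmul]

theorem tmul_tt_mem' (i j : ℕ) : tt p n k i ⊗ₜ[ZMod p] (tt p n k j ^ p ^ i) ∈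
    tensorFilt p n k (tDeg p n (i + j)) (ttWt p n k (i + j)) := by
  have h0 : ttWt p n k 0 = 0 := by
    have := NeZero.ne k
    rw [ttWt, if_neg (by omega)]
  have hm := tmul_tt_mem (p := p) (n := n) (k := k) i j
  rcases tmul_tt_cases (p := p) (n := n) (k := k) i j with h | h | ⟨h, h'⟩ | h
  · subst h
    rw [h0] at hm
    simpa using hm
  · subst h
    rw [h0] at hm
    simpa using hm
  · refine tensorFilt_mono ?_ hm
    have := genWt_add_lt (p := p) (n := n) h h'
    rw [ttWt, ttWt, ttWt, if_pos h, if_pos h', if_pos (by omega)]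
    omega
  · rw [h]; exact Submodule.zero_mem _

theorem mul_ttWt_le (hkn : k ≤ n) (m : ℕ) : p * ttWt p n k m ≤ ttWt p n k (m + n) - 1 := by
  unfold ttWt
  rw [if_pos (show k ≤ m + n by omega)]
  split_ifs with h
  · have := mul_genWt_add_one_le (p := p) (n := n) h
    omega
  · simp

/-- The generators `t_s` are primitive up to lower filtration. -/
theorem comulHom_tt_sub_mem (hkn : k ≤ n) {s : ℕ} (hs : k ≤ s) :
    comulHom p n k (tt p n k s) -
      (tt p n k s ⊗ₜ[ZMod p] 1 + 1 ⊗ₜ[ZMod p] tt p n k s) ∈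
      tensorFilt p n k (tDeg p n s) ((genWt p n k s : ℤ) - 1) := by
  have hn := Nat.pos_of_ne_zero (NeZero.ne n)
  have hk := Nat.pos_of_ne_zero (NeZero.ne k)
  have hB : ∀ b : MoravaAlg p n k ⊗[ZMod p] MoravaAlg p n k, b ^ p ^ n = b :=
    tensor_pow moravaAlg_pow moravaAlg_pow
  set x : ℕ → MoravaAlg p n k ⊗[ZMod p] MoravaAlg p n k := fun i => tt p n k i ⊗ₜ[ZMod p] 1
  set y : ℕ → MoravaAlg p n k ⊗[ZMod p] MoravaAlg p n k := fun j => 1 ⊗ₜ[ZMod p] tt p n k j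
  have hxy : ∀ i j, x i * y j ^ p ^ i = tt p n k i ⊗ₜ[ZMod p] (tt p n k j ^ p ^ i) := tmul_tt
  have h1 := one_le_genWt (p := p) (n := n) hs
  set A := s / n with hA
  have key := coprodEval_leading (F := fun t M => tensorFilt p n k t (M : ℤ)) hB
    one_mem_tensorFilt
    (fun t t' M M' x y hx hy => by
      have := mul_mem_tensorFilt hx hy
      rwa [← Nat.cast_add] at this)
    (fun t M M' h => tensorFilt_mono (by exact_mod_cast h))
    (fun t M x hx => pow_p_mem_tensorFilt hx)
    (δ := tDeg p n s) (W := ttWt p n k)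
    (fun m => (mul_ttWt_le hkn m).trans (Nat.sub_le _ _)) x y s
    (fun i j hij => by
      rw [hxy, ← tDeg_congr hij]
      exact tmul_tt_mem' i j)
  have key2 : coprodEval p n x y s ^ p ^ A -
      ∑ ij ∈ Finset.HasAntidiagonal.antidiagonal s, (x ij.1 * y ij.2 ^ p ^ ij.1) ^ p ^ A ∈
        tensorFilt p n k (p ^ A • tDeg p n s) ((genWt p n k s : ℤ) - 1) := by
    rw [← hA] at key
    split_ifs at key with h
    · refine tensorFilt_mono ?_ key
      have := mul_ttWt_le (p := p) hkn (s - n)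
      rw [Nat.sub_add_cancel h, show ttWt p n k s = genWt p n k s from if_pos hs] at this
      omega
    · rw [(Submodule.mem_bot _).mp key]
      exact Submodule.zero_mem _
  have key3 := pow_mem_tensorFilt key2 ((n - 1) * A)
  have hpow : ∀ b : MoravaAlg p n k ⊗[ZMod p] MoravaAlg p n k,
      (b ^ p ^ A) ^ p ^ ((n - 1) * A) = b := fun b => by
    have : A + (n - 1) * A = A * n := by
      obtain ⟨n', rfl⟩ : ∃ n', n = n' + 1 := ⟨n - 1, by omega⟩
      rw [Nat.add_sub_cancel]; ring
    rw [← pow_mul, ← pow_add, this, pow_q_iterate hB]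
  have : ExpChar (MoravaAlg p n k ⊗[ZMod p] MoravaAlg p n k) p := ExpChar.prime hp.out
  rw [← iterateFrobenius_def, map_sub, map_sum] at key3
  simp only [iterateFrobenius_def, hpow] at key3
  have hdeg : p ^ ((n - 1) * A) • p ^ A • tDeg p n s = tDeg p n s := by
    rw [smul_smul, ← pow_add, show (n - 1) * A + A = A * n by
      obtain ⟨n', rfl⟩ : ∃ n', n = n' + 1 := ⟨n - 1, by omega⟩
      rw [Nat.add_sub_cancel]; ring, q_smul_tDeg]
  rw [hdeg] at key3
  rw [comulHom_tt]
  have key4 : ∑ ij ∈ Finset.HasAntidiagonal.antidiagonal s, x ij.1 * y ij.2 ^ p ^ ij.1 -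
      (tt p n k s ⊗ₜ[ZMod p] 1 + 1 ⊗ₜ[ZMod p] tt p n k s) ∈
        tensorFilt p n k (tDeg p n s) ((genWt p n k s : ℤ) - 1) := by
    have hne : ((0, s) : ℕ × ℕ) ≠ (s, 0) := fun h => by
      have := congrArg Prod.fst h; simp only at this; omega
    have hsub : ({(0, s), (s, 0)} : Finset (ℕ × ℕ)) ⊆ Finset.HasAntidiagonal.antidiagonal s := by
      intro ij hij
      rw [Finset.mem_insert, Finset.mem_singleton] at hij
      rcases hij with rfl | rfl <;> simp
    rw [← Finset.sum_sdiff hsub, Finset.sum_pair hne]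
    have e : x (0, s).1 * y (0, s).2 ^ p ^ (0, s).1 + x (s, 0).1 * y (s, 0).2 ^ p ^ (s, 0).1 =
        tt p n k s ⊗ₜ[ZMod p] 1 + 1 ⊗ₜ[ZMod p] tt p n k s := by
      rw [hxy, hxy]
      simp only [tt_zero, one_pow, pow_zero, pow_one]
      abel
    rw [e, add_sub_cancel_right]
    refine Submodule.sum_mem _ fun ij hij => ?_
    obtain ⟨i, j⟩ := ij
    simp only [Finset.mem_sdiff, Finset.HasAntidiagonal.mem_antidiagonal, Finset.mem_insert,
      Finset.mem_singleton, Prod.mk.injEq, not_or] at hij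
    rw [hxy]
    have hm := tmul_tt_mem (p := p) (n := n) (k := k) i j
    rw [hij.1] at hm
    rcases tmul_tt_cases (p := p) (n := n) (k := k) i j with h | h | ⟨h, h'⟩ | h
    · exact absurd ⟨h, by omega⟩ hij.2.1
    · exact absurd ⟨by omega, h⟩ hij.2.2
    · refine tensorFilt_mono ?_ hm
      have := genWt_add_lt (p := p) (n := n) h h'
      rw [hij.1] at this
      simp only [ttWt, h, h', if_true]
      omega
    · rw [h]; exact Submodule.zero_mem _
  have := Submodule.add_mem _ key3 key4
  rwa [sub_add_sub_cancel] at this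

end TensorFiltration

/-! ### The diagonal modulo lower filtration -/

section Diagonal

variable {p n k : ℕ} [hp : Fact p.Prime] [NeZero n] [NeZero k]

theorem sub_mem_mul_tensorFilt {t t' : IDeg p n} {M M' : ℤ}
    {u u' v v' : MoravaAlg p n k ⊗[ZMod p] MoravaAlg p n k}
    (hu : u - u' ∈ tensorFilt p n k t (M - 1)) (hv : v - v' ∈ tensorFilt p n k t' (M' - 1))
    (hu' : u' ∈ tensorFilt p n k t M) (hv' : v' ∈ tensorFilt p n k t' M') :
    u * v - u' * v' ∈ tensorFilt p n k (t + t') (M + M' - 1) := by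
  have e : u * v - u' * v' = (u - u') * (v - v' + v') + u' * (v - v') := by ring
  rw [e]
  have h1 := mul_mem_tensorFilt hu (Submodule.add_mem _ (tensorFilt_mono (by omega) hv) hv')
  have h2 := mul_mem_tensorFilt hu' hv
  rw [show M - 1 + M' = M + M' - 1 by ring] at h1
  rw [show M + (M' - 1) = M + M' - 1 by ring] at h2
  exact Submodule.add_mem _ h1 h2

theorem hDeg_eq (a : GIdx n k) : hDeg p n k a = p ^ a.2.val • tDeg p n a.1.1 := by
  rw [hDeg, tDeg, nsmul_eq_mul, ← Nat.cast_mul]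
  congr 1
  exact mul_comm _ _

theorem pow_pow_add {B : Type*} [CommRing B] [Algebra (ZMod p) B] (a b : B) (j : ℕ) :
    (a + b) ^ p ^ j = a ^ p ^ j + b ^ p ^ j := add_pow_q a b

/-- The elements `t_s^{p^j}` are primitive up to lower filtration. -/
theorem comulHom_genPow_sub_mem (hkn : k ≤ n) (a : GIdx n k) :
    comulHom p n k (genPow p n k a) -
      (genPow p n k a ⊗ₜ[ZMod p] 1 + 1 ⊗ₜ[ZMod p] genPow p n k a) ∈
      tensorFilt p n k (hDeg p n k a) ((genWt p n k a.1 : ℤ) - 1) := by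
  have h := pow_mem_tensorFilt (comulHom_tt_sub_mem (p := p) hkn a.1.2) a.2.val
  rw [← hDeg_eq, ← gen_eq_tt] at h
  have e : comulHom p n k (genPow p n k a) = (comulHom p n k (gen p n k a.1)) ^ p ^ a.2.val := by
    rw [genPow, map_pow]
  have e2 : genPow p n k a ⊗ₜ[ZMod p] 1 + 1 ⊗ₜ[ZMod p] genPow p n k a =
      (gen p n k a.1 ⊗ₜ[ZMod p] 1 + 1 ⊗ₜ[ZMod p] gen p n k a.1) ^ p ^ a.2.val := by
    rw [pow_pow_add, Algebra.TensorProduct.tmul_pow, Algebra.TensorProduct.tmul_pow, one_pow,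
      genPow]
  have e3 : comulHom p n k (genPow p n k a) = (comulHom p n k (gen p n k a.1) -
      (gen p n k a.1 ⊗ₜ[ZMod p] 1 + 1 ⊗ₜ[ZMod p] gen p n k a.1)) ^ p ^ a.2.val +
      (genPow p n k a ⊗ₜ[ZMod p] 1 + 1 ⊗ₜ[ZMod p] genPow p n k a) := by
    rw [e2, ← pow_pow_add, sub_add_cancel, e]
  rw [e3, add_sub_cancel_right]
  exact h

theorem prod_factorial_add_single (a : GIdx n k) (e : GIdx n k →₀ ℕ) :
    ((e + Finsupp.single a 1).prod fun _ m => ((m.factorial : ℕ) : ZMod p)) =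
      (e a + 1 : ZMod p) * e.prod fun _ m => ((m.factorial : ℕ) : ZMod p) := by
  have h : ∀ f : GIdx n k →₀ ℕ, (f.prod fun _ m => ((m.factorial : ℕ) : ZMod p)) =
      ((f a).factorial : ZMod p) * (f.erase a).prod fun _ m => ((m.factorial : ℕ) : ZMod p) :=
    fun f => (Finsupp.mul_prod_erase' f a _ (by simp)).symm
  rw [h e, h (e + Finsupp.single a 1), Finsupp.erase_add, Finsupp.erase_single, add_zero,
    Finsupp.add_apply, Finsupp.single_eq_same, Nat.factorial_succ]
  push_cast
  ring

theorem natCast_succ_ne_zero {m : ℕ} (h : m + 1 < p) : (m + 1 : ZMod p) ≠ 0 := by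
  have : ((m + 1 : ℕ) : ZMod p) ≠ 0 := by
    rw [Ne, ZMod.natCast_eq_zero_iff]
    exact Nat.not_dvd_of_pos_of_lt (Nat.succ_pos _) h
  exact_mod_cast this

theorem genPow_mul_divMono (a : GIdx n k) (e : GIdx n k →₀ ℕ) (h : e a + 1 < p) :
    genPow p n k a * divMono p n k e = (e a + 1 : ZMod p) • divMono p n k (e + Finsupp.single a 1) := by
  rw [divMono, divMono, prod_factorial_add_single, gmono_add, gmono_single, pow_one, smul_smul,
    mul_inv, ← mul_assoc, mul_inv_cancel₀ (natCast_succ_ne_zero h), one_mul, mul_smul_comm, mul_comm]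

theorem sum_antidiagonal_swap' {M : Type*} [AddCommMonoid M]
    (F : (GIdx n k →₀ ℕ) → (GIdx n k →₀ ℕ) → M) (e : GIdx n k →₀ ℕ) :
    ∑ ij ∈ Finset.HasAntidiagonal.antidiagonal e, F ij.2 ij.1 =
      ∑ ij ∈ Finset.HasAntidiagonal.antidiagonal e, F ij.1 ij.2 :=
  Finset.sum_nbij' Prod.swap Prod.swap
    (fun ij h => by
      rw [Finset.HasAntidiagonal.mem_antidiagonal] at h ⊢; rw [← h]; exact add_comm _ _)
    (fun ij h => by
      rw [Finset.HasAntidiagonal.mem_antidiagonal] at h ⊢; rw [← h]; exact add_comm _ _)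
    (fun _ _ => rfl) (fun _ _ => rfl) (fun _ _ => rfl)

theorem sum_antidiagonal_add_single {M : Type*} [AddCommMonoid M] [Module (ZMod p) M]
    (Y : (GIdx n k →₀ ℕ) → (GIdx n k →₀ ℕ) → M) (e : GIdx n k →₀ ℕ) (a : GIdx n k) :
    ∑ ij ∈ Finset.HasAntidiagonal.antidiagonal e,
      (ij.2 a + 1 : ZMod p) • Y ij.1 (ij.2 + Finsupp.single a 1) =
    ∑ ij ∈ Finset.HasAntidiagonal.antidiagonal (e + Finsupp.single a 1 : GIdx n k →₀ ℕ),
      ((ij.2 a : ℕ) : ZMod p) • Y ij.1 ij.2 := by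
  have h := sum_antidiagonal_sub (fun i j : GIdx n k →₀ ℕ =>
    (j a + 1 : ZMod p) • Y i (j + Finsupp.single a 1)) (e + Finsupp.single a 1) a 1
  rw [if_pos (by simp), add_tsub_cancel_right] at h
  rw [← h]
  refine Finset.sum_congr rfl fun ij _ => ?_
  split_ifs with h1
  · rw [tsub_add_cancel_of_le (Finsupp.single_le_iff.mpr h1)]
    congr 1
    rw [Finsupp.tsub_apply, Finsupp.single_eq_same, Nat.cast_sub h1]
    simp
  · have : ij.2 a = 0 := by omega
    rw [this, Nat.cast_zero, zero_smul]

variable (p n k) in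
/-- The leading part `∑ y_{e'} ⊗ y_{e''}`, with `e' + e'' = e`, of the diagonal of the divided
monomial `y_e`. -/
def splitMono (e : GIdx n k →₀ ℕ) : MoravaAlg p n k ⊗[ZMod p] MoravaAlg p n k :=
  ∑ ij ∈ Finset.HasAntidiagonal.antidiagonal e, divMono p n k ij.1 ⊗ₜ[ZMod p] divMono p n k ij.2

theorem splitMono_add_single (a : GIdx n k) (e : GIdx n k →₀ ℕ) (h : e a + 1 < p) :
    (genPow p n k a ⊗ₜ[ZMod p] 1 + 1 ⊗ₜ[ZMod p] genPow p n k a) * splitMono p n k e =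
      (e a + 1 : ZMod p) • splitMono p n k (e + Finsupp.single a 1) := by
  have h1 : ∀ ij ∈ Finset.HasAntidiagonal.antidiagonal e, ij.1 a + ij.2 a = e a := fun ij hij => by
    rw [Finset.HasAntidiagonal.mem_antidiagonal] at hij
    rw [← hij, Finsupp.add_apply]
  have h2 : (genPow p n k a ⊗ₜ[ZMod p] 1 + 1 ⊗ₜ[ZMod p] genPow p n k a) * splitMono p n k e =
      ∑ ij ∈ Finset.HasAntidiagonal.antidiagonal e, (ij.1 a + 1 : ZMod p) •
        (divMono p n k (ij.1 + Finsupp.single a 1) ⊗ₜ[ZMod p] divMono p n k ij.2) +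
      ∑ ij ∈ Finset.HasAntidiagonal.antidiagonal e, (ij.2 a + 1 : ZMod p) •
        (divMono p n k ij.1 ⊗ₜ[ZMod p] divMono p n k (ij.2 + Finsupp.single a 1)) := by
    rw [splitMono, Finset.mul_sum, ← Finset.sum_add_distrib]
    refine Finset.sum_congr rfl fun ij hij => ?_
    have := h1 ij hij
    rw [add_mul, Algebra.TensorProduct.tmul_mul_tmul, Algebra.TensorProduct.tmul_mul_tmul, one_mul,
      one_mul, genPow_mul_divMono _ _ (by omega), genPow_mul_divMono _ _ (by omega),
      TensorProduct.smul_tmul', TensorProduct.tmul_smul]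
  have h3 : ∑ ij ∈ Finset.HasAntidiagonal.antidiagonal e, (ij.1 a + 1 : ZMod p) •
        (divMono p n k (ij.1 + Finsupp.single a 1) ⊗ₜ[ZMod p] divMono p n k ij.2) =
      ∑ ij ∈ Finset.HasAntidiagonal.antidiagonal (e + Finsupp.single a 1 : GIdx n k →₀ ℕ),
        ((ij.1 a : ℕ) : ZMod p) • (divMono p n k ij.1 ⊗ₜ[ZMod p] divMono p n k ij.2) := by
    have h4 := sum_antidiagonal_add_single (p := p)
      (fun i j => divMono p n k j ⊗ₜ[ZMod p] divMono p n k i) e a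
    rw [sum_antidiagonal_swap' fun i j => (i a + 1 : ZMod p) •
      (divMono p n k (i + Finsupp.single a 1) ⊗ₜ[ZMod p] divMono p n k j),
      sum_antidiagonal_swap' fun i j => (i a : ZMod p) •
      (divMono p n k i ⊗ₜ[ZMod p] divMono p n k j)] at h4
    exact h4
  rw [h2, h3, sum_antidiagonal_add_single (p := p)
      (fun i j => divMono p n k i ⊗ₜ[ZMod p] divMono p n k j) e a, ← Finset.sum_add_distrib,
      splitMono, Finset.smul_sum]
  refine Finset.sum_congr rfl fun ij hij => ?_
  rw [Finset.HasAntidiagonal.mem_antidiagonal] at hij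
  have := DFunLike.congr_fun hij a
  rw [Finsupp.add_apply, Finsupp.add_apply, Finsupp.single_eq_same] at this
  rw [← add_smul, ← Nat.cast_add, this]
  push_cast
  rfl

theorem splitMono_mem (e : GIdx n k →₀ ℕ) :
    splitMono p n k e ∈ tensorFilt p n k (eDeg p n k e) (eWt p n k e) := by
  refine Submodule.sum_mem _ fun ij hij => ?_
  rw [Finset.HasAntidiagonal.mem_antidiagonal] at hij
  have := tmul_mem_tensorFilt (divMono_mem_filt (p := p) ij.1 rfl le_rfl)
    (divMono_mem_filt (p := p) ij.2 rfl le_rfl)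
  rwa [← map_add, ← Nat.cast_add, ← map_add, hij] at this

theorem genPow_mem_filt (a : GIdx n k) :
    genPow p n k a ∈ filt p n k (hDeg p n k a) (genWt p n k a.1) := by
  have := gmono_mem_filt (p := p) (Finsupp.single a 1) rfl le_rfl
  rwa [gmono_single, pow_one, eDeg_single, one_smul, eWt_single, one_mul] at this

theorem genPow_tmul_mem (a : GIdx n k) :
    genPow p n k a ⊗ₜ[ZMod p] 1 + 1 ⊗ₜ[ZMod p] genPow p n k a ∈
      tensorFilt p n k (hDeg p n k a) (genWt p n k a.1) := by
  have h1 := tmul_mem_tensorFilt (genPow_mem_filt (p := p) a) one_mem_filt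
  have h2 := tmul_mem_tensorFilt one_mem_filt (genPow_mem_filt (p := p) a)
  rw [add_zero, add_zero] at h1
  rw [zero_add, zero_add] at h2
  exact Submodule.add_mem _ h1 h2

/-- The diagonal of the divided monomial `y_e` is `∑ y_{e'} ⊗ y_{e''}` up to lower filtration. -/
theorem comulHom_divMono_sub_mem (hkn : k ≤ n) (e : GIdx n k →₀ ℕ) (he : ∀ a, e a < p) :
    comulHom p n k (divMono p n k e) - splitMono p n k e ∈
      tensorFilt p n k (eDeg p n k e) ((eWt p n k e : ℤ) - 1) := by
  induction hN : e.degree using Nat.strong_induction_on generalizing e with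
  | _ N ih =>
    by_cases h0 : e = 0
    · subst h0
      have : comulHom p n k (divMono p n k 0) - splitMono p n k 0 = 0 := by
        simp [splitMono, divMono_zero, Algebra.TensorProduct.one_def]
      rw [this]
      exact Submodule.zero_mem _
    · obtain ⟨a, ha⟩ : ∃ a, e a ≠ 0 := by
        by_contra h; push Not at h; exact h0 (Finsupp.ext h)
      obtain ⟨f, rfl⟩ : ∃ f, e = f + Finsupp.single a 1 :=
        ⟨e - Finsupp.single a 1,
          (tsub_add_cancel_of_le (Finsupp.single_le_iff.mpr (Nat.one_le_iff_ne_zero.mpr ha))).symm⟩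
      have hf : ∀ b, f b < p := fun b => lt_of_le_of_lt (by simp) (he b)
      have hfa : f a + 1 < p := by simpa using he a
      have h1 := ih f.degree (by rw [← hN, map_add, Finsupp.degree_single]; omega) f hf rfl
      have h2 := sub_mem_mul_tensorFilt (comulHom_genPow_sub_mem (p := p) hkn a) h1
        (genPow_tmul_mem a) (splitMono_mem f)
      rw [← map_mul, genPow_mul_divMono _ _ hfa, splitMono_add_single _ _ hfa, map_smul,
        ← smul_sub] at h2
      have h3 := Submodule.smul_mem _ (f a + 1 : ZMod p)⁻¹ h2
      rw [smul_smul, inv_mul_cancel₀ (natCast_succ_ne_zero hfa), one_smul] at h3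
      rw [map_add, eDeg_single, one_smul, map_add, eWt_single, one_mul, add_comm (eDeg p n k f),
        add_comm (eWt p n k f), Nat.cast_add]
      exact h3

theorem comulHom_mem (hkn : k ≤ n) {t : IDeg p n} {M : ℤ} {x : MoravaAlg p n k}
    (hx : x ∈ filt p n k t M) : comulHom p n k x ∈ tensorFilt p n k t M := by
  rw [filt_eq_span] at hx
  induction hx using Submodule.span_induction with
  | mem x h =>
    obtain ⟨e, rfl, h2, rfl⟩ := h
    have := Submodule.add_mem _ (tensorFilt_mono (by omega) (comulHom_divMono_sub_mem hkn e.1 e.2))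
      (splitMono_mem e.1)
    rw [sub_add_cancel] at this
    exact tensorFilt_mono h2 this
  | zero => rw [map_zero]; exact Submodule.zero_mem _
  | add x y _ _ hx hy => rw [map_add]; exact Submodule.add_mem _ hx hy
  | smul c x _ hx => rw [map_smul]; exact Submodule.smul_mem _ _ hx

end Diagonal

/-! ### The cobar complex as a module of words -/

section CobarWords

variable {p n k : ℕ} [hp : Fact p.Prime] [NeZero n] [NeZero k]

theorem counitHom_genPow (a : GIdx n k) : counitHom p n k (genPow p n k a) = 0 := by
  have h0 : a.1.1 ≠ 0 := by have := NeZero.ne k; have := a.1.2; omega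
  rw [genPow, map_pow, gen_eq_tt, counitHom_tt, Pi.single_eq_of_ne h0,
    zero_pow (pow_pos hp.out.pos _).ne']

theorem counitHom_gmono {e : GIdx n k →₀ ℕ} (he : e ≠ 0) :
    counitHom p n k (gmono p n k e) = 0 := by
  obtain ⟨a, ha⟩ : ∃ a, e a ≠ 0 := by
    by_contra h; push Not at h; exact he (Finsupp.ext h)
  obtain ⟨f, rfl⟩ : ∃ f, e = Finsupp.single a 1 + f :=
    exists_add_of_le (Finsupp.single_le_iff.mpr (Nat.one_le_iff_ne_zero.mpr ha))
  rw [gmono_add, map_mul, gmono_single, pow_one, counitHom_genPow, zero_mul]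

theorem counit_divMono {e : GIdx n k →₀ ℕ} (he : e ≠ 0) :
    Coalgebra.counit (R := ZMod p) (divMono p n k e) = 0 := by
  change counitHom p n k (divMono p n k e) = 0
  rw [divMono, map_smul, counitHom_gmono he, smul_zero]

variable (p n k) in
/-- The divided monomial of a letter, as an element of the augmentation ideal. -/
def augMono (x : Letter p (GIdx n k)) : augIdeal p n k :=
  ⟨divMono p n k x.1, counit_divMono x.2.1⟩

theorem augProj_of_mem (v : augIdeal p n k) : augProj p n k v = v := by
  ext
  rw [augProj_coe, LinearMap.mem_ker.mp v.2, map_zero, sub_zero]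

theorem linearIndependent_augMono : LinearIndependent (ZMod p) (augMono p n k) := by
  have h := (linearIndependent_divMono (p := p) (n := n) (k := k)).comp
    (fun x : Letter p (GIdx n k) => (⟨x.1, x.2.2⟩ : Red p (GIdx n k)))
    (fun x y hxy => Subtype.ext (by simpa only [Subtype.mk.injEq] using hxy))
  exact LinearIndependent.of_comp (Submodule.subtype _) h

theorem span_augMono : ⊤ ≤ Submodule.span (ZMod p) (Set.range (augMono p n k)) := by
  rintro v -
  have h : ∀ x ∈ Submodule.span (ZMod p) (Set.range fun e : Red p (GIdx n k) => divMono p n k e.1),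
      augProj p n k x ∈ Submodule.span (ZMod p) (Set.range (augMono p n k)) := by
    intro x hx
    induction hx using Submodule.span_induction with
    | mem x h =>
      obtain ⟨e, rfl⟩ := h
      by_cases he : e.1 = 0
      · have : augProj p n k (divMono p n k e.1) = 0 := by
          ext
          rw [augProj_coe, he, divMono_zero, Bialgebra.counit_one, map_one, sub_self]
          rfl
        simp only [this]
        exact Submodule.zero_mem _
      · have := augProj_of_mem (augMono p n k ⟨e.1, he, e.2⟩)
        simp only [augMono] at this
        rw [this]
        exact Submodule.subset_span ⟨⟨e.1, he, e.2⟩, rfl⟩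
    | zero => rw [map_zero]; exact Submodule.zero_mem _
    | add x y _ _ hx hy => rw [map_add]; exact Submodule.add_mem _ hx hy
    | smul c x _ hx => rw [map_smul]; exact Submodule.smul_mem _ _ hx
  have := h v (span_divMono (Submodule.mem_top))
  rwa [augProj_of_mem] at this

variable (p n k) in
/-- The basis of the augmentation ideal consisting of divided monomials. -/
def augBasis : Module.Basis (Letter p (GIdx n k)) (ZMod p) (augIdeal p n k) :=
  Module.Basis.mk linearIndependent_augMono span_augMono

theorem bar_divMono (x : Letter p (GIdx n k)) :
    bar p n k (divMono p n k x.1) = TensorAlgebra.ι (ZMod p) (augBasis p n k x) := by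
  rw [bar, LinearMap.comp_apply, augBasis, Module.Basis.mk_apply]
  congr 1
  exact augProj_of_mem (augMono p n k x)

variable (p n k) in
/-- The element of the cobar complex given by a combination of words in divided monomials. -/
def wordCob : WordMod p (GIdx n k) Unit (ZMod p) →ₗ[ZMod p] Cobar p n k :=
  Finsupp.linearCombination (ZMod p) fun q => (q.1.map fun x => bar p n k (divMono p n k x.1)).prod

theorem wordCob_single (l : List (Letter p (GIdx n k))) (u : Unit) :
    wordCob p n k (Finsupp.single (l, u) 1) =
      (l.map fun x => bar p n k (divMono p n k x.1)).prod := by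
  simp [wordCob]

theorem wordCob_consL (x : Letter p (GIdx n k)) (z : WordMod p (GIdx n k) Unit (ZMod p)) :
    wordCob p n k (consL _ _ x z) = bar p n k (divMono p n k x.1) * wordCob p n k z := by
  have : (wordCob p n k).comp (consL _ _ x) =
      (LinearMap.mulLeft (ZMod p) (bar p n k (divMono p n k x.1))).comp (wordCob p n k) := by
    refine wordMod_ext fun l u => ?_
    rw [LinearMap.comp_apply, LinearMap.comp_apply, consL_single, wordCob_single, wordCob_single,
      LinearMap.mulLeft_apply, List.map_cons, List.prod_cons]
  exact LinearMap.congr_fun this z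

theorem bar_divMono_zero : bar p n k (divMono p n k 0) = 0 := by rw [divMono_zero, bar_one]

theorem wordCob_ltr (f : GIdx n k →₀ ℕ) (z : WordMod p (GIdx n k) Unit (ZMod p)) :
    wordCob p n k (ltr p _ _ f z) = bar p n k (divMono p n k f) * wordCob p n k z := by
  by_cases hf : f = 0
  · subst hf
    rw [ltr_zero, bar_divMono_zero, zero_mul, LinearMap.zero_apply, map_zero]
  · by_cases hf' : ∀ a, f a < p
    · exact (congrArg _ (LinearMap.congr_fun (ltr_coe ⟨f, hf, hf'⟩) z)).trans
        (wordCob_consL ⟨f, hf, hf'⟩ z)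
    · rw [ltr_eq_zero_of_not hf', divMono_eq_zero hf', map_zero, zero_mul, LinearMap.zero_apply,
        map_zero]

variable (p n k) in
/-- The sum of the `[y_{e'}|y_{e''}]` with `e' + e'' = e`. -/
def splitBar (e : GIdx n k →₀ ℕ) : Cobar p n k :=
  ∑ ij ∈ Finset.HasAntidiagonal.antidiagonal e,
    bar p n k (divMono p n k ij.1) * bar p n k (divMono p n k ij.2)

theorem wordCob_splitL (f : GIdx n k →₀ ℕ) (z : WordMod p (GIdx n k) Unit (ZMod p)) :
    wordCob p n k (splitL f z) = splitBar p n k f * wordCob p n k z := by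
  rw [splitL_apply, map_sum, splitBar, Finset.sum_mul]
  exact Finset.sum_congr rfl fun ij _ => by rw [wordCob_ltr, wordCob_ltr, mul_assoc]

theorem freeAlgebra_basis_apply {R X : Type*} [CommRing R] (m : FreeMonoid X) :
    FreeAlgebra.basisFreeMonoid R X m = (m.toList.map (FreeAlgebra.ι R)).prod := by
  rw [FreeAlgebra.basisFreeMonoid]
  simp [FreeAlgebra.equivMonoidAlgebraFreeMonoid, FreeMonoid.lift_apply]

theorem wordBasis_apply (l : List (Letter p (GIdx n k))) :
    (augBasis p n k).tensorAlgebra (FreeMonoid.ofList l) =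
      (l.map fun x => bar p n k (divMono p n k x.1)).prod := by
  rw [Module.Basis.tensorAlgebra, Module.Basis.map_apply, freeAlgebra_basis_apply,
    AlgEquiv.toLinearEquiv_apply, map_list_prod, FreeMonoid.toList_ofList, List.map_map]
  congr 1
  refine List.map_congr_left fun x _ => ?_
  rw [bar_divMono, Function.comp_apply]
  exact TensorAlgebra.equivFreeAlgebra_symm_ι _ _

variable (p n k) in
/-- Words in letters are a basis of the cobar complex. -/
def wordEquiv : WordMod p (GIdx n k) Unit (ZMod p) ≃ₗ[ZMod p] Cobar p n k :=
  (Finsupp.domLCongr ((Equiv.prodPUnit _).trans FreeMonoid.ofList) :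
    WordMod p (GIdx n k) Unit (ZMod p) ≃ₗ[ZMod p]
      (FreeMonoid (Letter p (GIdx n k)) →₀ ZMod p)).trans
    (augBasis p n k).tensorAlgebra.repr.symm

theorem wordEquiv_apply (z : WordMod p (GIdx n k) Unit (ZMod p)) :
    wordEquiv p n k z = wordCob p n k z := by
  have : (wordEquiv p n k).toLinearMap = wordCob p n k := by
    refine wordMod_ext fun l u => ?_
    rw [wordCob_single, ← wordBasis_apply]
    simp [wordEquiv]
  exact LinearMap.congr_fun this z

end CobarWords

/-! ### The May filtration of the cobar complex -/

section CobarFiltration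

variable {p n k : ℕ} [hp : Fact p.Prime] [NeZero n] [NeZero k]

variable (p n k) in
/-- The internal degree of a word. -/
def wDeg (l : List (Letter p (GIdx n k))) : IDeg p n := (l.map fun x => eDeg p n k x.1).sum

variable (p n k) in
/-- The filtration of a word. -/
def wWt (l : List (Letter p (GIdx n k))) : ℕ := (l.map fun x => eWt p n k x.1).sum

variable (p n k) in
/-- The words of length `s`, internal degree `t` and filtration at most `M`. -/
def wordsLE (s : ℕ) (t : IDeg p n) (M : ℤ) :
    Submodule (ZMod p) (WordMod p (GIdx n k) Unit (ZMod p)) :=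
  Finsupp.supported _ _ {q | q.1.length = s ∧ wDeg p n k q.1 = t ∧ (wWt p n k q.1 : ℤ) ≤ M}

variable (p n k) in
/-- The words of length `s`, internal degree `t` and filtration equal to `M`. -/
def wordsEq (s : ℕ) (t : IDeg p n) (M : ℤ) :
    Submodule (ZMod p) (WordMod p (GIdx n k) Unit (ZMod p)) :=
  Finsupp.supported _ _ {q | q.1.length = s ∧ wDeg p n k q.1 = t ∧ (wWt p n k q.1 : ℤ) = M}

theorem wDeg_cons (x : Letter p (GIdx n k)) (l : List (Letter p (GIdx n k))) :
    wDeg p n k (x :: l) = eDeg p n k x.1 + wDeg p n k l := by simp [wDeg]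

theorem wWt_cons (x : Letter p (GIdx n k)) (l : List (Letter p (GIdx n k))) :
    wWt p n k (x :: l) = eWt p n k x.1 + wWt p n k l := by simp [wWt]

theorem wordsEq_le {s : ℕ} {t : IDeg p n} {M M' : ℤ} (h : M ≤ M') :
    wordsEq p n k s t M ≤ wordsLE p n k s t M' :=
  Finsupp.supported_mono fun _ hq => ⟨hq.1, hq.2.1, hq.2.2.le.trans h⟩

theorem wordsLE_mono {s : ℕ} {t : IDeg p n} {M M' : ℤ} (h : M ≤ M') :
    wordsLE p n k s t M ≤ wordsLE p n k s t M' :=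
  Finsupp.supported_mono fun _ hq => ⟨hq.1, hq.2.1, hq.2.2.trans h⟩

theorem single_mem_wordsEq (l : List (Letter p (GIdx n k))) (u : Unit) (c : ZMod p) :
    Finsupp.single (l, u) c ∈ wordsEq p n k l.length (wDeg p n k l) (wWt p n k l) :=
  Finsupp.single_mem_supported _ _ ⟨rfl, rfl, rfl⟩

theorem consL_mem_wordsEq (x : Letter p (GIdx n k)) {s : ℕ} {t : IDeg p n} {M : ℤ}
    {z : WordMod p (GIdx n k) Unit (ZMod p)} (hz : z ∈ wordsEq p n k s t M) :
    consL _ _ x z ∈ wordsEq p n k (s + 1) (eDeg p n k x.1 + t) (eWt p n k x.1 + M) := by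
  refine map_mem_of_supported _ _ _ ?_ z hz
  rintro ⟨l, u⟩ ⟨h1, h2, h3⟩
  rw [consL_single]
  refine Finsupp.single_mem_supported _ _ ⟨?_, ?_, ?_⟩
  · rw [List.length_cons]; exact congrArg (· + 1) h1
  · rw [wDeg_cons]; exact congrArg _ h2
  · rw [wWt_cons, Nat.cast_add]; exact congrArg _ h3

theorem ltr_mem_wordsEq (f : GIdx n k →₀ ℕ) {s : ℕ} {t : IDeg p n} {M : ℤ}
    {z : WordMod p (GIdx n k) Unit (ZMod p)} (hz : z ∈ wordsEq p n k s t M) :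
    ltr p _ _ f z ∈ wordsEq p n k (s + 1) (eDeg p n k f + t) (eWt p n k f + M) := by
  rcases ltr_cases (p := p) (K := ZMod p) (Y := Unit) f with h | ⟨x, rfl⟩
  · rw [h]; exact Submodule.zero_mem _
  · rw [ltr_coe]; exact consL_mem_wordsEq x hz

theorem splitL_mem_wordsEq (f : GIdx n k →₀ ℕ) {s : ℕ} {t : IDeg p n} {M : ℤ}
    {z : WordMod p (GIdx n k) Unit (ZMod p)} (hz : z ∈ wordsEq p n k s t M) :
    splitL f z ∈ wordsEq p n k (s + 2) (eDeg p n k f + t) (eWt p n k f + M) := by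
  rw [splitL_apply]
  refine Submodule.sum_mem _ fun ij hij => ?_
  rw [Finset.HasAntidiagonal.mem_antidiagonal] at hij
  have := ltr_mem_wordsEq ij.1 (ltr_mem_wordsEq ij.2 hz)
  rwa [← add_assoc, ← add_assoc, ← map_add, ← Nat.cast_add, ← map_add, hij] at this

/-- The differential of the associated graded complex is homogeneous. -/
theorem cobD_mem_wordsEq {s : ℕ} {t : IDeg p n} {M : ℤ}
    {z : WordMod p (GIdx n k) Unit (ZMod p)} (hz : z ∈ wordsEq p n k s t M) :
    cobD p (GIdx n k) (ZMod p) z ∈ wordsEq p n k (s + 1) t M := by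
  refine map_mem_of_supported _ _ _ ?_ z hz
  rintro ⟨l, u⟩ ⟨h1, h2, h3⟩
  simp only at h1 h2 h3
  subst h1 h2 h3
  clear hz
  induction l with
  | nil => rw [cobD, wordD_nil]; exact Submodule.zero_mem _
  | cons x l ih =>
    rw [← consL_single, cobD, wordD_consL]
    have h1 := splitL_mem_wordsEq x.1 (single_mem_wordsEq (p := p) l u 1)
    have h2 := consL_mem_wordsEq x ih
    rw [← wDeg_cons, ← Nat.cast_add, ← wWt_cons] at h1 h2
    exact Submodule.sub_mem _ (Submodule.neg_mem _ h1) h2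

theorem bar_mono_mem {f : Expo k} (hf : f ≠ 0) : bar p n k (mono p n k f) ∈
    cobarFilt p n k 1 (expDeg p n k f) (expWt p n k f) :=
  Submodule.subset_span ⟨[f], rfl, by simpa using hf, by simp, by simp, by simp⟩

theorem bar_mem {t : IDeg p n} {M : ℤ} {x : MoravaAlg p n k} (hx : x ∈ filt p n k t M) :
    bar p n k x ∈ cobarFilt p n k 1 t M := by
  unfold filt at hx
  induction hx using Submodule.span_induction with
  | mem x h =>
    obtain ⟨e, rfl, h2, rfl⟩ := h
    by_cases he : e = 0
    · have : mono p n k (0 : Expo k) = 1 := by simp [mono]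
      rw [he, this, bar_one]
      exact Submodule.zero_mem _
    · exact cobarFilt_mono h2 (bar_mono_mem he)
  | zero => rw [map_zero]; exact Submodule.zero_mem _
  | add x y _ _ hx hy => rw [map_add]; exact Submodule.add_mem _ hx hy
  | smul c x _ hx => rw [map_smul]; exact Submodule.smul_mem _ _ hx

theorem bar_divMono_mem (e : GIdx n k →₀ ℕ) : bar p n k (divMono p n k e) ∈
    cobarFilt p n k 1 (eDeg p n k e) (eWt p n k e) := bar_mem (divMono_mem_filt e rfl le_rfl)

theorem wordCob_single_mem (l : List (Letter p (GIdx n k))) (u : Unit) :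
    wordCob p n k (Finsupp.single (l, u) 1) ∈
      cobarFilt p n k l.length (wDeg p n k l) (wWt p n k l) := by
  induction l with
  | nil => rw [wordCob_single]; exact one_mem_cobarFilt
  | cons x l ih =>
    rw [← consL_single, wordCob_consL, wDeg_cons, wWt_cons, Nat.cast_add, List.length_cons,
      add_comm l.length]
    exact mul_mem_cobarFilt (bar_divMono_mem x.1) ih

theorem wordCob_mem {s : ℕ} {t : IDeg p n} {M : ℤ} {z : WordMod p (GIdx n k) Unit (ZMod p)}
    (hz : z ∈ wordsLE p n k s t M) : wordCob p n k z ∈ cobarFilt p n k s t M := by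
  refine map_mem_of_supported _ _ _ ?_ z hz
  rintro ⟨l, u⟩ ⟨h1, h2, h3⟩
  simp only at h1 h2 h3
  subst h1 h2
  exact cobarFilt_mono h3 (wordCob_single_mem l u)

theorem ltr_mem_wordsLE (f : GIdx n k →₀ ℕ) {s : ℕ} {t : IDeg p n} {M : ℤ}
    {z : WordMod p (GIdx n k) Unit (ZMod p)} (hz : z ∈ wordsLE p n k s t M) :
    ltr p _ _ f z ∈ wordsLE p n k (s + 1) (eDeg p n k f + t) (eWt p n k f + M) := by
  refine map_mem_of_supported _ _ _ ?_ z hz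
  rintro ⟨l, u⟩ ⟨h1, h2, h3⟩
  simp only at h1 h2 h3
  subst h1 h2
  exact wordsEq_le (by omega) (ltr_mem_wordsEq f (single_mem_wordsEq l u 1))

/-- The filtration of the cobar complex in terms of words in divided monomials. -/
theorem exists_wordCob {s : ℕ} {t : IDeg p n} {M : ℤ} {x : Cobar p n k}
    (hx : x ∈ cobarFilt p n k s t M) : ∃ z ∈ wordsLE p n k s t M, wordCob p n k z = x := by
  suffices h : cobarFilt p n k s t M ≤ (wordsLE p n k s t M).map (wordCob p n k) from h hx
  refine Submodule.span_le.mpr ?_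
  rintro _ ⟨l, rfl, h1, rfl, h3, rfl⟩
  have key : ∃ z ∈ wordsLE p n k l.length (l.map (expDeg p n k)).sum
      ((l.map (expWt p n k)).sum : ℤ), wordCob p n k z =
        (l.map fun e => bar p n k (mono p n k e)).prod := by
    clear h3 hx
    induction l with
    | nil =>
      exact ⟨Finsupp.single ([], ()) 1, wordsEq_le le_rfl (single_mem_wordsEq [] () 1), by
        rw [wordCob_single]; rfl⟩
    | cons f l ih =>
      obtain ⟨z, hz, hz'⟩ := ih fun e he => h1 e (List.mem_cons_of_mem _ he)
      obtain ⟨e, e1, e2, e3, -⟩ := exists_red (p := p) (n := n) f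
      refine ⟨(e.1.prod fun _ m => ((m.factorial : ℕ) : ZMod p)) • ltr p _ _ e.1 z, ?_, ?_⟩
      · have := Submodule.smul_mem _ (e.1.prod fun _ m => ((m.factorial : ℕ) : ZMod p))
          (ltr_mem_wordsLE e.1 hz)
        rw [List.length_cons, List.map_cons, List.sum_cons, List.map_cons, List.sum_cons, ← e2]
        refine Finsupp.supported_mono ?_ this
        rintro q ⟨q1, q2, q3⟩
        refine ⟨q1, q2, q3.trans ?_⟩
        push_cast at e3 ⊢
        omega
      · rw [map_smul, wordCob_ltr, List.map_cons, List.prod_cons, ← smul_mul_assoc, ← map_smul,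
          ← gmono_eq_smul, e1, hz']
  obtain ⟨z, hz, hz'⟩ := key
  exact ⟨z, wordsLE_mono h3 hz, hz'⟩

variable (p n k) in
/-- The map `x ⊗ y ↦ [x|y]`. -/
def barTensor : MoravaAlg p n k ⊗[ZMod p] MoravaAlg p n k →ₗ[ZMod p] Cobar p n k :=
  (LinearMap.mul' (ZMod p) (Cobar p n k)).comp (TensorProduct.map (bar p n k) (bar p n k))

theorem barTensor_mem {t : IDeg p n} {M : ℤ} {x : MoravaAlg p n k ⊗[ZMod p] MoravaAlg p n k}
    (hx : x ∈ tensorFilt p n k t M) : barTensor p n k x ∈ cobarFilt p n k 2 t M := by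
  refine Submodule.span_induction (p := fun x _ => barTensor p n k x ∈ cobarFilt p n k 2 t M)
    ?_ ?_ ?_ ?_ hx
  · rintro _ ⟨e, f, rfl, h2, rfl⟩
    have h := mul_mem_cobarFilt (bar_mem (p := p) (n := n) (Submodule.subset_span ⟨e, rfl, le_rfl, rfl⟩))
      (bar_mem (Submodule.subset_span ⟨f, rfl, le_rfl, rfl⟩))
    exact cobarFilt_mono h2 h
  · rw [map_zero]; exact Submodule.zero_mem _
  · intro x y _ _ hx hy
    rw [map_add]; exact Submodule.add_mem _ hx hy
  · intro c x _ hx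
    rw [map_smul]; exact Submodule.smul_mem _ _ hx

theorem redComul_sub_mem (hkn : k ≤ n) (e : GIdx n k →₀ ℕ) (he : ∀ a, e a < p) :
    redComul p n k (divMono p n k e) - splitBar p n k e ∈
      cobarFilt p n k 2 (eDeg p n k e) ((eWt p n k e : ℤ) - 1) := by
  have h := barTensor_mem (comulHom_divMono_sub_mem hkn e he)
  have e1 : barTensor p n k (splitMono p n k e) = splitBar p n k e := by
    rw [splitMono, map_sum, splitBar]
    rfl
  rw [map_sub, e1] at h
  exact h

/-- Up to lower filtration, the differential of the cobar complex is the one of the associated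
graded complex. -/
theorem cobarD_wordCob_sub_mem (hkn : k ≤ n) {s : ℕ} {t : IDeg p n} {M : ℤ}
    {z : WordMod p (GIdx n k) Unit (ZMod p)} (hz : z ∈ wordsLE p n k s t M) :
    cobarD p n k (wordCob p n k z) - wordCob p n k (cobD p (GIdx n k) (ZMod p) z) ∈
      cobarFilt p n k (s + 1) t (M - 1) := by
  refine map_mem_of_supported ((cobarD p n k).comp (wordCob p n k) -
    (wordCob p n k).comp (cobD p (GIdx n k) (ZMod p))) _ (cobarFilt p n k (s + 1) t (M - 1)) ?_ z hz
  rintro ⟨l, u⟩ ⟨h1, h2, h3⟩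
  simp only at h1 h2 h3
  subst h1 h2
  refine cobarFilt_mono (sub_le_sub_right h3 1) ?_
  clear h3 hz
  rw [LinearMap.sub_apply, LinearMap.comp_apply, LinearMap.comp_apply]
  induction l with
  | nil =>
    rw [cobD, wordD_nil, wordCob_single, List.map_nil, List.prod_nil, cobarD_one, map_zero, sub_zero]
    exact Submodule.zero_mem _
  | cons x l ih =>
    rw [← consL_single, cobD, wordD_consL, wordCob_consL, map_sub, map_neg, wordCob_splitL,
      wordCob_consL, ← cobD, cobarD_mul, cobarSgn_bar, cobarD_bar]
    have e : ∀ a b c d f g : Cobar p n k, -a * b + -c * d - (-(f * b) - c * g) =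
        -((a - f) * b) - c * (d - g) := fun a b c d f g => by noncomm_ring
    rw [e]
    have h1 := mul_mem_cobarFilt (redComul_sub_mem (p := p) hkn x.1 x.2.2)
      (wordCob_single_mem l u)
    have h2 := mul_mem_cobarFilt (bar_divMono_mem x.1) ih
    rw [wDeg_cons, wWt_cons, List.length_cons, Nat.cast_add]
    rw [show 2 + l.length = l.length + 1 + 1 by ring,
      show (eWt p n k x.1 : ℤ) - 1 + wWt p n k l = eWt p n k x.1 + wWt p n k l - 1 by ring] at h1
    rw [show 1 + (l.length + 1) = l.length + 1 + 1 by ring, ← add_sub_assoc] at h2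
    exact Submodule.sub_mem _ (Submodule.neg_mem _ h1) h2

/-- The filtration submodules of the cobar complex are subcomplexes. -/
theorem cobarD_mem (hkn : k ≤ n) {s : ℕ} {t : IDeg p n} {M : ℤ} {x : Cobar p n k}
    (hx : x ∈ cobarFilt p n k s t M) : cobarD p n k x ∈ cobarFilt p n k (s + 1) t M := by
  obtain ⟨z, hz, rfl⟩ := exists_wordCob hx
  have h1 : _ ∈ cobarFilt p n k (s + 1) t M :=
    cobarFilt_mono (by omega : M - 1 ≤ M) (cobarD_wordCob_sub_mem hkn hz)
  have h2 : cobD p (GIdx n k) (ZMod p) z ∈ wordsLE p n k (s + 1) t M := by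
    refine map_mem_of_supported _ _ _ ?_ z hz
    rintro ⟨l, u⟩ ⟨h1, h2, h3⟩
    simp only at h1 h2 h3
    subst h1 h2
    exact wordsEq_le h3 (cobD_mem_wordsEq (single_mem_wordsEq l u 1))
  have := Submodule.add_mem _ h1 (wordCob_mem h2)
  rwa [sub_add_cancel] at this

theorem range_pow_le (s : ℕ) :
    LinearMap.range (TensorAlgebra.ι (ZMod p) (M := augIdeal p n k)) ^ s ≤
      (Finsupp.supported (ZMod p) (ZMod p)
        {q : List (Letter p (GIdx n k)) × Unit | q.1.length = s}).map (wordCob p n k) := by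
  induction s with
  | zero =>
    rw [pow_zero, Submodule.one_eq_span, Submodule.span_singleton_le_iff_mem]
    exact ⟨Finsupp.single ([], ()) 1, Finsupp.single_mem_supported _ _ rfl, by
      rw [wordCob_single]; rfl⟩
  | succ s ih =>
    rw [pow_succ', Submodule.mul_le]
    rintro _ ⟨v, rfl⟩ y hy
    obtain ⟨z, hz, rfl⟩ := ih hy
    have hv : v ∈ Submodule.span (ZMod p) (Set.range (augBasis p n k)) := by
      rw [(augBasis p n k).span_eq]; trivial
    induction hv using Submodule.span_induction with
    | mem v h =>
      obtain ⟨x, rfl⟩ := h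
      rw [← bar_divMono, ← wordCob_consL]
      refine ⟨_, ?_, rfl⟩
      refine map_mem_of_supported (consL _ _ x) _ _ ?_ z hz
      rintro ⟨l, u⟩ h
      rw [consL_single]
      exact Finsupp.single_mem_supported _ _ (congrArg (· + 1) h)
    | zero => rw [map_zero, zero_mul]; exact Submodule.zero_mem _
    | add x y _ _ hx hy => rw [map_add, add_mul]; exact Submodule.add_mem _ hx hy
    | smul c x _ hx => rw [map_smul, smul_mul_assoc]; exact Submodule.smul_mem _ _ hx

/-- The filtration of the part of tensor degree `s` of the cobar complex is exhaustive. -/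
theorem iSup_cobarDeg (s : ℕ) : ⨆ t, cobarDeg p n k s t =
    LinearMap.range (TensorAlgebra.ι (ZMod p) (M := augIdeal p n k)) ^ s := by
  refine le_antisymm (iSup_le fun t => iSup_le fun M => Submodule.span_le.mpr ?_) ?_
  · rintro _ ⟨l, rfl, -, -, -, rfl⟩
    induction l with
    | nil => exact Submodule.one_le.mp le_rfl
    | cons e l ih =>
      rw [List.map_cons, List.prod_cons, List.length_cons, pow_succ']
      exact Submodule.mul_mem_mul ⟨_, rfl⟩ ih
  · refine (range_pow_le s).trans ?_
    rintro _ ⟨z, hz, rfl⟩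
    refine map_mem_of_supported _ _ _ ?_ z hz
    rintro ⟨l, u⟩ h
    refine Submodule.mem_iSup_of_mem (wDeg p n k l) (Submodule.mem_iSup_of_mem (wWt p n k l) ?_)
    have := wordCob_single_mem (p := p) l u
    rwa [show l.length = s from h] at this

end CobarFiltration

/-! ### Direct sums of subquotients -/

section SubquotientSystem

namespace SubquotientSystem

variable {R A ι : Type*} [CommRing R] [Ring A] [Algebra R A] [AddMonoid ι] [DecidableEq ι]
  (Q : SubquotientSystem R A ι)

theorem sym_congr {i j : ι} (h : i = j) {x : Q.Z i} {y : Q.Z j} (hxy : (x : A) = y) :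
    Q.sym i x = Q.sym j y := by
  subst h
  rw [Subtype.ext hxy]

theorem cls_eq_zero {i : ι} {x : Q.Z i} : Q.cls i x = 0 ↔ (x : A) ∈ Q.B i :=
  Submodule.Quotient.mk_eq_zero _

theorem sym_apply_self (i : ι) (x : Q.Z i) : Q.sym i x i = Q.cls i x :=
  DirectSum.lof_apply R i (Q.cls i x)

theorem sym_apply_of_ne {i j : ι} (h : i ≠ j) (x : Q.Z i) : Q.sym i x j = 0 :=
  DirectSum.of_eq_of_ne i j _ (Ne.symm h)

theorem sym_eq_zero {i : ι} {x : Q.Z i} : Q.sym i x = 0 ↔ (x : A) ∈ Q.B i := by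
  rw [← Q.cls_eq_zero]
  constructor
  · intro h
    rw [← Q.sym_apply_self, h]; rfl
  · intro h
    rw [sym, LinearMap.comp_apply, h, map_zero]

theorem total_induction {P : Q.Total → Prop} (h0 : P 0) (hs : ∀ i x, P (Q.sym i x))
    (ha : ∀ x y, P x → P y → P (x + y)) (x : Q.Total) : P x := by
  induction x using DirectSum.induction_on with
  | zero => exact h0
  | of i x => obtain ⟨x, rfl⟩ := Q.exists_cls x; exact hs i x
  | add x y hx hy => exact ha x y hx hy

/-- An element of the direct sum is the sum of the classes of its components. -/
theorem exists_eq_sum_sym (x : Q.Total) (z : ∀ i, Q.Z i) (hz : ∀ i, Q.cls i (z i) = x i) :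
    ∃ S : Finset ι, (∀ i ∉ S, x i = 0) ∧ x = ∑ i ∈ S, Q.sym i (z i) := by
  classical
  refine ⟨DFinsupp.support x, fun i hi => DFinsupp.notMem_support_iff.mp hi, ?_⟩
  conv_lhs => rw [← DirectSum.sum_support_of x]
  refine Finset.sum_congr rfl fun i _ => ?_
  rw [← hz]
  rfl

theorem sum_sym_apply (S : Finset ι) (z : ∀ i, Q.Z i) {i : ι} (hi : i ∈ S) :
    (∑ j ∈ S, Q.sym j (z j) : Q.Total) i = Q.cls i (z i) := by
  rw [DirectSum.sum_apply, Finset.sum_eq_single i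
    (fun j _ hj => Q.sym_apply_of_ne hj _) (fun h => absurd hi h), Q.sym_apply_self]

theorem sym_cast {i j : ι} (h : i = j) (x : Q.Z i) (hx : (x : A) ∈ Q.Z j) :
    Q.sym i x = Q.sym j ⟨x, hx⟩ := Q.sym_congr h rfl

theorem neg_one_pow_mul_sym (s : ℕ) {i : ι} (x : Q.Z i) (y : Q.Z i)
    (h : (y : A) = (-1) ^ s * x) : (-1) ^ s * Q.sym i x = Q.sym i y := by
  rcases neg_one_pow_eq_or A s with h1 | h1 <;> rcases Nat.even_or_odd s with h2 | h2
  · rw [h2.neg_one_pow, one_mul]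
    exact Q.sym_congr rfl (by rw [h, h1, one_mul])
  · rw [h2.neg_one_pow, neg_one_mul, ← map_neg]
    rw [h2.neg_one_pow, neg_one_mul] at h
    exact Q.sym_congr rfl h.symm
  · rw [h2.neg_one_pow, one_mul]
    rw [h2.neg_one_pow, one_mul] at h
    exact Q.sym_congr rfl h.symm
  · rw [h2.neg_one_pow, neg_one_mul, ← map_neg]
    rw [h2.neg_one_pow, neg_one_mul] at h
    exact Q.sym_congr rfl h.symm

theorem map_sym_mul_sym (D : Q.Total →ₗ[R] Q.Total) (s : ℕ) {i j i' j' l : ι} (x : Q.Z i) (y : Q.Z j)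
    (dx : Q.Z i') (dy : Q.Z j') (dxy : Q.Z l) (hx : D (Q.sym i x) = Q.sym i' dx)
    (hy : D (Q.sym j y) = Q.sym j' dy)
    (hxy : D (Q.sym (i + j) ⟨x * y, Q.mul_mem x.2 y.2⟩) = Q.sym l dxy) (h1 : i' + j = l)
    (h2 : i + j' = l) (hd : (dxy : A) = dx * y + (-1) ^ s * (x * dy)) :
    D (Q.sym i x * Q.sym j y) =
      D (Q.sym i x) * Q.sym j y + (-1) ^ s * (Q.sym i x * D (Q.sym j y)) := by
  have m1 := Q.mul_mem dx.2 y.2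
  have m2 := Q.mul_mem x.2 dy.2
  have m1' := m1
  have m2' := m2
  rw [h1] at m1'
  rw [h2] at m2'
  have m3 : (-1) ^ s * ((x : A) * dy) ∈ Q.Z l := by
    rcases neg_one_pow_eq_or A s with h | h <;> rw [h]
    · rwa [one_mul]
    · rw [neg_one_mul]; exact Submodule.neg_mem _ m2'
  rw [hx, hy, sym_mul, sym_mul, sym_mul, hxy, Q.sym_cast h1 ⟨_, m1⟩ m1', Q.sym_cast h2 ⟨_, m2⟩ m2',
    Q.neg_one_pow_mul_sym s _ ⟨_, m3⟩ rfl, ← map_add]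
  exact Q.sym_congr rfl hd

/-- A criterion for `Q'.Total` to be the homology of `Q.Total` with respect to a homogeneous
differential `D`. -/
theorem exists_homology_equiv (Q' : SubquotientSystem R A ι) (D : Q.Total →ₗ[R] Q.Total)
    (hZ : ∀ i, Q'.Z i ≤ Q.Z i)
    (hD : ∀ i (z : Q'.Z i), D (Q.sym i ⟨z, hZ i z.2⟩) = 0)
    (hB : ∀ i (z : Q'.Z i), (z : A) ∈ Q'.B i ↔ Q.sym i ⟨z, hZ i z.2⟩ ∈ LinearMap.range D)
    (hr : ∀ y i, DirectSum.lof R ι Q.Piece i (D y i) ∈ LinearMap.range D)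
    (hs : ∀ u, D u = 0 → ∀ i, ∃ z : Q'.Z i, Q.cls i ⟨z, hZ i z.2⟩ = u i) :
    ∃ φ : Q'.Total ≃ₗ[R]
        LinearMap.ker D ⧸ (LinearMap.range D).submoduleOf (LinearMap.ker D),
      ∀ i (z : Q'.Z i), ∃ (hz : (z : A) ∈ Q.Z i) (hd : Q.sym i ⟨z, hz⟩ ∈ LinearMap.ker D),
        φ (Q'.sym i z) = Submodule.Quotient.mk ⟨_, hd⟩ := by
  let T : ∀ i, Q'.Z i →ₗ[R] LinearMap.ker D := fun i =>
    LinearMap.codRestrict (LinearMap.ker D) ((Q.sym i).comp (Submodule.inclusion (hZ i)))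
      fun z => LinearMap.mem_ker.mpr (hD i z)
  let N := (LinearMap.range D).submoduleOf (LinearMap.ker D)
  let ψ : Q'.Total →ₗ[R] LinearMap.ker D ⧸ N :=
    DirectSum.toModule R ι _ fun i => Submodule.liftQ _ (N.mkQ.comp (T i)) (by
      intro z hz
      rw [LinearMap.mem_ker, LinearMap.comp_apply, Submodule.mkQ_apply,
        Submodule.Quotient.mk_eq_zero]
      exact (hB i z).mp hz)
  have hψ : ∀ i z, ψ (Q'.sym i z) = N.mkQ (T i z) := by
    intro i z
    exact DirectSum.toModule_lof R (M := Q'.Piece) (φ := fun i => Submodule.liftQ _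
      (N.mkQ.comp (T i)) (fun z hz => by
        rw [LinearMap.mem_ker, LinearMap.comp_apply, Submodule.mkQ_apply,
          Submodule.Quotient.mk_eq_zero]
        exact (hB i z).mp hz)) i (Q'.cls i z)
  have hinj : Function.Injective ψ := by
    rw [injective_iff_map_eq_zero]
    intro x hx
    choose z hz using fun i => Q'.exists_cls (x i)
    obtain ⟨S, hS, e⟩ := Q'.exists_eq_sum_sym x z hz
    have h1 : ∑ i ∈ S, Q.sym i ⟨z i, hZ i (z i).2⟩ ∈ LinearMap.range D := by
      rw [e, map_sum, Finset.sum_congr rfl fun i _ => hψ i (z i), ← map_sum, Submodule.mkQ_apply,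
        Submodule.Quotient.mk_eq_zero] at hx
      have hx' : ((∑ i ∈ S, T i (z i) : LinearMap.ker D) : Q.Total) ∈ LinearMap.range D := hx
      rwa [Submodule.coe_sum] at hx'
    obtain ⟨y, hy⟩ := h1
    refine DFinsupp.ext fun i => ?_
    by_cases hi : i ∈ S
    · have h2 := hr y i
      rw [hy, Q.sum_sym_apply S (fun i => ⟨z i, hZ i (z i).2⟩) hi] at h2
      rw [← hz i]
      exact Q'.cls_eq_zero.mpr ((hB i (z i)).mpr h2)
    · exact hS i hi
  have hsurj : Function.Surjective ψ := by
    intro v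
    obtain ⟨⟨u, hu⟩, rfl⟩ := Submodule.mkQ_surjective _ v
    choose z hz using hs u hu
    obtain ⟨S, -, e⟩ := Q.exists_eq_sum_sym u (fun i => ⟨z i, hZ i (z i).2⟩) hz
    refine ⟨∑ i ∈ S, Q'.sym i (z i), ?_⟩
    rw [map_sum, Finset.sum_congr rfl fun i _ => hψ i (z i), ← map_sum]
    refine congrArg _ (Subtype.ext ?_)
    rw [Submodule.coe_sum]
    exact e.symm
  exact ⟨LinearEquiv.ofBijective ψ ⟨hinj, hsurj⟩, fun i z => ⟨hZ i z.2, hD i z, hψ i z⟩⟩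

end SubquotientSystem

end SubquotientSystem

/-! ### The pages of the spectral sequence -/

section SpectralSequence

variable {p n k : ℕ} [hp : Fact p.Prime] [NeZero n] [NeZero k]

theorem pageD_sym (r : ℕ) (s : ℕ) (t : IDeg p n) (M : ℤ) (z : (page p n k r).Z (s, t, M)) :
    pageD p n k r ((page p n k r).sym (s, t, M) z) =
      (page p n k r).sym (s + 1, t, M - r) (pageDCycles p n k r s t M z) := by
  rw [pageD, SubquotientSystem.sym, LinearMap.comp_apply, DirectSum.toModule_lof]
  rfl

theorem pageDCycles_coe (r : ℕ) (s : ℕ) (t : IDeg p n) (M : ℤ)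
    (z : (page p n k r).Z (s, t, M)) :
    (pageDCycles p n k r s t M z : Cobar p n k) = cobarD p n k z := rfl

theorem pageD_represents (r : ℕ) (s : ℕ) (t : IDeg p n) (M : ℤ)
    (z : (page p n k r).Z (s, t, M)) : (page p n k r).Represents (s + 1, t, M - r)
      (cobarD p n k z) (pageD p n k r ((page p n k r).sym (s, t, M) z)) :=
  ⟨cobarD_mem_pageZ (i := (s, t, M)) z.2, (pageD_sym r s t M z).symm⟩

theorem pageD_pageD (r : ℕ) (x : PageTotal p n k r) : pageD p n k r (pageD p n k r x) = 0 := by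
  induction x using SubquotientSystem.total_induction with
  | h0 => rw [map_zero, map_zero]
  | hs i x =>
    obtain ⟨s, t, M⟩ := i
    rw [pageD_sym, pageD_sym, SubquotientSystem.sym_eq_zero]
    have : ((pageDCycles p n k r (s + 1) t (M - r) (pageDCycles p n k r s t M x) :
      (page p n k r).Z _) : Cobar p n k) = 0 := cobarD_cobarD _
    rw [this]
    exact Submodule.zero_mem _
  | ha x y hx hy => rw [map_add, map_add, hx, hy, add_zero]

theorem tri_add (s s' : ℕ) (t t' : IDeg p n) (M M' : ℤ) :
    ((s, t, M) : Tri p n) + (s', t', M') = (s + s', t + t', M + M') := rfl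

theorem mul_mem_pageZ (r : ℕ) {s s' : ℕ} {t t' : IDeg p n} {M M' : ℤ}
    (x : (page p n k r).Z (s, t, M)) (y : (page p n k r).Z (s', t', M')) :
    (x * y : Cobar p n k) ∈ (page p n k r).Z (s + s', t + t', M + M') := by
  have := (page p n k r).mul_mem x.2 y.2
  rwa [tri_add] at this

theorem pageD_mul_sym (r : ℕ) {s s' : ℕ} {t t' : IDeg p n} {M M' : ℤ}
    (x : (page p n k r).Z (s, t, M)) (y : (page p n k r).Z (s', t', M')) :
    pageD p n k r ((page p n k r).sym (s, t, M) x * (page p n k r).sym (s', t', M') y) =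
      pageD p n k r ((page p n k r).sym (s, t, M) x) * (page p n k r).sym (s', t', M') y +
        (-1) ^ s * ((page p n k r).sym (s, t, M) x *
          pageD p n k r ((page p n k r).sym (s', t', M') y)) := by
  have h0 := mul_mem_pageZ r x y
  have hx : (x : Cobar p n k) ∈ cobarFilt p n k s t M := (mem_pageZ.mp x.2).1
  have e : pageD p n k r ((page p n k r).sym ((s, t, M) + (s', t', M'))
      ⟨x * y, (page p n k r).mul_mem x.2 y.2⟩) =
        (page p n k r).sym (s + s' + 1, t + t', M + M' - r)
          (pageDCycles p n k r (s + s') (t + t') (M + M') ⟨x * y, h0⟩) := by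
    rw [← pageD_sym]
    exact congrArg _ ((page p n k r).sym_congr (tri_add s s' t t' M M') rfl)
  refine (page p n k r).map_sym_mul_sym (pageD p n k r) s (l := (s + s' + 1, t + t', M + M' - r))
    x y _ _ (pageDCycles p n k r (s + s') (t + t') (M + M') ⟨x * y, h0⟩)
    (pageD_sym r s t M x) (pageD_sym r s' t' M' y) e ?_ ?_ ?_
  · rw [tri_add, add_right_comm, sub_add_eq_add_sub]
  · rw [tri_add, ← add_sub_assoc, add_assoc]
  · rw [pageDCycles_coe, pageDCycles_coe, pageDCycles_coe, cobarD_mul_of_mem hx]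

theorem pageD_mul (r : ℕ) (s : ℕ) (t : IDeg p n) (M : ℤ) (x : (page p n k r).Z (s, t, M))
    (y : PageTotal p n k r) : pageD p n k r ((page p n k r).sym (s, t, M) x * y) =
      pageD p n k r ((page p n k r).sym (s, t, M) x) * y +
        (-1) ^ s * ((page p n k r).sym (s, t, M) x * pageD p n k r y) := by
  generalize hu : (page p n k r).sym (s, t, M) x = u
  induction y using SubquotientSystem.total_induction with
  | h0 => simp only [map_zero, mul_zero, add_zero]
  | ha y y' hy hy' => rw [mul_add, map_add, hy, hy', map_add, mul_add, mul_add, mul_add]; abel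
  | hs i y => rw [← hu]; exact pageD_mul_sym r x y

theorem pageZ_mono {r r' : ℤ} {s : ℕ} {t : IDeg p n} {M M' : ℤ} (h : M ≤ M')
    (h' : M - r ≤ M' - r') : pageZ p n k r (s, t, M) ≤ pageZ p n k r' (s, t, M') := by
  intro x hx
  rw [mem_pageZ] at hx ⊢
  exact ⟨cobarFilt_mono h hx.1, cobarFilt_mono h' hx.2⟩

theorem mem_pageB_of_mem {r : ℤ} {s : ℕ} {t : IDeg p n} {M : ℤ} {x : Cobar p n k}
    (h : x ∈ pageZ p n k (r - 1) (s, t, M - 1)) : x ∈ pageB p n k r (s, t, M) :=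
  mem_pageB.mpr ⟨x, h, 0, Or.inl rfl, by rw [map_zero, add_zero]⟩

theorem pageZ_succ_le (r : ℕ) (i : Tri p n) :
    pageZ p n k ((r + 1 : ℕ) : ℤ) i ≤ pageZ p n k r i := by
  obtain ⟨s, t, M⟩ := i
  exact pageZ_mono le_rfl (by push_cast; omega)

theorem pageD_sym_eq_zero (r : ℕ) (i : Tri p n) (z : (page p n k r).Z i)
    (hz : (z : Cobar p n k) ∈ pageZ p n k ((r + 1 : ℕ) : ℤ) i) :
    pageD p n k r ((page p n k r).sym i z) = 0 := by
  obtain ⟨s, t, M⟩ := i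
  rw [pageD_sym, SubquotientSystem.sym_eq_zero, pageDCycles_coe]
  have hz := (mem_pageZ.mp hz).2
  have h : cobarD p n k z ∈ pageZ p n k ((r : ℤ) - 1) (s + 1, t, M - r - 1) := by
    rw [mem_pageZ, cobarD_cobarD]
    refine ⟨cobarFilt_mono ?_ hz, Submodule.zero_mem _⟩
    push_cast; omega
  exact mem_pageB_of_mem h

theorem pageDPiece_cls (r : ℕ) (s : ℕ) (t : IDeg p n) (M : ℤ) (z : (page p n k r).Z (s, t, M)) :
    pageDPiece p n k r s t M ((page p n k r).cls _ z) =
      (page p n k r).cls (s + 1, t, M - r) (pageDCycles p n k r s t M z) := rfl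

theorem pageD_apply_succ (r : ℕ) (x : PageTotal p n k r) (s : ℕ) (t : IDeg p n) (M : ℤ) :
    pageD p n k r x (s + 1, t, M - r) = pageDPiece p n k r s t M (x (s, t, M)) := by
  induction x using SubquotientSystem.total_induction with
  | h0 => rw [map_zero, DirectSum.zero_apply, DirectSum.zero_apply, map_zero]
  | hs i y =>
    obtain ⟨s', t', M'⟩ := i
    rw [pageD_sym]
    by_cases h : ((s', t', M') : Tri p n) = (s, t, M)
    · obtain ⟨rfl, rfl, rfl⟩ : s' = s ∧ t' = t ∧ M' = M := by simpa using h
      rw [SubquotientSystem.sym_apply_self, SubquotientSystem.sym_apply_self, pageDPiece_cls]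
    · rw [SubquotientSystem.sym_apply_of_ne _ h, map_zero, SubquotientSystem.sym_apply_of_ne]
      intro h'
      refine h ?_
      simpa using h'
  | ha x y hx hy => rw [map_add, DirectSum.add_apply, DirectSum.add_apply, map_add, hx, hy]

theorem pageD_apply (r : ℕ) (x : PageTotal p n k r) (s : ℕ) (t : IDeg p n) (M : ℤ)
    (z : (page p n k r).Z (s, t, M)) (hz : (page p n k r).cls _ z = x (s, t, M)) :
    pageD p n k r x (s + 1, t, M - r) =
      (page p n k r).cls (s + 1, t, M - r) (pageDCycles p n k r s t M z) := by
  rw [pageD_apply_succ, ← hz, pageDPiece_cls]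

theorem pageD_apply_zero (r : ℕ) (x : PageTotal p n k r) (t : IDeg p n) (M : ℤ) :
    pageD p n k r x (0, t, M) = 0 := by
  induction x using SubquotientSystem.total_induction with
  | h0 => rw [map_zero]; rfl
  | hs i y =>
    obtain ⟨s', t', M'⟩ := i
    rw [pageD_sym, SubquotientSystem.sym_apply_of_ne]
    intro h
    simpa using congrArg Prod.fst h
  | ha x y hx hy => rw [map_add, DirectSum.add_apply, hx, hy, add_zero]

/-- The image of `d_r` is generated by homogeneous elements. -/
theorem lof_pageD_mem_range (r : ℕ) (x : PageTotal p n k r) (i : Tri p n) :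
    DirectSum.lof (ZMod p) (Tri p n) (page p n k r).Piece i (pageD p n k r x i) ∈
      LinearMap.range (pageD p n k r) := by
  obtain ⟨s, t, M⟩ := i
  cases s with
  | zero => rw [pageD_apply_zero, map_zero]; exact Submodule.zero_mem _
  | succ s =>
    obtain ⟨M, rfl⟩ : ∃ M', M = M' - r := ⟨M + r, by ring⟩
    obtain ⟨z, hz⟩ := (page p n k r).exists_cls (x (s, t, M))
    rw [pageD_apply r x s t M z hz]
    exact ⟨_, pageD_sym r s t M z⟩

/-- The elements of `B_{r+1}` are the elements of `Z_{r+1}` representing boundaries on `E_r`. -/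
theorem mem_pageB_succ_iff (r : ℕ) (i : Tri p n) (z : (page p n k (r + 1)).Z i) :
    (z : Cobar p n k) ∈ (page p n k (r + 1)).B i ↔
      (page p n k r).sym i ⟨z, pageZ_succ_le r i z.2⟩ ∈ LinearMap.range (pageD p n k r) := by
  obtain ⟨s, t, M⟩ := i
  obtain ⟨z, hzZ⟩ := z
  constructor
  · intro h
    obtain ⟨a, ha, w, hw, hz⟩ := mem_pageB.mp h
    have e1 : ((r + 1 : ℕ) : ℤ) - 1 = r := by push_cast; ring
    rw [e1] at ha hw
    have ha' : a ∈ pageB p n k r (s, t, M) :=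
      mem_pageB_of_mem (pageZ_mono le_rfl (by omega) ha)
    rcases hw with rfl | ⟨s, rfl, hw⟩
    · rw [map_zero, add_zero] at hz
      subst hz
      have : (page p n k r).sym (s, t, M) ⟨a, pageZ_succ_le r _ hzZ⟩ = 0 :=
        (page p n k r).sym_eq_zero.mpr ha'
      rw [this]
      exact Submodule.zero_mem _
    · refine ⟨(page p n k r).sym (s, t, M + r) ⟨w, hw⟩, ?_⟩
      rw [pageD_sym, ← sub_eq_zero, (page p n k r).sym_cast
        (show ((s + 1, t, M + r - r) : Tri p n) = (s + 1, t, M) by rw [add_sub_cancel_right])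
        _ (by
          have := cobarD_mem_pageZ hw
          rwa [add_sub_cancel_right] at this), ← map_sub, SubquotientSystem.sym_eq_zero]
      have := Submodule.neg_mem _ ha'
      rw [← add_sub_cancel_right a (cobarD p n k w), hz, neg_sub] at this
      exact this
  · rintro ⟨y, hy⟩
    have h1 := congrArg (fun u : PageTotal p n k r => u (s, t, M)) hy
    simp only at h1
    rw [SubquotientSystem.sym_apply_self] at h1
    have hzZ' := mem_pageZ.mp hzZ
    cases s with
    | zero =>
      rw [pageD_apply_zero, eq_comm, SubquotientSystem.cls_eq_zero] at h1
      obtain ⟨a, ha, w, hw | ⟨s', hs', -⟩, hz⟩ := mem_pageB.mp h1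
      · rw [hw, map_zero, add_zero] at hz
        subst hz
        refine mem_pageB_of_mem (mem_pageZ.mpr ⟨(mem_pageZ.mp ha).1, cobarFilt_mono ?_ hzZ'.2⟩)
        push_cast; omega
      · omega
    | succ s =>
      obtain ⟨w, hw⟩ := (page p n k r).exists_cls (y (s, t, M + r))
      have h2 := pageD_apply r y s t (M + r) w hw
      have e2 : ((s + 1, t, M + r - r) : Tri p n) = (s + 1, t, M) := by rw [add_sub_cancel_right]
      have h3 : (page p n k r).sym (s + 1, t, M) ⟨z, pageZ_succ_le r _ hzZ⟩ =
          (page p n k r).sym (s + 1, t, M + r - r) (pageDCycles p n k r s t (M + r) w) := by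
        rw [SubquotientSystem.sym, SubquotientSystem.sym, LinearMap.comp_apply,
          LinearMap.comp_apply, ← h1, ← h2, e2]
      rw [(page p n k r).sym_cast e2 _ (e2 ▸ (pageDCycles p n k r s t (M + r) w).2), ← sub_eq_zero,
        ← map_sub, SubquotientSystem.sym_eq_zero] at h3
      obtain ⟨a, ha, v, hv, hz⟩ := mem_pageB.mp h3
      have hw' := mem_pageZ.mp w.2
      have hz' : a + cobarD p n k (w.1 + v) = z := by
        have : a + cobarD p n k v = z - cobarD p n k w.1 := hz
        rw [map_add, add_left_comm, this, add_sub_cancel]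
      refine mem_pageB.mpr ⟨a, ?_, w.1 + v, Or.inr ⟨s, rfl, ?_⟩, hz'⟩
      · refine mem_pageZ.mpr ⟨(mem_pageZ.mp ha).1, ?_⟩
        have : cobarD p n k a = cobarD p n k z := by
          rw [← hz', map_add, cobarD_cobarD, add_zero]
        rw [this]
        refine cobarFilt_mono ?_ hzZ'.2
        push_cast; omega
      · have hv' : v ∈ pageZ p n k r (s, t, M + r) := by
          rcases hv with rfl | ⟨s', hs', hv⟩
          · exact Submodule.zero_mem _
          · obtain rfl : s' = s := by omega
            exact pageZ_mono (by omega) (by omega) hv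
        have := Submodule.add_mem _ w.2 hv'
        rwa [show ((r + 1 : ℕ) : ℤ) - 1 = r by push_cast; ring]

/-- A homogeneous component of a cycle on `E_r` is represented by an element of `Z_{r+1}`. -/
theorem exists_pageZ_succ (r : ℕ) (u : PageTotal p n k r) (hu : pageD p n k r u = 0) (i : Tri p n) :
    ∃ z : (page p n k (r + 1)).Z i,
      (page p n k r).cls i ⟨z, pageZ_succ_le r i z.2⟩ = u i := by
  obtain ⟨s, t, M⟩ := i
  obtain ⟨z, hz⟩ := (page p n k r).exists_cls (u (s, t, M))
  have h1 := pageD_apply r u s t M z hz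
  rw [hu] at h1
  have h2 : cobarD p n k z ∈ pageB p n k r (s + 1, t, M - r) :=
    (page p n k r).cls_eq_zero.mp h1.symm
  obtain ⟨a, ha, w, hw, hdz⟩ := mem_pageB.mp h2
  have hw' : w ∈ pageZ p n k ((r : ℤ) - 1) (s, t, M - 1) := by
    rcases hw with rfl | ⟨s', hs', hw⟩
    · exact Submodule.zero_mem _
    · obtain rfl : s' = s := by omega
      exact pageZ_mono (by omega) (by omega) hw
  have hz' : z.1 - w ∈ (page p n k (r + 1)).Z (s, t, M) := by
    refine mem_pageZ.mpr ⟨Submodule.sub_mem _ (mem_pageZ.mp z.2).1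
      (cobarFilt_mono (by omega) (mem_pageZ.mp hw').1), ?_⟩
    rw [map_sub, ← hdz, add_sub_cancel_right]
    refine cobarFilt_mono ?_ (mem_pageZ.mp ha).1
    push_cast; omega
  refine ⟨⟨_, hz'⟩, ?_⟩
  rw [← hz, ← sub_eq_zero, ← map_sub, SubquotientSystem.cls_eq_zero]
  have : z.1 - w - z.1 ∈ pageB p n k r (s, t, M) := by
    rw [sub_right_comm, sub_self, zero_sub]
    exact Submodule.neg_mem _ (mem_pageB_of_mem hw')
  exact this

/-- `E_{r+1}` is the homology of `E_r`. -/
theorem exists_page_succ_equiv (r : ℕ) :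
    ∃ φ : PageTotal p n k (r + 1) ≃ₗ[ZMod p] PageHomology p n k r,
      ∀ i (z : (page p n k (r + 1)).Z i), ∃ (hz : (z : Cobar p n k) ∈ (page p n k r).Z i)
        (hd : (page p n k r).sym i ⟨z, hz⟩ ∈ LinearMap.ker (pageD p n k r)),
        φ ((page p n k (r + 1)).sym i z) = Submodule.Quotient.mk ⟨_, hd⟩ :=
  (page p n k r).exists_homology_equiv (page p n k (r + 1)) (pageD p n k r)
    (fun i => pageZ_succ_le r i) (fun i z => pageD_sym_eq_zero r i _ z.2)
    (mem_pageB_succ_iff r) (lof_pageD_mem_range r) (exists_pageZ_succ r)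

end SpectralSequence

/-! ### The internal grading -/

section Grading

variable {p n k : ℕ} [hp : Fact p.Prime] [NeZero n] [NeZero k]

theorem filt_of_neg (t : IDeg p n) {M : ℤ} (h : M < 0) : filt p n k t M = ⊥ := by
  rw [filt, Submodule.span_eq_bot]
  rintro x ⟨e, -, h1, -⟩
  omega

variable (p n k) in
/-- The projection of `S(n,k)` onto its part of internal degree `t`. -/
def degProj (t : IDeg p n) : MoravaAlg p n k →ₗ[ZMod p] MoravaAlg p n k :=
  (divBasis p n k).constr (ZMod p) fun e => if eDeg p n k e.1 = t then divMono p n k e.1 else 0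

theorem degProj_divMono (t : IDeg p n) (e : Red p (GIdx n k)) :
    degProj p n k t (divMono p n k e.1) =
      if eDeg p n k e.1 = t then divMono p n k e.1 else 0 := by
  have := (divBasis p n k).constr_basis (ZMod p)
    (fun e => if eDeg p n k e.1 = t then divMono p n k e.1 else 0) e
  rwa [divBasis_apply] at this

theorem degProj_of_mem (t t' : IDeg p n) {x : MoravaAlg p n k} (hx : x ∈ ⨆ M, filt p n k t' M) :
    degProj p n k t x = if t' = t then x else 0 := by
  suffices h : ⨆ M, filt p n k t' M ≤ LinearMap.eqLocus (degProj p n k t)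
      (if t' = t then LinearMap.id else 0) by
    have := h hx
    rw [LinearMap.mem_eqLocus] at this
    rw [this]
    split_ifs <;> rfl
  refine iSup_le fun M => ?_
  rw [filt_eq_span, Submodule.span_le]
  rintro _ ⟨e, rfl, -, rfl⟩
  rw [SetLike.mem_coe, LinearMap.mem_eqLocus, degProj_divMono]
  split_ifs <;> rfl

/-- The internal grading of `S(n,k)`. -/
theorem isInternal_filt : DirectSum.IsInternal fun t => ⨆ M, filt p n k t M := by
  have key : ∀ (x : ⨁ t, (⨆ M, filt p n k t M : Submodule (ZMod p) (MoravaAlg p n k))) (t : IDeg p n),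
      degProj p n k t (DirectSum.coeAddMonoidHom (fun t => ⨆ M, filt p n k t M) x) = x t := by
    intro x t
    induction x using DirectSum.induction_on with
    | zero => rw [map_zero, map_zero]; rfl
    | of t' x =>
      rw [DirectSum.coeAddMonoidHom_of, degProj_of_mem t t' x.2]
      split_ifs with h
      · subst h; rw [DirectSum.of_eq_same]
      · rw [DirectSum.of_eq_of_ne _ _ _ (Ne.symm h)]; rfl
    | add x y hx hy => rw [map_add, map_add, hx, hy]; rfl
  constructor
  · intro x y hxy
    refine DFinsupp.ext fun t => Subtype.ext ?_
    rw [← key, ← key, hxy]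
  · intro x
    have hx : x ∈ Submodule.span (ZMod p) (Set.range (divBasis p n k)) := by
      rw [(divBasis p n k).span_eq]; trivial
    have : Submodule.span (ZMod p) (Set.range (divBasis p n k)) ≤
        LinearMap.range (DirectSum.coeLinearMap fun t => ⨆ M, filt p n k t M) := by
      rw [Submodule.span_le]
      rintro _ ⟨e, rfl⟩
      refine ⟨DirectSum.lof (ZMod p) _ _ (eDeg p n k e.1)
        ⟨divMono p n k e.1, Submodule.mem_iSup_of_mem (eWt p n k e.1)
          (divMono_mem_filt e.1 rfl le_rfl)⟩, ?_⟩
      rw [DirectSum.coeLinearMap_lof, divBasis_apply]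
    exact this hx

end Grading

/-! ### Convergence -/

section Convergence

variable {p n k : ℕ} [hp : Fact p.Prime] [NeZero n] [NeZero k]

theorem cobarFilt_of_neg (s : ℕ) (t : IDeg p n) {M : ℤ} (h : M < 0) :
    cobarFilt p n k s t M = ⊥ := by
  rw [cobarFilt, Submodule.span_eq_bot]
  rintro x ⟨l, -, -, -, h1, -⟩
  omega

theorem genWt_le_eWt {e : GIdx n k →₀ ℕ} {a : GIdx n k} (h : e a ≠ 0) :
    genWt p n k a.1 ≤ eWt p n k e := by
  have : e = Finsupp.single a 1 + (e - Finsupp.single a 1) := by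
    rw [add_tsub_cancel_of_le]
    exact Finsupp.single_le_iff.mpr (Nat.one_le_iff_ne_zero.mpr h)
  rw [this, map_add, eWt_single, one_mul]
  exact le_self_add

/-- As `M(t_s) ≥ 2s - 1`, only finitely many generators occur in monomials of bounded filtration. -/
theorem finite_letters (N : ℕ) :
    {x : Letter p (GIdx n k) | eWt p n k x.1 ≤ N}.Finite := by
  have h1 : {a : GIdx n k | a.1.1 ≤ N + 1}.Finite := by
    have : (Set.Iic (N + 1) ×ˢ (Set.univ : Set (ZMod n))).Finite :=
      (Set.finite_Iic _).prod Set.finite_univ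
    refine (this.preimage (f := fun a : GIdx n k => (a.1.1, a.2)) ?_).subset ?_
    · rintro ⟨a, b⟩ - ⟨a', b'⟩ - h
      obtain ⟨h1, h2⟩ := Prod.mk.inj h
      exact Prod.ext (Subtype.ext h1) h2
    · intro a ha
      exact ⟨ha, trivial⟩
  have h2 := Set.finite_Iic (∑ a ∈ h1.toFinset, Finsupp.single a p)
  refine (h2.preimage (f := fun x : Letter p (GIdx n k) => x.1)
    Subtype.val_injective.injOn).subset ?_
  intro x hx
  rw [Set.mem_preimage, Set.mem_Iic]
  intro a
  by_cases ha : x.1 a = 0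
  · rw [ha]; exact Nat.zero_le _
  · have h3 := two_mul_sub_one_le_genWt (p := p) (n := n) (k := k) a.1
    have h4 := genWt_le_eWt (p := p) ha
    have h5 : eWt p n k x.1 ≤ N := hx
    have h6 : a ∈ h1.toFinset := h1.mem_toFinset.mpr (by change a.1.1 ≤ _; omega)
    rw [Finsupp.finsetSum_apply, Finset.sum_eq_single a
      (fun b _ hb => Finsupp.single_eq_of_ne (Ne.symm hb)) (fun h => absurd h6 h),
      Finsupp.single_eq_same]
    exact (x.2.2 a).le

theorem finite_words (s N : ℕ) :
    {l : List (Letter p (GIdx n k)) | l.length = s ∧ wWt p n k l ≤ N}.Finite := by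
  induction s with
  | zero =>
    refine (Set.finite_singleton []).subset ?_
    rintro l ⟨h, -⟩
    exact List.length_eq_zero_iff.mp h
  | succ s ih =>
    refine ((finite_letters N).image2 List.cons ih).subset ?_
    rintro (_ | ⟨x, l⟩) ⟨h1, h2⟩
    · simp at h1
    · rw [wWt_cons] at h2
      exact ⟨x, by change eWt p n k x.1 ≤ N; omega, l, ⟨by simpa using h1, by omega⟩, rfl⟩

/-- The filtration submodules of the cobar complex have finite dimension. -/
theorem finite_cobarFilt (s : ℕ) (t : IDeg p n) (M : ℤ) :
    Module.Finite (ZMod p) (cobarFilt p n k s t M) := by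
  have h1 : ({q : List (Letter p (GIdx n k)) × Unit |
      q.1.length = s ∧ wDeg p n k q.1 = t ∧ (wWt p n k q.1 : ℤ) ≤ M}).Finite := by
    refine ((finite_words s M.toNat).prod (Set.finite_univ (α := Unit))).subset ?_
    rintro ⟨l, u⟩ ⟨h1, -, h3⟩
    have h4 : (wWt p n k l : ℤ) ≤ M := h3
    exact ⟨⟨h1, by change wWt p n k l ≤ _; omega⟩, trivial⟩
  have h2 : (wordsLE p n k s t M).FG := by
    rw [wordsLE, Finsupp.supported_eq_span_single]
    exact Submodule.fg_span (h1.image _)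
  have h3 : Module.Finite (ZMod p) ((wordsLE p n k s t M).map (wordCob p n k)) :=
    Module.Finite.iff_fg.mpr (h2.map _)
  have h4 : cobarFilt p n k s t M ≤ (wordsLE p n k s t M).map (wordCob p n k) := by
    intro x hx
    obtain ⟨z, hz, rfl⟩ := exists_wordCob hx
    exact ⟨z, hz, rfl⟩
  exact Submodule.finiteDimensional_of_le h4

theorem mem_cobarDeg {s : ℕ} {t : IDeg p n} {x : Cobar p n k} :
    x ∈ cobarDeg p n k s t ↔ ∃ M, x ∈ cobarFilt p n k s t M :=
  Submodule.mem_iSup_of_directed _ (Monotone.directed_le fun _ _ h => cobarFilt_mono h)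

/-- As `FC^{s+1,t,M}` has finite dimension, the coboundaries in it are the differentials of
elements of bounded filtration. -/
theorem exists_cobarFilt_bound (s : ℕ) (t : IDeg p n) (M : ℤ) : ∃ N : ℤ, ∀ x ∈ cobarDeg p n k s t,
    cobarD p n k x ∈ cobarFilt p n k (s + 1) t M →
      ∃ w ∈ cobarFilt p n k s t N, cobarD p n k w = cobarD p n k x := by
  have := finite_cobarFilt (p := p) (n := n) (k := k) (s + 1) t M
  have h1 : Module.Finite (ZMod p) (cobarFilt p n k (s + 1) t M ⊓
      (cobarDeg p n k s t).map (cobarD p n k) : Submodule (ZMod p) (Cobar p n k)) :=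
    Submodule.finiteDimensional_of_le inf_le_left
  obtain ⟨T, hT⟩ := Module.Finite.iff_fg.mp h1
  have h2 : ∀ v : T, ∃ N : ℤ, v.1 ∈ (cobarFilt p n k s t N).map (cobarD p n k) := by
    intro v
    have hv : v.1 ∈ Submodule.span (ZMod p) (T : Set (Cobar p n k)) := Submodule.subset_span v.2
    rw [hT] at hv
    obtain ⟨-, w, hw, hw'⟩ := hv
    obtain ⟨N, hN⟩ := mem_cobarDeg.mp hw
    exact ⟨N, w, hN, hw'⟩
  choose f hf using h2
  obtain ⟨N, hN⟩ := (Set.finite_range f).bddAbove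
  refine ⟨N, fun x hx hd => ?_⟩
  have h3 : cobarD p n k x ∈ Submodule.span (ZMod p) (T : Set (Cobar p n k)) := by
    rw [hT]; exact ⟨hd, x, hx, rfl⟩
  have h4 : Submodule.span (ZMod p) (T : Set (Cobar p n k)) ≤
      (cobarFilt p n k s t N).map (cobarD p n k) := by
    rw [Submodule.span_le]
    intro v hv
    exact Submodule.map_mono (cobarFilt_mono (hN ⟨⟨v, hv⟩, rfl⟩)) (hf ⟨v, hv⟩)
  obtain ⟨w, hw, hw'⟩ := h4 h3
  exact ⟨w, hw, hw'⟩

theorem extFilt_monotone (s : ℕ) (t : IDeg p n) : Monotone (extFilt p n k s t) :=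
  fun _ _ h => Submodule.map_mono (Submodule.comap_mono (cobarFilt_mono h))

theorem extFilt_of_neg (s : ℕ) (t : IDeg p n) {M : ℤ} (h : M < 0) :
    extFilt p n k s t M = ⊥ := by
  rw [eq_bot_iff]
  rintro _ ⟨z, hz, rfl⟩
  have hz' : z.1 ∈ cobarFilt p n k s t M := hz
  rw [cobarFilt_of_neg s t h, Submodule.mem_bot] at hz'
  rw [show z = 0 from Subtype.ext hz', map_zero]
  exact Submodule.zero_mem _

theorem iSup_extFilt (s : ℕ) (t : IDeg p n) : ⨆ M, extFilt p n k s t M = ⊤ := by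
  rw [eq_top_iff]
  rintro x -
  obtain ⟨z, rfl⟩ := Submodule.mkQ_surjective _ x
  obtain ⟨M, hM⟩ := mem_cobarDeg.mp z.2.1
  exact Submodule.mem_iSup_of_mem M ⟨z, hM, rfl⟩

/-- For `r > M`, the elements of `Z_r` are cocycles. -/
theorem cobarD_eq_zero_of_mem_pageZ {r : ℤ} {s : ℕ} {t : IDeg p n} {M : ℤ} (h : M < r)
    {z : Cobar p n k} (hz : z ∈ pageZ p n k r (s, t, M)) : cobarD p n k z = 0 := by
  have := (mem_pageZ.mp hz).2
  rwa [cobarFilt_of_neg _ _ (by omega), Submodule.mem_bot] at this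

variable (p n k) in
/-- The map sending a cocycle of filtration at most `M` to its class. -/
def toGrExt (s : ℕ) (t : IDeg p n) (M : ℤ) (V : Submodule (ZMod p) (Cobar p n k))
    (hV : V ≤ cobarFilt p n k s t M) (hd : ∀ z ∈ V, cobarD p n k z = 0) :
    V →ₗ[ZMod p] GrExt p n k s t M :=
  (Submodule.mkQ _).comp (LinearMap.codRestrict (extFilt p n k s t M)
    ((Submodule.mkQ _).comp (Submodule.inclusion
      (show V ≤ cobarCocycles p n k s t from fun _ hz => mem_cobarCocycles (hV hz) (hd _ hz))))
    fun z => ⟨⟨z, mem_cobarCocycles (hV z.2) (hd _ z.2)⟩, hV z.2, rfl⟩)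

theorem grExtClass_eq_zero {s : ℕ} {t : IDeg p n} {M : ℤ} (z : Cobar p n k)
    (hz : z ∈ cobarFilt p n k s t M) (hd : cobarD p n k z = 0) :
    grExtClass z hz hd = 0 ↔ ∃ y ∈ cobarFilt p n k s t (M - 1), cobarD p n k y = 0 ∧
      z - y ∈ cobarBoundaries p n k s t := by
  rw [grExtClass, Submodule.Quotient.mk_eq_zero]
  constructor
  · rintro ⟨y, hy, h⟩
    refine ⟨y, hy, y.2.2, ?_⟩
    have h' : (Submodule.Quotient.mk y : ExtGroup p n k s t) =
      Submodule.Quotient.mk ⟨z, mem_cobarCocycles hz hd⟩ := h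
    exact (Submodule.Quotient.eq ((cobarBoundaries p n k s t).submoduleOf _)).mp h'.symm
  · rintro ⟨y, hy, hdy, h⟩
    refine ⟨⟨y, mem_cobarCocycles hy hdy⟩, hy, ?_⟩
    exact ((Submodule.Quotient.eq ((cobarBoundaries p n k s t).submoduleOf
      (cobarCocycles p n k s t)) (x := ⟨z, mem_cobarCocycles hz hd⟩)
      (y := ⟨y, mem_cobarCocycles hy hdy⟩)).mpr h).symm

theorem mem_cobarBoundaries {s : ℕ} {t : IDeg p n} {x : Cobar p n k} :
    x ∈ cobarBoundaries p n k s t ↔ ∃ w, (w = 0 ∨ ∃ s', s' + 1 = s ∧ w ∈ cobarDeg p n k s' t) ∧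
      cobarD p n k w = x := by
  cases s with
  | zero =>
    rw [cobarBoundaries, Submodule.mem_bot]
    constructor
    · rintro rfl; exact ⟨0, Or.inl rfl, map_zero _⟩
    · rintro ⟨w, rfl | ⟨s', hs', -⟩, rfl⟩
      · exact map_zero _
      · omega
  | succ s =>
    rw [cobarBoundaries]
    constructor
    · rintro ⟨w, hw, rfl⟩; exact ⟨w, Or.inr ⟨s, rfl, hw⟩, rfl⟩
    · rintro ⟨w, rfl | ⟨s', hs', hw⟩, rfl⟩
      · exact ⟨0, Submodule.zero_mem _, rfl⟩
      · obtain rfl : s' = s := by omega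
        exact ⟨w, hw, rfl⟩

/-- For large `r`, the page `E_r` is the associated graded of the cohomology. -/
theorem exists_page_equiv_grExt (s : ℕ) (t : IDeg p n) (M : ℤ) :
    ∃ r₀ : ℕ, ∀ r ≥ r₀, ∃ φ : (page p n k r).Piece (s, t, M) ≃ₗ[ZMod p] GrExt p n k s t M,
      ∀ z (hz : z ∈ cobarFilt p n k s t M) (hd : cobarD p n k z = 0),
        φ ((page p n k r).cls _ ⟨z, mem_page_of_cocycle r hz hd⟩) = grExtClass z hz hd := by
  obtain ⟨N, hN⟩ : ∃ N : ℤ, ∀ s', s' + 1 = s → ∀ x ∈ cobarDeg p n k s' t,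
      cobarD p n k x ∈ cobarFilt p n k s t M →
        ∃ w ∈ cobarFilt p n k s' t N, cobarD p n k w = cobarD p n k x := by
    cases s with
    | zero => exact ⟨0, fun s' hs' => by omega⟩
    | succ s =>
      obtain ⟨N, hN⟩ := exists_cobarFilt_bound (p := p) (n := n) (k := k) s t M
      refine ⟨N, fun s' hs' => ?_⟩
      obtain rfl : s' = s := by omega
      exact hN
  refine ⟨M.toNat + (N - M).toNat + 1, fun r hr => ?_⟩
  have hZd : ∀ z ∈ (page p n k r).Z (s, t, M), cobarD p n k z = 0 := fun z hz =>
    cobarD_eq_zero_of_mem_pageZ (r := r) (by omega) hz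
  have hZF : (page p n k r).Z (s, t, M) ≤ cobarFilt p n k s t M := fun z hz => (mem_pageZ.mp hz).1
  have hf : ∀ z : (page p n k r).Z (s, t, M), toGrExt p n k s t M _ hZF hZd z =
      grExtClass z.1 (hZF z.2) (hZd _ z.2) := fun z => rfl
  have hker : ∀ z : (page p n k r).Z (s, t, M),
      toGrExt p n k s t M _ hZF hZd z = 0 ↔ z.1 ∈ (page p n k r).B (s, t, M) := by
    intro z
    rw [hf, grExtClass_eq_zero]
    refine Iff.trans ?_ (mem_pageB (r := (r : ℤ)) (x := z.1)).symm
    constructor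
    · rintro ⟨y, hy, hdy, h⟩
      refine ⟨y, mem_pageZ.mpr ⟨hy, by rw [hdy]; exact Submodule.zero_mem _⟩, ?_⟩
      obtain ⟨w, rfl | ⟨s', hs', hw⟩, h⟩ := mem_cobarBoundaries.mp h
      · exact ⟨0, Or.inl rfl, by rw [h]; exact add_sub_cancel _ _⟩
      · have h5 : cobarD p n k w ∈ cobarFilt p n k s t M := by
          rw [h]
          exact Submodule.sub_mem _ (hZF z.2) (cobarFilt_mono (by omega) hy)
        obtain ⟨v, hv, hvw⟩ := hN s' hs' w hw h5
        refine ⟨v, Or.inr ⟨s', hs', mem_pageZ.mpr ⟨cobarFilt_mono (by omega) hv, ?_⟩⟩, ?_⟩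
        · rw [hvw, hs', add_sub_cancel_right]; exact h5
        · rw [hvw, h]; exact add_sub_cancel _ _
    · rintro ⟨y, hy, w, hw, h⟩
      refine ⟨y, (mem_pageZ.mp hy).1, cobarD_eq_zero_of_mem_pageZ (by omega) hy,
        mem_cobarBoundaries.mpr ⟨w, ?_, ?_⟩⟩
      · rcases hw with hw | ⟨s', hs', hw⟩
        · exact Or.inl hw
        · exact Or.inr ⟨s', hs', mem_cobarDeg.mpr ⟨_, (mem_pageZ.mp hw).1⟩⟩
      · rw [← h, add_sub_cancel_left]
  have hsurj : Function.Surjective (toGrExt p n k s t M _ hZF hZd) := by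
    intro v
    obtain ⟨⟨u, z, hz, hu⟩, rfl⟩ := Submodule.mkQ_surjective _ v
    subst hu
    exact ⟨⟨z.1, mem_page_of_cocycle r hz z.2.2⟩, rfl⟩
  let e1 := LinearMap.quotKerEquivOfSurjective _ hsurj
  have e0 : ((page p n k r).B (s, t, M)).submoduleOf ((page p n k r).Z (s, t, M)) =
      LinearMap.ker (toGrExt p n k s t M _ hZF hZd) := by
    ext z
    rw [LinearMap.mem_ker, hker]
    rfl
  refine ⟨(Submodule.quotEquivOfEq _ _ e0).trans e1, fun z hz hd => ?_⟩
  rfl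

end Convergence

/-! ### Truncated polynomial Hopf algebras -/

section TruncatedPolynomial

/-- Induction on exponents, adding one variable at a time. -/
theorem finsupp_nat_induction {σ : Type*} {P : (σ →₀ ℕ) → Prop} (h0 : P 0)
    (hs : ∀ e a, P e → P (e + Finsupp.single a 1)) (e : σ →₀ ℕ) : P e := by
  induction e using Finsupp.induction₂ with
  | zero => exact h0
  | add_single a b f _ hb hf =>
    clear hb
    induction b with
    | zero => rwa [Finsupp.single_zero, add_zero]
    | succ b ih => rw [Finsupp.single_add, ← add_assoc]; exact hs _ _ ih

variable {p : ℕ} [hp : Fact p.Prime] {K : Type*} [Field K] [CharP K p] {σ : Type*}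

/-- The ideal generated by the `p`-th powers of the variables. -/
abbrev truncIdeal (p : ℕ) (K σ : Type*) [Field K] : Ideal (MvPolynomial σ K) :=
  Ideal.span (Set.range fun a : σ => (MvPolynomial.X a ^ p : MvPolynomial σ K))

/-- The truncated polynomial algebra of height `p` on generators indexed by `σ`. -/
abbrev TruncPoly (p : ℕ) (K σ : Type*) [Field K] : Type _ := MvPolynomial σ K ⧸ truncIdeal p K σ

/-- The generators of a truncated polynomial algebra. -/
def truncX (p : ℕ) (K : Type*) {σ : Type*} [Field K] (a : σ) : TruncPoly p K σ :=
  Ideal.Quotient.mk _ (MvPolynomial.X a)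

theorem exists_truncLift {A : Type*} [CommRing A] [Algebra K A] (x : σ → A) (hx : ∀ a, x a ^ p = 0) :
    ∃ f : TruncPoly p K σ →ₐ[K] A, ∀ a, f (truncX p K a) = x a := by
  refine ⟨Ideal.Quotient.liftₐ _ (MvPolynomial.aeval x) ?_, fun a => ?_⟩
  · intro f hf
    rw [← RingHom.mem_ker]
    refine (Ideal.span_le (I := RingHom.ker (MvPolynomial.aeval (R := K) x))).mpr ?_ hf
    rintro _ ⟨a, rfl⟩
    rw [SetLike.mem_coe, RingHom.mem_ker, map_pow, MvPolynomial.aeval_X, hx]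
  · exact MvPolynomial.aeval_X (R := K) x a

theorem truncPoly_hom_ext {B : Type*} [Semiring B] [Algebra K B] {f f' : TruncPoly p K σ →ₐ[K] B}
    (h : ∀ a, f (truncX p K a) = f' (truncX p K a)) : f = f' := by
  have h1 : f.comp (Ideal.Quotient.mkₐ K (truncIdeal p K σ)) =
      f'.comp (Ideal.Quotient.mkₐ K (truncIdeal p K σ)) := MvPolynomial.algHom_ext h
  refine AlgHom.ext fun y => ?_
  obtain ⟨z, rfl⟩ := Ideal.Quotient.mk_surjective y
  exact DFunLike.congr_fun h1 z

/-- A commutative algebra with a basis formed by the monomials with exponents less than `p` in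
elements `x a` with `x a ^ p = 0` is a truncated polynomial algebra; the monomials are given
recursively. -/
theorem exists_trunc_equiv {A : Type*} [CommRing A] [Algebra K A] (x : σ → A)
    (hx : ∀ a, x a ^ p = 0) (g : (σ →₀ ℕ) → A) (h0 : g 0 = 1)
    (hs : ∀ e a, g (e + Finsupp.single a 1) = x a * g e)
    (hli : LinearIndependent K fun e : Red p σ => g e.1)
    (hsp : ⊤ ≤ Submodule.span K (Set.range fun e : Red p σ => g e.1)) :
    ∃ Θ : TruncPoly p K σ ≃ₐ[K] A, ∀ a, Θ (truncX p K a) = x a := by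
  obtain ⟨f, hf⟩ := exists_truncLift (K := K) x hx
  let m : (σ →₀ ℕ) → TruncPoly p K σ := fun e =>
    Ideal.Quotient.mk (truncIdeal p K σ) (MvPolynomial.monomial e 1)
  have hm : ∀ e a, m (e + Finsupp.single a 1) = truncX p K a * m e := by
    intro e a
    rw [truncX, ← map_mul, MvPolynomial.X, MvPolynomial.monomial_mul, one_mul, add_comm]
  have hfm : ∀ e, f (m e) = g e := by
    intro e
    induction e using finsupp_nat_induction with
    | h0 => rw [h0]; exact map_one f
    | hs e a h => rw [hm, hs, map_mul, h, hf]
  have hred : ∀ e : σ →₀ ℕ, (¬ ∀ a, e a < p) → m e = 0 := by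
    intro e he
    push Not at he
    obtain ⟨a, ha⟩ := he
    have e1 : e = Finsupp.single a p + (e - Finsupp.single a p) := by
      rw [add_tsub_cancel_of_le]
      exact Finsupp.single_le_iff.mpr ha
    have e2 : (MvPolynomial.monomial e 1 : MvPolynomial σ K) = MvPolynomial.X a ^ p *
        MvPolynomial.monomial (e - Finsupp.single a p) 1 := by
      rw [MvPolynomial.X_pow_eq_monomial, MvPolynomial.monomial_mul, one_mul, ← e1]
    refine Ideal.Quotient.eq_zero_iff_mem.mpr ?_
    rw [e2]
    exact Ideal.mul_mem_right _ _ (Ideal.subset_span ⟨a, rfl⟩)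
  have hspan : ∀ y : TruncPoly p K σ,
      y ∈ Submodule.span K (Set.range fun e : Red p σ => m e.1) := by
    intro y
    obtain ⟨y, rfl⟩ := Ideal.Quotient.mk_surjective y
    induction y using MvPolynomial.induction_on' with
    | monomial e c =>
      have : Ideal.Quotient.mk (truncIdeal p K σ) (MvPolynomial.monomial e c) = c • m e := by
        have : (MvPolynomial.monomial e c : MvPolynomial σ K) = c • MvPolynomial.monomial e 1 := by
          rw [MvPolynomial.smul_monomial, smul_eq_mul, mul_one]
        rw [this]
        exact map_smul (Ideal.Quotient.mkₐ K (truncIdeal p K σ)) c _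
      rw [this]
      refine Submodule.smul_mem _ _ ?_
      by_cases he : ∀ a, e a < p
      · exact Submodule.subset_span ⟨⟨e, he⟩, rfl⟩
      · rw [hred e he]; exact Submodule.zero_mem _
    | add y z hy hz => rw [map_add]; exact Submodule.add_mem _ hy hz
  have hinj : Function.Injective f := by
    rw [injective_iff_map_eq_zero]
    intro y hy
    obtain ⟨c, rfl⟩ := (Finsupp.mem_span_range_iff_exists_finsupp).mp (hspan y)
    rw [Finsupp.sum, map_sum, Finset.sum_congr rfl fun e _ => by rw [map_smul, hfm]] at hy
    have := linearIndependent_iff'.mp hli c.support c hy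
    refine Finset.sum_eq_zero fun e he => ?_
    simp only [this e he, zero_smul]
  have hsurj : Function.Surjective f := by
    intro y
    have : Submodule.span K (Set.range fun e : Red p σ => g e.1) ≤ LinearMap.range f.toLinearMap := by
      rw [Submodule.span_le]
      rintro _ ⟨e, rfl⟩
      exact ⟨m e.1, hfm e.1⟩
    exact this (hsp trivial)
  exact ⟨AlgEquiv.ofBijective f ⟨hinj, hsurj⟩, hf⟩

section

variable {A : Type*} [CommRing A] [Algebra K A] (Θ : TruncPoly p K σ ≃ₐ[K] A)

theorem exists_lift_of_equiv {B : Type*} [CommRing B] [Algebra K B] (b : σ → B)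
    (hb : ∀ a, b a ^ p = 0) : ∃ f : A →ₐ[K] B, ∀ a, f (Θ (truncX p K a)) = b a := by
  obtain ⟨f, hf⟩ := exists_truncLift (K := K) b hb
  refine ⟨f.comp Θ.symm.toAlgHom, fun a => ?_⟩
  rw [← hf]
  exact congrArg f (Θ.symm_apply_apply _)

theorem hom_ext_of_equiv {B : Type*} [Semiring B] [Algebra K B] {f f' : A →ₐ[K] B}
    (h : ∀ a, f (Θ (truncX p K a)) = f' (Θ (truncX p K a))) : f = f' := by
  have := truncPoly_hom_ext (f := f.comp Θ.toAlgHom) (f' := f'.comp Θ.toAlgHom) h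
  refine AlgHom.ext fun y => ?_
  obtain ⟨z, rfl⟩ := Θ.surjective y
  exact DFunLike.congr_fun this z

/-- A truncated polynomial algebra of height `p` over a field of characteristic `p` is a Hopf
algebra with primitive generators. -/
theorem exists_hopfData_of_equiv : ∃ H : HopfData K A, ∀ a, H.comul (Θ (truncX p K a)) =
    Θ (truncX p K a) ⊗ₜ[K] 1 + 1 ⊗ₜ[K] Θ (truncX p K a) := by
  have hx : ∀ a, Θ (truncX p K a) ^ p = 0 := by
    intro a
    rw [← map_pow, truncX, ← map_pow, Ideal.Quotient.eq_zero_iff_mem.mpr, map_zero]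
    exact Ideal.subset_span ⟨a, rfl⟩
  by_cases hA : Subsingleton A
  · have : Subsingleton (A ⊗[K] A) := by
      refine ⟨fun y z => ?_⟩
      have : ∀ y : A ⊗[K] A, y = 0 := fun y => by
        rw [← one_mul y, Algebra.TensorProduct.one_def, Subsingleton.elim (1 : A) 0,
          TensorProduct.zero_tmul, zero_mul]
      rw [this y, this z]
    exfalso
    obtain ⟨f, -⟩ := exists_lift_of_equiv Θ (B := K) (fun _ => 0)
      (fun _ => zero_pow hp.out.ne_zero)
    have : (1 : K) = 0 := by
      rw [← map_one f, Subsingleton.elim (1 : A) 0, map_zero]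
    exact one_ne_zero this
  rw [not_subsingleton_iff_nontrivial] at hA
  have hAA : CharP (A ⊗[K] A) p := charP_of_injective_algebraMap' K p
  obtain ⟨c, hc⟩ := exists_lift_of_equiv Θ
    (fun a => Θ (truncX p K a) ⊗ₜ[K] (1 : A) + (1 : A) ⊗ₜ[K] Θ (truncX p K a)) (fun a => by
      rw [add_pow_char, Algebra.TensorProduct.tmul_pow, Algebra.TensorProduct.tmul_pow, hx,
        TensorProduct.zero_tmul, TensorProduct.tmul_zero, add_zero])
  obtain ⟨ε, hε⟩ := exists_lift_of_equiv Θ (B := K) (fun _ => 0)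
    (fun _ => zero_pow hp.out.ne_zero)
  obtain ⟨S, hS⟩ := exists_lift_of_equiv Θ (fun a => -Θ (truncX p K a)) (fun a => by
    rw [neg_pow, hx, mul_zero])
  refine ⟨⟨c, ε, S.toLinearMap, ?_, ?_, ?_, ?_, ?_⟩, hc⟩
  · refine hom_ext_of_equiv Θ fun a => ?_
    simp only [AlgHom.comp_apply, hc, map_add, Algebra.TensorProduct.map_tmul, AlgHom.id_apply,
      map_one, TensorProduct.add_tmul, TensorProduct.tmul_add, Algebra.TensorProduct.one_def]
    abel
  · refine hom_ext_of_equiv Θ fun a => ?_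
    simp [hc, hε]
  · refine hom_ext_of_equiv Θ fun a => ?_
    simp [hc, hε]
  · have : ((Algebra.TensorProduct.lmul' K (S := A)).comp
        ((Algebra.TensorProduct.map S (.id K A)).comp c)) = (Algebra.ofId K A).comp ε := by
      refine hom_ext_of_equiv Θ fun a => ?_
      simp [hc, hε, hS]
    exact congrArg AlgHom.toLinearMap this
  · have : ((Algebra.TensorProduct.lmul' K (S := A)).comp
        ((Algebra.TensorProduct.map (.id K A) S).comp c)) = (Algebra.ofId K A).comp ε := by
      refine hom_ext_of_equiv Θ fun a => ?_
      simp [hc, hε, hS]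
    exact congrArg AlgHom.toLinearMap this

end

/-- The statement of `exists_trunc_equiv` and `exists_hopfData_of_equiv` for a ring whose
multiplication is commutative. -/
theorem exists_trunc_hopfData {A : Type*} [Ring A] [Algebra K A] (hcomm : ∀ a b : A, a * b = b * a)
    (x : σ → A) (hx : ∀ a, x a ^ p = 0) (g : (σ →₀ ℕ) → A) (h0 : g 0 = 1)
    (hs : ∀ e a, g (e + Finsupp.single a 1) = x a * g e)
    (hli : LinearIndependent K fun e : Red p σ => g e.1)
    (hsp : ⊤ ≤ Submodule.span K (Set.range fun e : Red p σ => g e.1)) :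
    ∃ (H : HopfData K A) (Θ : TruncPoly p K σ ≃ₐ[K] A), ∀ a, Θ (truncX p K a) = x a ∧
      H.comul (x a) = x a ⊗ₜ[K] 1 + 1 ⊗ₜ[K] x a := by
  let _ : CommRing A := { ‹Ring A› with mul_comm := hcomm }
  obtain ⟨Θ, hΘ⟩ := exists_trunc_equiv x hx g h0 hs hli hsp
  obtain ⟨H, hH⟩ := exists_hopfData_of_equiv Θ
  refine ⟨H, Θ, fun a => ⟨hΘ a, ?_⟩⟩
  rw [← hΘ]
  exact hH a

end TruncatedPolynomial

/-! ### Maps out of sums of subquotients -/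

section InducedComul

namespace SubquotientSystem

variable {R A ι : Type*} [CommRing R] [Ring A] [Algebra R A] [AddCommMonoid ι] [DecidableEq ι]
  (Q : SubquotientSystem R A ι)

/-- The pairs of a sum of tensors `y ⊗ z` of total degree `i` and the sum of the tensors of the
classes. -/
def tensorPairs (i : ι) : Submodule R ((A ⊗[R] A) × (Q.Total ⊗[R] Q.Total)) :=
  Submodule.span R {w | ∃ (a b : ι) (y : Q.Z a) (z : Q.Z b), a + b = i ∧
    ((y : A) ⊗ₜ[R] (z : A), Q.sym a y ⊗ₜ[R] Q.sym b z) = w}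

theorem tmul_mem_tensorPairs {a b i : ι} (h : a + b = i) (y : Q.Z a) (z : Q.Z b) :
    ((y : A) ⊗ₜ[R] (z : A), Q.sym a y ⊗ₜ[R] Q.sym b z) ∈ Q.tensorPairs i :=
  Submodule.subset_span ⟨a, b, y, z, h, rfl⟩

theorem mul_mem_tensorPairs {i j : ι} {w w' : (A ⊗[R] A) × (Q.Total ⊗[R] Q.Total)}
    (hw : w ∈ Q.tensorPairs i) (hw' : w' ∈ Q.tensorPairs j) : w * w' ∈ Q.tensorPairs (i + j) := by
  have h : Q.tensorPairs i * Q.tensorPairs j ≤ Q.tensorPairs (i + j) := by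
    unfold tensorPairs
    rw [Submodule.span_mul_span]
    apply Submodule.span_mono
    rintro _ ⟨_, ⟨a, b, y, z, rfl, rfl⟩, _, ⟨a', b', y', z', rfl, rfl⟩, rfl⟩
    refine ⟨a + a', b + b', ⟨_, Q.mul_mem y.2 y'.2⟩, ⟨_, Q.mul_mem z.2 z'.2⟩,
      add_add_add_comm _ _ _ _, ?_⟩
    refine Prod.ext ?_ ?_
    · exact (Algebra.TensorProduct.tmul_mul_tmul _ _ _ _).symm
    · change _ = Q.sym a y ⊗ₜ[R] Q.sym b z * Q.sym a' y' ⊗ₜ[R] Q.sym b' z'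
      rw [Algebra.TensorProduct.tmul_mul_tmul, sym_mul, sym_mul]
  exact h (Submodule.mul_mem_mul hw hw')

theorem exists_of_mem_tensorPairs {i : ι} {u : A ⊗[R] A} {v : Q.Total ⊗[R] Q.Total}
    (h : (u, v) ∈ Q.tensorPairs i) : ∃ (m : ℕ) (a b : Fin m → ι) (y : ∀ l, Q.Z (a l))
      (z : ∀ l, Q.Z (b l)), (∀ l, a l + b l = i) ∧ u = ∑ l, (y l : A) ⊗ₜ[R] (z l : A) ∧
      v = ∑ l, Q.sym (a l) (y l) ⊗ₜ[R] Q.sym (b l) (z l) := by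
  obtain ⟨m, f, g, hfg⟩ := Submodule.mem_span_set'.mp h
  choose a b y z hab hg using fun l => (g l).2
  refine ⟨m, a, b, fun l => f l • y l, z, hab, ?_, ?_⟩
  · refine (congrArg Prod.fst hfg).symm.trans ?_
    rw [Prod.fst_sum]
    refine Finset.sum_congr rfl fun l _ => ?_
    rw [← hg]
    rfl
  · refine (congrArg Prod.snd hfg).symm.trans ?_
    rw [Prod.snd_sum]
    refine Finset.sum_congr rfl fun l _ => ?_
    rw [← hg, map_smul]
    rfl

/-- The linear map on the direct sum of all components given by linear maps on the `Z i`
vanishing on the `B i`. -/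
def totalLift {V : Type*} [AddCommGroup V] [Module R V] (f : ∀ i, Q.Z i →ₗ[R] V)
    (hf : ∀ i (z : Q.Z i), (z : A) ∈ Q.B i → f i z = 0) : Q.Total →ₗ[R] V :=
  DirectSum.toModule R ι V fun i => Submodule.liftQ ((Q.B i).submoduleOf (Q.Z i)) (f i) (hf i)

theorem totalLift_sym {V : Type*} [AddCommGroup V] [Module R V] (f : ∀ i, Q.Z i →ₗ[R] V)
    (hf : ∀ i (z : Q.Z i), (z : A) ∈ Q.B i → f i z = 0) (i : ι) (z : Q.Z i) :
    Q.totalLift f hf (Q.sym i z) = f i z :=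
  DirectSum.toModule_lof R (M := Q.Piece) (φ := fun i =>
    Submodule.liftQ ((Q.B i).submoduleOf (Q.Z i)) (f i) (hf i)) i (Q.cls i z)

end SubquotientSystem

end InducedComul

/-! ### The associated bigraded Hopf algebra -/

section AssociatedGraded

variable {p n k : ℕ} [hp : Fact p.Prime] [NeZero n] [NeZero k]

theorem grS_mul_comm (x y : GrS p n k) : x * y = y * x := by
  induction x using SubquotientSystem.total_induction with
  | h0 => rw [zero_mul, mul_zero]
  | ha x x' hx hx' => rw [add_mul, mul_add, hx, hx']
  | hs i x =>
    induction y using SubquotientSystem.total_induction with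
    | h0 => rw [zero_mul, mul_zero]
    | ha y y' hy hy' => rw [add_mul, mul_add, hy, hy']
    | hs j y =>
      rw [SubquotientSystem.sym_mul, SubquotientSystem.sym_mul]
      exact (grSystem p n k).sym_congr (add_comm _ _) (mul_comm _ _)

variable (p n k) in
/-- The bidegree of a monomial. -/
def biDeg (e : GIdx n k →₀ ℕ) : IDeg p n × ℤ := (eDeg p n k e, (eWt p n k e : ℤ))

theorem biDeg_add (e f : GIdx n k →₀ ℕ) :
    biDeg p n k (e + f) = biDeg p n k e + biDeg p n k f := by
  rw [biDeg, map_add, map_add, Nat.cast_add]; rfl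

theorem biDeg_zero : biDeg p n k 0 = 0 := by
  rw [biDeg, map_zero, map_zero]; rfl

variable (p n k) in
/-- The class in the associated graded algebra of a monomial in the `t_s^{p^j}`. -/
def gmonoSym (e : GIdx n k →₀ ℕ) : GrS p n k :=
  (grSystem p n k).sym (biDeg p n k e) ⟨gmono p n k e, gmono_mem_filt e rfl le_rfl⟩

variable (p n k) in
/-- The class of `t_s^{p^j}` in the associated graded algebra. -/
def genSym (a : GIdx n k) : GrS p n k :=
  (grSystem p n k).sym (hDeg p n k a, (genWt p n k a.1 : ℤ)) ⟨genPow p n k a, genPow_mem_filt a⟩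

theorem gmonoSym_zero : gmonoSym p n k 0 = 1 :=
  (grSystem p n k).sym_congr (j := 0) (y := ⟨1, (grSystem p n k).one_mem⟩) biDeg_zero gmono_zero

theorem biDeg_single_one (a : GIdx n k) :
    biDeg p n k (Finsupp.single a 1) = (hDeg p n k a, (genWt p n k a.1 : ℤ)) := by
  rw [biDeg, eDeg_single, one_smul, eWt_single, one_mul]

theorem gmonoSym_add_single (e : GIdx n k →₀ ℕ) (a : GIdx n k) :
    gmonoSym p n k (e + Finsupp.single a 1) = genSym p n k a * gmonoSym p n k e := by
  rw [gmonoSym, genSym, gmonoSym, SubquotientSystem.sym_mul]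
  refine (grSystem p n k).sym_congr ?_ ?_
  · rw [biDeg_add, biDeg_single_one, add_comm]
  · change gmono p n k (e + Finsupp.single a 1) = genPow p n k a * gmono p n k e
    rw [gmono_add, gmono_single, pow_one, mul_comm]

theorem gmonoSym_single (a : GIdx n k) (m : ℕ) :
    gmonoSym p n k (Finsupp.single a m) = genSym p n k a ^ m := by
  induction m with
  | zero => rw [Finsupp.single_zero, gmonoSym_zero, pow_zero]
  | succ m ih => rw [Finsupp.single_add, gmonoSym_add_single, ih, pow_succ']

theorem p_mul_genWt_pos (a : GIdx n k) : genWt p n k a.1 < p * genWt p n k a.1 := by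
  have h1 := one_le_genWt (p := p) (n := n) a.1.2
  have h2 := hp.out.two_le
  nlinarith

/-- The `p`-th power of `t_s^{p^j}` has filtration `M(t_s) < p M(t_s)`. -/
theorem genSym_pow (a : GIdx n k) : genSym p n k a ^ p = 0 := by
  rw [← gmonoSym_single, gmonoSym, SubquotientSystem.sym_eq_zero]
  change gmono p n k (Finsupp.single a p) ∈
    filt p n k (eDeg p n k (Finsupp.single a p)) ((eWt p n k (Finsupp.single a p) : ℤ) - 1)
  have h := genPow_mem_filt (p := p) (shift n k a)
  have h1 := p_mul_genWt_pos (p := p) a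
  rw [genPow_shift, hDeg_shift] at h
  rw [gmono_single, eDeg_single, eWt_single]
  exact filt_mono (by change (genWt p n k a.1 : ℤ) ≤ _; omega) h

variable (p n k) in
/-- The coefficient of a divided monomial, as a functional on the associated graded algebra. -/
def grCoord (e : Red p (GIdx n k)) : GrS p n k →ₗ[ZMod p] ZMod p :=
  (grSystem p n k).totalLift
    (fun i => if i = biDeg p n k e.1 then
      ((divBasis p n k).coord e).comp (Submodule.subtype _) else 0) (by
    intro i x hx
    split_ifs with h
    · subst h
      have : filt p n k (eDeg p n k e.1) ((eWt p n k e.1 : ℤ) - 1) ≤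
          LinearMap.ker ((divBasis p n k).coord e) := by
        rw [filt_eq_span, Submodule.span_le]
        rintro _ ⟨f, -, h2, rfl⟩
        rw [SetLike.mem_coe, LinearMap.mem_ker, ← divBasis_apply, Module.Basis.coord_apply,
          Module.Basis.repr_self, Finsupp.single_eq_of_ne]
        rintro rfl
        omega
      exact this hx
    · rfl)

theorem grCoord_self (e : Red p (GIdx n k)) : grCoord p n k e (gmonoSym p n k e.1) ≠ 0 := by
  rw [grCoord, gmonoSym, SubquotientSystem.totalLift_sym, if_pos rfl]
  change (divBasis p n k).coord e (gmono p n k e.1) ≠ 0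
  rw [gmono_eq_smul, map_smul, ← divBasis_apply, Module.Basis.coord_apply,
    Module.Basis.repr_self, Finsupp.single_eq_same, smul_eq_mul, mul_one]
  exact prod_factorial_ne_zero e

theorem grCoord_of_ne {e f : Red p (GIdx n k)} (h : e ≠ f) :
    grCoord p n k e (gmonoSym p n k f.1) = 0 := by
  rw [grCoord, gmonoSym, SubquotientSystem.totalLift_sym]
  split_ifs
  · change (divBasis p n k).coord e (gmono p n k f.1) = 0
    rw [gmono_eq_smul, map_smul, ← divBasis_apply, Module.Basis.coord_apply,
      Module.Basis.repr_self, Finsupp.single_eq_of_ne h, smul_zero]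
  · rfl

theorem linearIndependent_gmonoSym :
    LinearIndependent (ZMod p) fun e : Red p (GIdx n k) => gmonoSym p n k e.1 := by
  rw [linearIndependent_iff']
  intro S c hc e he
  have h1 := congrArg (grCoord p n k e) hc
  rw [map_zero, map_sum, Finset.sum_eq_single e] at h1
  · rw [map_smul, smul_eq_mul] at h1
    exact (mul_eq_zero.mp h1).resolve_right (grCoord_self e)
  · intro f _ hf
    rw [map_smul, grCoord_of_ne (Ne.symm hf), smul_zero]
  · intro h; exact absurd he h

theorem span_gmonoSym :
    ⊤ ≤ Submodule.span (ZMod p) (Set.range fun e : Red p (GIdx n k) => gmonoSym p n k e.1) := by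
  rintro x -
  induction x using SubquotientSystem.total_induction with
  | h0 => exact Submodule.zero_mem _
  | ha x y hx hy => exact Submodule.add_mem _ hx hy
  | hs i x =>
    obtain ⟨t, M⟩ := i
    obtain ⟨x, hx⟩ := x
    have key : ∀ y ∈ filt p n k t M, ∀ h : y ∈ (grSystem p n k).Z (t, M),
        (grSystem p n k).sym (t, M) ⟨y, h⟩ ∈
          Submodule.span (ZMod p) (Set.range fun e : Red p (GIdx n k) => gmonoSym p n k e.1) := by
      intro y hy
      have hle : filt p n k t M = (grSystem p n k).Z (t, M) := rfl
      have hy0 := hy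
      rw [filt_eq_span] at hy
      induction hy using Submodule.span_induction with
      | mem y hy =>
        intro h
        obtain ⟨e, rfl, h2, rfl⟩ := hy
        rcases h2.lt_or_eq with h2 | h2
        · have : (grSystem p n k).sym (eDeg p n k e.1, M) ⟨divMono p n k e.1, h⟩ = 0 :=
            (grSystem p n k).sym_eq_zero.mpr (divMono_mem_filt e.1 rfl (by
              change (eWt p n k e.1 : ℤ) ≤ M - 1; omega))
          rw [this]
          exact Submodule.zero_mem _
        · subst h2
          have e1 : (e.1.prod fun _ m => ((m.factorial : ℕ) : ZMod p)) •
              (grSystem p n k).sym (eDeg p n k e.1, (eWt p n k e.1 : ℤ)) ⟨divMono p n k e.1, h⟩ =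
                gmonoSym p n k e.1 := by
            rw [← map_smul, gmonoSym]
            exact (grSystem p n k).sym_congr rfl (gmono_eq_smul e).symm
          have e2 : gmonoSym p n k e.1 ∈ Submodule.span (ZMod p)
            (Set.range fun e : Red p (GIdx n k) => gmonoSym p n k e.1) :=
              Submodule.subset_span ⟨e, rfl⟩
          rw [← e1] at e2
          have := Submodule.smul_mem _ (e.1.prod fun _ m => ((m.factorial : ℕ) : ZMod p))⁻¹ e2
          rwa [smul_smul, inv_mul_cancel₀ (prod_factorial_ne_zero e), one_smul] at this
      | zero =>
        intro h
        rw [(grSystem p n k).sym_eq_zero.mpr (Submodule.zero_mem _)]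
        exact Submodule.zero_mem _
      | add y z hy hz ihy ihz =>
        intro h
        rw [← filt_eq_span] at hy hz
        have := Submodule.add_mem _ (ihy hy hy) (ihz hz hz)
        rwa [← map_add] at this
      | smul c y hy ihy =>
        intro h
        rw [← filt_eq_span] at hy
        have := Submodule.smul_mem _ c (ihy hy hy)
        rwa [← map_smul] at this
    exact key x hx hx

theorem lower_mem_tensorPairs {t : IDeg p n} {M : ℤ} {u : MoravaAlg p n k ⊗[ZMod p] MoravaAlg p n k}
    (hu : u ∈ tensorFilt p n k t (M - 1)) :
    (u, 0) ∈ (grSystem p n k).tensorPairs (t, M) := by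
  suffices h : tensorFilt p n k t (M - 1) ≤ ((grSystem p n k).tensorPairs (t, M)).comap
      (LinearMap.inl (ZMod p) _ _) from h hu
  unfold tensorFilt
  rw [Submodule.span_le]
  rintro _ ⟨e, f, rfl, h2, rfl⟩
  have he : mono p n k e ∈ filt p n k (expDeg p n k e) (expWt p n k e) :=
    Submodule.subset_span ⟨e, rfl, le_rfl, rfl⟩
  have hf : mono p n k f ∈ filt p n k (expDeg p n k f) (M - expWt p n k e - 1) :=
    Submodule.subset_span ⟨f, rfl, by omega, rfl⟩
  have hf' : mono p n k f ∈ filt p n k (expDeg p n k f) (M - expWt p n k e) :=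
    filt_mono (by omega) hf
  have h := (grSystem p n k).tmul_mem_tensorPairs
    (a := (expDeg p n k e, (expWt p n k e : ℤ))) (b := (expDeg p n k f, M - expWt p n k e))
    (i := (expDeg p n k e + expDeg p n k f, M)) (Prod.ext rfl (add_sub_cancel _ _))
    ⟨_, he⟩ ⟨_, hf'⟩
  have h0 : (grSystem p n k).sym (expDeg p n k f, M - expWt p n k e) ⟨mono p n k f, hf'⟩ = 0 :=
    (grSystem p n k).sym_eq_zero.mpr hf
  rw [h0, TensorProduct.tmul_zero] at h
  exact h

/-- A diagonal for which the classes of the `t_s^{p^j}` are primitive is the induced one. -/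
theorem isInducedComul_of_primitive (hkn : k ≤ n)
    (Δ : GrS p n k →ₐ[ZMod p] GrS p n k ⊗[ZMod p] GrS p n k)
    (hΔ : ∀ a, Δ (genSym p n k a) = genSym p n k a ⊗ₜ[ZMod p] 1 + 1 ⊗ₜ[ZMod p] genSym p n k a) :
    IsInducedComul p n k Δ := by
  have hgen : ∀ a, (comulHom p n k (genPow p n k a), Δ (genSym p n k a)) ∈
      (grSystem p n k).tensorPairs (hDeg p n k a, (genWt p n k a.1 : ℤ)) := by
    intro a
    have h1 := lower_mem_tensorPairs (comulHom_genPow_sub_mem (p := p) hkn a)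
    have h2 := (grSystem p n k).tmul_mem_tensorPairs (add_zero (hDeg p n k a, (genWt p n k a.1 : ℤ)))
      ⟨_, genPow_mem_filt a⟩ ⟨1, (grSystem p n k).one_mem⟩
    have h3 := (grSystem p n k).tmul_mem_tensorPairs (zero_add (hDeg p n k a, (genWt p n k a.1 : ℤ)))
      ⟨1, (grSystem p n k).one_mem⟩ ⟨_, genPow_mem_filt a⟩
    have h4 := Submodule.add_mem _ h1 (Submodule.add_mem _ h2 h3)
    rw [Prod.mk_add_mk, Prod.mk_add_mk, zero_add, sub_add_cancel] at h4
    rw [hΔ]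
    exact h4
  have hmono : ∀ e, (comulHom p n k (gmono p n k e), Δ (gmonoSym p n k e)) ∈
      (grSystem p n k).tensorPairs (biDeg p n k e) := by
    intro e
    induction e using finsupp_nat_induction with
    | h0 =>
      have := (grSystem p n k).tmul_mem_tensorPairs (zero_add (0 : IDeg p n × ℤ))
        ⟨1, (grSystem p n k).one_mem⟩ ⟨1, (grSystem p n k).one_mem⟩
      rw [gmonoSym_zero, gmono_zero, map_one, map_one, biDeg_zero]
      exact this
    | hs e a ih =>
      have := (grSystem p n k).mul_mem_tensorPairs (hgen a) ih
      rw [gmonoSym_add_single, biDeg_add, biDeg_single_one, gmono_add, gmono_single, pow_one,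
        map_mul, map_mul, add_comm (biDeg p n k e), mul_comm (comulHom p n k (gmono p n k e))]
      exact this
  rintro ⟨t, M⟩ ⟨x, hx⟩
  refine (grSystem p n k).exists_of_mem_tensorPairs (i := (t, M)) (u := comulHom p n k x) ?_
  have hx0 : x ∈ filt p n k t M := hx
  have key : ∀ y ∈ filt p n k t M, ∀ h : y ∈ (grSystem p n k).Z (t, M),
      (comulHom p n k y, Δ ((grSystem p n k).sym (t, M) ⟨y, h⟩)) ∈
        (grSystem p n k).tensorPairs (t, M) := by
    intro y hy
    rw [filt_eq_span] at hy
    induction hy using Submodule.span_induction with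
    | mem y hy =>
      intro h
      obtain ⟨e, rfl, h2, rfl⟩ := hy
      rcases h2.lt_or_eq with h2 | h2
      · have h3 : divMono p n k e.1 ∈ filt p n k (eDeg p n k e.1) (M - 1) :=
          divMono_mem_filt e.1 rfl (by omega)
        have : (grSystem p n k).sym (eDeg p n k e.1, M) ⟨divMono p n k e.1, h⟩ = 0 :=
          (grSystem p n k).sym_eq_zero.mpr h3
        rw [this, map_zero]
        exact lower_mem_tensorPairs (comulHom_mem hkn h3)
      · subst h2
        have e1 : (grSystem p n k).sym (eDeg p n k e.1, (eWt p n k e.1 : ℤ)) ⟨divMono p n k e.1, h⟩ =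
            (e.1.prod fun _ m => ((m.factorial : ℕ) : ZMod p))⁻¹ • gmonoSym p n k e.1 := by
          rw [gmonoSym, ← map_smul]
          exact (grSystem p n k).sym_congr rfl rfl
        have := Submodule.smul_mem _ (e.1.prod fun _ m => ((m.factorial : ℕ) : ZMod p))⁻¹ (hmono e.1)
        rw [e1, divMono, map_smul, map_smul]
        exact this
    | zero =>
      intro h
      rw [(grSystem p n k).sym_eq_zero.mpr (Submodule.zero_mem _), map_zero, map_zero]
      exact Submodule.zero_mem _
    | add y z hy hz ihy ihz =>
      intro h
      rw [← filt_eq_span] at hy hz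
      have := Submodule.add_mem _ (ihy hy) (ihz hz)
      rwa [Prod.mk_add_mk, ← map_add, ← map_add, ← map_add] at this
    | smul c y hy ihy =>
      intro h
      rw [← filt_eq_span] at hy
      have := Submodule.smul_mem _ c (ihy hy)
      rwa [Prod.smul_mk, ← map_smul, ← map_smul, ← map_smul] at this
  exact key x hx0 hx

/-- The associated graded Hopf algebra of `S(n,k)`. -/
theorem exists_grS_hopfData (hkn : k ≤ n) :
    ∃ H : HopfData (ZMod p) (GrS p n k), IsInducedComul p n k H.comul ∧
      ∃ Θ : TruncAlg p n k ≃ₐ[ZMod p] GrS p n k, ∀ a,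
        (grSystem p n k).Represents (hDeg p n k a, (genWt p n k a.1 : ℤ)) (genPow p n k a)
          (Θ (truncGen p n k a)) ∧
        H.comul (Θ (truncGen p n k a)) =
          Θ (truncGen p n k a) ⊗ₜ[ZMod p] 1 + 1 ⊗ₜ[ZMod p] Θ (truncGen p n k a) := by
  obtain ⟨H, Θ, h⟩ := exists_trunc_hopfData (p := p) grS_mul_comm (genSym p n k) genSym_pow
    (gmonoSym p n k) gmonoSym_zero gmonoSym_add_single linearIndependent_gmonoSym span_gmonoSym
  have hΘ : ∀ a, Θ (truncGen p n k a) = genSym p n k a := fun a => (h a).1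
  refine ⟨H, isInducedComul_of_primitive hkn H.comul fun a => (h a).2, Θ, fun a => ⟨?_, ?_⟩⟩
  · rw [hΘ]
    exact ⟨genPow_mem_filt a, rfl⟩
  · rw [hΘ]
    exact (h a).2

end AssociatedGraded

/-! ### The first page as a vector space -/

section FirstPage

variable {p n k : ℕ} [hp : Fact p.Prime] [NeZero n] [NeZero k]

variable (p n k) in
/-- The tridegree of a word. -/
def wTri (l : List (Letter p (GIdx n k))) : Tri p n := (l.length, wDeg p n k l, (wWt p n k l : ℤ))

variable (p n k) in
/-- The part of a combination of words of a given tridegree. -/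
def wordPart (i : Tri p n) : WordMod p (GIdx n k) Unit (ZMod p) →ₗ[ZMod p]
    WordMod p (GIdx n k) Unit (ZMod p) :=
  Finsupp.linearCombination (ZMod p) fun q =>
    if wTri p n k q.1 = i then Finsupp.single q 1 else 0

theorem wordPart_single (i : Tri p n) (q : List (Letter p (GIdx n k)) × Unit) (c : ZMod p) :
    wordPart p n k i (Finsupp.single q c) =
      if wTri p n k q.1 = i then Finsupp.single q c else 0 := by
  rw [wordPart, Finsupp.linearCombination_single]
  split_ifs
  · rw [Finsupp.smul_single, smul_eq_mul, mul_one]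
  · rw [smul_zero]

theorem wordPart_of_mem {s : ℕ} {t : IDeg p n} {M : ℤ} {z : WordMod p (GIdx n k) Unit (ZMod p)}
    (hz : z ∈ wordsEq p n k s t M) : wordPart p n k (s, t, M) z = z := by
  rw [← sub_eq_zero]
  refine map_mem_of_supported (wordPart p n k (s, t, M) - LinearMap.id) _
    (⊥ : Submodule (ZMod p) (WordMod p (GIdx n k) Unit (ZMod p))) ?_ z hz
  rintro q ⟨h1, h2, h3⟩
  rw [LinearMap.sub_apply, wordPart_single, if_pos (Prod.ext h1 (Prod.ext h2 h3))]
  exact sub_self _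

theorem wordPart_of_mem_of_ne {s : ℕ} {t : IDeg p n} {M : ℤ}
    {z : WordMod p (GIdx n k) Unit (ZMod p)} (hz : z ∈ wordsEq p n k s t M) {i : Tri p n}
    (h : (s, t, M) ≠ i) : wordPart p n k i z = 0 := by
  refine map_mem_of_supported (wordPart p n k i) _
    (⊥ : Submodule (ZMod p) (WordMod p (GIdx n k) Unit (ZMod p))) ?_ z hz
  rintro q ⟨h1, h2, h3⟩
  rw [wordPart_single, if_neg]
  · exact Submodule.zero_mem _
  · rintro rfl
    exact h (Prod.ext h1.symm (Prod.ext h2.symm h3.symm))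

theorem wordPart_mem (s : ℕ) (t : IDeg p n) (M : ℤ) (z : WordMod p (GIdx n k) Unit (ZMod p)) :
    wordPart p n k (s, t, M) z ∈ wordsEq p n k s t M := by
  refine map_mem_of_supported (wordPart p n k (s, t, M)) Set.univ (wordsEq p n k s t M) ?_ z (by simp)
  rintro q -
  rw [wordPart_single]
  split_ifs with h
  · exact Finsupp.single_mem_supported _ _
      ⟨congrArg Prod.fst h, congrArg (fun i => i.2.1) h, congrArg (fun i => i.2.2) h⟩
  · exact Submodule.zero_mem _

theorem sub_wordPart_mem {s : ℕ} {t : IDeg p n} {M : ℤ} {z : WordMod p (GIdx n k) Unit (ZMod p)}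
    (hz : z ∈ wordsLE p n k s t M) :
    z - wordPart p n k (s, t, M) z ∈ wordsLE p n k s t (M - 1) := by
  refine map_mem_of_supported (LinearMap.id - wordPart p n k (s, t, M)) _
    (wordsLE p n k s t (M - 1)) ?_ z hz
  rintro q ⟨h1, h2, h3⟩
  rw [LinearMap.sub_apply, LinearMap.id_apply, wordPart_single]
  split_ifs with h
  · rw [sub_self]; exact Submodule.zero_mem _
  · rw [sub_zero]
    refine Finsupp.single_mem_supported _ _ ⟨h1, h2, ?_⟩
    have : (wWt p n k q.1 : ℤ) ≠ M := fun h' => h (Prod.ext h1 (Prod.ext h2 h'))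
    change (wWt p n k q.1 : ℤ) ≤ M - 1
    have h3 : (wWt p n k q.1 : ℤ) ≤ M := h3
    omega

theorem wordPart_of_mem_lower {s : ℕ} {t : IDeg p n} {M : ℤ}
    {z : WordMod p (GIdx n k) Unit (ZMod p)} (hz : z ∈ wordsLE p n k s t (M - 1)) :
    wordPart p n k (s, t, M) z = 0 := by
  refine map_mem_of_supported (wordPart p n k (s, t, M)) _
    (⊥ : Submodule (ZMod p) (WordMod p (GIdx n k) Unit (ZMod p))) ?_ z hz
  rintro q ⟨h1, h2, h3⟩
  have h3 : (wWt p n k q.1 : ℤ) ≤ M - 1 := h3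
  rw [wordPart_single, if_neg]
  · exact Submodule.zero_mem _
  · intro h
    have : (wWt p n k q.1 : ℤ) = M := congrArg (fun i => i.2.2) h
    omega

theorem wordPart_cobD (s : ℕ) (t : IDeg p n) (M : ℤ) (z : WordMod p (GIdx n k) Unit (ZMod p)) :
    wordPart p n k (s + 1, t, M) (cobD p (GIdx n k) (ZMod p) z) =
      cobD p (GIdx n k) (ZMod p) (wordPart p n k (s, t, M) z) := by
  rw [← sub_eq_zero]
  refine map_mem_of_supported ((wordPart p n k (s + 1, t, M)).comp (cobD p (GIdx n k) (ZMod p)) -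
    (cobD p (GIdx n k) (ZMod p)).comp (wordPart p n k (s, t, M))) Set.univ
    (⊥ : Submodule (ZMod p) (WordMod p (GIdx n k) Unit (ZMod p))) ?_ z (by simp)
  rintro ⟨l, u⟩ -
  rw [LinearMap.sub_apply, LinearMap.comp_apply, LinearMap.comp_apply, wordPart_single,
    Submodule.mem_bot]
  have h := cobD_mem_wordsEq (single_mem_wordsEq (p := p) l u 1)
  split_ifs with h'
  · obtain ⟨rfl, rfl, rfl⟩ : l.length = s ∧ wDeg p n k l = t ∧ (wWt p n k l : ℤ) = M := by
      simpa [wTri] using h'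
    rw [wordPart_of_mem h, sub_self]
  · rw [map_zero, sub_zero, wordPart_of_mem_of_ne h]
    intro h''
    refine h' ?_
    simpa [wTri] using h''

theorem wordPart_cobD_zero (t : IDeg p n) (M : ℤ) (z : WordMod p (GIdx n k) Unit (ZMod p)) :
    wordPart p n k (0, t, M) (cobD p (GIdx n k) (ZMod p) z) = 0 := by
  refine map_mem_of_supported ((wordPart p n k (0, t, M)).comp (cobD p (GIdx n k) (ZMod p)))
    Set.univ (⊥ : Submodule (ZMod p) (WordMod p (GIdx n k) Unit (ZMod p))) ?_ z (by simp)
  rintro ⟨l, u⟩ -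
  refine wordPart_of_mem_of_ne (cobD_mem_wordsEq (single_mem_wordsEq (p := p) l u 1)) ?_
  intro h
  simpa using congrArg Prod.fst h

theorem cobD_wordPart_eq_zero {z : WordMod p (GIdx n k) Unit (ZMod p)}
    (hz : cobD p (GIdx n k) (ZMod p) z = 0) (i : Tri p n) :
    cobD p (GIdx n k) (ZMod p) (wordPart p n k i z) = 0 := by
  obtain ⟨s, t, M⟩ := i
  rw [← wordPart_cobD, hz, map_zero]

theorem exists_eq_sum_wordPart (z : WordMod p (GIdx n k) Unit (ZMod p)) :
    ∃ S : Finset (Tri p n), ∀ T, S ⊆ T → ∑ i ∈ T, wordPart p n k i z = z := by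
  classical
  induction z using Finsupp.induction_linear with
  | zero => exact ⟨∅, fun T _ => Finset.sum_eq_zero fun i _ => map_zero _⟩
  | add f g hf hg =>
    obtain ⟨S, hS⟩ := hf
    obtain ⟨S', hS'⟩ := hg
    refine ⟨S ∪ S', fun T hT => ?_⟩
    rw [Finset.sum_congr rfl fun i _ => map_add _ f g, Finset.sum_add_distrib,
      hS T (Finset.union_subset_left hT), hS' T (Finset.union_subset_right hT)]
  | single q c =>
    refine ⟨{wTri p n k q.1}, fun T hT => ?_⟩
    rw [Finset.sum_eq_single (wTri p n k q.1), wordPart_single, if_pos rfl]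
    · intro i _ hi
      rw [wordPart_single, if_neg (Ne.symm hi)]
    · intro h
      exact absurd (hT (Finset.mem_singleton_self _)) h

variable (p n k) in
/-- The combination of words representing an element of the cobar complex. -/
def words (x : Cobar p n k) : WordMod p (GIdx n k) Unit (ZMod p) := (wordEquiv p n k).symm x

theorem wordCob_words (x : Cobar p n k) : wordCob p n k (words p n k x) = x := by
  rw [← wordEquiv_apply, words, LinearEquiv.apply_symm_apply]

theorem words_wordCob (z : WordMod p (GIdx n k) Unit (ZMod p)) :
    words p n k (wordCob p n k z) = z := by
  rw [← wordEquiv_apply, words, LinearEquiv.symm_apply_apply]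

theorem words_mem {s : ℕ} {t : IDeg p n} {M : ℤ} {x : Cobar p n k}
    (hx : x ∈ cobarFilt p n k s t M) : words p n k x ∈ wordsLE p n k s t M := by
  obtain ⟨z, hz, rfl⟩ := exists_wordCob hx
  rwa [words_wordCob]

theorem words_sub (x y : Cobar p n k) : words p n k (x - y) = words p n k x - words p n k y :=
  map_sub (wordEquiv p n k).symm x y

theorem words_add (x y : Cobar p n k) : words p n k (x + y) = words p n k x + words p n k y :=
  map_add (wordEquiv p n k).symm x y

/-- The words of leading filtration in the differential of `x`. -/
theorem wordPart_cobarD (hkn : k ≤ n) {s : ℕ} {t : IDeg p n} {M : ℤ} {x : Cobar p n k}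
    (hx : x ∈ cobarFilt p n k s t M) : wordPart p n k (s + 1, t, M) (words p n k (cobarD p n k x)) =
      cobD p (GIdx n k) (ZMod p) (wordPart p n k (s, t, M) (words p n k x)) := by
  have h := words_mem (cobarD_wordCob_sub_mem hkn (words_mem hx))
  rw [words_sub, words_wordCob, wordCob_words] at h
  have h' := wordPart_of_mem_lower h
  rw [map_sub, sub_eq_zero] at h'
  rw [h', wordPart_cobD]

theorem cobD_wordPart_words (hkn : k ≤ n) (i : Tri p n) {x : Cobar p n k}
    (hx : x ∈ (page p n k 1).Z i) :
    cobD p (GIdx n k) (ZMod p) (wordPart p n k i (words p n k x)) = 0 := by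
  obtain ⟨s, t, M⟩ := i
  obtain ⟨h1, h2⟩ := mem_pageZ.mp hx
  rw [← wordPart_cobarD hkn h1]
  rw [Nat.cast_one] at h2
  exact wordPart_of_mem_lower (words_mem h2)

/-- The linear map from `E_1` to the span of the `γ_N`, on representatives. -/
def firstPageCycles (hkn : k ≤ n) (i : Tri p n) :
    (page p n k 1).Z i →ₗ[ZMod p] ((GIdx n k →₀ ℕ) →₀ ZMod p) :=
  (cobClass (GIdx n k) (ZMod p) hp.out.two_le).comp
    (LinearMap.codRestrict (LinearMap.ker (cobD p (GIdx n k) (ZMod p)))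
      ((wordPart p n k i).comp ((wordEquiv p n k).symm.toLinearMap.comp (Submodule.subtype _)))
      fun x => cobD_wordPart_words hkn i x.2)

theorem cobRel_firstPageCycles (hkn : k ≤ n) (i : Tri p n) (x : (page p n k 1).Z i) :
    CobRel hp.out.two_le (wordPart p n k i (words p n k x)) (firstPageCycles hkn i x) :=
  cobRel_cobClass hp.out.two_le ⟨wordPart p n k i (words p n k x), cobD_wordPart_words hkn i x.2⟩

theorem firstPageCycles_eq_zero (hkn : k ≤ n) (i : Tri p n) (x : (page p n k 1).Z i)
    (hx : (x : Cobar p n k) ∈ (page p n k 1).B i) : firstPageCycles hkn i x = 0 := by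
  refine eq_of_cobRel hp.out.two_le (cobRel_firstPageCycles hkn i x) ?_
  obtain ⟨s, t, M⟩ := i
  obtain ⟨y, hy, w, hw, h⟩ := mem_pageB.mp hx
  rw [← h, words_add, map_add, wordPart_of_mem_lower (words_mem (mem_pageZ.mp hy).1), zero_add]
  rcases hw with rfl | ⟨s, rfl, hw⟩
  · rw [map_zero]
    have : wordPart p n k (s, t, M) (words p n k 0) = cobD p (GIdx n k) (ZMod p) 0 := by
      rw [map_zero, words, map_zero, map_zero]
    rw [this]
    exact cobRel_cobD _ _
  · have hw := (mem_pageZ.mp hw).1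
    rw [Nat.cast_one, sub_self, add_zero] at hw
    rw [wordPart_cobarD hkn hw]
    exact cobRel_cobD _ _

/-- The linear map from `E_1` to the span of the `γ_N`. -/
def firstPageMap (hkn : k ≤ n) : PageTotal p n k 1 →ₗ[ZMod p] ((GIdx n k →₀ ℕ) →₀ ZMod p) :=
  (page p n k 1).totalLift (firstPageCycles hkn) (firstPageCycles_eq_zero hkn)

theorem firstPageMap_sym (hkn : k ≤ n) {i : Tri p n} (x : (page p n k 1).Z i)
    {w : (GIdx n k →₀ ℕ) →₀ ZMod p}
    (h : CobRel hp.out.two_le (wordPart p n k i (words p n k x)) w) :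
    firstPageMap hkn ((page p n k 1).sym i x) = w := by
  rw [firstPageMap, SubquotientSystem.totalLift_sym]
  exact eq_of_cobRel hp.out.two_le (cobRel_firstPageCycles hkn i x) h

theorem wordCob_mem_page (hkn : k ≤ n) {s : ℕ} {t : IDeg p n} {M : ℤ}
    {z : WordMod p (GIdx n k) Unit (ZMod p)} (hz : z ∈ wordsEq p n k s t M)
    (hd : cobD p (GIdx n k) (ZMod p) z = 0) : wordCob p n k z ∈ (page p n k 1).Z (s, t, M) := by
  have hz' := wordsEq_le le_rfl hz
  have h := cobarD_wordCob_sub_mem hkn hz'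
  rw [hd, map_zero, sub_zero] at h
  refine mem_pageZ.mpr ⟨wordCob_mem hz', ?_⟩
  rwa [Nat.cast_one]

theorem cobRel_sum (hp2 : 2 ≤ p) {ι : Type*} (S : Finset ι)
    (z : ι → WordMod p (GIdx n k) Unit (ZMod p)) (w : ι → (GIdx n k →₀ ℕ) →₀ ZMod p)
    (h : ∀ i ∈ S, CobRel hp2 (z i) (w i)) : CobRel hp2 (∑ i ∈ S, z i) (∑ i ∈ S, w i) := by
  classical
  induction S using Finset.induction_on with
  | empty =>
    have := cobRel_cobD (I := GIdx n k) (K := ZMod p) hp2 0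
    rwa [map_zero] at this
  | insert a S ha ih =>
    rw [Finset.sum_insert ha, Finset.sum_insert ha]
    exact cobRel_add hp2 (h a (Finset.mem_insert_self _ _))
      (ih fun i hi => h i (Finset.mem_insert_of_mem hi))

theorem firstPageMap_surjective (hkn : k ≤ n) :
    Function.Surjective (firstPageMap (p := p) hkn) := by
  intro w
  obtain ⟨z, hz, hzw⟩ := exists_cocycle_cobRel hp.out.two_le w
  obtain ⟨S, hS⟩ := exists_eq_sum_wordPart z
  choose v hv using fun i : Tri p n => exists_cobRel hp.out.two_le _ (cobD_wordPart_eq_zero hz i)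
  have hvw : ∑ i ∈ S, v i = w := by
    have := cobRel_sum hp.out.two_le S _ v fun i _ => hv i
    rw [hS S subset_rfl] at this
    exact eq_of_cobRel hp.out.two_le this hzw
  have hm : ∀ i : Tri p n, wordPart p n k i z ∈ wordsEq p n k i.1 i.2.1 i.2.2 :=
    fun i => wordPart_mem i.1 i.2.1 i.2.2 z
  refine ⟨∑ i ∈ S, (page p n k 1).sym i ⟨wordCob p n k (wordPart p n k i z),
    wordCob_mem_page hkn (hm i) (cobD_wordPart_eq_zero hz i)⟩, ?_⟩
  rw [map_sum, ← hvw]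
  refine Finset.sum_congr rfl fun i _ => firstPageMap_sym hkn _ ?_
  rw [words_wordCob, wordPart_of_mem (hm i)]
  exact hv i

/-- If the leading words of a representative form a coboundary, its class in `E_1` is zero. -/
theorem mem_pageB_of_wordPart (hkn : k ≤ n) {i : Tri p n} (x : (page p n k 1).Z i)
    (y : WordMod p (GIdx n k) Unit (ZMod p))
    (h : wordPart p n k i (words p n k x) = wordPart p n k i (cobD p (GIdx n k) (ZMod p) y)) :
    (x : Cobar p n k) ∈ (page p n k 1).B i := by
  obtain ⟨s, t, M⟩ := i
  obtain ⟨x, hx⟩ := x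
  have hx1 := (mem_pageZ.mp hx).1
  have h1 := sub_wordPart_mem (words_mem hx1)
  have h1' := wordCob_mem h1
  rw [map_sub, wordCob_words] at h1'
  have hF : ∀ z ∈ cobarFilt p n k s t (M - 1), z ∈ pageB p n k ((1 : ℕ) : ℤ) (s, t, M) := by
    intro z hz
    refine mem_pageB_of_mem (mem_pageZ.mpr ⟨hz, ?_⟩)
    rw [Nat.cast_one, sub_self, sub_zero]
    exact cobarD_mem hkn hz
  have e : x = (x - wordCob p n k (wordPart p n k (s, t, M) (words p n k x))) +
      wordCob p n k (wordPart p n k (s, t, M) (words p n k x)) := (sub_add_cancel _ _).symm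
  change x ∈ pageB p n k ((1 : ℕ) : ℤ) (s, t, M)
  rw [e]
  refine Submodule.add_mem _ (hF _ h1') ?_
  change wordPart p n k (s, t, M) (words p n k x) = _ at h
  rw [h]
  cases s with
  | zero => rw [wordPart_cobD_zero, map_zero]; exact Submodule.zero_mem _
  | succ s =>
    rw [wordPart_cobD]
    have hy := wordsEq_le le_rfl (wordPart_mem s t M y)
    have h3 := Submodule.neg_mem _ (hF _ (cobarD_wordCob_sub_mem hkn hy))
    have h4 : cobarD p n k (wordCob p n k (wordPart p n k (s, t, M) y)) ∈
        pageB p n k ((1 : ℕ) : ℤ) (s + 1, t, M) := by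
      refine mem_pageB.mpr ⟨0, Submodule.zero_mem _, _, Or.inr ⟨s, rfl, mem_pageZ.mpr ⟨?_, ?_⟩⟩,
        zero_add _⟩
      · rw [Nat.cast_one, sub_self, add_zero]; exact wordCob_mem hy
      · rw [Nat.cast_one, sub_self, add_zero, sub_zero]; exact cobarD_mem hkn (wordCob_mem hy)
    have := Submodule.add_mem _ h3 h4
    rwa [neg_sub, sub_add_cancel] at this

theorem firstPageMap_injective (hkn : k ≤ n) :
    Function.Injective (firstPageMap (p := p) hkn) := by
  rw [injective_iff_map_eq_zero]
  intro x hx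
  choose z hz using fun i => (page p n k 1).exists_cls (x i)
  obtain ⟨S, hS, e⟩ := (page p n k 1).exists_eq_sum_sym x z hz
  have h1 : CobRel hp.out.two_le (∑ i ∈ S, wordPart p n k i (words p n k (z i)))
      (firstPageMap hkn x) := by
    rw [e, map_sum]
    refine cobRel_sum _ _ _ _ fun i _ => ?_
    have := cobRel_firstPageCycles hkn i (z i)
    rwa [firstPageMap_sym hkn (z i) this]
  rw [hx] at h1
  obtain ⟨y, hy⟩ := mem_range_of_cobRel_zero _ h1
  refine DFinsupp.ext fun i => ?_
  by_cases hi : i ∈ S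
  · rw [← hz i]
    refine (page p n k 1).cls_eq_zero.mpr (mem_pageB_of_wordPart hkn (z i) y ?_)
    have hm : ∀ (j : Tri p n) (u : WordMod p (GIdx n k) Unit (ZMod p)),
        wordPart p n k j u ∈ wordsEq p n k j.1 j.2.1 j.2.2 :=
      fun j u => wordPart_mem j.1 j.2.1 j.2.2 u
    rw [hy, map_sum, Finset.sum_eq_single i]
    · exact (wordPart_of_mem (hm i _)).symm
    · intro j _ hj
      exact wordPart_of_mem_of_ne (hm j _) hj
    · intro h; exact absurd hi h
  · exact hS i hi

end FirstPage

/-! ### Relations between the operators `h_a` and `b_a` -/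

section Operators

variable {p : ℕ} [hp : Fact p.Prime] {I : Type*} [LinearOrder I]

theorem opH_anticomm (a a' : I) (w : (I →₀ ℕ) →₀ ZMod p) :
    opH p (ZMod p) a (opH p (ZMod p) a' w) = -opH p (ZMod p) a' (opH p (ZMod p) a w) := by
  suffices h : (opH p (ZMod p) a).comp (opH p (ZMod p) a') =
      -(opH p (ZMod p) a').comp (opH p (ZMod p) a) from LinearMap.congr_fun h w
  refine Finsupp.lhom_ext' fun N => LinearMap.ext_ring ?_
  simp only [LinearMap.comp_apply, LinearMap.neg_apply, Finsupp.lsingle_apply, opH_single]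
  rcases eq_or_ne a a' with rfl | haa
  · split_ifs with h
    · rw [map_smul, opH_single]
      have h2 := par_add hp.out.two_le (N a)
      have e : (N + Finsupp.single a 1 : I →₀ ℕ) a = N a + 1 := by simp
      rw [e]
      split_ifs with h'
      · obtain rfl : p = 2 := le_antisymm (by omega) hp.out.two_le
        exact (ZModModule.neg_eq_self _).symm
      · rw [smul_zero, neg_zero]
    · rw [map_zero, neg_zero]
  · have e1 : (N + Finsupp.single a' 1 : I →₀ ℕ) a = N a := by simp [Ne.symm haa]
    have e2 : (N + Finsupp.single a 1 : I →₀ ℕ) a' = N a' := by simp [haa]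
    have e3 : N + Finsupp.single a' 1 + Finsupp.single a 1 =
      N + Finsupp.single a 1 + Finsupp.single a' 1 := add_right_comm _ _ _
    have e4 : sg (ZMod p) a' N * sg (ZMod p) a (N + Finsupp.single a' 1) =
        -(sg (ZMod p) a N * sg (ZMod p) a' (N + Finsupp.single a 1)) := by
      rcases lt_or_gt_of_ne haa with h | h
      · rw [sg_add_single_not_le (not_le.mpr h), sg_add_single_le h.le]; ring
      · rw [sg_add_single_not_le (not_le.mpr h), sg_add_single_le h.le]; ring
    by_cases h1 : par p (N a) ≤ 1 <;> by_cases h2 : par p (N a') ≤ 1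
    · rw [if_pos h1, if_pos h2, map_smul, map_smul, opH_single, opH_single, e1, e2, if_pos h1,
        if_pos h2, smul_smul, smul_smul, e3, e4, neg_smul]
    · rw [if_pos h1, if_neg h2, map_smul, map_zero, opH_single, e2, if_neg h2, smul_zero, neg_zero]
    · rw [if_neg h1, if_pos h2, map_smul, map_zero, opH_single, e1, if_neg h1, smul_zero, neg_zero]
    · rw [if_neg h1, if_neg h2, map_zero, map_zero, neg_zero]

theorem opH_opB_comm (a a' : I) (w : (I →₀ ℕ) →₀ ZMod p) :
    opH p (ZMod p) a (opB (ZMod p) a' w) = opB (ZMod p) a' (opH p (ZMod p) a w) := by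
  suffices h : (opH p (ZMod p) a).comp (opB (ZMod p) a') =
      (opB (ZMod p) a').comp (opH p (ZMod p) a) from LinearMap.congr_fun h w
  refine Finsupp.lhom_ext' fun N => LinearMap.ext_ring ?_
  simp only [LinearMap.comp_apply, Finsupp.lsingle_apply, opH_single, opB_single]
  have e1 : par p ((N + Finsupp.single a' 2 : I →₀ ℕ) a) = par p (N a) := by
    rcases eq_or_ne a a' with rfl | h
    · have : (N + Finsupp.single a 2 : I →₀ ℕ) a = N a + 2 := by simp
      rw [this, par, par]
      simp [Nat.even_add]
    · simp [Ne.symm h]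
  have e2 : sg (ZMod p) a (N + Finsupp.single a' 2) = sg (ZMod p) a N := by
    rw [sg, sg, map_add, show Finsupp.single a' 2 = Finsupp.single a' 1 + Finsupp.single a' 1 from
      Finsupp.single_add a' 1 1, map_add, pow_add, pow_add, ← mul_pow]
    simp
  rw [e1, e2]
  split_ifs
  · rw [map_smul, opB_single, add_right_comm]
  · rw [map_zero]

theorem opB_comm (a a' : I) (w : (I →₀ ℕ) →₀ ZMod p) :
    opB (ZMod p) a (opB (ZMod p) a' w) = opB (ZMod p) a' (opB (ZMod p) a w) := by
  suffices h : (opB (ZMod p) a).comp (opB (ZMod p) a') =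
      (opB (ZMod p) a').comp (opB (ZMod p) a) from LinearMap.congr_fun h w
  refine Finsupp.lhom_ext' fun N => LinearMap.ext_ring ?_
  simp only [LinearMap.comp_apply, Finsupp.lsingle_apply, opB_single]
  rw [add_right_comm]

theorem opH_opH_self (h2 : p = 2) (a : I) (w : (I →₀ ℕ) →₀ ZMod p) :
    opH p (ZMod p) a (opH p (ZMod p) a w) = opB (ZMod p) a w := by
  suffices h : (opH p (ZMod p) a).comp (opH p (ZMod p) a) = opB (ZMod p) a from
    LinearMap.congr_fun h w
  refine Finsupp.lhom_ext' fun N => LinearMap.ext_ring ?_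
  simp only [LinearMap.comp_apply, Finsupp.lsingle_apply, opH_single, opB_single]
  subst h2
  have hpar : ∀ m, par 2 m ≤ 1 := fun m => by rw [par]; split_ifs <;> omega
  rw [if_pos (hpar _), map_smul, opH_single, if_pos (hpar _), sg_add_single_le le_rfl, smul_smul,
    mul_neg, sg_mul_self, neg_one_smul, ZModModule.neg_eq_self, add_assoc, ← Finsupp.single_add]

end Operators

/-! ### Products on the first page -/

section FirstPageProduct

variable {p n k : ℕ} [hp : Fact p.Prime] [NeZero n] [NeZero k]

/-- The coefficients of the cocycle of `b_a`, by Wilson's theorem. -/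
theorem choose_div_eq {m : ℕ} (h0 : 0 < m) (hm : m < p) : ((p.choose m / p : ℕ) : ZMod p) =
    -(((m.factorial : ℕ) : ZMod p)⁻¹ * (((p - m).factorial : ℕ) : ZMod p)⁻¹) := by
  obtain ⟨c, hc⟩ := hp.out.dvd_choose_self h0.ne' hm
  have h1 := Nat.choose_mul_factorial_mul_factorial hm.le
  rw [hc, ← Nat.mul_factorial_pred hp.out.ne_zero, mul_assoc, mul_assoc] at h1
  have h2 := Nat.eq_of_mul_eq_mul_left hp.out.pos h1
  have h3 := congrArg (Nat.cast : ℕ → ZMod p) h2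
  rw [ZMod.wilsons_lemma] at h3
  push_cast at h3
  rw [hc, Nat.mul_div_cancel_left _ hp.out.pos]
  have h4 := factorial_ne_zero_of_lt hm
  have h5 := factorial_ne_zero_of_lt (p := p) (m := p - m) (by omega)
  field_simp
  linear_combination h3

/-- The cocycle of `b_a` in terms of divided powers: the terms with `m = 0` and `m = p` vanish. -/
theorem bCocycle_eq (a : GIdx n k) : bCocycle p n k a = -splitBar p n k (Finsupp.single a p) := by
  have hz : ∀ m, ¬ m < p → divMono p n k (Finsupp.single a m) = 0 := fun m hm =>
    divMono_eq_zero fun h => hm (by simpa using h a)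
  rw [splitBar, Finsupp.antidiagonal_single, Finset.sum_map, ← Finset.sum_neg_distrib,
    Finset.Nat.sum_antidiagonal_eq_sum_range_succ_mk, bCocycle]
  have hsub : Finset.Ioo 0 p ⊆ Finset.range p.succ := by
    intro m hm
    rw [Finset.mem_Ioo] at hm
    rw [Finset.mem_range]; omega
  refine Eq.trans (Finset.sum_congr rfl fun m hm => ?_) (Finset.sum_subset hsub fun m hm hm' => ?_)
  · rw [Finset.mem_Ioo] at hm
    change _ = -(bar p n k (divMono p n k (Finsupp.single a m)) *
      bar p n k (divMono p n k (Finsupp.single a (p - m))))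
    rw [divMono_single, divMono_single, map_smul, map_smul, smul_mul_smul_comm,
      choose_div_eq hm.1 hm.2, neg_smul]
  · change -(bar p n k (divMono p n k (Finsupp.single a m)) *
      bar p n k (divMono p n k (Finsupp.single a (p - m)))) = 0
    rw [Finset.mem_Ioo] at hm'
    rcases Nat.eq_zero_or_pos m with rfl | h0
    · rw [Finsupp.single_zero, bar_divMono_zero, zero_mul, neg_zero]
    · rw [hz m (by tauto), map_zero, zero_mul, neg_zero]

theorem wordCob_betaL (a : GIdx n k) (z : WordMod p (GIdx n k) Unit (ZMod p)) :
    wordCob p n k (betaL a z) = bCocycle p n k a * wordCob p n k z := by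
  rw [betaL, LinearMap.neg_apply, map_neg, wordCob_splitL, bCocycle_eq, neg_mul]

theorem divMono_single_one (a : GIdx n k) :
    divMono p n k (Finsupp.single a 1) = genPow p n k a := by
  rw [divMono_single, Nat.factorial_one, Nat.cast_one, inv_one, one_smul, pow_one]

theorem wordCob_ltr_single (a : GIdx n k) (z : WordMod p (GIdx n k) Unit (ZMod p)) :
    wordCob p n k (ltr p _ _ (Finsupp.single a 1) z) =
      bar p n k (genPow p n k a) * wordCob p n k z := by
  rw [wordCob_ltr, divMono_single_one]

theorem bDeg_eq (a : GIdx n k) : bDeg p n k a = p • hDeg p n k a := by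
  rw [bDeg, hDeg, ← Nat.cast_smul_eq_nsmul ℕ, nsmul_eq_mul, ← Nat.cast_mul]
  congr 1
  simp only [Nat.cast_id]
  ring

theorem ltr_single_mem (a : GIdx n k) {s : ℕ} {t : IDeg p n} {M : ℤ}
    {z : WordMod p (GIdx n k) Unit (ZMod p)} (hz : z ∈ wordsEq p n k s t M) :
    ltr p _ _ (Finsupp.single a 1) z ∈
      wordsEq p n k (1 + s) (hDeg p n k a + t) ((genWt p n k a.1 : ℤ) + M) := by
  have := ltr_mem_wordsEq (Finsupp.single a 1) hz
  rwa [eDeg_single, one_smul, eWt_single, one_mul, add_comm s 1] at this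

theorem betaL_mem (a : GIdx n k) {s : ℕ} {t : IDeg p n} {M : ℤ}
    {z : WordMod p (GIdx n k) Unit (ZMod p)} (hz : z ∈ wordsEq p n k s t M) :
    betaL a z ∈ wordsEq p n k (2 + s) (bDeg p n k a + t) ((p * genWt p n k a.1 : ℤ) + M) := by
  have := Submodule.neg_mem _ (splitL_mem_wordsEq (Finsupp.single a p) hz)
  rwa [eDeg_single, ← bDeg_eq, eWt_single, add_comm s 2, Nat.cast_mul] at this

theorem cobD_nil : cobD p (GIdx n k) (ZMod p) (Finsupp.single ([], ()) 1) = 0 := wordD_nil _ _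

theorem cobD_ltr_single (a : GIdx n k) :
    cobD p (GIdx n k) (ZMod p) (ltr p _ _ (Finsupp.single a 1) (Finsupp.single ([], ()) 1)) = 0 := by
  rw [cobD, ltr_single_anticomm hp.out.two_le, ← cobD, cobD_nil, map_zero, neg_zero]

theorem cobD_betaL (a : GIdx n k) :
    cobD p (GIdx n k) (ZMod p) (betaL a (Finsupp.single ([], ()) 1)) = 0 := by
  rw [cobD, betaL_comm, ← cobD, cobD_nil, map_zero]

theorem wordCob_nil : wordCob p n k (Finsupp.single ([], ()) 1) = 1 := wordCob_single [] ()

theorem nil_mem_wordsEq : Finsupp.single ([], ()) 1 ∈ wordsEq p n k 0 0 0 :=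
  single_mem_wordsEq [] () 1

theorem bar_genPow_mem_page (hkn : k ≤ n) (a : GIdx n k) : bar p n k (genPow p n k a) ∈
    (page p n k 1).Z (1, hDeg p n k a, (genWt p n k a.1 : ℤ)) := by
  have h := wordCob_mem_page hkn (ltr_single_mem a nil_mem_wordsEq) (cobD_ltr_single (p := p) a)
  rwa [wordCob_ltr_single, wordCob_nil, mul_one, add_zero, add_zero, add_zero] at h

theorem bCocycle_mem_page (hkn : k ≤ n) (a : GIdx n k) : bCocycle p n k a ∈
    (page p n k 1).Z (2, bDeg p n k a, (p * genWt p n k a.1 : ℤ)) := by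
  have h := wordCob_mem_page hkn (betaL_mem a nil_mem_wordsEq) (cobD_betaL (p := p) a)
  rwa [wordCob_betaL, wordCob_nil, mul_one, add_zero, add_zero, add_zero] at h

/-- An operator that shifts tridegrees commutes with taking homogeneous parts. -/
theorem wordPart_comp (L : WordMod p (GIdx n k) Unit (ZMod p) →ₗ[ZMod p]
      WordMod p (GIdx n k) Unit (ZMod p)) (s₀ : ℕ) (t₀ : IDeg p n) (M₀ : ℤ)
    (hL : ∀ s t M, ∀ z ∈ wordsEq p n k s t M, L z ∈ wordsEq p n k (s₀ + s) (t₀ + t) (M₀ + M))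
    (s : ℕ) (t : IDeg p n) (M : ℤ) (z : WordMod p (GIdx n k) Unit (ZMod p)) :
    wordPart p n k (s₀ + s, t₀ + t, M₀ + M) (L z) = L (wordPart p n k (s, t, M) z) := by
  rw [← sub_eq_zero]
  refine map_mem_of_supported ((wordPart p n k (s₀ + s, t₀ + t, M₀ + M)).comp L -
    L.comp (wordPart p n k (s, t, M))) Set.univ
    (⊥ : Submodule (ZMod p) (WordMod p (GIdx n k) Unit (ZMod p))) ?_ z (by simp)
  rintro ⟨l, u⟩ -
  rw [LinearMap.sub_apply, LinearMap.comp_apply, LinearMap.comp_apply, wordPart_single,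
    Submodule.mem_bot]
  have h := hL _ _ _ _ (single_mem_wordsEq (p := p) l u 1)
  split_ifs with h'
  · obtain ⟨rfl, rfl, rfl⟩ : l.length = s ∧ wDeg p n k l = t ∧ (wWt p n k l : ℤ) = M := by
      simpa [wTri] using h'
    rw [wordPart_of_mem h, sub_self]
  · rw [map_zero, sub_zero, wordPart_of_mem_of_ne h]
    intro h''
    refine h' ?_
    simpa [wTri] using h''

/-- Left multiplication on `E_1` by the class of `c` corresponds to the operator `O` on the span of
the `γ_N`, if left multiplication by `c` is homogeneous on words and compatible with `O`. -/
theorem firstPageMap_sym_mul (hkn : k ≤ n) {s₀ : ℕ} {t₀ : IDeg p n} {M₀ : ℤ}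
    (c : (page p n k 1).Z (s₀, t₀, M₀))
    (L : WordMod p (GIdx n k) Unit (ZMod p) →ₗ[ZMod p] WordMod p (GIdx n k) Unit (ZMod p))
    (O : ((GIdx n k →₀ ℕ) →₀ ZMod p) →ₗ[ZMod p] ((GIdx n k →₀ ℕ) →₀ ZMod p))
    (hLc : ∀ z, wordCob p n k (L z) = c * wordCob p n k z)
    (hL : ∀ s t M, ∀ z ∈ wordsEq p n k s t M, L z ∈ wordsEq p n k (s₀ + s) (t₀ + t) (M₀ + M))
    (hO : ∀ z w, CobRel hp.out.two_le z w → CobRel hp.out.two_le (L z) (O w))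
    (x : PageTotal p n k 1) :
    firstPageMap hkn ((page p n k 1).sym (s₀, t₀, M₀) c * x) = O (firstPageMap hkn x) := by
  refine (page p n k 1).total_induction (P := fun x => firstPageMap hkn
    ((page p n k 1).sym (s₀, t₀, M₀) c * x) = O (firstPageMap hkn x)) ?_ ?_ ?_ x
  · rw [mul_zero, map_zero, map_zero]
  · rintro ⟨s, t, M⟩ y
    have h := cobRel_firstPageCycles hkn (s, t, M) y
    rw [firstPageMap_sym hkn y h, SubquotientSystem.sym_mul]
    refine firstPageMap_sym hkn _ ?_
    have e : words p n k ((c : Cobar p n k) * y) = L (words p n k y) := by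
      rw [← words_wordCob (L _), hLc, wordCob_words]
    change CobRel _ (wordPart p n k ((s₀, t₀, M₀) + (s, t, M)) (words p n k (c * y))) _
    rw [e, tri_add, wordPart_comp L s₀ t₀ M₀ hL]
    exact hO _ _ h
  · intro x y hx hy
    rw [mul_add, map_add, hx, hy, map_add, map_add]

variable (p) in
/-- The class `h_a` in `E_1`. -/
def hClass (hkn : k ≤ n) (a : GIdx n k) : PageTotal p n k 1 :=
  (page p n k 1).sym (1, hDeg p n k a, (genWt p n k a.1 : ℤ)) ⟨_, bar_genPow_mem_page hkn a⟩

variable (p) in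
/-- The class `b_a` in `E_1`. -/
def bClass (hkn : k ≤ n) (a : GIdx n k) : PageTotal p n k 1 :=
  (page p n k 1).sym (2, bDeg p n k a, (p * genWt p n k a.1 : ℤ)) ⟨_, bCocycle_mem_page hkn a⟩

theorem firstPageMap_hClass_mul (hkn : k ≤ n) (a : GIdx n k) (x : PageTotal p n k 1) :
    firstPageMap hkn (hClass p hkn a * x) = opH p (ZMod p) a (firstPageMap hkn x) :=
  firstPageMap_sym_mul hkn _ (ltr p _ _ (Finsupp.single a 1)) _ (wordCob_ltr_single a)
    (fun _ _ _ _ => ltr_single_mem a) (fun _ _ => cobRel_ltr _ a) x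

theorem firstPageMap_bClass_mul (hkn : k ≤ n) (a : GIdx n k) (x : PageTotal p n k 1) :
    firstPageMap hkn (bClass p hkn a * x) = opB (ZMod p) a (firstPageMap hkn x) :=
  firstPageMap_sym_mul hkn _ (betaL a) _ (wordCob_betaL a)
    (fun _ _ _ _ => betaL_mem a) (fun _ _ => cobRel_betaL _ a) x

theorem firstPageMap_one (hkn : k ≤ n) :
    firstPageMap (p := p) hkn 1 = Finsupp.single 0 1 := by
  have h1 : (1 : Cobar p n k) ∈ (page p n k 1).Z 0 := (page p n k 1).one_mem
  refine firstPageMap_sym (i := 0) hkn (⟨1, h1⟩ : (page p n k 1).Z 0) ?_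
  have e : words p n k 1 = Finsupp.single ([], ()) 1 := by
    rw [← wordCob_nil, words_wordCob]
  change CobRel _ (wordPart p n k (0, 0, 0) (words p n k 1)) _
  rw [e, wordPart_of_mem nil_mem_wordsEq]
  exact cobRel_one _

theorem hClass_mul_hClass (hkn : k ≤ n) (a a' : GIdx n k) :
    hClass p hkn a * hClass p hkn a' = -(hClass p hkn a' * hClass p hkn a) := by
  apply firstPageMap_injective hkn
  rw [map_neg, ← mul_one (hClass p hkn a'), firstPageMap_hClass_mul, firstPageMap_hClass_mul,
    mul_one, ← mul_one (hClass p hkn a), firstPageMap_hClass_mul, firstPageMap_hClass_mul,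
    opH_anticomm]

theorem hClass_mul_bClass (hkn : k ≤ n) (a a' : GIdx n k) :
    hClass p hkn a * bClass p hkn a' = bClass p hkn a' * hClass p hkn a := by
  apply firstPageMap_injective hkn
  rw [← mul_one (bClass p hkn a'), firstPageMap_hClass_mul, firstPageMap_bClass_mul,
    mul_one, ← mul_one (hClass p hkn a), firstPageMap_bClass_mul, firstPageMap_hClass_mul,
    opH_opB_comm]

theorem bClass_mul_bClass (hkn : k ≤ n) (a a' : GIdx n k) :
    bClass p hkn a * bClass p hkn a' = bClass p hkn a' * bClass p hkn a := by
  apply firstPageMap_injective hkn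
  rw [← mul_one (bClass p hkn a'), firstPageMap_bClass_mul, firstPageMap_bClass_mul,
    mul_one, ← mul_one (bClass p hkn a), firstPageMap_bClass_mul, firstPageMap_bClass_mul,
    opB_comm]

theorem hClass_mul_self (hkn : k ≤ n) (h2 : p = 2) (a : GIdx n k) :
    hClass p hkn a * hClass p hkn a = bClass p hkn a := by
  apply firstPageMap_injective hkn
  have := opH_opH_self h2 a (firstPageMap hkn 1)
  rwa [← firstPageMap_hClass_mul hkn, ← firstPageMap_hClass_mul hkn, ← firstPageMap_bClass_mul hkn,
    mul_one, mul_one] at this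

end FirstPageProduct

/-! ### Products of anticommuting elements -/

section AnticommutingProducts

variable {I A A' : Type*} [Ring A] [Ring A']

/-- Permuting the factors changes a product of pairwise anticommuting elements by a sign, which is
the same for all families of anticommuting elements. -/
theorem exists_zsmul_prod_of_perm {f : I → A} {g : I → A'} (hf : ∀ a b, f a * f b = -(f b * f a))
    (hg : ∀ a b, g a * g b = -(g b * g a)) {l l' : List I} (h : l.Perm l') :
    ∃ ε : ℤ, (l.map f).prod = ε • (l'.map f).prod ∧ (l.map g).prod = ε • (l'.map g).prod := by
  induction h with
  | nil => exact ⟨1, by simp, by simp⟩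
  | cons a _ ih =>
    obtain ⟨ε, h1, h2⟩ := ih
    refine ⟨ε, ?_, ?_⟩ <;>
      rw [List.map_cons, List.map_cons, List.prod_cons, List.prod_cons]
    · rw [h1, mul_smul_comm]
    · rw [h2, mul_smul_comm]
  | swap a b l =>
    refine ⟨-1, ?_, ?_⟩ <;>
      simp only [List.map_cons, List.prod_cons, ← mul_assoc, neg_one_zsmul]
    · rw [hf, neg_mul]
    · rw [hg, neg_mul]
  | trans _ _ ih ih' =>
    obtain ⟨ε, h1, h2⟩ := ih
    obtain ⟨ε', h3, h4⟩ := ih'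
    exact ⟨ε * ε', by rw [h1, h3, smul_smul], by rw [h2, h4, smul_smul]⟩

theorem prod_eq_zero_of_not_nodup {f : I → A} (hf : ∀ a b, f a * f b = -(f b * f a))
    (hf0 : ∀ a, f a * f a = 0) {l : List I} (hl : ¬ l.Nodup) : (l.map f).prod = 0 := by
  obtain ⟨x, hx⟩ := List.exists_duplicate_iff_not_nodup.mpr hl
  obtain ⟨l', hl'⟩ := (List.duplicate_iff_sublist.mp hx).exists_perm_append
  obtain ⟨ε, h1, -⟩ := exists_zsmul_prod_of_perm hf hf hl'
  rw [h1]
  simp [← mul_assoc, hf0]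

theorem ι_anticomm {K M : Type*} [CommRing K] [AddCommGroup M] [Module K M] (x y : M) :
    ExteriorAlgebra.ι K x * ExteriorAlgebra.ι K y =
      -(ExteriorAlgebra.ι K y * ExteriorAlgebra.ι K x) :=
  eq_neg_of_add_eq_zero_left (ExteriorAlgebra.ι_add_mul_swap x y)

end AnticommutingProducts

/-! ### Tensor products of exterior and polynomial algebras -/

section ExteriorPolynomial

variable {K I : Type*} [CommRing K] [LinearOrder I]

/-- The elements of a finite set in increasing order, as a list. -/
def finsetList (S : Finset I) : List I :=
  List.ofFn (Set.powersetCard.ofFinEmbEquiv.symm (Set.powersetCard.ofCard (rfl : S.card = S.card)))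

theorem mem_finsetList (S : Finset I) (a : I) : a ∈ finsetList S ↔ a ∈ S := by
  rw [finsetList, List.mem_ofFn]
  exact Set.powersetCard.mem_range_ofFinEmbEquiv_symm_iff_mem _ a

theorem nodup_finsetList (S : Finset I) : (finsetList S).Nodup :=
  List.nodup_ofFn.mpr (RelEmbedding.injective _)

theorem perm_finsetList {l : List I} (hl : l.Nodup) :
    l.Perm (finsetList l.toFinset) := by
  rw [List.perm_ext_iff_of_nodup hl (nodup_finsetList _)]
  intro a
  rw [mem_finsetList, List.mem_toFinset]

variable (K) in
/-- The product of the exterior generators in the list `l` and the polynomial ones in the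
list `l₂`. -/
def extMon (l l₂ : List I) : ExteriorAlgebra K (I →₀ K) ⊗[K] MvPolynomial I K :=
  (l.map fun a => ExteriorAlgebra.ι K (Finsupp.single a (1 : K))).prod ⊗ₜ[K]
    (l₂.map fun a => (MvPolynomial.X a : MvPolynomial I K)).prod

variable (K I) in
/-- The basis of the tensor product of an exterior and a polynomial algebra on generators indexed
by `I`. -/
def extBasis : Module.Basis (Finset I × (I →₀ ℕ)) K
    (ExteriorAlgebra K (I →₀ K) ⊗[K] MvPolynomial I K) :=
  (Finsupp.basisSingleOne (R := K) (ι := I)).ExteriorAlgebra.tensorProduct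
    (MvPolynomial.basisMonomials I K)

theorem prod_X_eq_monomial (l : List I) :
    (l.map fun a => (MvPolynomial.X a : MvPolynomial I K)).prod =
      MvPolynomial.monomial (Multiset.toFinsupp (l : Multiset I)) 1 := by
  induction l with
  | nil => simp
  | cons a l ih =>
    rw [List.map_cons, List.prod_cons, ih, MvPolynomial.X, MvPolynomial.monomial_mul, mul_one,
      ← Multiset.cons_coe, ← Multiset.singleton_add, map_add, Multiset.toFinsupp_singleton]

theorem extBasis_apply (S : Finset I) (l₂ : List I) :
    extBasis K I (S, Multiset.toFinsupp (l₂ : Multiset I)) = extMon K (finsetList S) l₂ := by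
  have e : (Finsupp.basisSingleOne (R := K) (ι := I)).ExteriorAlgebra S =
      ((finsetList S).map fun a => ExteriorAlgebra.ι K (Finsupp.single a (1 : K))).prod := by
    rw [ExteriorAlgebra.basis_apply_ofCard _ (rfl : S.card = S.card)]
    refine (ExteriorAlgebra.ιMulti_apply _).trans ?_
    rw [finsetList, List.map_ofFn]
    congr 2
  rw [extBasis, Module.Basis.tensorProduct_apply, extMon, MvPolynomial.coe_basisMonomials,
    prod_X_eq_monomial, e]

theorem extMon_mul (l l₂ l' l₂' : List I) :
    extMon K l l₂ * extMon K l' l₂' = extMon K (l ++ l') (l₂ ++ l₂') := by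
  rw [extMon, extMon, extMon, Algebra.TensorProduct.tmul_mul_tmul, List.map_append,
    List.prod_append, List.map_append, List.prod_append]

/-- The exponent `2m`, increased by one on `S`; each exponent is obtained from exactly one pair
`(S, m)`. -/
def parityEquiv (I : Type*) [DecidableEq I] : Finset I × (I →₀ ℕ) ≃ (I →₀ ℕ) where
  toFun q := Multiset.toFinsupp q.1.val + 2 • q.2
  invFun N := (N.support.filter fun a => Odd (N a), N.mapRange (· / 2) (Nat.zero_div 2))
  left_inv q := by
    have h : ∀ a, Multiset.toFinsupp q.1.val a = if a ∈ q.1 then 1 else 0 := fun a => by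
      rw [Multiset.toFinsupp_apply, Multiset.count_eq_of_nodup q.1.nodup]; rfl
    refine Prod.ext (Finset.ext fun a => ?_) (Finsupp.ext fun a => ?_)
    · simp only [Finset.mem_filter, Finsupp.mem_support_iff, Finsupp.add_apply, Finsupp.smul_apply,
        h, smul_eq_mul, Nat.odd_iff]
      split_ifs with h' <;> simp only [h', iff_true, iff_false] <;> omega
    · simp only [Finsupp.mapRange_apply, Finsupp.add_apply, Finsupp.smul_apply, h, smul_eq_mul]
      split_ifs <;> omega
  right_inv N := by
    refine Finsupp.ext fun a => ?_
    have h : Multiset.toFinsupp (N.support.filter fun a => Odd (N a)).val a =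
        if N a % 2 = 1 then 1 else 0 := by
      rw [Multiset.toFinsupp_apply, Multiset.count_eq_of_nodup (Finset.nodup _)]
      simp only [Finset.mem_val, Finset.mem_filter, Finsupp.mem_support_iff, Nat.odd_iff]
      split_ifs <;> omega
    rw [Finsupp.add_apply, Finsupp.smul_apply, h, Finsupp.mapRange_apply, smul_eq_mul]
    split_ifs <;> omega

variable {A : Type*} [Ring A] [Algebra K A]

/-- An algebra in which the products of distinct `h a` and of any `b a` form a basis, if the `h a`
anticommute and the `b a` commute with each other, is as a module the tensor product of an exterior
and a polynomial algebra, and also as an algebra if the `h a` have square zero. -/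
theorem exists_extPoly_equiv (h b : I → A) (hh : ∀ a a', h a * h a' = -(h a' * h a))
    (hb : ∀ a a', h a * b a' = b a' * h a) (bb : ∀ a a', b a * b a' = b a' * b a)
    (G : A ≃ₗ[K] ((I →₀ ℕ) →₀ K))
    (hG : ∀ l l₂ : List I, l.Nodup → ∃ ε : Kˣ, G ((l.map h).prod * (l₂.map b).prod) =
      Finsupp.single (Multiset.toFinsupp (l : Multiset I) +
        2 • Multiset.toFinsupp (l₂ : Multiset I)) (ε : K)) :
    ∃ φ : (ExteriorAlgebra K (I →₀ K) ⊗[K] MvPolynomial I K) ≃ₗ[K] A,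
      (∀ l l₂, l.Nodup → φ (extMon K l l₂) = (l.map h).prod * (l₂.map b).prod) ∧
      ((∀ a, h a * h a = 0) → ∀ x y, φ (x * y) = φ x * φ y) := by
  have hl₂ : ∀ {l l' : List I}, l.Perm l' → (l.map b).prod = (l'.map b).prod := fun hp =>
    (hp.map b).prod_eq' (List.pairwise_map.mpr (List.pairwise_of_forall bb))
  have hlist : ∀ m : I →₀ ℕ, Multiset.toFinsupp ((Finsupp.toMultiset m).toList : Multiset I) = m :=
    fun m => by rw [Multiset.coe_toList, Finsupp.toMultiset_toFinsupp]
  have hS : ∀ S : Finset I, ((finsetList S : List I) : Multiset I) = S.val := fun S =>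
    (Multiset.Nodup.ext (Multiset.coe_nodup.mpr (nodup_finsetList S)) S.nodup).mpr fun a => by
      rw [Multiset.mem_coe, mem_finsetList]; rfl
  -- the products of the generators, indexed by the basis of the source
  let v : Finset I × (I →₀ ℕ) → A := fun q =>
    ((finsetList q.1).map h).prod * ((Finsupp.toMultiset q.2).toList.map b).prod
  choose ε hε using fun q : Finset I × (I →₀ ℕ) =>
    hG (finsetList q.1) (Finsupp.toMultiset q.2).toList (nodup_finsetList q.1)
  have hv : ∀ q, G (v q) = Finsupp.single (parityEquiv I q) (ε q : K) := by
    intro q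
    rw [hε q, hlist, hS]
    rfl
  let B : Module.Basis (Finset I × (I →₀ ℕ)) K A :=
    (((Finsupp.basisSingleOne (R := K)).reindex (parityEquiv I).symm).unitsSMul ε).map G.symm
  have hB : ∀ q, B q = v q := by
    intro q
    apply G.injective
    rw [hv]
    simp only [B, Module.Basis.map_apply, LinearEquiv.apply_symm_apply,
      Module.Basis.unitsSMul_apply, Module.Basis.reindex_apply, Equiv.symm_symm,
      Finsupp.coe_basisSingleOne, Units.smul_def, Finsupp.smul_single, smul_eq_mul, mul_one]
  let φ := (extBasis K I).equiv B (Equiv.refl _)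
  have hφ : ∀ q, φ (extBasis K I q) = v q := fun q => by
    rw [← hB]; exact Module.Basis.equiv_apply _ _ _ _
  have key : ∀ l l₂, l.Nodup → φ (extMon K l l₂) = (l.map h).prod * (l₂.map b).prod := by
    intro l l₂ hl
    obtain ⟨c, h1, h2⟩ := exists_zsmul_prod_of_perm
      (fun a b => ι_anticomm (K := K) (Finsupp.single a (1 : K)) (Finsupp.single b 1)) hh
      (perm_finsetList hl)
    have h3 := hφ (l.toFinset, Multiset.toFinsupp (l₂ : Multiset I))
    have h4 : ((Multiset.toFinsupp (l₂ : Multiset I)).toMultiset.toList).Perm l₂ := by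
      rw [← Multiset.coe_eq_coe, Multiset.coe_toList, Multiset.toFinsupp_toMultiset]
    rw [extBasis_apply] at h3
    simp only [v] at h3
    rw [hl₂ h4] at h3
    rw [extMon, h1, h2, ← TensorProduct.smul_tmul', map_zsmul, smul_mul_assoc]
    exact congrArg _ h3
  refine ⟨φ, key, fun h0 => ?_⟩
  have key' : ∀ l l₂, φ (extMon K l l₂) = (l.map h).prod * (l₂.map b).prod := by
    intro l l₂
    by_cases hl : l.Nodup
    · exact key l l₂ hl
    · rw [extMon, prod_eq_zero_of_not_nodup hh h0 hl, zero_mul, prod_eq_zero_of_not_nodup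
        (fun a b => ι_anticomm (K := K) (Finsupp.single a (1 : K)) (Finsupp.single b 1))
        (fun a => ExteriorAlgebra.ι_sq_zero _) hl, TensorProduct.zero_tmul, map_zero]
  suffices hmul : (LinearMap.mul K _).compr₂ φ.toLinearMap =
      (LinearMap.mul K A).compl₁₂ φ.toLinearMap φ.toLinearMap from
    fun x y => LinearMap.congr_fun₂ hmul x y
  refine (extBasis K I).ext fun q => (extBasis K I).ext fun q' => ?_
  obtain ⟨S, m⟩ := q
  obtain ⟨S', m'⟩ := q'
  rw [← hlist m, ← hlist m', extBasis_apply, extBasis_apply]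
  simp only [LinearMap.compr₂_apply, LinearMap.compl₁₂_apply, LinearMap.mul_apply',
    LinearEquiv.coe_coe]
  rw [extMon_mul, key', key', key', List.map_append, List.prod_append, List.map_append,
    List.prod_append]
  have hc : Commute ((Finsupp.toMultiset m).toList.map b).prod ((finsetList S').map h).prod := by
    refine Commute.list_prod_left _ _ fun x hx => Commute.list_prod_right _ _ fun y hy => ?_
    obtain ⟨a, -, rfl⟩ := List.mem_map.mp hx
    obtain ⟨a', -, rfl⟩ := List.mem_map.mp hy
    exact (hb a' a).symm
  exact hc.symm.mul_mul_mul_comm _ _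

end ExteriorPolynomial

/-! ### The first page as an algebra -/

section FirstPageAlgebra

variable {p n k : ℕ} [hp : Fact p.Prime] [NeZero n] [NeZero k]

theorem firstPageMap_prod_bClass (hkn : k ≤ n) (l : List (GIdx n k)) :
    firstPageMap hkn (l.map (bClass p hkn)).prod =
      Finsupp.single (2 • Multiset.toFinsupp (l : Multiset (GIdx n k))) 1 := by
  induction l with
  | nil => simpa using firstPageMap_one hkn
  | cons a l ih =>
    rw [List.map_cons, List.prod_cons, firstPageMap_bClass_mul, ih, opB_single,
      ← Multiset.cons_coe, ← Multiset.singleton_add, map_add, Multiset.toFinsupp_singleton,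
      smul_add, Finsupp.smul_single, smul_eq_mul, mul_one, add_comm]

theorem par_of_even {m : ℕ} (h : Even m) : par p m = 1 := if_pos h

/-- Products of distinct `h_a` correspond to the `γ_N`, up to a sign. -/
theorem firstPageMap_prod_hClass_mul (hkn : k ≤ n) (x : PageTotal p n k 1) (N : GIdx n k →₀ ℕ)
    (hx : firstPageMap hkn x = Finsupp.single N 1) (l : List (GIdx n k)) (hl : l.Nodup)
    (hN : ∀ a, Even (N a)) :
    ∃ ε : (ZMod p)ˣ, firstPageMap hkn ((l.map (hClass p hkn)).prod * x) =
      Finsupp.single (Multiset.toFinsupp (l : Multiset (GIdx n k)) + N) (ε : ZMod p) := by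
  induction l with
  | nil => exact ⟨1, by simpa using hx⟩
  | cons a l ih =>
    obtain ⟨ha, hl⟩ := List.nodup_cons.mp hl
    obtain ⟨ε, hε⟩ := ih hl
    have hsg : IsUnit (sg (ZMod p) a (Multiset.toFinsupp (l : Multiset (GIdx n k)) + N)) :=
      IsUnit.pow _ isUnit_one.neg
    refine ⟨ε * hsg.unit, ?_⟩
    have e : (Multiset.toFinsupp (l : Multiset (GIdx n k)) + N) a = N a := by
      rw [Finsupp.add_apply, Multiset.toFinsupp_apply, Multiset.count_eq_zero.mpr
        (by simpa using ha), zero_add]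
    rw [List.map_cons, List.prod_cons, mul_assoc, firstPageMap_hClass_mul, hε,
      ← mul_one (ε : ZMod p), ← smul_eq_mul, ← Finsupp.smul_single, map_smul, opH_single, e,
      par_of_even (hN a), if_pos le_rfl, smul_smul, Finsupp.smul_single, smul_eq_mul, mul_one,
      ← Multiset.cons_coe, ← Multiset.singleton_add, map_add, Multiset.toFinsupp_singleton,
      Units.val_mul, IsUnit.unit_spec]
    congr 1
    abel

theorem hClass_sq_eq_zero (hkn : k ≤ n) (h2 : p ≠ 2) (a : GIdx n k) :
    hClass p hkn a * hClass p hkn a = 0 := by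
  have h := add_eq_zero_iff_eq_neg.mpr (hClass_mul_hClass (p := p) hkn a a)
  rw [← two_smul (ZMod p)] at h
  refine (smul_eq_zero_iff_right ?_).mp h
  intro h'
  have h3 : ((2 : ℕ) : ZMod p) = 0 := by rwa [Nat.cast_two]
  rw [ZMod.natCast_eq_zero_iff] at h3
  exact h2 ((Nat.prime_dvd_prime_iff_eq hp.out Nat.prime_two).mp h3)

theorem exists_extPoly_equiv_page (hkn : k ≤ n) :
    ∃ φ : ExtPoly p n k ≃ₗ[ZMod p] PageTotal p n k 1,
      (∀ l l₂, l.Nodup → φ (extPolyMon p n k l l₂) =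
        (l.map (hClass p hkn)).prod * (l₂.map (bClass p hkn)).prod) ∧
      (p ≠ 2 → ∀ x y, φ (x * y) = φ x * φ y) := by
  obtain ⟨φ, h1, h2⟩ := exists_extPoly_equiv (hClass p hkn) (bClass p hkn)
    (hClass_mul_hClass hkn) (hClass_mul_bClass hkn) (bClass_mul_bClass hkn)
    (LinearEquiv.ofBijective (firstPageMap hkn)
      ⟨firstPageMap_injective hkn, firstPageMap_surjective hkn⟩)
    (fun l l₂ hl => firstPageMap_prod_hClass_mul hkn _ _ (firstPageMap_prod_bClass hkn l₂) l hl
      fun a => by rw [Finsupp.smul_apply, smul_eq_mul]; exact even_two_mul _)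
  exact ⟨φ, h1, fun hp2 => h2 (hClass_sq_eq_zero hkn hp2)⟩

end FirstPageAlgebra

end MaySS

end

open MaySS

theorem theorem2p8 (p n k : ℕ) [Fact p.Prime] [NeZero n] [NeZero k] (hkn : k ≤ n) :
    -- the filtration of `S(n,k)`
    ((∀ t, Monotone (filt p n k t)) ∧ (∀ t, ∀ M < 0, filt p n k t M = ⊥) ∧
      DirectSum.IsInternal fun t => ⨆ M, filt p n k t M) ∧
    -- the associated bigraded Hopf algebra is a truncated polynomial algebra, with the class of
    -- `t_s ^ (p ^ j)` as primitive generators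
    (∃ H : HopfData (ZMod p) (GrS p n k), IsInducedComul p n k H.comul ∧
      ∃ Θ : TruncAlg p n k ≃ₐ[ZMod p] GrS p n k, ∀ a,
        (grSystem p n k).Represents (hDeg p n k a, (genWt p n k a.1 : ℤ)) (genPow p n k a)
          (Θ (truncGen p n k a)) ∧
        H.comul (Θ (truncGen p n k a)) =
          Θ (truncGen p n k a) ⊗ₜ[ZMod p] 1 + 1 ⊗ₜ[ZMod p] Θ (truncGen p n k a)) ∧
    -- the filtration of the cobar complex by subcomplexes
    ((∀ s, ⨆ t, cobarDeg p n k s t =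
        LinearMap.range (TensorAlgebra.ι (ZMod p) (M := augIdeal p n k)) ^ s) ∧
      ∀ s t M, (cobarFilt p n k s t M).map (cobarD p n k) ≤ cobarFilt p n k (s + 1) t M) ∧
    -- the spectral sequence: degrees of `d_r`, Leibniz rule, next page as homology of `E_r`
    (∀ r : ℕ,
      (∀ s t M (z : (page p n k r).Z (s, t, M)),
        (page p n k r).Represents (s + 1, t, M - r) (cobarD p n k z)
          (pageD p n k r ((page p n k r).sym (s, t, M) z))) ∧
      (∀ x, pageD p n k r (pageD p n k r x) = 0) ∧
      (∀ s t M (x : (page p n k r).Z (s, t, M)) (y : PageTotal p n k r),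
        pageD p n k r ((page p n k r).sym (s, t, M) x * y) =
          pageD p n k r ((page p n k r).sym (s, t, M) x) * y +
            (-1) ^ s * ((page p n k r).sym (s, t, M) x * pageD p n k r y)) ∧
      ∃ φ : PageTotal p n k (r + 1) ≃ₗ[ZMod p] PageHomology p n k r,
        ∀ i (z : (page p n k (r + 1)).Z i), ∃ (hz : (z : Cobar p n k) ∈ (page p n k r).Z i)
          (hd : (page p n k r).sym i ⟨z, hz⟩ ∈ LinearMap.ker (pageD p n k r)),
          φ ((page p n k (r + 1)).sym i z) = Submodule.Quotient.mk ⟨_, hd⟩) ∧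
    -- convergence to the cohomology of `S(n,k)`
    (∀ s t, Monotone (extFilt p n k s t) ∧ (∀ M < 0, extFilt p n k s t M = ⊥) ∧
      ⨆ M, extFilt p n k s t M = ⊤) ∧
    (∀ s t M, ∃ r₀ : ℕ, ∀ r ≥ r₀, ∃ φ : (page p n k r).Piece (s, t, M) ≃ₗ[ZMod p] GrExt p n k s t M,
      ∀ z (hz : z ∈ cobarFilt p n k s t M) (hd : cobarD p n k z = 0),
        φ ((page p n k r).cls _ ⟨z, mem_page_of_cocycle r hz hd⟩) = grExtClass z hz hd) ∧
    -- the first page, for `p = 2` as a vector space, with the square of `h a` equal to `b a`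
    (∃ h b : Idx k × ZMod n → PageTotal p n k 1,
      (∀ a, (page p n k 1).Represents (1, hDeg p n k a, (genWt p n k a.1 : ℤ))
        (bar p n k (genPow p n k a)) (h a)) ∧
      (∀ a, (page p n k 1).Represents (2, bDeg p n k a, (p * genWt p n k a.1 : ℤ))
        (bCocycle p n k a) (b a)) ∧
      (∀ a a', h a * h a' = -(h a' * h a)) ∧
      (∀ a a', h a * b a' = b a' * h a) ∧
      (∀ a a', b a * b a' = b a' * b a) ∧
      (p = 2 → ∀ a, h a * h a = b a) ∧
      ∃ φ : ExtPoly p n k ≃ₗ[ZMod p] PageTotal p n k 1,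
        (∀ l l₂, l.Nodup → φ (extPolyMon p n k l l₂) = (l.map h).prod * (l₂.map b).prod) ∧
        (p ≠ 2 → ∀ x y, φ (x * y) = φ x * φ y)) := by
  
  refine ⟨⟨fun t M M' h => filt_mono h, fun t M h => filt_of_neg t h, isInternal_filt⟩,
    exists_grS_hopfData hkn, ⟨iSup_cobarDeg, fun s t M => ?_⟩,
    fun r => ⟨pageD_represents r, pageD_pageD r, pageD_mul r, exists_page_succ_equiv r⟩,
    fun s t => ⟨extFilt_monotone s t, fun M h => extFilt_of_neg s t h, iSup_extFilt s t⟩,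
    exists_page_equiv_grExt,
    hClass p hkn, bClass p hkn, fun a => ⟨_, rfl⟩, fun a => ⟨_, rfl⟩, hClass_mul_hClass hkn,
    hClass_mul_bClass hkn, bClass_mul_bClass hkn, hClass_mul_self hkn,
    exists_extPoly_equiv_page hkn⟩
  rintro _ ⟨x, hx, rfl⟩
  exact cobarD_mem hkn hx
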